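/- Let $m,n\ge 0$ be integers with $(m,n)\neq(0,1)$. All spaces are complex super vector spaces. **Superfunctions.** Let $x_1,\dots,x_{m+2n}$ be variables, the first $m$ even ($|i|=0$), the last $2n$ odd and anticommuting ($|i|=1$). Superfunctions on $\mathbb R^{m|2n}$ are functions of $(x_1,\dots,x_m)\in\mathbb R^m$ with values in the Grassmann algebra $\Lambda(\mathbb C^{2n})$ of the odd variables, and $\mathcal P(\mathbb C^{m|2n})=\mathbb C[z_1,\dots,z_m]\otimes\Lambda(\mathbb C^{2n})$; bars denote conjugation of the coefficients. Put $\beta=\mathrm{diag}\big(I_m,\begin{pmatrix}0&-I_n\\ I_n&0\end{pmatrix}\big)$, let $\beta^{ij}$ be the entries of $\beta^{-1}$, and put $z^j=\sum_i z_i\beta^{ij}$, $\partial_i=\sum_j\beta_{ij}\,\partial/\partial z_j$ (left derivatives), $z\bullet w=\sum_j z^jw_j$, $R^2=x\bullet x$, $R_z^2=z\bullet z$, $\|z\|^2=z\bullet\bar z$. The superintegral over $\mathbb R^{m|2n}$ is the Lebesgue integral over $\mathbb R^m$ of $\pi^{-n}\partial_{x_{m+2n}}\cdots\partial_{x_{m+1}}f$;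 over $\mathbb C^{m|2n}$ it is the Lebesgue integral over $\mathbb C^m$ of $\pi^{-2n}\partial_{\bar z_{m+2n}}\partial_{z_{m+2n}}\cdots\partial_{\bar z_{m+1}}\partial_{z_{m+1}}f$. **Metaplectic models.** Let $\omega=\int\exp(-2R^2)\,dx$, $\gamma=\int\exp(-\|z\|^2)\,dz$, and $$\langle f,g\rangle_W=\tfrac1\omega\int f\,\overline g\,dx,\qquad \langle p,q\rangle_F=\tfrac1\gamma\int\exp(-\|z\|^2)\,p(z)\,\overline{q(z)}\,dz .$$ Let $\widetilde W$ be the smallest space of superfunctions on $\mathbb R^{m|2n}$ that contains $\exp(-R^2)$ and $x_1\exp(-R^2)$ (only the former if $m=n=0$) and is stable under multiplication by all $x_ix_j$ and under all $\partial_i\partial_j$. Let $\widetilde F=\mathcal P(\mathbb C^{m|2n})$, and let $\widetilde F_{\rm even}$ be its subspace spanned by the monomials of even total degree. The Segal–Bargmann transform is $$\mathrm{SB}f(z)=\tfrac1\omega\exp(-\tfrac12R_z^2)\int\exp(2\,z\bullet x)\exp(-R_x^2)f(x)\,dx .$$ **Minimal models.** Let $J$ be the Jordan superalgebra spanned by the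 supermatrices $\ell_{ij}=\sum_k\big(\beta_{jk}E_{ik}+(-1)^{|i||j|}\beta_{ik}E_{jk}\big)$, with product $X\cdot Y=\frac12(XY+(-1)^{|X||Y|}YX)$ and multiplication operators $L_X$. Use as a basis $(u)$ of $J$ the $\ell_{ij}$ with $i\le j$ and $(i,j)$ not an equal pair of odd indices; they are also used as the coordinates of $J$, and $\mathcal P(J)$ denotes the superpolynomials in them. Let $\lambda(L_X)=-\frac14\mathrm{str}X$ (so $\lambda(L_{\ell_{ij}})=-\frac12\beta_{ij}$). For a basis element $x$ the Bessel operator is $$\mathcal B(x)=-2\sum_u\lambda(L_{xu})\,\partial_u+\sum_{u,v}\widetilde P_{u,v}(x)\,\partial_v\partial_u,\qquad \widetilde P_{u,v}(x)=(-1)^{|x|(|u|+|v|)}\big(L_uL_v+(-1)^{|u||v|}L_vL_u-L_{uv}\big)(x),$$ where elements of $J$ act by multiplication as linear superfunctions. Let $\mathcal I\subset\mathcal P(J)$ be the ideal generated by all $\ell_{ij}\ell_{kl}-(-1)^{|k||j|}\ell_{ik}\ell_{jl}$, let $F=\mathcal P(J)/\mathcal I$ carry the Bessel–Fischer product $\langle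 p,q\rangle_{\mathcal B}=p(\mathcal B)\bar q\,|_{\ell=0}$, and let $\psi_{\mathbb C}:F\to\widetilde F_{\rm even}$ be the folding map, the algebra morphism with $\ell_{ij}\mapsto z_iz_j$. Put $2e=\sum_{i,j}\ell_{ij}\beta^{ij}$, and let $W$ be the image, in the superfunctions modulo $\mathcal I\exp(-2e)$, of the smallest space of superfunctions in the real variables $\ell_{ij}$ that contains $\exp(-2e)$ and is stable under multiplication by all $\ell_{ij}$ and under all Bessel operators. The folding map $\psi_{\mathbb R}$ on $W$ is $p\exp(-2e)\mapsto\psi_{\mathbb C}(p)\exp(-R^2)$, the Schrödinger product on $W$ is $\langle f,g\rangle=\langle\psi_{\mathbb R}f,\psi_{\mathbb R}g\rangle_W$, and the minimal-orbit Segal–Bargmann transform is $\widehat{\mathrm{SB}}=\psi_{\mathbb C}^{-1}\circ\mathrm{SB}\circ\psi_{\mathbb R}:W\to F$. **Hilbert superspaces (de Goursac–Michel).** A Hermitian superspace is a super vector space with a sesquilinear, superhermitian, non-degenerate product $\langle\cdot,\cdot\rangle$. A fundamental symmetry is an endomorphism $S$ with $S^4=1$ and $\langle Sx,Sy\rangle=\langle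 x,y\rangle$ such that $(x,y)_S:=\langle x,Sy\rangle$ is an inner product; the space is a Hilbert superspace if it is complete for one such $(\cdot,\cdot)_S$. The topology does not depend on $S$; bounded operators are the continuous linear ones. The superadjoint $T^\dagger$ of a bounded operator $T$ is the bounded operator with $\langle T^\dagger x,y\rangle=(-1)^{|T||x|}\langle x,Ty\rangle$. A superunitary isomorphism is an even bounded operator $T$ with $T^\dagger T=1$ and $TT^\dagger=1$. Let $S_F(z_{i_1}z_{i_2}\cdots z_{i_k})=z^{i_k}\cdots z^{i_2}z^{i_1}$ on $\widetilde F$, $T_F=\psi_{\mathbb C}^{-1}S_F\psi_{\mathbb C}$ on $F$, and $T_W=\widehat{\mathrm{SB}}^{-1}T_F\widehat{\mathrm{SB}}$ on $W$. **Theorem.** (a) $\mathrm{SB}$ maps $\widetilde W$ into $\widetilde F$, and $\langle\mathrm{SB}f,\mathrm{SB}g\rangle_F=\langle f,g\rangle_W$ for all $f,g\in\widetilde W$. (b) The Bessel–Fischer product and the maps $\psi_{\mathbb C}$, $\psi_{\mathbb R}$ are well defined on $F$ and $W$, every $p\exp(-2e)$ with $p\in\mathcal P(J)$ represents an element of $W$,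 and $S_F$, $T_F$, $T_W$ are fundamental symmetries of the Hermitian superspaces $(\widetilde F,\langle\cdot,\cdot\rangle_F)$, $(F,\langle\cdot,\cdot\rangle_{\mathcal B})$ and $(W,\langle\cdot,\cdot\rangle)$. (c) Let $\mathcal F(\mathbb C^{m|2n})$, $\mathcal F(\mathcal O_{\mathbb C})$, $L^2(\mathcal O_{\mathbb R})$ be the completions of $\widetilde F$, $F$, $W$ for $(\cdot,\cdot)_{S_F}$, $(\cdot,\cdot)_{T_F}$, $(\cdot,\cdot)_{T_W}$, with the products extended by continuity. Let $L^2(\mathbb R^{m|2n})=L^2(\mathbb R^m)\otimes\Lambda(\mathbb C^{2n})$ with the product $\langle\cdot,\cdot\rangle_W$, let $\mathcal F_{\rm even}(\mathbb C^{m|2n})$ be the closure of $\widetilde F_{\rm even}$ in $\mathcal F(\mathbb C^{m|2n})$, and let $L^2_{\rm even}(\mathbb R^{m|2n})$ be the subspace of the elements of $L^2(\mathbb R^{m|2n})$ that are invariant under $x\mapsto-x$ in all even and odd variables. All these are Hilbert superspaces, and each of the following maps, defined on $\widetilde W$, $F$, $W$, $W$ respectively, extends to exactly one superunitary isomorphism: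 1. $\mathrm{SB}:L^2(\mathbb R^{m|2n})\to\mathcal F(\mathbb C^{m|2n})$; 2. $\psi_{\mathbb C}:\mathcal F(\mathcal O_{\mathbb C})\to\mathcal F_{\rm even}(\mathbb C^{m|2n})$; 3. $\psi_{\mathbb R}:L^2(\mathcal O_{\mathbb R})\to L^2_{\rm even}(\mathbb R^{m|2n})$; 4. $\widehat{\mathrm{SB}}:L^2(\mathcal O_{\mathbb R})\to\mathcal F(\mathcal O_{\mathbb C})$. -/

import Mathlib

noncomputable section

namespace SegalBargmann

/-! ## Grassmann algebras -/

/-- The Grassmann algebra over `R` in anticommuting variables indexed by the ordered type `τ`.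
An element is given by its coefficients with respect to the basis of ordered monomials
`θ_S = θ_{s₁} ⋯ θ_{s_k}`, where `S = {s₁ < ⋯ < s_k}`; the same notation is used for the module
`M ⊗ Λ` with coefficients in a module `M`. -/
def Gr (R τ : Type*) := Finset τ → R

namespace Gr

variable {R R' τ τ' : Type*}

instance instAddCommGroup [AddCommGroup R] : AddCommGroup (Gr R τ) :=
  inferInstanceAs (AddCommGroup (Finset τ → R))

instance instModule [AddCommGroup R] [Module ℂ R] : Module ℂ (Gr R τ) :=
  inferInstanceAs (Module ℂ (Finset τ → R))

@[ext] theorem ext' {f g : Gr R τ} (h : ∀ S, f S = g S) : f = g := funext h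

@[simp] theorem add_apply [AddCommGroup R] (f g : Gr R τ) (S : Finset τ) :
    (f + g) S = f S + g S := rfl
@[simp] theorem zero_apply [AddCommGroup R] (S : Finset τ) : (0 : Gr R τ) S = 0 := rfl
@[simp] theorem smul_apply [AddCommGroup R] [Module ℂ R] (c : ℂ) (f : Gr R τ) (S : Finset τ) :
    (c • f) S = c • f S := rfl

/-- Number of pairs `(s, t) ∈ S × T` with `t < s`. -/
def inv [LinearOrder τ] (S T : Finset τ) : ℕ := ((S ×ˢ T).filter fun p => p.2 < p.1).card

theorem inv_union_left [LinearOrder τ] {S T : Finset τ} (h : Disjoint S T) (U : Finset τ) :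
    inv (S ∪ T) U = inv S U + inv T U := by
  unfold inv
  rw [Finset.union_product, Finset.filter_union, Finset.card_union_of_disjoint]
  apply Finset.disjoint_filter_filter
  exact Finset.disjoint_product.2 (Or.inl h)

theorem inv_union_right [LinearOrder τ] {S T : Finset τ} (h : Disjoint S T) (U : Finset τ) :
    inv U (S ∪ T) = inv U S + inv U T := by
  unfold inv
  rw [Finset.product_union, Finset.filter_union, Finset.card_union_of_disjoint]
  apply Finset.disjoint_filter_filter
  exact Finset.disjoint_product.2 (Or.inr h)

section ring
variable [CommRing R] [LinearOrder τ]

/-- The product determined by `θ_S θ_T = (-1)^{inv S T} θ_{S ∪ T}` for disjoint `S`, `T`, and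
`θ_S θ_T = 0` otherwise. -/
instance instMul : Mul (Gr R τ) :=
  ⟨fun f g U => ∑ S ∈ U.powerset, (-1) ^ inv S (U \ S) * (f S * g (U \ S))⟩

/-- The constant (degree zero in `θ`) element with coefficient `r`. -/
def const (r : R) : Gr R τ := fun S => if S = ∅ then r else 0

instance instOne : One (Gr R τ) := ⟨const 1⟩

/-- The odd variable `θ_t`. -/
def gen (t : τ) : Gr R τ := fun S => if S = {t} then 1 else 0

theorem mul_apply (f g : Gr R τ) (U : Finset τ) :
    (f * g) U = ∑ S ∈ U.powerset, (-1) ^ inv S (U \ S) * (f S * g (U \ S)) := rfl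

theorem const_mul (r : R) (f : Gr R τ) (U : Finset τ) : (const r * f : Gr R τ) U = r * f U := by
  rw [mul_apply, Finset.sum_eq_single ∅]
  · simp [const, inv]
  · intro S _ hS; simp [const, hS]
  · simp

theorem mul_const (r : R) (f : Gr R τ) (U : Finset τ) : (f * const r : Gr R τ) U = f U * r := by
  rw [mul_apply, Finset.sum_eq_single U]
  · simp [const, inv]
  · intro S hS hSU
    have : U \ S ≠ ∅ := by
      rw [Ne, Finset.sdiff_eq_empty_iff_subset]
      exact fun h => hSU (Finset.Subset.antisymm (Finset.mem_powerset.1 hS) h)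
    simp [const, this]
  · simp

theorem mul_assoc' (f g h : Gr R τ) : f * g * h = f * (g * h) := by
  ext U
  simp only [mul_apply, Finset.sum_mul, Finset.mul_sum]
  rw [Finset.sum_sigma', Finset.sum_sigma']
  refine Finset.sum_bij' (fun p _ => ⟨p.2, p.1 \ p.2⟩) (fun p _ => ⟨p.1 ∪ p.2, p.1⟩)
    ?_ ?_ ?_ ?_ ?_
  · rintro ⟨T, S⟩ hp
    simp only [Finset.mem_sigma, Finset.mem_powerset] at hp ⊢
    exact ⟨hp.2.trans hp.1, Finset.sdiff_subset_sdiff hp.1 le_rfl⟩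
  · rintro ⟨S, V⟩ hp
    simp only [Finset.mem_sigma, Finset.mem_powerset] at hp ⊢
    exact ⟨Finset.union_subset hp.1 (hp.2.trans Finset.sdiff_subset), Finset.subset_union_left⟩
  · rintro ⟨T, S⟩ hp
    simp only [Finset.mem_sigma, Finset.mem_powerset] at hp ⊢
    simp [Finset.union_sdiff_of_subset hp.2]
  · rintro ⟨S, V⟩ hp
    simp only [Finset.mem_sigma, Finset.mem_powerset] at hp ⊢
    have : Disjoint V S := Finset.disjoint_of_subset_left hp.2 Finset.sdiff_disjoint
    simp [Finset.union_sdiff_cancel_left this.symm]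
  · rintro ⟨T, S⟩ hp
    simp only [Finset.mem_sigma, Finset.mem_powerset] at hp
    have e1 : (U \ S) \ (T \ S) = U \ T := by
      ext x; simp only [Finset.mem_sdiff]
      have := @hp.2 x
      tauto
    have d1 : Disjoint S (T \ S) := Finset.disjoint_sdiff
    have d2 : Disjoint (T \ S) (U \ T) :=
      Finset.disjoint_of_subset_left Finset.sdiff_subset Finset.disjoint_sdiff
    have i1 : inv T (U \ T) = inv S (U \ T) + inv (T \ S) (U \ T) := by
      conv_lhs => rw [← Finset.union_sdiff_of_subset hp.2]
      rw [inv_union_left d1, Finset.union_sdiff_of_subset hp.2]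
    have i2 : inv S (U \ S) = inv S (T \ S) + inv S (U \ T) := by
      rw [← inv_union_right d2]
      congr 1
      ext x; simp only [Finset.mem_sdiff, Finset.mem_union]
      have := @hp.1 x
      have := @hp.2 x
      tauto
    simp only [e1, i1, i2, pow_add]
    ring

instance instRing : Ring (Gr R τ) :=
  { Gr.instAddCommGroup, Gr.instMul, Gr.instOne with
    mul_assoc := mul_assoc'
    one_mul := fun f => by ext U; exact (const_mul 1 f U).trans (one_mul _)
    mul_one := fun f => by ext U; exact (mul_const 1 f U).trans (mul_one _)
    left_distrib := fun f g h => by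
      ext U; simp only [mul_apply, add_apply, mul_add, Finset.sum_add_distrib]
    right_distrib := fun f g h => by
      ext U; simp only [mul_apply, add_apply, add_mul, mul_add, Finset.sum_add_distrib]
    zero_mul := fun f => by ext U; simp [mul_apply]
    mul_zero := fun f => by ext U; simp [mul_apply] }

instance instAlgebra [Algebra ℂ R] : Algebra ℂ (Gr R τ) :=
  Algebra.ofModule
    (fun c f g => by
      ext U
      simp only [mul_apply, smul_apply, Finset.smul_sum, smul_mul_assoc, mul_smul_comm])
    (fun c f g => by
      ext U
      simp only [mul_apply, smul_apply, Finset.smul_sum, mul_smul_comm])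

/-- The left derivative `∂/∂θ_t`, with `∂_t θ_U = (-1)^{#{s ∈ U | s < t}} θ_{U \ {t}}` for
`t ∈ U` and `∂_t θ_U = 0` for `t ∉ U`. -/
def pdOdd (t : τ) (f : Gr R τ) : Gr R τ := fun S =>
  if t ∈ S then 0 else (-1) ^ (S.filter fun s => s < t).card * f (insert t S)

open Classical in
/-- Relabelling of the odd variables along an injection that preserves the order. -/
def relabel [LinearOrder τ'] (e : τ ↪o τ') (f : Gr R τ) : Gr R τ' := fun U =>
  if h : ∃ S : Finset τ, S.map e.toEmbedding = U then f h.choose else 0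

end ring

/-- Apply a map to all coefficients. -/
def mapCoeff (φ : R → R') (f : Gr R τ) : Gr R' τ := fun S => φ (f S)

/-- The homogeneous parts of parity `0` and `1`: the parity of `θ_S` is `#S` modulo two. -/
def part [AddCommGroup R] [Module ℂ R] (a : ZMod 2) : Submodule ℂ (Gr R τ) where
  carrier := {f | ∀ S : Finset τ, (S.card : ZMod 2) ≠ a → f S = 0}
  add_mem' := fun hf hg S hS => by simp [hf S hS, hg S hS]
  zero_mem' := fun _ _ => rfl
  smul_mem' := fun c f hf S hS => by simp [hf S hS]

end Gr
/-! ## Hermitian and Hilbert superspaces -/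

/-- A complex supervector space `V` together with a pairing on it (no axioms yet). -/
structure SuperForm (V : Type*) [AddCommGroup V] [Module ℂ V] where
  /-- The homogeneous subspaces `V_0` and `V_1`. -/
  part : ZMod 2 → Submodule ℂ V
  /-- The pairing `⟨x, y⟩`. -/
  form : V → V → ℂ

namespace SuperForm

variable {V V₁ V₂ : Type*} [AddCommGroup V] [Module ℂ V] [AddCommGroup V₁] [Module ℂ V₁]
  [AddCommGroup V₂] [Module ℂ V₂]

/-- Hermitian superspaces: `V = V_0 ⊕ V_1` and the pairing is a super-inner product, i.e. it is
sesquilinear (left-linear and right-antilinear), superhermitian and non-degenerate. -/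
structure IsHermitian (H : SuperForm V) : Prop where
  isCompl : IsCompl (H.part 0) (H.part 1)
  form_add_left : ∀ x y z, H.form (x + y) z = H.form x z + H.form y z
  form_smul_left : ∀ (c : ℂ) (x y), H.form (c • x) y = c * H.form x y
  form_add_right : ∀ x y z, H.form x (y + z) = H.form x y + H.form x z
  form_smul_right : ∀ (c : ℂ) (x y), H.form x (c • y) = (starRingEnd ℂ) c * H.form x y
  superhermitian : ∀ a b : ZMod 2, ∀ x ∈ H.part a, ∀ y ∈ H.part b,
    H.form x y = (-1) ^ (a.val * b.val) * (starRingEnd ℂ) (H.form y x)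
  nondegenerate : ∀ x, (∀ y, H.form x y = 0) → x = 0

/-- Fundamental symmetries `J` of a Hermitian superspace: endomorphisms with `J⁴ = 1` and
`⟨J x, J y⟩ = ⟨x, y⟩`, for which `(x, y)_J = ⟨x, J y⟩` is an inner product. -/
structure IsFundamentalSymmetry (H : SuperForm V) (J : V → V) : Prop where
  isHermitian : H.IsHermitian
  isLinear : IsLinearMap ℂ J
  iterate_four : ∀ x, J (J (J (J x))) = x
  form_map : ∀ x y, H.form (J x) (J y) = H.form x y
  inner_conj : ∀ x y, H.form x (J y) = (starRingEnd ℂ) (H.form y (J x))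
  inner_nonneg : ∀ x, 0 ≤ (H.form x (J x)).re
  inner_definite : ∀ x, H.form x (J x) = 0 → x = 0

/-- The norm `‖x‖_J = √⟨x, J x⟩`. -/
def normJ (H : SuperForm V) (J : V → V) (x : V) : ℝ := √(H.form x (J x)).re

/-- `J` is a fundamental symmetry for which `(V, (·,·)_J)` is a Hilbert space: every Cauchy
sequence for `‖·‖_J` converges. -/
structure IsHilbertSymmetry (H : SuperForm V) (J : V → V) : Prop
    extends H.IsFundamentalSymmetry J where
  complete : ∀ u : ℕ → V,
    (∀ ε : ℝ, 0 < ε → ∃ N, ∀ p ≥ N, ∀ q ≥ N, H.normJ J (u p - u q) < ε) →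
    ∃ x, ∀ ε : ℝ, 0 < ε → ∃ N, ∀ p ≥ N, H.normJ J (u p - x) < ε

/-- Hilbert superspaces. -/
def IsHilbert (H : SuperForm V) : Prop := ∃ J : V → V, H.IsHilbertSymmetry J

/-- Bounded operators between Hilbert superspaces: linear maps that are continuous for the
Hilbert topologies. (The topology defined by `(·,·)_J` does not depend on `J`.) -/
def IsBounded (H₁ : SuperForm V₁) (H₂ : SuperForm V₂) (T : V₁ →ₗ[ℂ] V₂) : Prop :=
  ∃ (J₁ : V₁ → V₁) (J₂ : V₂ → V₂), H₁.IsHilbertSymmetry J₁ ∧ H₂.IsHilbertSymmetry J₂ ∧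
    ∃ C : ℝ, ∀ x, H₂.normJ J₂ (T x) ≤ C * H₁.normJ J₁ x

/-- `T` is homogeneous of parity `t`. -/
def HasParity (H₁ : SuperForm V₁) (H₂ : SuperForm V₂) (t : ZMod 2) (T : V₁ →ₗ[ℂ] V₂) : Prop :=
  ∀ a : ZMod 2, ∀ x ∈ H₁.part a, T x ∈ H₂.part (t + a)

/-- `T'` is the superadjoint of the operator `T` of parity `t`. -/
def IsSuperadjoint (H₁ : SuperForm V₁) (H₂ : SuperForm V₂) (t : ZMod 2)
    (T : V₁ →ₗ[ℂ] V₂) (T' : V₂ →ₗ[ℂ] V₁) : Prop :=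
  H₂.IsBounded H₁ T' ∧ ∀ a : ZMod 2, ∀ x ∈ H₂.part a, ∀ y : V₁,
    H₁.form (T' x) y = (-1) ^ (t.val * a.val) * H₂.form x (T y)

/-- Superunitary operators: bounded operators `T` of even parity between Hilbert superspaces
such that `T† T = 1` and `T T† = 1`. -/
structure IsSuperunitary (H₁ : SuperForm V₁) (H₂ : SuperForm V₂) (T : V₁ →ₗ[ℂ] V₂) : Prop where
  isHilbert_left : H₁.IsHilbert
  isHilbert_right : H₂.IsHilbert
  isBounded : H₁.IsBounded H₂ T
  even : H₁.HasParity H₂ 0 T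
  adjoint : ∃ T' : V₂ →ₗ[ℂ] V₁, H₁.IsSuperadjoint H₂ 0 T T' ∧
    T' ∘ₗ T = LinearMap.id ∧ T ∘ₗ T' = LinearMap.id

/-- The superspace structure induced on a subspace. -/
def restrict (H : SuperForm V) (N : Submodule ℂ V) : SuperForm N where
  part a := (H.part a).comap N.subtype
  form x y := H.form x y

/-- The space `V` with the inner product `(·,·)_J`. -/
def PreHilbert (H : SuperForm V) (J : V → V) (_ : H.IsFundamentalSymmetry J) : Type _ := V

section completion
variable {H : SuperForm V} {J : V → V} (h : H.IsFundamentalSymmetry J)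

/-- `(·,·)_J` as an inner product; Mathlib takes the first argument to be the antilinear one. -/
abbrev core : @InnerProductSpace.Core ℂ V _ _ _ where
  inner x y := H.form y (J x)
  conj_inner_symm x y := (h.inner_conj y x).symm
  re_inner_nonneg x := h.inner_nonneg x
  add_left x y z := by rw [h.isLinear.map_add, h.isHermitian.form_add_right]
  smul_left x y r := by rw [h.isLinear.map_smul, h.isHermitian.form_smul_right]
  definite x hx := h.inner_definite x hx

instance : NormedAddCommGroup (PreHilbert H J h) :=
  @InnerProductSpace.Core.toNormedAddCommGroup ℂ V _ _ _ (core h)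

instance : InnerProductSpace ℂ (PreHilbert H J h) :=
  @InnerProductSpace.ofCore ℂ V _ _ _ (core h).toCore

/-- The completion of `V` with respect to `(·,·)_J`. -/
abbrev Completion : Type _ := UniformSpace.Completion (PreHilbert H J h)

/-- The inclusion of `V` in its completion. -/
def toCompletion : V →ₗ[ℂ] Completion h where
  toFun x := ((show PreHilbert H J h from x : PreHilbert H J h) : Completion h)
  map_add' x y := UniformSpace.Completion.coe_add (α := PreHilbert H J h) x y
  map_smul' c x := UniformSpace.Completion.coe_smul (X := PreHilbert H J h) c x

/-- The completion as a superspace: the homogeneous parts are the closures of those of `V`, and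
the pairing is the extension by continuity of the pairing of `V`. -/
def completion : SuperForm (Completion h) where
  part a := ((H.part a).map (toCompletion h)).topologicalClosure
  form := Function.curry ((UniformSpace.Completion.isDenseInducing_coe.prodMap
    UniformSpace.Completion.isDenseInducing_coe).extend
      (fun p : PreHilbert H J h × PreHilbert H J h => H.form p.1 p.2))

end completion

end SuperForm

/-! ## Indices and the orthosymplectic metric -/

/-- Indices of the `m + 2n` variables: `inl i` is the `i`-th even index, `inr a` the `a`-th odd
index. -/
abbrev Idx (m n : ℕ) := Fin m ⊕ Fin (2 * n)

/-- The parity `|i|` of an index. -/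
def par {m n : ℕ} : Idx m n → ℕ
  | Sum.inl _ => 0
  | Sum.inr _ => 1

/-- The metric `β`, the block matrix with blocks `I_m` and `((0, -I_n), (I_n, 0))`. -/
def beta {m n : ℕ} : Idx m n → Idx m n → ℂ
  | Sum.inl i, Sum.inl j => if i = j then 1 else 0
  | Sum.inr a, Sum.inr b =>
      if (b : ℕ) = a + n then -1 else if (a : ℕ) = b + n then 1 else 0
  | _, _ => 0

/-- The entries `β^{ij}` of the inverse matrix of `β`, which is the transpose of `β`. -/
def betaInv {m n : ℕ} (i j : Idx m n) : ℂ := beta j i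

/-- The trace product `v • w = ∑ v^j w_j` with `v^j = ∑ v_i β^{ij}`. -/
def traceProd {m n : ℕ} {A : Type*} [Ring A] [Algebra ℂ A] (v w : Idx m n → A) : A :=
  ∑ j, (∑ i, betaInv i j • v i) * w j

/-! ## Superfunctions and superpolynomials -/

/-- Superfunctions: functions of the even variables `x ∈ X` with values in the Grassmann algebra
of the odd variables. -/
abbrev SFun (X τ : Type*) := Gr (X → ℂ) τ

/-- Superpolynomials `𝒫(ℂ^{σ}) ⊗ Λ(ℂ^{τ})`. -/
abbrev SPoly (σ τ : Type*) := Gr (MvPolynomial σ ℂ) τ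

/-- The exponential `exp(a_0) ∑ (a - a_0)^k / k!` of an even superfunction `a` with body `a_0`.
The sum is finite as `a - a_0` is nilpotent. -/
def sexp {X τ : Type*} [LinearOrder τ] [Fintype τ] (a : SFun X τ) : SFun X τ :=
  Gr.const (fun x => Complex.exp (a ∅ x)) *
    ∑ k ∈ Finset.range (Fintype.card τ + 1), ((k.factorial : ℂ)⁻¹) • (a - Gr.const (a ∅)) ^ k

/-- Superpolynomials as superfunctions of complex even variables. -/
def evalC {σ τ : Type*} (p : SPoly σ τ) : SFun (σ → ℂ) τ :=
  Gr.mapCoeff (fun q z => MvPolynomial.eval z q) p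

/-- Superpolynomials as superfunctions of real even variables. -/
def evalR {σ τ : Type*} (p : SPoly σ τ) : SFun (σ → ℝ) τ :=
  Gr.mapCoeff (fun q x => MvPolynomial.eval (fun i => (x i : ℂ)) q) p

/-- Complex conjugation of the coefficients of a superfunction. -/
def conjFun {X τ : Type*} (f : SFun X τ) : SFun X τ :=
  Gr.mapCoeff (fun q x => (starRingEnd ℂ) (q x)) f

/-- Conjugation `p ↦ p̄` of the coefficients of a superpolynomial. -/
def conjPoly {σ τ : Type*} (p : SPoly σ τ) : SPoly σ τ :=
  Gr.mapCoeff (MvPolynomial.map (starRingEnd ℂ)) p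

/-- The partial derivative in an even real variable of a superfunction. -/
def pdFun {σ : Type*} [DecidableEq σ] (i : σ) (g : (σ → ℝ) → ℂ) : (σ → ℝ) → ℂ :=
  fun x => deriv (fun s : ℝ => g (Function.update x i s)) (x i)

/-- The left partial derivative in the variable `i`, given the partial derivatives `d` in the
even variables of the coefficients. -/
def pd {R σ τ : Type*} [CommRing R] [LinearOrder τ] (d : σ → R → R) :
    σ ⊕ τ → Gr R τ → Gr R τ
  | Sum.inl i => Gr.mapCoeff (d i)
  | Sum.inr t => Gr.pdOdd t

/-- The word `∏ φ₀(i)^{α_i} ∏_{t ∈ S} φ₁(t)` obtained by substitution in `z^α θ_S`. -/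
def word {σ τ M : Type*} [Fintype σ] [LinearOrder τ] [Monoid M] (φ₀ : σ → M) (φ₁ : τ → M)
    (α : σ →₀ ℕ) (S : Finset τ) : M :=
  ((Finset.univ : Finset σ).toList.map fun i => φ₀ i ^ α i).prod *
    ((S.sort (· ≤ ·)).map φ₁).prod

/-- Substitution `z_i ↦ φ₀ i`, `θ_t ↦ φ₁ t` in a superpolynomial, with values in an algebra. -/
def subst {σ τ A : Type*} [Fintype σ] [LinearOrder τ] [Fintype τ] [Ring A] [Algebra ℂ A]
    (φ₀ : σ → A) (φ₁ : τ → A) (p : SPoly σ τ) : A :=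
  ∑ S : Finset τ, ∑ α ∈ (p S).support, (p S).coeff α • word φ₀ φ₁ α S

/-- The operator obtained from `p` by the substitution `z_i ↦ φ₀ i`, `θ_t ↦ φ₁ t` of operators
for the variables, applied to `v`. -/
def substOp {σ τ V : Type*} [Fintype σ] [LinearOrder τ] [Fintype τ] [AddCommGroup V] [Module ℂ V]
    (φ₀ : σ → V → V) (φ₁ : τ → V → V) (p : SPoly σ τ) (v : V) : V :=
  ∑ S : Finset τ, ∑ α ∈ (p S).support,
    (p S).coeff α • (word (M := Function.End V) φ₀ φ₁ α S) v

/-! ## The Schrödinger side: superfunctions on `ℝ^{m|2n}` -/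

section Schrodinger
variable (m n : ℕ)

/-- Superfunctions on `ℝ^{m|2n}`. -/
abbrev SFR := SFun (Fin m → ℝ) (Fin (2 * n))

variable {m n}

/-- The coordinates `x_i` of `ℝ^{m|2n}`. -/
def xvar : Idx m n → SFR m n
  | Sum.inl i => Gr.const fun x => (x i : ℂ)
  | Sum.inr a => Gr.gen a

/-- The derivatives `∂_i = ∑ β_{ij} ∂/∂x_j` on superfunctions on `ℝ^{m|2n}`. -/
def dR (i : Idx m n) (f : SFR m n) : SFR m n := ∑ j, beta i j • pd pdFun j f

/-- The superintegral over `ℝ^{m|2n}`: the Berezin integral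
`π^{-n} ∂/∂x_{m+2n} ⋯ ∂/∂x_{m+1}` followed by the Lebesgue integral over `ℝ^m`. -/
def intR (f : SFR m n) : ℂ :=
  ∫ x, ((Real.pi : ℂ) ^ n)⁻¹ *
    ((List.finRange (2 * n)).foldl (fun g t => Gr.pdOdd t g) f) ∅ x

/-- The constant `ω = ∫ exp(-2R²)`. -/
def omega (m n : ℕ) : ℂ := intR (sexp (-(2 : ℂ) • traceProd (xvar (m := m) (n := n)) xvar))

/-- The `L²`-product `⟨f, g⟩_W = ω⁻¹ ∫ f(x) \overline{g(x)} dx`. -/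
def formW (f g : SFR m n) : ℂ := (omega m n)⁻¹ * intR (f * conjFun g)

/-- The superfunction `exp(-R²)` on `ℝ^{m|2n}`. -/
def gauss (m n : ℕ) : SFR m n := sexp (-traceProd xvar xvar)

/-- `i` is the first of the indices `1, …, m + 2n`. -/
def IsFirst {m n : ℕ} : Idx m n → Prop
  | Sum.inl i => (i : ℕ) = 0
  | Sum.inr a => m = 0 ∧ (a : ℕ) = 0

/-- The metaplectic Schrödinger model `W̃ = U(𝔤) exp(-R²) ⊕ U(𝔤) x_1 exp(-R²)`. Here `U(𝔤)` acts
through the operators `-2ı x_i x_j` and `-(ı/2) ∂_i ∂_j`, by which the elements `ℓ_{ij}^±` act;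
these elements generate `𝔤`. -/
def schrodingerModel (m n : ℕ) : Submodule ℂ (SFR m n) :=
  sInf {N | gauss m n ∈ N ∧ (∀ i, IsFirst i → xvar i * gauss m n ∈ N) ∧
    (∀ i j, ∀ f ∈ N, xvar i * xvar j * f ∈ N) ∧ (∀ i j, ∀ f ∈ N, dR i (dR j f) ∈ N)}

/-- The Lebesgue superspace `L²(ℝ^{m|2n}) = L²(ℝ^m) ⊗ Λ(ℝ^{2n})`. -/
abbrev L2 (m n : ℕ) := Gr (MeasureTheory.Lp ℂ 2 (MeasureTheory.volume : MeasureTheory.Measure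
  (Fin m → ℝ))) (Fin (2 * n))

/-- `L²(ℝ^{m|2n})` with the product `⟨·,·⟩_W`. -/
def l2Super (m n : ℕ) : SuperForm (L2 m n) where
  part := Gr.part
  form f g := formW (fun S => (f S : (Fin m → ℝ) → ℂ)) (fun S => (g S : (Fin m → ℝ) → ℂ))

open Classical in
/-- The element of `L²(ℝ^{m|2n})` defined by a superfunction with square integrable
coefficients. -/
def toL2 (f : SFR m n) : L2 m n := fun S =>
  if h : MeasureTheory.MemLp (f S) 2 MeasureTheory.volume then h.toLp (f S) else 0

/-- The map `f(x) ↦ f(-x)` on `L²(ℝ^m)`. -/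
def reflect (m : ℕ) :
    MeasureTheory.Lp ℂ 2 (MeasureTheory.volume : MeasureTheory.Measure (Fin m → ℝ)) →ₗ[ℂ]
    MeasureTheory.Lp ℂ 2 (MeasureTheory.volume : MeasureTheory.Measure (Fin m → ℝ)) :=
  MeasureTheory.Lp.compMeasurePreservingₗ ℂ (fun x => -x)
    (MeasureTheory.Measure.measurePreserving_neg MeasureTheory.volume)

/-- `L²_even(ℝ^{m|2n})`: the elements that are invariant under the change of sign of all even and
odd variables. -/
def l2Even (m n : ℕ) : Submodule ℂ (L2 m n) where
  carrier := {f | ∀ S : Finset (Fin (2 * n)), reflect m (f S) = ((-1 : ℂ) ^ S.card) • f S}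
  add_mem' := fun hf hg S => by rw [Gr.add_apply, map_add, hf S, hg S, smul_add]
  zero_mem' := fun S => by simp
  smul_mem' := fun c f hf S => by rw [Gr.smul_apply, map_smul, hf S, smul_comm]

end Schrodinger

/-! ## The Fock side: superpolynomials on `ℂ^{m|2n}` -/

section Fock
variable {m n : ℕ}

/-- Superfunctions on `ℂ^{m|2n}` (without conjugate odd variables). -/
abbrev SFC (m n : ℕ) := SFun (Fin m → ℂ) (Fin (2 * n))

/-- Superpolynomials on `ℂ^{m|2n}`; this is the metaplectic Fock model `F̃`. -/
abbrev Fock (m n : ℕ) := SPoly (Fin m) (Fin (2 * n))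

/-- The variables `z_i` of `𝒫(ℂ^{m|2n})`. -/
def zvar : Idx m n → Fock m n
  | Sum.inl i => Gr.const (MvPolynomial.X i)
  | Sum.inr a => Gr.gen a

/-- Two copies of the odd variables. -/
abbrev Odd2 (n : ℕ) := Fin (2 * n) ⊕ₗ Fin (2 * n)

/-- The first copy of the odd variables. -/
def oddFst (n : ℕ) : Fin (2 * n) ↪o Odd2 n :=
  ⟨⟨fun a => Sum.inlₗ a, fun _ _ h => Sum.inl_injective (toLex.injective h)⟩,
    Sum.Lex.inl_le_inl_iff⟩

/-- The second copy of the odd variables. -/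
def oddSnd (n : ℕ) : Fin (2 * n) ↪o Odd2 n :=
  ⟨⟨fun a => Sum.inrₗ a, fun _ _ h => Sum.inr_injective (toLex.injective h)⟩,
    Sum.Lex.inr_le_inr_iff⟩

/-- The variables `z_i` among the superfunctions of `z` and `z̄`; the odd `z_i` are the first copy
of the odd variables. -/
def zC : Idx m n → SFun (Fin m → ℂ) (Odd2 n)
  | Sum.inl i => Gr.const fun z => z i
  | Sum.inr a => Gr.gen (oddFst n a)

/-- The variables `z̄_i` among the superfunctions of `z` and `z̄`; the odd `z̄_i` are the second
copy of the odd variables. -/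
def zbarC : Idx m n → SFun (Fin m → ℂ) (Odd2 n)
  | Sum.inl i => Gr.const fun z => (starRingEnd ℂ) (z i)
  | Sum.inr a => Gr.gen (oddSnd n a)

/-- The superfunction `exp(-‖z‖²)` with `‖z‖² = z • z̄`. -/
def gaussC (m n : ℕ) : SFun (Fin m → ℂ) (Odd2 n) := sexp (-traceProd (zC (m := m)) zbarC)

/-- The superintegral over `ℂ^{m|2n}`: the Berezin integral
`π^{-2n} ∂/∂z̄_{m+2n} ∂/∂z_{m+2n} ⋯ ∂/∂z̄_{m+1} ∂/∂z_{m+1}` followed by the Lebesgue integral over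
`ℂ^m`. -/
def intC (f : SFun (Fin m → ℂ) (Odd2 n)) : ℂ :=
  ∫ z, ((Real.pi : ℂ) ^ (2 * n))⁻¹ *
    ((List.finRange (2 * n)).foldl
      (fun g t => Gr.pdOdd (oddSnd n t) (Gr.pdOdd (oddFst n t) g)) f) ∅ z

/-- The Fock product
`⟨p, q⟩_F = γ⁻¹ ∫ exp(-‖z‖²) p(z) \overline{q(z)} dz` with `γ = ∫ exp(-‖z‖²) dz`. -/
def formF (p q : SFC m n) : ℂ :=
  (intC (gaussC m n))⁻¹ *
    intC (gaussC m n * Gr.relabel (oddFst n) p * Gr.relabel (oddSnd n) (conjFun q))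

/-- The metaplectic Fock model with the Fock product. -/
def fockSuper (m n : ℕ) : SuperForm (Fock m n) where
  part := Gr.part
  form p q := formF (evalC p) (evalC q)

/-- The map `S_F`, linear with `S_F(z_{i_1} ⋯ z_{i_k}) = z^{i_k} ⋯ z^{i_1}`. As `z^i = z_i` for
the even variables, it acts on the odd variables only. -/
def symF (p : Fock m n) : Fock m n :=
  ∑ S : Finset (Fin (2 * n)), Gr.const (p S) *
    (((S.sort (· ≤ ·)).reverse.map fun a =>
      ∑ i : Idx m n, betaInv i (Sum.inr a) • zvar i).prod)

/-- Superpolynomials of even degree (in all the variables together). -/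
def fockEven (m n : ℕ) : Submodule ℂ (Fock m n) where
  carrier := {p | ∀ (S : Finset (Fin (2 * n))) (α : Fin m →₀ ℕ),
    ¬ Even (α.degree + S.card) → (p S).coeff α = 0}
  add_mem' := fun hp hq S α h => by simp [hp S α h, hq S α h]
  zero_mem' := fun S α _ => by simp
  smul_mem' := fun c p hp S α h => by simp [hp S α h]

end Fock

/-! ## The Segal-Bargmann transform -/

section SB
variable {m n : ℕ}

/-- Superfunctions of `z` and `x`, for the integral kernel of the Segal-Bargmann transform; the
first copy of the odd variables belongs to `z`, the second to `x`. -/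
abbrev SFZX (m n : ℕ) := SFun ((Fin m → ℂ) × (Fin m → ℝ)) (Odd2 n)

/-- The variables `z_i`. -/
def zK : Idx m n → SFZX m n
  | Sum.inl i => Gr.const fun p => p.1 i
  | Sum.inr a => Gr.gen (oddFst n a)

/-- The variables `x_i`. -/
def xK : Idx m n → SFZX m n
  | Sum.inl i => Gr.const fun p => (p.2 i : ℂ)
  | Sum.inr a => Gr.gen (oddSnd n a)

/-- The integrand `exp(2 (z • x)) exp(-R_x²) f(x)`. -/
def integrandSB (f : SFR m n) : SFZX m n :=
  sexp ((2 : ℂ) • traceProd zK xK) * sexp (-traceProd xK xK) *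
    Gr.relabel (oddSnd n) (Gr.mapCoeff (fun g p => g p.2) f)

/-- The coordinates `z_i` of `ℂ^{m|2n}`, as superfunctions. -/
def zS (i : Idx m n) : SFC m n := evalC (zvar i)

/-- The superintegral `∫ exp(2 (z • x)) exp(-R_x²) f(x) dx` over `x`, as a function of `z`. -/
def intSB (f : SFR m n) : SFC m n := fun S z =>
  ∫ x, ((Real.pi : ℂ) ^ n)⁻¹ *
    ((List.finRange (2 * n)).foldl (fun g t => Gr.pdOdd (oddSnd n t) g) (integrandSB f))
      (S.map (oddFst n).toEmbedding) (z, x)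

/-- The Segal-Bargmann transform
`SB(f)(z) = ω⁻¹ exp(-R_z²/2) ∫ exp(2 (z • x)) exp(-R_x²) f(x) dx`. -/
def SB (f : SFR m n) : SFC m n :=
  (omega m n)⁻¹ • (sexp (-(1 / 2 : ℂ) • traceProd zS zS) * intSB f)

/-- The Segal-Bargmann transform of `f`, as a superpolynomial. -/
def SBpoly (f : SFR m n) : Fock m n := Function.invFun evalC (SB f)

end SB

/-! ## The Jordan superalgebra and its Bessel operators -/

section Jordan
variable {m n : ℕ}

/-- The matrix of `ℓ_{ij} = ∑_k (β_{jk} E_{ik} + (-1)^{|i||j|} β_{ik} E_{jk})`. -/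
def ellMat (i j : Idx m n) : Matrix (Idx m n) (Idx m n) ℂ :=
  ∑ k, (Matrix.single i k (beta j k) + Matrix.single j k ((-1) ^ (par i * par j) * beta i k))

/-- The odd part of a supermatrix. -/
def oddPart (X : Matrix (Idx m n) (Idx m n) ℂ) : Matrix (Idx m n) (Idx m n) ℂ :=
  Matrix.of fun i j => if par i = par j then 0 else X i j

/-- The Jordan product, the bilinear product with `X · Y = (X Y + (-1)^{|X||Y|} Y X) / 2` for
homogeneous `X` and `Y`. -/
def jordan (X Y : Matrix (Idx m n) (Idx m n) ℂ) : Matrix (Idx m n) (Idx m n) ℂ :=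
  (1 / 2 : ℂ) • (X * Y + Y * X) - oddPart Y * oddPart X

/-- The value `λ(L_X)` of the character with `λ(L_{ℓ_{ij}}) = λ β_{ij}`, for `λ = -1/2`; it is
`λ/2` times the supertrace of `X`. -/
def charL (X : Matrix (Idx m n) (Idx m n) ℂ) : ℂ := (-1 / 4) * ∑ i, (-1) ^ par i * X i i

/-- The even variables of `𝒫(J)`: `ℓ_{ij}` for `i ≤ j` both even, or `i < j` both odd. -/
abbrev EvJ (m n : ℕ) :=
  {p : Fin m × Fin m // p.1 ≤ p.2} ⊕ {p : Fin (2 * n) × Fin (2 * n) // p.1 < p.2}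

/-- The odd variables of `𝒫(J)`: `ℓ_{ij}` for `i` even and `j` odd. -/
abbrev OdJ (m n : ℕ) := Fin m ×ₗ Fin (2 * n)

/-- The indices `(i, j)` of the element `ℓ_{ij}` in the basis of `J`. -/
def pairOf : EvJ m n ⊕ OdJ m n → Idx m n × Idx m n
  | Sum.inl (Sum.inl p) => (Sum.inl p.1.1, Sum.inl p.1.2)
  | Sum.inl (Sum.inr p) => (Sum.inr p.1.1, Sum.inr p.1.2)
  | Sum.inr p => (Sum.inl (ofLex p).1, Sum.inr (ofLex p).2)

/-- The basis of `J`, as matrices. -/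
def basisMat (u : EvJ m n ⊕ OdJ m n) : Matrix (Idx m n) (Idx m n) ℂ :=
  ellMat (pairOf u).1 (pairOf u).2

/-- The parity of the basis elements of `J`. -/
def parJ (u : EvJ m n ⊕ OdJ m n) : ℕ := par (pairOf u).1 + par (pairOf u).2

section
variable {R : Type*} [CommRing R] [Algebra ℂ R]

/-- `ℓ_{ij}` for arbitrary indices as a superfunction on `J`, where `ev` gives the even
coordinates; `ℓ_{ij} = (-1)^{|i||j|} ℓ_{ji}`. -/
def ell (ev : EvJ m n → R) : Idx m n → Idx m n → Gr R (OdJ m n)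
  | Sum.inl i, Sum.inl j =>
      if h : i ≤ j then Gr.const (ev (Sum.inl ⟨(i, j), h⟩))
      else Gr.const (ev (Sum.inl ⟨(j, i), (not_le.1 h).le⟩))
  | Sum.inr a, Sum.inr b =>
      if h : a < b then Gr.const (ev (Sum.inr ⟨(a, b), h⟩))
      else if h : b < a then -Gr.const (ev (Sum.inr ⟨(b, a), h⟩))
      else 0
  | Sum.inl i, Sum.inr b => Gr.gen (toLex (i, b))
  | Sum.inr a, Sum.inl j => Gr.gen (toLex (j, a))

/-- The linear superfunction on `J` belonging to a matrix in `J`; it takes the matrix of `ℓ_{ij}`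
to `ℓ_{ij}`. -/
def linJ (ev : EvJ m n → R) (X : Matrix (Idx m n) (Idx m n) ℂ) : Gr R (OdJ m n) :=
  ∑ i, ∑ k, ∑ j, ((1 / 2 : ℂ) * X i k * betaInv k j) • ell ev i j

/-- The matrix `P̃_{u,v}(x) = (-1)^{|x|(|u|+|v|)} (L_u L_v + (-1)^{|u||v|} L_v L_u - L_{uv})(x)` for
elements `u`, `v`, `x` of the basis of `J`. -/
def Ptilde (u v x : EvJ m n ⊕ OdJ m n) : Matrix (Idx m n) (Idx m n) ℂ :=
  ((-1 : ℂ) ^ (parJ x * (parJ u + parJ v))) •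
    (jordan (basisMat u) (jordan (basisMat v) (basisMat x))
      + ((-1 : ℂ) ^ (parJ u * parJ v)) • jordan (basisMat v) (jordan (basisMat u) (basisMat x))
      - jordan (jordan (basisMat u) (basisMat v)) (basisMat x))

/-- The Bessel operator
`ℬ(x) = ∑_u λ_u(x) ∂_u + ∑_{u,v} P̃_{u,v}(x) ∂_v ∂_u` for `λ = -1/2`, with `λ_u(x) = -2 λ(L_{xu})`,
for `x` in the basis of `J`. -/
def bessel (ev : EvJ m n → R) (d : EvJ m n → R → R) (x : EvJ m n ⊕ OdJ m n)
    (f : Gr R (OdJ m n)) : Gr R (OdJ m n) :=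
  ∑ u, ((-2 : ℂ) * charL (jordan (basisMat x) (basisMat u))) • pd d u f +
    ∑ u, ∑ v, linJ ev (Ptilde u v x) * pd d v (pd d u f)

end

end Jordan

/-! ## The minimal Fock model and the Bessel-Fischer product -/

section MinFock
variable {m n : ℕ}

/-- The superpolynomials `𝒫(J) = 𝒫(ℂ^{m̂|2n̂})`. -/
abbrev PJ (m n : ℕ) := SPoly (EvJ m n) (OdJ m n)

/-- The variables `ℓ_{ij}` of `𝒫(J)`. -/
def ellP (i j : Idx m n) : PJ m n := ell MvPolynomial.X i j

/-- The Bessel operators on superpolynomials. -/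
def besselP (x : EvJ m n ⊕ OdJ m n) : PJ m n → PJ m n :=
  bessel MvPolynomial.X (fun i q => MvPolynomial.pderiv i q) x

/-- The ideal `ℐ = 𝒫(J) V`, where `V` is spanned by the superpolynomials
`ℓ_{ij} ℓ_{kl} - (-1)^{|k||j|} ℓ_{ik} ℓ_{jl}`. -/
def idealJ (m n : ℕ) : Submodule ℂ (PJ m n) :=
  Submodule.span ℂ {f | ∃ (p : PJ m n) (i j k l : Idx m n),
    f = p * (ellP i j * ellP k l - ((-1 : ℂ) ^ (par k * par j)) • (ellP i k * ellP j l))}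

/-- The minimal Fock model `F = 𝒫(J) / ℐ`. -/
abbrev MinFock (m n : ℕ) := PJ m n ⧸ idealJ m n

/-- The Bessel-Fischer product `p(ℬ) q̄ |_{ℓ = 0}` of superpolynomials. -/
def besselFischer (p q : PJ m n) : ℂ :=
  MvPolynomial.constantCoeff
    ((substOp (fun i => besselP (Sum.inl i)) (fun t => besselP (Sum.inr t)) p (conjPoly q)) ∅)

/-- The minimal Fock model with the Bessel-Fischer product, computed on representatives. -/
def minFockSuper (m n : ℕ) : SuperForm (MinFock m n) where
  part a := (Gr.part a).map (idealJ m n).mkQ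
  form x y := besselFischer x.out y.out

/-- The folding map `ℓ_{ij} ↦ z_i z_j` on superpolynomials. -/
def fold (p : PJ m n) : Fock m n :=
  subst (fun u => zvar (pairOf (Sum.inl u)).1 * zvar (pairOf (Sum.inl u)).2)
    (fun t => zvar (pairOf (Sum.inr t)).1 * zvar (pairOf (Sum.inr t)).2) p

/-- The folding isomorphism `ψ_ℂ` on the minimal Fock model, computed on representatives. -/
def psiC (x : MinFock m n) : Fock m n := fold x.out

/-- The map `T_F = ψ_ℂ⁻¹ ∘ S_F ∘ ψ_ℂ`. -/
def symMinF (x : MinFock m n) : MinFock m n := Function.invFun psiC (symF (psiC x))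

end MinFock

/-! ## The minimal Schrödinger model -/

section MinSchrodinger
variable {m n : ℕ}

/-- Superfunctions on `ℝ^{m̂|2n̂}`. -/
abbrev SFJ (m n : ℕ) := SFun (EvJ m n → ℝ) (OdJ m n)

/-- The even coordinates of `ℝ^{m̂|2n̂}`. -/
def evJ (u : EvJ m n) : (EvJ m n → ℝ) → ℂ := fun t => (t u : ℂ)

/-- The superfunction `exp(-2e)` with `2e = ∑ ℓ_{ij} β^{ij}`. -/
def expJ (m n : ℕ) : SFJ m n := sexp (-∑ i, ∑ j, betaInv i j • ell evJ i j)

/-- The subspace `ℐ exp(-2e)` of the superfunctions on `ℝ^{m̂|2n̂}`. -/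
def idealExp (m n : ℕ) : Submodule ℂ (SFJ m n) :=
  Submodule.span ℂ {f | ∃ p ∈ idealJ m n, f = evalR p * expJ m n}

/-- The module `U(𝔤) exp(-2e)`. Here `U(𝔤)` acts through the operators `-2ı ℓ_{ij}` and
`-(ı/2) ℬ(ℓ_{ij})`, by which the elements `ℓ_{ij}^±` act; these elements generate `𝔤`. -/
def modExp (m n : ℕ) : Submodule ℂ (SFJ m n) :=
  sInf {N | expJ m n ∈ N ∧ (∀ i j, ∀ f ∈ N, ell evJ i j * f ∈ N) ∧
    (∀ x, ∀ f ∈ N, bessel evJ pdFun x f ∈ N)}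

/-- The minimal Schrödinger model `W = U(𝔤) exp(-2e) mod ℐ`, as a subspace of the space of
superfunctions modulo `ℐ exp(-2e)`. -/
def minSchrodinger (m n : ℕ) : Submodule ℂ (SFJ m n ⧸ idealExp m n) :=
  (modExp m n).map (idealExp m n).mkQ

/-- The class of `p exp(-2e)`. -/
def expClass (p : PJ m n) : SFJ m n ⧸ idealExp m n := (idealExp m n).mkQ (evalR p * expJ m n)

/-- The folding map `p exp(-2e) ↦ ψ(p) exp(-R²)`. -/
def psiR (w : SFJ m n ⧸ idealExp m n) : SFR m n :=
  evalR (fold (Function.invFun expClass w)) * gauss m n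

/-- The minimal Schrödinger model with the Schrödinger product
`⟨f, g⟩ = ⟨ψ_ℝ f, ψ_ℝ g⟩_W`. -/
def minSchrodingerSuper (m n : ℕ) : SuperForm (minSchrodinger m n) where
  part a := ((Gr.part a).map (idealExp m n).mkQ).comap (minSchrodinger m n).subtype
  form v w := formW (psiR (v : SFJ m n ⧸ idealExp m n)) (psiR (w : SFJ m n ⧸ idealExp m n))

/-- The minimal-orbit Segal-Bargmann transform `ψ_ℂ⁻¹ ∘ SB ∘ ψ_ℝ`. -/
def SBhat (w : minSchrodinger m n) : MinFock m n :=
  Function.invFun psiC (SBpoly (psiR (w : SFJ m n ⧸ idealExp m n)))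

/-- The map `T_W`, the conjugate of `T_F` by the minimal-orbit Segal-Bargmann transform. -/
def symMinW (w : minSchrodinger m n) : minSchrodinger m n :=
  Function.invFun SBhat (symMinF (SBhat w))

end MinSchrodinger

/-- The operator `φ`, defined on a set `A` of elements of `V₁` (given by `ι₁`) and with values in
`V₂ ⊆ Z` (given by `ι₂`), extends to exactly one superunitary operator from `V₁` to `V₂`. -/
def ExtendsToSuperunitary {A V₁ V₂ Z : Type*} [AddCommGroup V₁] [Module ℂ V₁] [AddCommGroup V₂]
    [Module ℂ V₂] (H₁ : SuperForm V₁) (H₂ : SuperForm V₂) (ι₁ : A → V₁) (ι₂ : V₂ → Z)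
    (φ : A → Z) : Prop :=
  ∃! T : V₁ →ₗ[ℂ] V₂, (∀ a, ι₂ (T (ι₁ a)) = φ a) ∧ H₁.IsSuperunitary H₂ T

end SegalBargmann
end

/-!
The theorem compares four models. All of them are described by superpolynomials, on which every
claim becomes a statement about the operators "multiply by `z_i`" and "differentiate by `z_i`".

*The Segal-Bargmann transform.* The metaplectic Schrödinger model consists of all `p exp(-R²)`
with a superpolynomial `p` (`schrodingerModel_eq`); for `(m, n) = (0, 1)` this would fail. Let
`invSB` be the map that takes `1` to `exp(-R²)` and intertwines multiplication by `z_i` with the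
creation operator `x_i - ½ ∂_i`; its values are Hermite superfunctions, and it is onto the
Schrödinger model (`range_invSB`). Integration by parts in the even and odd variables shows that
`SB` takes creation operators to multiplication by `z_i`, and a Gaussian integral shows that `exp(-R²)`
goes to `1`. Hence `SB` is inverse to `invSB` (`SB_invSB`). In the Fock product the adjoint of
multiplication by `z_i` is `∂_i`, and in the Schrödinger product the adjoint of a creation
operator is the corresponding annihilation operator, so both products are determined by the
products with the vacuum, where they agree (`formW_invSB`).

*The minimal models.* The folding map `ℓ_{ij} ↦ z_i z_j` intertwines the Bessel operator of
`ℓ_{ij}` with `∂_i ∂_j` (`foldAlg_besselₗ`), by a computation with supermatrices. Therefore the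
Bessel-Fischer product is the pullback of the Fock product (`besselFischer_eq`). The kernel of the
folding map is the ideal `ℐ` (`foldAlg_eq_zero_iff`): one extends `𝒫(J)/ℐ` by an odd half to a
module over `𝒫(ℂ^{m|2n})` on which `ℓ_{ij}` acts as `z_i z_j`, and applies an element of the
kernel to `1`. The image consists of the superpolynomials of even degree. So the minimal models
are the even halves of the metaplectic ones.

*Fundamental symmetries.* The form `⟨p, S_F q⟩_F` is the standard inner product for which the
monomials are orthogonal (`fockForm_symFₗ`), and the square of `S_F` is the parity operator.
Fundamental symmetries with the latter property determine the grading, pull back along injections,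
pass to completions and closed subspaces (`SuperForm.IsGradedSymmetry`,
`SuperForm.IsHilbertModel`), and a densely defined map with dense range that preserves the forms
and commutes with such symmetries extends to exactly one superunitary operator
(`SuperForm.existsUnique_superunitary`).

*The Lebesgue superspace.* The transform of `S_F` on superfunctions acts on the odd variables
only, by a weighted Hodge star (`hodge_hermiteGauss`). It therefore extends to
`L²(ℝ^m) ⊗ Λ(ℂ^{2n})`, which becomes a Hilbert space with a weighted `ℓ²`-sum of the norms of the
coefficients (`l2_isHilbertModel`). Polynomials times Gaussians are dense in `L²(ℝ^m)`, by
injectivity of the Fourier transform (`denseRange_gaussLp`), and the projection onto the functions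
that are invariant under `x ↦ -x` gives the even case (`denseRange_hermiteL2_even`).
-/

set_option linter.unusedSectionVars false
open MeasureTheory

noncomputable section

namespace SegalBargmann

/-! ### Grassmann algebras -/

namespace Gr

theorem neg_apply {R τ : Type*} [AddCommGroup R] (a : Gr R τ) (S : Finset τ) :
    (-a) S = - a S := rfl

theorem sub_apply {R τ : Type*} [AddCommGroup R] (a b : Gr R τ) (S : Finset τ) :
    (a - b) S = a S - b S := rfl

theorem sum_apply {ι R τ : Type*} [AddCommGroup R] (s : Finset ι) (f : ι → Gr R τ)
    (S : Finset τ) : (∑ i ∈ s, f i) S = ∑ i ∈ s, f i S := by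
  induction s using Finset.cons_induction with
  | empty => rfl
  | cons a s ha ih => rw [Finset.sum_cons, Finset.sum_cons, add_apply, ih]

section basic
variable {R τ : Type*} [CommRing R] [LinearOrder τ]

theorem inv_singleton_left (t : τ) (U : Finset τ) :
    inv {t} U = (U.filter fun s => s < t).card := by
  unfold inv
  rw [Finset.singleton_product, Finset.filter_map, Finset.card_map]
  rfl

theorem gen_mul_apply (t : τ) (f : Gr R τ) (S : Finset τ) :
    (gen t * f : Gr R τ) S =
      if t ∈ S then (-1) ^ (S.filter fun s => s < t).card * f (S.erase t) else 0 := by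
  rw [mul_apply]
  split_ifs with h
  · rw [Finset.sum_eq_single {t}]
    · rw [inv_singleton_left, Finset.sdiff_singleton_eq_erase, gen, if_pos rfl, one_mul]
      congr 3
      ext s; simp only [Finset.mem_filter, Finset.mem_erase]
      exact ⟨fun h => ⟨h.1.2, h.2⟩, fun h => ⟨⟨h.2.ne, h.1⟩, h.2⟩⟩
    · intro T _ hT; simp [gen, hT]
    · intro hT; exact absurd (by simpa using h) hT
  · apply Finset.sum_eq_zero
    intro T hT
    have : T ≠ {t} := by rintro rfl; exact h (by simpa using hT)
    simp [gen, this]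

theorem one_apply (S : Finset τ) : (1 : Gr R τ) S = if S = ∅ then 1 else 0 := rfl

theorem const_one : (const 1 : Gr R τ) = 1 := rfl

theorem card_filter_insert (s t : τ) (S : Finset τ) (h : t ∉ S) :
    ((insert t S).filter fun x => x < s).card =
      (S.filter fun x => x < s).card + if t < s then 1 else 0 := by
  rw [Finset.filter_insert]
  split_ifs
  · rw [Finset.card_insert_of_notMem (by simp [h])]
  · rfl

theorem card_filter_erase (s t : τ) (S : Finset τ) (h : t ∈ S) :
    (S.filter fun x => x < s).card =
      ((S.erase t).filter fun x => x < s).card + if t < s then 1 else 0 := by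
  conv_lhs => rw [← Finset.insert_erase h]
  exact card_filter_insert s t _ (by simp)

/-- The operators `θ_s` and `∂/∂θ_t` satisfy the canonical anticommutation relations. -/
theorem pdOdd_gen_mul (s t : τ) (f : Gr R τ) :
    pdOdd t (gen s * f) = (if s = t then f else 0) - gen s * pdOdd t f := by
  ext S
  rw [sub_apply, pdOdd, gen_mul_apply, gen_mul_apply]
  by_cases hst : s = t
  · subst hst
    by_cases hs : s ∈ S
    · have h1 := card_filter_erase s s S hs
      rw [if_neg (lt_irrefl s), add_zero] at h1
      simp [hs, pdOdd, ← mul_assoc, ← pow_add, h1, ← two_mul]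
    · simp [hs, card_filter_insert, ← mul_assoc, ← pow_add, ← two_mul]
  · by_cases ht : t ∈ S
    · have h1 : t ∈ S.erase s := by simp [ht, Ne.symm hst]
      simp [ht, hst, pdOdd, h1]
    · by_cases hs : s ∈ S
      · have h1 : t ∉ S.erase s := by simp [ht]
        have h2 : (insert t S).erase s = insert t (S.erase s) := by
          rw [Finset.erase_insert_of_ne (Ne.symm hst)]
        simp only [ht, hst, hs, pdOdd, h1, if_false, if_true, Finset.mem_insert, or_true, h2,
          zero_apply, zero_sub]
        rw [card_filter_insert s t S ht, card_filter_erase t s S hs]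
        rcases lt_or_gt_of_ne hst with h | h
        · simp [h, not_lt.2 h.le, pow_add]; ring
        · simp [h, not_lt.2 h.le, pow_add]; ring
      · have h1 : s ∉ insert t S := by simp [hst, hs]
        simp [ht, hst, hs, h1]

theorem gen_mul_gen_mul (s t : τ) (f : Gr R τ) :
    (gen s * (gen t * f) : Gr R τ) = - (gen t * (gen s * f)) := by
  ext S
  rw [neg_apply]
  simp only [gen_mul_apply, Finset.mem_erase]
  by_cases hst : s = t
  · subst hst; simp
  · by_cases hs : s ∈ S
    · by_cases ht : t ∈ S
      · simp only [hs, ht, hst, Ne.symm hst, ne_eq, not_false_eq_true, and_self, if_true]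
        rw [Finset.erase_right_comm, card_filter_erase s t S ht, card_filter_erase t s S hs]
        rcases lt_or_gt_of_ne hst with h | h
        · simp [h, not_lt.2 h.le, pow_add]; ring
        · simp [h, not_lt.2 h.le, pow_add]; ring
      · simp [ht]
    · simp [hs]

theorem gen_mul_gen (s t : τ) : (gen s * gen t : Gr R τ) = - (gen t * gen s) := by
  have := gen_mul_gen_mul (R := R) s t 1
  simpa only [mul_one] using this

theorem gen_mul_self_mul (s : τ) (f : Gr R τ) : (gen s * (gen s * f) : Gr R τ) = 0 := by
  ext S
  simp [gen_mul_apply]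

theorem gen_mul_self (s : τ) : (gen s * gen s : Gr R τ) = 0 := by
  have := gen_mul_self_mul (R := R) s 1
  simpa only [mul_one] using this

theorem const_mul_comm (r : R) (f : Gr R τ) : (const r * f : Gr R τ) = f * const r := by
  ext S; rw [mul_const, const_mul, mul_comm]

theorem const_mul_const (r s : R) : (const r * const s : Gr R τ) = const (r * s) := by
  ext S; rw [const_mul, const, const]; split_ifs <;> simp

theorem const_add (r s : R) : (const (r + s) : Gr R τ) = const r + const s := by
  ext S; rw [add_apply]; simp only [const]; split_ifs <;> simp

theorem const_zero : (const 0 : Gr R τ) = 0 := by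
  ext S; simp [const]

theorem pdOdd_add (t : τ) (f g : Gr R τ) : pdOdd t (f + g) = pdOdd t f + pdOdd t g := by
  ext S; simp only [pdOdd, add_apply]; split_ifs <;> ring

theorem pdOdd_const (t : τ) (r : R) : pdOdd t (const r : Gr R τ) = 0 := by
  ext S; simp [pdOdd, const, Finset.insert_ne_empty]

theorem pdOdd_const_mul (t : τ) (r : R) (f : Gr R τ) :
    pdOdd t (const r * f) = const r * pdOdd t f := by
  ext S; simp only [const_mul, pdOdd]; split_ifs <;> ring

theorem pdOdd_gen (s t : τ) : pdOdd t (gen s : Gr R τ) = if s = t then 1 else 0 := by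
  have := pdOdd_gen_mul (R := R) s t 1
  rw [mul_one, ← const_one, pdOdd_const, mul_zero, sub_zero] at this
  exact this

/-- The element with the single coefficient `r` at `S`. -/
def single (S : Finset τ) (r : R) : Gr R τ := fun T => if T = S then r else 0

theorem single_insert (S : Finset τ) (t : τ) (ht : t ∉ S) (r : R) :
    (single (insert t S) r : Gr R τ) =
      gen t * single S ((-1) ^ (S.filter fun s => s < t).card * r) := by
  ext T
  rw [gen_mul_apply]
  by_cases h : t ∈ T
  · rw [if_pos h]
    simp only [single]
    by_cases hT : T = insert t S
    · subst hT
      simp [ht, card_filter_insert, ← mul_assoc, ← pow_add, ← two_mul]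
    · have : T.erase t ≠ S := by rintro rfl; exact hT (by simp [h])
      simp [hT, this]
  · have : T ≠ insert t S := by rintro rfl; simp at h
    simp [h, single, this]

theorem sum_single [Fintype τ] (f : Gr R τ) : f = ∑ S, single S (f S) := by
  ext T
  rw [sum_apply, Finset.sum_eq_single T]
  · simp [single]
  · intro S _ hS; simp [single, Ne.symm hS]
  · simp

/-- A Grassmann algebra is generated from its constants by addition and left multiplication by
the generators. -/
theorem induction [Fintype τ] {P : Gr R τ → Prop} (hc : ∀ r, P (const r))
    (ha : ∀ f g, P f → P g → P (f + g)) (hg : ∀ t f, P f → P (gen t * f)) (f : Gr R τ) : P f := by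
  have hs : ∀ (S : Finset τ) (r : R), P (single S r) := by
    intro S
    induction S using Finset.induction_on with
    | empty => exact hc
    | insert t S ht ih => intro r; rw [single_insert S t ht]; exact hg _ _ (ih _)
  rw [sum_single f]
  refine Finset.sum_induction _ P ha ?_ fun S _ => hs S _
  rw [← const_zero]; exact hc 0

end basic

section parity

/-- The parity involution, which acts by `(-1)^a` on the part of parity `a`. -/
def parity {R τ : Type*} [AddCommGroup R] [Module ℂ R] : Gr R τ →ₗ[ℂ] Gr R τ where
  toFun f S := ((-1 : ℂ) ^ S.card) • f S
  map_add' f g := by ext S; exact smul_add _ _ _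
  map_smul' c f := by ext S; exact smul_comm _ c (f S)

theorem parity_apply {R τ : Type*} [AddCommGroup R] [Module ℂ R] (f : Gr R τ) (S : Finset τ) :
    parity f S = ((-1 : ℂ) ^ S.card) • f S := rfl

theorem parity_parity {R τ : Type*} [AddCommGroup R] [Module ℂ R] (f : Gr R τ) :
    parity (parity f) = f := by
  ext S; rw [parity_apply, parity_apply, smul_smul, ← pow_add, ← two_mul]; simp

theorem mem_part_iff {R τ : Type*} [AddCommGroup R] [Module ℂ R] (f : Gr R τ) (a : ZMod 2) :
    f ∈ part a ↔ parity f = ((-1 : ℂ) ^ a.val) • f := by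
  constructor
  · intro h
    ext S
    rw [parity_apply, smul_apply]
    by_cases hS : (S.card : ZMod 2) = a
    · congr 1
      rw [← hS, ZMod.val_natCast]
      exact neg_one_pow_eq_pow_mod_two _
    · rw [h S hS, smul_zero, smul_zero]
  · intro h S hS
    have h1 : parity f S = (((-1 : ℂ) ^ a.val) • f) S := by rw [h]
    rw [parity_apply, smul_apply] at h1
    have h2 : ((-1 : ℂ) ^ S.card) = - (-1) ^ a.val := by
      rw [neg_one_pow_eq_pow_mod_two, ← ZMod.val_natCast]
      generalize (S.card : ZMod 2) = b at hS
      clear h1 h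
      fin_cases a <;> fin_cases b <;> first | exact absurd rfl hS | simp [ZMod.val]
    rw [h2, neg_smul] at h1
    have h3 : (2 : ℂ) • (((-1 : ℂ) ^ a.val) • f S) = 0 := by
      rw [two_smul]; nth_rewrite 1 [← h1]; simp
    rw [smul_smul] at h3
    exact (smul_eq_zero_iff_right (M := R)
      (mul_ne_zero two_ne_zero (pow_ne_zero _ (by norm_num)))).1 h3

variable {R τ : Type*} [CommRing R] [Algebra ℂ R] [LinearOrder τ]

theorem parity_const (r : R) : parity (const r : Gr R τ) = const r := by
  ext S; rw [parity_apply, const]; split_ifs with h <;> simp [h]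

theorem parity_one : parity (1 : Gr R τ) = 1 := parity_const 1

theorem parity_gen_mul (t : τ) (f : Gr R τ) : parity (gen t * f) = - (gen t * parity f) := by
  ext S
  rw [neg_apply, parity_apply, gen_mul_apply, gen_mul_apply]
  split_ifs with h
  · rw [parity_apply, ← Finset.card_erase_add_one h, pow_succ]
    simp
  · simp

theorem parity_gen (t : τ) : parity (gen t : Gr R τ) = - gen t := by
  have := parity_gen_mul (R := R) t 1
  rwa [mul_one, parity_one, mul_one] at this

theorem parity_const_mul (r : R) (f : Gr R τ) : parity (const r * f) = const r * parity f := by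
  ext S; simp only [parity_apply, const_mul, mul_smul_comm]

theorem pdOdd_smul (t : τ) (c : ℂ) (f : Gr R τ) : pdOdd t (c • f) = c • pdOdd t f := by
  ext S; simp only [pdOdd, smul_apply]; split_ifs <;> simp

/-- `∂/∂θ_t` as a linear map. -/
def pdOddₗ (t : τ) : Gr R τ →ₗ[ℂ] Gr R τ where
  toFun := pdOdd t
  map_add' := pdOdd_add t
  map_smul' := pdOdd_smul t

theorem pdOddₗ_apply (t : τ) (f : Gr R τ) : pdOddₗ t f = pdOdd t f := rfl

theorem parity_pdOdd (t : τ) (f : Gr R τ) : parity (pdOdd t f) = - pdOdd t (parity f) := by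
  ext S
  rw [neg_apply, parity_apply, pdOdd, pdOdd]
  split_ifs with h
  · simp
  · rw [parity_apply, Finset.card_insert_of_notMem h, pow_succ]
    simp

variable [Fintype τ]

theorem parity_mul (f g : Gr R τ) : parity (f * g) = parity f * parity g := by
  induction f using Gr.induction with
  | hc r => rw [parity_const_mul, parity_const]
  | ha f₁ f₂ h₁ h₂ => rw [add_mul, map_add, map_add, h₁, h₂, add_mul]
  | hg t f h => rw [mul_assoc, parity_gen_mul, h, parity_gen_mul, neg_mul, mul_assoc]

/-- `∂/∂θ_t` is an antiderivation. -/
theorem pdOdd_mul (t : τ) (f g : Gr R τ) :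
    pdOdd t (f * g) = pdOdd t f * g + parity f * pdOdd t g := by
  induction f using Gr.induction with
  | hc r => rw [pdOdd_const_mul, parity_const, pdOdd_const, zero_mul, zero_add]
  | ha f₁ f₂ h₁ h₂ => rw [add_mul, pdOdd_add, h₁, h₂, pdOdd_add, map_add, add_mul, add_mul]; abel
  | hg s f h =>
    rw [mul_assoc, pdOdd_gen_mul, h, pdOdd_gen_mul, parity_gen_mul]
    split_ifs <;> noncomm_ring

theorem mul_gen (f : Gr R τ) (t : τ) : f * gen t = gen t * parity f := by
  induction f using Gr.induction with
  | hc r => rw [parity_const, const_mul_comm]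
  | ha f₁ f₂ h₁ h₂ => rw [add_mul, h₁, h₂, map_add, mul_add]
  | hg s f h => rw [mul_assoc, h, parity_gen_mul, mul_neg, gen_mul_gen_mul]

/-- Homogeneous elements supercommute with all elements. -/
theorem mul_comm_of_parity {r : Gr R τ} {c : ℕ} (hr : parity r = ((-1 : ℂ) ^ c) • r)
    (f : Gr R τ) : r * f = (parity^[c] f) * r := by
  induction f using Gr.induction with
  | hc x =>
    have : parity^[c] (const x : Gr R τ) = const x :=
      Function.iterate_fixed (parity_const x) c
    rw [this, const_mul_comm]
  | ha f₁ f₂ h₁ h₂ => rw [mul_add, h₁, h₂, ← Module.End.pow_apply, ← Module.End.pow_apply,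
      ← Module.End.pow_apply, map_add, add_mul]
  | hg s f h =>
    have h1 : ∀ k : ℕ, parity^[k] (gen s * f : Gr R τ) =
        ((-1 : ℂ) ^ k) • (gen s * parity^[k] f) := by
      intro k
      induction k with
      | zero => simp
      | succ k ih =>
        rw [Function.iterate_succ_apply', ih, map_smul, parity_gen_mul,
          Function.iterate_succ_apply', pow_succ, mul_neg_one, neg_smul, smul_neg]
    rw [h1, ← mul_assoc, mul_gen, hr, mul_smul_comm, smul_mul_assoc, smul_mul_assoc, mul_assoc,
      mul_assoc, h]

theorem mul_comm_of_even {r : Gr R τ} (hr : parity r = r) (f : Gr R τ) : r * f = f * r := by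
  have := mul_comm_of_parity (c := 0) (r := r) (by simpa using hr) f
  simpa using this

end parity
end Gr
namespace Gr

section relabel
variable {R R' τ τ' : Type*} [CommRing R] [CommRing R'] [LinearOrder τ] [LinearOrder τ']

theorem relabel_map (e : τ ↪o τ') (f : Gr R τ) (S : Finset τ) :
    relabel e f (S.map e.toEmbedding) = f S := by
  have h : ∃ T : Finset τ, T.map e.toEmbedding = S.map e.toEmbedding := ⟨S, rfl⟩
  rw [relabel, dif_pos h]
  congr 1
  exact Finset.map_injective _ h.choose_spec

theorem relabel_of_not (e : τ ↪o τ') (f : Gr R τ) (U : Finset τ')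
    (h : ¬ ∃ S : Finset τ, S.map e.toEmbedding = U) : relabel e f U = 0 := by
  rw [relabel, dif_neg h]

theorem relabel_add (e : τ ↪o τ') (f g : Gr R τ) :
    relabel e (f + g) = relabel e f + relabel e g := by
  ext U
  by_cases h : ∃ S : Finset τ, S.map e.toEmbedding = U
  · obtain ⟨S, rfl⟩ := h
    rw [add_apply, relabel_map, relabel_map, relabel_map, add_apply]
  · rw [add_apply, relabel_of_not e _ U h, relabel_of_not e _ U h, relabel_of_not e _ U h,
      add_zero]

theorem relabel_const (e : τ ↪o τ') (r : R) : relabel e (const r : Gr R τ) = const r := by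
  ext U
  by_cases h : ∃ S : Finset τ, S.map e.toEmbedding = U
  · obtain ⟨S, rfl⟩ := h
    rw [relabel_map]; simp [const]
  · rw [relabel_of_not e _ U h, const, if_neg]
    rintro rfl; exact h ⟨∅, by simp⟩

theorem relabel_gen_mul (e : τ ↪o τ') (t : τ) (f : Gr R τ) :
    relabel e (gen t * f) = gen (e t) * relabel e f := by
  ext U
  by_cases h : ∃ S : Finset τ, S.map e.toEmbedding = U
  · obtain ⟨S, rfl⟩ := h
    rw [relabel_map, gen_mul_apply, gen_mul_apply]
    have h1 : (S.map e.toEmbedding).erase (e t) = (S.erase t).map e.toEmbedding :=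
      (Finset.map_erase e.toEmbedding S t).symm
    have h2 : ((S.map e.toEmbedding).filter fun s => s < e t).card =
        (S.filter fun s => s < t).card := by
      rw [Finset.filter_map, Finset.card_map]
      congr 1
      ext s; simp
    rw [h1, h2, relabel_map]
    simp
  · rw [relabel_of_not e _ U h, gen_mul_apply]
    split_ifs with hU
    · rw [relabel_of_not, mul_zero]
      rintro ⟨S, hS⟩
      apply h
      refine ⟨insert t S, ?_⟩
      rw [Finset.map_insert, hS]
      exact Finset.insert_erase hU
    · rfl

theorem pdOdd_relabel [Fintype τ] (e : τ ↪o τ') (t : τ) (f : Gr R τ) :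
    pdOdd (e t) (relabel e f) = relabel e (pdOdd t f) := by
  induction f using Gr.induction with
  | hc r => rw [relabel_const, pdOdd_const, pdOdd_const, ← const_zero, ← const_zero,
      relabel_const]
  | ha f₁ f₂ h₁ h₂ => rw [relabel_add, pdOdd_add, h₁, h₂, pdOdd_add, relabel_add]
  | hg s f h =>
    rw [relabel_gen_mul, pdOdd_gen_mul, h, pdOdd_gen_mul, sub_eq_add_neg, sub_eq_add_neg,
      relabel_add]
    have hneg : ∀ g : Gr R τ, relabel e (-g) = - relabel e g := by
      intro g
      rw [eq_neg_iff_add_eq_zero, ← relabel_add, neg_add_cancel, ← const_zero, relabel_const,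
        const_zero]
    rw [hneg, relabel_gen_mul]
    by_cases hst : s = t
    · simp [hst]
    · simp only [hst, EmbeddingLike.apply_eq_iff_eq, if_false]
      rw [← const_zero, ← const_zero, relabel_const]

theorem pdOdd_relabel_of_ne [Fintype τ] (e : τ ↪o τ') (t : τ') (ht : ∀ s, e s ≠ t)
    (f : Gr R τ) : pdOdd t (relabel e f) = 0 := by
  induction f using Gr.induction with
  | hc r => rw [relabel_const, pdOdd_const]
  | ha f₁ f₂ h₁ h₂ => rw [relabel_add, pdOdd_add, h₁, h₂, add_zero]
  | hg s f h => rw [relabel_gen_mul, pdOdd_gen_mul, h, if_neg (ht s), mul_zero, sub_zero]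

theorem parity_relabel [Algebra ℂ R] (e : τ ↪o τ') (f : Gr R τ) :
    parity (relabel e f) = relabel e (parity f) := by
  ext U
  by_cases h : ∃ S : Finset τ, S.map e.toEmbedding = U
  · obtain ⟨S, rfl⟩ := h
    rw [relabel_map, parity_apply, parity_apply, relabel_map, Finset.card_map]
  · rw [parity_apply, relabel_of_not e _ U h, relabel_of_not e _ U h, smul_zero]

theorem relabel_smul [Algebra ℂ R] (e : τ ↪o τ') (c : ℂ) (f : Gr R τ) :
    relabel e (c • f) = c • relabel e f := by
  ext U
  by_cases h : ∃ S : Finset τ, S.map e.toEmbedding = U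
  · obtain ⟨S, rfl⟩ := h
    rw [relabel_map, smul_apply, smul_apply, relabel_map]
  · rw [smul_apply, relabel_of_not e _ U h, relabel_of_not e _ U h, smul_zero]

/-! ### Coefficientwise maps -/

theorem mapCoeff_mul (φ : R →+* R') (f g : Gr R τ) :
    mapCoeff φ (f * g) = mapCoeff φ f * mapCoeff φ g := by
  ext S
  simp [mapCoeff, mul_apply, map_sum]

theorem mapCoeff_const (φ : R →+* R') (r : R) :
    mapCoeff φ (const r : Gr R τ) = const (φ r) := by
  ext S
  simp only [mapCoeff, const]; split_ifs <;> simp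

theorem mapCoeff_gen (φ : R →+* R') (t : τ) : mapCoeff φ (gen t : Gr R τ) = gen t := by
  ext S
  simp only [mapCoeff, gen]; split_ifs <;> simp

theorem mapCoeff_add (φ : R →+* R') (f g : Gr R τ) :
    mapCoeff φ (f + g) = mapCoeff φ f + mapCoeff φ g := by
  ext S
  simp [mapCoeff]

theorem pdOdd_mapCoeff (φ : R →+* R') (t : τ) (f : Gr R τ) :
    pdOdd t (mapCoeff φ f) = mapCoeff φ (pdOdd t f) := by
  ext S
  simp only [mapCoeff, pdOdd]; split_ifs <;> simp

theorem mapCoeff_relabel (φ : R →+* R') (e : τ ↪o τ') (f : Gr R τ) :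
    mapCoeff φ (relabel e f) = relabel e (mapCoeff φ f) := by
  ext U
  by_cases h : ∃ S : Finset τ, S.map e.toEmbedding = U
  · obtain ⟨S, rfl⟩ := h
    rw [relabel_map, mapCoeff, relabel_map, mapCoeff]
  · rw [mapCoeff, relabel_of_not e _ U h, relabel_of_not e _ U h, map_zero]

variable [Algebra ℂ R] [Algebra ℂ R']

/-- The morphism of Grassmann algebras given by a morphism of the coefficients. -/
def mapAlg (φ : R →ₐ[ℂ] R') : Gr R τ →ₐ[ℂ] Gr R' τ :=
  AlgHom.ofLinearMap
    { toFun := mapCoeff φ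
      map_add' := mapCoeff_add (φ : R →+* R')
      map_smul' := fun c f => by ext S; simp [mapCoeff] }
    (mapCoeff_const (φ : R →+* R') 1 |>.trans (by rw [map_one, const_one]))
    (mapCoeff_mul (φ : R →+* R'))

theorem mapAlg_apply (φ : R →ₐ[ℂ] R') (f : Gr R τ) (S : Finset τ) :
    mapAlg φ f S = φ (f S) := rfl

theorem mapAlg_const (φ : R →ₐ[ℂ] R') (r : R) : mapAlg φ (const r : Gr R τ) = const (φ r) :=
  mapCoeff_const (φ : R →+* R') r

theorem mapAlg_gen (φ : R →ₐ[ℂ] R') (t : τ) : mapAlg φ (gen t : Gr R τ) = gen t :=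
  mapCoeff_gen (φ : R →+* R') t

theorem pdOdd_mapAlg (φ : R →ₐ[ℂ] R') (t : τ) (f : Gr R τ) :
    pdOdd t (mapAlg φ f) = mapAlg φ (pdOdd t f) :=
  pdOdd_mapCoeff (φ : R →+* R') t f

theorem mapAlg_relabel (φ : R →ₐ[ℂ] R') (e : τ ↪o τ') (f : Gr R τ) :
    mapAlg φ (relabel e f) = relabel e (mapAlg φ f) :=
  mapCoeff_relabel (φ : R →+* R') e f

theorem parity_mapAlg (φ : R →ₐ[ℂ] R') (f : Gr R τ) :
    parity (mapAlg φ f) = mapAlg φ (parity f) := by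
  ext S
  simp [mapAlg_apply, parity_apply]

/-- The value at a point of a superfunction, an element of the Grassmann algebra over `ℂ`. -/
def ev {X : Type*} (x : X) : SFun X τ →ₐ[ℂ] Gr ℂ τ := mapAlg (Pi.evalAlgHom ℂ (fun _ => ℂ) x)

theorem ev_apply {X : Type*} (x : X) (f : SFun X τ) (S : Finset τ) : ev x f S = f S x := rfl

theorem ext_ev {X : Type*} {f g : SFun X τ} (h : ∀ x, ev x f = ev x g) : f = g := by
  ext S x
  exact congrFun (h x) S

theorem const_eq_smul (c : ℂ) : (const c : Gr ℂ τ) = c • 1 := by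
  ext S; rw [smul_apply, const, one_apply]; split_ifs <;> simp

theorem const_mul_eq_smul (c : ℂ) (f : Gr ℂ τ) : const c * f = c • f := by
  rw [const_eq_smul, smul_mul_assoc, one_mul]

end relabel

section exponential
variable {τ : Type*} [LinearOrder τ] [Fintype τ]

/-- The exponential of a nilpotent element of a Grassmann algebra. -/
def nilExp (a : Gr ℂ τ) : Gr ℂ τ :=
  ∑ k ∈ Finset.range (Fintype.card τ + 1), ((k.factorial : ℂ)⁻¹) • a ^ k

theorem ev_sexp {X : Type*} (a : SFun X τ) (x : X) :
    ev x (sexp a) = Complex.exp (a ∅ x) • nilExp (ev x a - const (a ∅ x)) := by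
  rw [sexp, map_mul, ev, mapAlg_const, const_mul_eq_smul, nilExp, map_sum]
  simp only [map_smul, map_pow, map_sub, mapAlg_const]
  rfl

theorem pow_apply_of_card_lt {a : Gr ℂ τ} (ha : a ∅ = 0) (k : ℕ) (S : Finset τ)
    (hS : S.card < k) : (a ^ k) S = 0 := by
  induction k generalizing S with
  | zero => simp at hS
  | succ k ih =>
    rw [pow_succ, mul_apply]
    apply Finset.sum_eq_zero
    intro T hT
    by_cases h : S \ T = ∅
    · rw [h, ha]; simp
    · rw [ih T]
      · simp
      · have h1 : 0 < (S \ T).card := Finset.card_pos.2 (Finset.nonempty_iff_ne_empty.2 h)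
        have h2 := Finset.card_sdiff_add_card_eq_card (Finset.mem_powerset.1 hT)
        omega

theorem parity_pow {a : Gr ℂ τ} (hp : parity a = a) (k : ℕ) : parity (a ^ k) = a ^ k := by
  induction k with
  | zero => rw [pow_zero, parity_one]
  | succ k ih => rw [pow_succ, parity_mul, ih, hp]

theorem parity_nilExp {a : Gr ℂ τ} (hp : parity a = a) : parity (nilExp a) = nilExp a := by
  simp only [nilExp, map_sum, map_smul, parity_pow hp]

theorem pdOdd_pow {a : Gr ℂ τ} (hp : parity a = a) (t : τ) (k : ℕ) :
    pdOdd t (a ^ (k + 1)) = ((k : ℂ) + 1) • (pdOdd t a * a ^ k) := by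
  induction k with
  | zero => simp
  | succ k ih =>
    rw [pow_succ', pdOdd_mul, hp, ih, mul_smul_comm, ← mul_assoc,
      mul_comm_of_even hp (pdOdd t a), mul_assoc, ← pow_succ']
    push_cast
    module

theorem pdOdd_nilExp {a : Gr ℂ τ} (ha : a ∅ = 0) (hp : parity a = a) (t : τ) :
    pdOdd t (nilExp a) = pdOdd t a * nilExp a := by
  have hnil : a ^ (Fintype.card τ + 1) = 0 := by
    ext S
    exact pow_apply_of_card_lt ha _ S (Nat.lt_succ_of_le (Finset.card_le_univ S))
  have h0 : pdOdd t a * a ^ (Fintype.card τ) = 0 := by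
    have h1 := pdOdd_pow hp t (Fintype.card τ)
    rw [hnil] at h1
    have h2 : pdOdd t (0 : Gr ℂ τ) = 0 := (pdOddₗ t).map_zero
    rw [h2] at h1
    exact (smul_eq_zero_iff_right (M := Gr ℂ τ)
      (Nat.cast_add_one_ne_zero (R := ℂ) (Fintype.card τ))).1 h1.symm
  rw [nilExp, ← pdOddₗ_apply, map_sum, Finset.sum_range_succ', Finset.mul_sum,
    Finset.sum_range_succ]
  simp only [map_smul, pdOddₗ_apply, mul_smul_comm, h0, smul_zero, add_zero, pow_zero]
  rw [← const_one, pdOdd_const, smul_zero, add_zero]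
  refine Finset.sum_congr rfl fun k _ => ?_
  rw [pdOdd_pow hp, smul_smul, Nat.factorial_succ]
  congr 1
  have h1 : (k.factorial : ℂ) ≠ 0 := by exact_mod_cast k.factorial_ne_zero
  have h2 : (k : ℂ) + 1 ≠ 0 := by exact_mod_cast Nat.succ_ne_zero k
  push_cast
  field_simp

theorem nilExp_empty {a : Gr ℂ τ} (ha : a ∅ = 0) : nilExp a ∅ = 1 := by
  rw [nilExp, Finset.sum_range_succ', add_apply, sum_apply, Finset.sum_eq_zero]
  · simp [one_apply]
  · intro k _
    rw [smul_apply, pow_apply_of_card_lt ha _ _ (by simp), smul_zero]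

end exponential
end Gr

/-! ### Substitution in superpolynomials -/

section substitution
variable {σ τ A : Type*} [Fintype σ] [LinearOrder τ] [Fintype τ] [Ring A] [Algebra ℂ A]

/-- Elements of an algebra that can be substituted for the variables of superpolynomials: those
for the even variables are central among them, those for the odd variables anticommute. -/
structure Supercommuting {σ τ A : Type*} [Ring A] (φ₀ : σ → A) (φ₁ : τ → A) : Prop where
  even_even : ∀ i j, φ₀ i * φ₀ j = φ₀ j * φ₀ i
  even_odd : ∀ i t, φ₀ i * φ₁ t = φ₁ t * φ₀ i
  odd_odd : ∀ s t, φ₁ s * φ₁ t = - (φ₁ t * φ₁ s)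

/-- The linear map on polynomials with prescribed values on the monomials. -/
def onMonomials {σ V : Type*} [AddCommGroup V] [Module ℂ V] (w : (σ →₀ ℕ) → V) :
    MvPolynomial σ ℂ →ₗ[ℂ] V :=
  (MvPolynomial.basisMonomials σ ℂ).constr ℂ w

theorem onMonomials_monomial {σ V : Type*} [AddCommGroup V] [Module ℂ V] (w : (σ →₀ ℕ) → V)
    (α : σ →₀ ℕ) (c : ℂ) : onMonomials w (MvPolynomial.monomial α c) = c • w α := by
  have h : MvPolynomial.monomial α c = c • MvPolynomial.basisMonomials σ ℂ α := by
    rw [MvPolynomial.coe_basisMonomials, MvPolynomial.smul_monomial, smul_eq_mul, mul_one]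
  rw [h, map_smul, onMonomials, Module.Basis.constr_basis]

theorem onMonomials_apply {σ V : Type*} [AddCommGroup V] [Module ℂ V] (w : (σ →₀ ℕ) → V)
    (q : MvPolynomial σ ℂ) : onMonomials w q = ∑ α ∈ q.support, q.coeff α • w α := by
  conv_lhs => rw [q.as_sum, map_sum]
  simp only [onMonomials_monomial]

/-- The coefficient of `θ_S`, as a linear map. -/
def Gr.coeffₗ {R τ : Type*} [AddCommGroup R] [Module ℂ R] (S : Finset τ) : Gr R τ →ₗ[ℂ] R where
  toFun f := f S
  map_add' _ _ := rfl
  map_smul' _ _ := rfl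

theorem Gr.coeffₗ_apply {R τ : Type*} [AddCommGroup R] [Module ℂ R] (S : Finset τ) (f : Gr R τ) :
    Gr.coeffₗ S f = f S := rfl

/-- Substitution in superpolynomials as a linear map. -/
def substₗ (φ₀ : σ → A) (φ₁ : τ → A) : SPoly σ τ →ₗ[ℂ] A :=
  ∑ S : Finset τ, onMonomials (fun α => word φ₀ φ₁ α S) ∘ₗ Gr.coeffₗ S

theorem substₗ_apply (φ₀ : σ → A) (φ₁ : τ → A) (p : SPoly σ τ) :
    substₗ φ₀ φ₁ p = subst φ₀ φ₁ p := by
  rw [substₗ, LinearMap.sum_apply, subst]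
  refine Finset.sum_congr rfl fun S _ => ?_
  rw [LinearMap.comp_apply, onMonomials_apply]
  rfl

theorem substₗ_single (φ₀ : σ → A) (φ₁ : τ → A) (S : Finset τ) (α : σ →₀ ℕ) (c : ℂ) :
    substₗ φ₀ φ₁ (Gr.single S (MvPolynomial.monomial α c)) = c • word φ₀ φ₁ α S := by
  rw [substₗ, LinearMap.sum_apply, Finset.sum_eq_single S]
  · rw [LinearMap.comp_apply, ← onMonomials_monomial (fun α => word φ₀ φ₁ α S), Gr.coeffₗ_apply,
      Gr.single, if_pos rfl]
  · intro T _ hT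
    rw [LinearMap.comp_apply, Gr.coeffₗ_apply, Gr.single, if_neg hT, map_zero]
  · simp

theorem SPoly.induction_single {P : SPoly σ τ → Prop}
    (hs : ∀ S α c, P (Gr.single S (MvPolynomial.monomial α c)))
    (ha : ∀ p q, P p → P q → P (p + q)) (p : SPoly σ τ) : P p := by
  have h0 : P 0 := by
    have := hs ∅ 0 0
    have h : (Gr.single ∅ (MvPolynomial.monomial 0 0) : SPoly σ τ) = 0 := by
      ext1 S; simp [Gr.single]
    rwa [h] at this
  have h1 : ∀ S q, P (Gr.single S q) := by
    intro S q
    induction q using MvPolynomial.induction_on' with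
    | monomial α c => exact hs S α c
    | add p q hp hq =>
      have : (Gr.single S (p + q) : SPoly σ τ) = Gr.single S p + Gr.single S q := by
        ext1 T; rw [Gr.add_apply]; simp only [Gr.single]; split_ifs <;> simp
      rw [this]; exact ha _ _ hp hq
  rw [Gr.sum_single p]
  exact Finset.sum_induction _ P ha h0 fun S _ => h1 S _

open Classical in
theorem prod_map_add_single (φ : σ → A) (hφ : ∀ i j, φ i * φ j = φ j * φ i) (i : σ)
    (α : σ →₀ ℕ) (l : List σ) (hl : l.Nodup) :
    (l.map fun j => φ j ^ (α + Finsupp.single i 1 : σ →₀ ℕ) j).prod =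
      if i ∈ l then φ i * (l.map fun j => φ j ^ α j).prod
      else (l.map fun j => φ j ^ α j).prod := by
  induction l with
  | nil => simp
  | cons a l ih =>
    rw [List.nodup_cons] at hl
    rw [List.map_cons, List.prod_cons, ih hl.2, List.map_cons, List.prod_cons]
    by_cases ha : a = i
    · subst ha
      simp [hl.1, pow_succ', mul_assoc]
    · have h1 : (α + Finsupp.single i 1 : σ →₀ ℕ) a = α a := by
        simp [Ne.symm ha]
      have h2 : Commute (φ a ^ α a) (φ i) := (show Commute (φ a) (φ i) from hφ a i).pow_left _
      rw [h1]
      by_cases hi : i ∈ l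
      · simp only [hi, if_true, List.mem_cons, or_true]
        rw [← mul_assoc, h2.eq, mul_assoc]
      · simp [hi, Ne.symm ha]

theorem mul_sort_prod (φ₁ : τ → A) (h : ∀ s t, φ₁ s * φ₁ t = - (φ₁ t * φ₁ s)) (t : τ)
    (S : Finset τ) : φ₁ t * ((S.sort (· ≤ ·)).map φ₁).prod =
      if t ∈ S then 0 else ((-1 : ℂ) ^ (S.filter fun s => s < t).card) •
        (((insert t S).sort (· ≤ ·)).map φ₁).prod := by
  have hsq : ∀ s, φ₁ s * φ₁ s = 0 := by
    intro s
    have h1 : (2 : ℂ) • (φ₁ s * φ₁ s) = 0 := by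
      rw [two_smul]; nth_rewrite 1 [h s s]; simp
    exact (smul_eq_zero_iff_right (M := A) (two_ne_zero (α := ℂ))).1 h1
  induction S using Finset.induction_on_min with
  | empty => simp
  | insert a S ha ih =>
    have haS : a ∉ S := fun h => lt_irrefl _ (ha a h)
    have hsort : ∀ U : Finset τ, (∀ x ∈ U, a < x) →
        (((insert a U).sort (· ≤ ·)).map φ₁).prod = φ₁ a * ((U.sort (· ≤ ·)).map φ₁).prod := by
      intro U hU
      rw [Finset.sort_insert _ (fun b hb => (hU b hb).le) (fun h => lt_irrefl _ (hU a h)),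
        List.map_cons, List.prod_cons]
    rcases lt_trichotomy t a with hta | rfl | hat
    · have h1 : ∀ x ∈ insert a S, t < x := by
        intro x hx
        rcases Finset.mem_insert.1 hx with rfl | hx
        · exact hta
        · exact hta.trans (ha x hx)
      have h2 : t ∉ insert a S := fun h => lt_irrefl _ (h1 t h)
      have h3 : ((insert a S).filter fun s => s < t) = ∅ :=
        Finset.filter_eq_empty_iff.2 fun x hx => not_lt.2 (h1 x hx).le
      rw [if_neg h2, h3, Finset.card_empty, pow_zero, one_smul,
        Finset.sort_insert _ (fun b hb => (h1 b hb).le) h2, List.map_cons, List.prod_cons]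
    · rw [hsort S ha, ← mul_assoc, hsq, zero_mul, if_pos (Finset.mem_insert_self _ _)]
    · rw [hsort S ha, ← mul_assoc, h t a, neg_mul, mul_assoc, ih]
      by_cases ht : t ∈ S
      · simp [ht]
      · have h1 : t ∉ insert a S := by simp [ht, hat.ne']
        rw [if_neg ht, if_neg h1, Finset.insert_comm, hsort (insert t S)]
        · rw [Gr.card_filter_insert t a S haS, if_pos hat, pow_succ, mul_neg_one, neg_smul,
            mul_smul_comm]
        · intro x hx
          rcases Finset.mem_insert.1 hx with rfl | hx
          · exact hat
          · exact ha x hx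

variable {φ₀ : σ → A} {φ₁ : τ → A}

theorem substₗ_one : substₗ φ₀ φ₁ 1 = 1 := by
  have h : (1 : SPoly σ τ) = Gr.single ∅ (MvPolynomial.monomial 0 1) := by
    ext1 S; rw [Gr.one_apply]; rfl
  rw [h, substₗ_single, one_smul, word]
  simp

theorem substₗ_X_mul (h : Supercommuting φ₀ φ₁) (i : σ) (p : SPoly σ τ) :
    substₗ φ₀ φ₁ (Gr.const (MvPolynomial.X i) * p) = φ₀ i * substₗ φ₀ φ₁ p := by
  induction p using SPoly.induction_single with
  | ha p q hp hq => rw [mul_add, map_add, hp, hq, map_add, mul_add]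
  | hs S α c =>
    have h1 : (Gr.const (MvPolynomial.X i) * Gr.single S (MvPolynomial.monomial α c) : SPoly σ τ)
        = Gr.single S (MvPolynomial.monomial (α + Finsupp.single i 1) c) := by
      ext1 T
      rw [Gr.const_mul]
      simp only [Gr.single]
      split_ifs
      · rw [mul_comm, MvPolynomial.X, MvPolynomial.monomial_mul, mul_one]
      · rw [mul_zero]
    rw [h1, substₗ_single, substₗ_single, word, word,
      prod_map_add_single φ₀ h.even_even i α _ (Finset.nodup_toList _)]
    simp [mul_assoc]

theorem substₗ_gen_mul (h : Supercommuting φ₀ φ₁) (t : τ) (p : SPoly σ τ) :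
    substₗ φ₀ φ₁ (Gr.gen t * p) = φ₁ t * substₗ φ₀ φ₁ p := by
  induction p using SPoly.induction_single with
  | ha p q hp hq => rw [mul_add, map_add, hp, hq, map_add, mul_add]
  | hs S α c =>
    have hcomm : Commute (φ₁ t) ((Finset.univ : Finset σ).toList.map fun i => φ₀ i ^ α i).prod := by
      apply Commute.list_prod_right
      intro x hx
      obtain ⟨i, _, rfl⟩ := List.mem_map.1 hx
      exact (show Commute (φ₁ t) (φ₀ i) from (h.even_odd i t).symm).pow_right _
    have hw : φ₁ t * word φ₀ φ₁ α S =
        ((Finset.univ : Finset σ).toList.map fun i => φ₀ i ^ α i).prod *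
          (φ₁ t * ((S.sort (· ≤ ·)).map φ₁).prod) := by
      rw [word, ← mul_assoc, hcomm.eq, mul_assoc]
    rw [substₗ_single, mul_smul_comm, hw, mul_sort_prod φ₁ h.odd_odd]
    by_cases ht : t ∈ S
    · have h1 : (Gr.gen t * Gr.single S (MvPolynomial.monomial α c) : SPoly σ τ) = 0 := by
        ext1 T
        rw [Gr.gen_mul_apply]
        split_ifs with hT
        · have : T.erase t ≠ S := by rintro rfl; simp at ht
          simp [Gr.single, this]
        · rfl
      rw [h1, map_zero, if_pos ht, mul_zero, smul_zero]
    · have h1 : (Gr.gen t * Gr.single S (MvPolynomial.monomial α c) : SPoly σ τ) =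
          ((-1 : ℂ) ^ (S.filter fun s => s < t).card) •
            Gr.single (insert t S) (MvPolynomial.monomial α c) := by
        have h2 : (Gr.single (insert t S) (MvPolynomial.monomial α c) : SPoly σ τ) =
            ((-1 : ℂ) ^ (S.filter fun s => s < t).card) •
              (Gr.gen t * Gr.single S (MvPolynomial.monomial α c)) := by
          rw [Gr.single_insert S t ht, ← mul_smul_comm]
          congr 1
          ext1 T
          rw [Gr.smul_apply]
          simp only [Gr.single]
          split_ifs
          · rw [Algebra.smul_def, map_pow, map_neg, map_one]
          · rw [smul_zero]
        rw [h2, smul_smul, ← pow_add, ← two_mul]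
        simp
      rw [h1, map_smul, substₗ_single, if_neg ht, word, mul_smul_comm]
      rw [smul_comm]

/-- Superpolynomials are generated by `1` and left multiplication by the variables. -/
theorem SPoly.induction {P : SPoly σ τ → Prop} (h1 : P 1)
    (ha : ∀ p q, P p → P q → P (p + q)) (hs : ∀ (c : ℂ) p, P p → P (c • p))
    (hX : ∀ i p, P p → P (Gr.const (MvPolynomial.X i) * p))
    (hg : ∀ t p, P p → P (Gr.gen t * p)) (p : SPoly σ τ) : P p := by
  induction p using Gr.induction with
  | ha f g hf hg => exact ha f g hf hg
  | hg t f hf => exact hg t f hf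
  | hc r =>
    induction r using MvPolynomial.induction_on with
    | C a =>
      have : (Gr.const (MvPolynomial.C a) : SPoly σ τ) = a • 1 := by
        ext1 S
        rw [Gr.smul_apply, Gr.one_apply, Gr.const]
        split_ifs
        · rw [MvPolynomial.smul_eq_C_mul, mul_one]
        · rw [smul_zero]
      rw [this]; exact hs _ _ h1
    | add p q hp hq => rw [Gr.const_add]; exact ha _ _ hp hq
    | mul_X p i hp => rw [mul_comm, ← Gr.const_mul_const]; exact hX _ _ hp

/-- Substitution of supercommuting elements is an algebra morphism. -/
theorem substₗ_mul (h : Supercommuting φ₀ φ₁) (p q : SPoly σ τ) :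
    substₗ φ₀ φ₁ (p * q) = substₗ φ₀ φ₁ p * substₗ φ₀ φ₁ q := by
  induction p using SPoly.induction with
  | h1 => rw [one_mul, substₗ_one, one_mul]
  | ha p p' hp hp' => rw [add_mul, map_add, hp, hp', map_add, add_mul]
  | hs c p hp => rw [smul_mul_assoc, map_smul, hp, map_smul, smul_mul_assoc]
  | hX i p hp => rw [mul_assoc, substₗ_X_mul h, hp, substₗ_X_mul h, mul_assoc]
  | hg t p hp => rw [mul_assoc, substₗ_gen_mul h, hp, substₗ_gen_mul h, mul_assoc]

/-- Substitution of supercommuting elements as an algebra morphism. -/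
def substAlg (h : Supercommuting φ₀ φ₁) : SPoly σ τ →ₐ[ℂ] A :=
  AlgHom.ofLinearMap (substₗ φ₀ φ₁) substₗ_one (substₗ_mul h)

theorem substAlg_apply (h : Supercommuting φ₀ φ₁) (p : SPoly σ τ) :
    substAlg h p = subst φ₀ φ₁ p := substₗ_apply φ₀ φ₁ p

theorem substAlg_X (h : Supercommuting φ₀ φ₁) (i : σ) :
    substAlg h (Gr.const (MvPolynomial.X i)) = φ₀ i := by
  have := substₗ_X_mul h i 1
  rwa [mul_one, substₗ_one, mul_one] at this

theorem substAlg_gen (h : Supercommuting φ₀ φ₁) (t : τ) :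
    substAlg h (Gr.gen t) = φ₁ t := by
  have := substₗ_gen_mul h t 1
  rwa [mul_one, substₗ_one, mul_one] at this

/-- Two algebra morphisms on superpolynomials agree if they agree on the variables. -/
theorem SPoly.algHom_ext {f g : SPoly σ τ →ₐ[ℂ] A}
    (hX : ∀ i, f (Gr.const (MvPolynomial.X i)) = g (Gr.const (MvPolynomial.X i)))
    (hg : ∀ t, f (Gr.gen t) = g (Gr.gen t)) : f = g := by
  ext p
  induction p using SPoly.induction with
  | h1 => rw [map_one, map_one]
  | ha p q hp hq => rw [map_add, hp, hq, map_add]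
  | hs c p hp => rw [map_smul, hp, map_smul]
  | hX i p hp => rw [map_mul, map_mul, hX, hp]
  | hg t p hp => rw [map_mul, map_mul, hg, hp]

/-- Substitution of linear operators, evaluated at a vector. -/
theorem substOp_eq {V : Type*} [AddCommGroup V] [Module ℂ V] (D₀ : σ → Module.End ℂ V)
    (D₁ : τ → Module.End ℂ V) (p : SPoly σ τ) (v : V) :
    substOp (fun i => D₀ i) (fun t => D₁ t) p v = substₗ D₀ D₁ p v := by
  rw [substₗ_apply, subst, substOp, LinearMap.sum_apply]
  refine Finset.sum_congr rfl fun S _ => ?_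
  rw [LinearMap.sum_apply]
  refine Finset.sum_congr rfl fun α _ => ?_
  rw [LinearMap.smul_apply]
  congr 1
  let c : Module.End ℂ V →* Function.End V :=
    { toFun := fun f => ⇑f, map_one' := rfl, map_mul' := fun _ _ => rfl }
  have : word (M := Function.End V) (fun i => ⇑(D₀ i)) (fun t => ⇑(D₁ t)) α S =
      c (word D₀ D₁ α S) := by
    simp only [word, map_mul, map_list_prod, List.map_map]
    congr 2
    refine List.map_congr_left fun i _ => ?_
    exact (map_pow c (D₀ i) (α i)).symm
  rw [this]
  rfl

end substitution

/-! ### The orthosymplectic metric -/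

section metric
variable {m n : ℕ}

/-- The index `i'` with `β_{i i'} ≠ 0`. -/
def dual : Idx m n → Idx m n
  | Sum.inl i => Sum.inl i
  | Sum.inr a => Sum.inr (if h : (a : ℕ) < n then ⟨a + n, by omega⟩ else ⟨a - n, by omega⟩)

/-- The non-zero entry `β_{i i'}` of the `i`-th row of `β`. -/
def betaSign : Idx m n → ℂ
  | Sum.inl _ => 1
  | Sum.inr a => if (a : ℕ) < n then -1 else 1

theorem dual_dual (i : Idx m n) : dual (dual i) = i := by
  rcases i with i | a
  · rfl
  · have := a.2
    by_cases h : (a : ℕ) < n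
    · simp [dual, h]
    · have h2 : (a : ℕ) - n < n := by omega
      simp only [dual, h, dif_neg, not_false_eq_true, dif_pos h2, Sum.inr.injEq, Fin.ext_iff]
      omega

theorem par_dual (i : Idx m n) : par (dual i) = par i := by
  rcases i with i | a <;> rfl

theorem betaSign_sq (i : Idx m n) : betaSign i * betaSign i = 1 := by
  rcases i with i | a
  · simp [betaSign]
  · simp only [betaSign]; split_ifs <;> norm_num

theorem betaSign_dual (i : Idx m n) : betaSign (dual i) = (-1) ^ par i * betaSign i := by
  rcases i with i | a
  · simp [dual, betaSign, par]
  · have := a.2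
    by_cases h : (a : ℕ) < n
    · simp [dual, betaSign, par, h]
    · have h2 : (a : ℕ) - n < n := by omega
      simp [dual, betaSign, par, h, h2]

theorem beta_eq (i j : Idx m n) : beta i j = if j = dual i then betaSign i else 0 := by
  rcases i with i | a <;> rcases j with j | b
  · simp [beta, dual, betaSign, eq_comm]
  · simp [beta, dual]
  · simp [beta, dual]
  · have ha := a.2
    have hb := b.2
    by_cases h : (a : ℕ) < n
    · simp only [beta, dual, h, dif_pos, betaSign, if_true, Sum.inr.injEq, Fin.ext_iff]
      split_ifs <;> first | rfl | omega
    · simp only [beta, dual, h, dif_neg, not_false_eq_true, betaSign, if_false, Sum.inr.injEq,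
        Fin.ext_iff]
      split_ifs <;> first | rfl | omega

theorem beta_symm (i j : Idx m n) : beta i j = (-1) ^ par i * beta j i := by
  rw [beta_eq, beta_eq]
  by_cases h : j = dual i
  · subst h
    rw [if_pos rfl, dual_dual, if_pos rfl, betaSign_dual, ← mul_assoc, ← pow_add, ← two_mul]
    simp
  · rw [if_neg h, if_neg, mul_zero]
    rintro rfl
    exact h (dual_dual j).symm

theorem beta_of_par_ne {i j : Idx m n} (h : par i ≠ par j) : beta i j = 0 := by
  rw [beta_eq, if_neg]
  rintro rfl
  exact h (par_dual i).symm

theorem conj_beta (i j : Idx m n) : (starRingEnd ℂ) (beta i j) = beta i j := by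
  rw [beta_eq]
  split_ifs
  · rcases i with i | a
    · simp [betaSign]
    · simp only [betaSign]; split_ifs <;> simp
  · simp

theorem sum_beta_smul {V : Type*} [AddCommGroup V] [Module ℂ V] (i : Idx m n) (v : Idx m n → V) :
    ∑ j, beta i j • v j = betaSign i • v (dual i) := by
  rw [Finset.sum_eq_single (dual i)]
  · rw [beta_eq, if_pos rfl]
  · intro j _ hj; rw [beta_eq, if_neg hj, zero_smul]
  · simp

theorem sum_betaInv_smul {V : Type*} [AddCommGroup V] [Module ℂ V] (j : Idx m n)
    (v : Idx m n → V) : ∑ i, betaInv i j • v i = betaSign j • v (dual j) :=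
  sum_beta_smul j v

/-- The sign `(-1)^{|i||j|}`. -/
def eps (i j : Idx m n) : ℂ := (-1) ^ (par i * par j)

theorem eps_comm (i j : Idx m n) : eps i j = eps j i := by rw [eps, eps, mul_comm]

theorem eps_mul_self (i j : Idx m n) : eps i j * eps i j = 1 := by
  rw [eps, ← pow_add, ← two_mul]; simp

theorem eps_dual_left (i j : Idx m n) : eps (dual i) j = eps i j := by rw [eps, eps, par_dual]

theorem eps_dual_right (i j : Idx m n) : eps i (dual j) = eps i j := by rw [eps, eps, par_dual]

/-- The parity involution for odd `i`, the identity for even `i`. -/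
def sgn {R τ : Type*} [AddCommGroup R] [Module ℂ R] (i : Idx m n) : Gr R τ →ₗ[ℂ] Gr R τ :=
  Gr.parity ^ par i

theorem sgn_inl {R τ : Type*} [AddCommGroup R] [Module ℂ R] (i : Fin m) (f : Gr R τ) :
    sgn (n := n) (Sum.inl i) f = f := rfl

theorem sgn_inr {R τ : Type*} [AddCommGroup R] [Module ℂ R] (a : Fin (2 * n)) (f : Gr R τ) :
    sgn (m := m) (Sum.inr a) f = Gr.parity f := rfl

theorem sgn_dual {R τ : Type*} [AddCommGroup R] [Module ℂ R] (i : Idx m n) :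
    (sgn (dual i) : Gr R τ →ₗ[ℂ] Gr R τ) = sgn i := by rw [sgn, sgn, par_dual]

theorem sgn_sgn {R τ : Type*} [AddCommGroup R] [Module ℂ R] (i : Idx m n) (f : Gr R τ) :
    sgn i (sgn i f) = f := by
  rcases i with i | a
  · rfl
  · exact Gr.parity_parity f

end metric

/-! ### Superpolynomials on `ℂ^{m|2n}` -/

section fock
variable {m n : ℕ}

theorem Fock.induction {P : Fock m n → Prop} (h1 : P 1)
    (ha : ∀ p q, P p → P q → P (p + q)) (hs : ∀ (c : ℂ) p, P p → P (c • p))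
    (hz : ∀ i p, P p → P (zvar i * p)) (p : Fock m n) : P p :=
  SPoly.induction h1 ha hs (fun i p => hz (Sum.inl i) p) (fun t p => hz (Sum.inr t) p) p

/-- The partial derivative `∂/∂z_i` on superpolynomials. -/
def dz : Idx m n → Fock m n →ₗ[ℂ] Fock m n
  | Sum.inl i =>
    { toFun := Gr.mapCoeff (MvPolynomial.pderiv i)
      map_add' := fun f g => by ext1 S; simp [Gr.mapCoeff]
      map_smul' := fun c f => by ext1 S; simp [Gr.mapCoeff] }
  | Sum.inr a => Gr.pdOddₗ a

theorem dz_inl_apply (i : Fin m) (p : Fock m n) (S : Finset (Fin (2 * n))) :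
    dz (Sum.inl i) p S = MvPolynomial.pderiv i (p S) := rfl

theorem dz_zvar_mul (i j : Idx m n) (p : Fock m n) :
    dz i (zvar j * p) = (if i = j then p else 0) + eps i j • (zvar j * dz i p) := by
  rcases i with i | a <;> rcases j with j | b
  · ext1 S
    rw [dz_inl_apply, Gr.add_apply, Gr.smul_apply]
    simp only [zvar, Gr.const_mul, Derivation.leibniz, dz_inl_apply, MvPolynomial.pderiv_X,
      smul_eq_mul, eps, par, mul_zero, pow_zero, one_smul, Sum.inl.injEq]
    by_cases h : i = j
    · subst h; simp; ring
    · simp [h]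
  · ext1 S
    rw [dz_inl_apply, Gr.add_apply, Gr.smul_apply]
    simp only [zvar, Gr.gen_mul_apply, dz_inl_apply, eps, par, reduceCtorEq, if_false]
    split_ifs <;> simp
  · simp only [dz, zvar, Gr.pdOddₗ_apply, Gr.pdOdd_const_mul, eps, par]
    simp
  · simp only [dz, zvar, Gr.pdOddₗ_apply, Gr.pdOdd_gen_mul, eps, par, Sum.inr.injEq, mul_one,
      pow_one, neg_smul, one_smul, ← sub_eq_add_neg, eq_comm (a := a)]

theorem dz_one (i : Idx m n) : dz i (1 : Fock m n) = 0 := by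
  rcases i with i | a
  · ext1 S
    rw [dz_inl_apply, Gr.one_apply]
    split_ifs <;> simp
  · rw [← Gr.const_one]; exact Gr.pdOdd_const _ _

/-- The derivative `∂_i = ∑ β_{ij} ∂/∂z_j` on superpolynomials. -/
def dF (i : Idx m n) : Fock m n →ₗ[ℂ] Fock m n := betaSign i • dz (dual i)

theorem dF_apply (i : Idx m n) (p : Fock m n) : dF i p = betaSign i • dz (dual i) p := rfl

theorem dF_one (i : Idx m n) : dF i (1 : Fock m n) = 0 := by
  rw [dF_apply, dz_one, smul_zero]

theorem dF_zvar_mul (i j : Idx m n) (p : Fock m n) :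
    dF i (zvar j * p) = beta i j • p + eps i j • (zvar j * dF i p) := by
  rw [dF_apply, dF_apply, dz_zvar_mul, beta_eq, eps_dual_left, smul_add, mul_smul_comm,
    smul_comm (betaSign i)]
  congr 1
  by_cases h : j = dual i
  · simp [h]
  · simp [h, Ne.symm h]

theorem sgn_one (i : Idx m n) : sgn i (1 : Fock m n) = 1 := by
  rcases i with i | a
  · rfl
  · exact Gr.parity_one

theorem sgn_zvar_mul (i j : Idx m n) (p : Fock m n) :
    sgn i (zvar j * p) = eps i j • (zvar j * sgn i p) := by
  rcases i with i | a <;> rcases j with j | b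
  · simp [sgn_inl, eps, par]
  · simp [sgn_inl, eps, par]
  · simp [sgn_inr, eps, par, zvar, Gr.parity_const_mul]
  · simp [sgn_inr, eps, par, zvar, Gr.parity_gen_mul]

theorem mul_zvar (p : Fock m n) (j : Idx m n) : p * zvar j = zvar j * sgn j p := by
  rcases j with j | b
  · exact (Gr.const_mul_comm _ _).symm
  · exact Gr.mul_gen p b

theorem zvar_mul_zvar (i j : Idx m n) :
    (zvar i * zvar j : Fock m n) = eps i j • (zvar j * zvar i) := by
  have h := mul_zvar (zvar i) j
  have h2 := sgn_zvar_mul j i 1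
  rw [mul_one, sgn_one, mul_one] at h2
  rw [h, h2, mul_smul_comm, eps_comm]

theorem dz_sgn (i j : Idx m n) (p : Fock m n) : dz i (sgn j p) = eps i j • sgn j (dz i p) := by
  rcases j with j | b
  · simp [sgn_inl, eps, par]
  · rcases i with i | a
    · ext1 S
      simp [sgn_inr, eps, par, dz_inl_apply, Gr.parity_apply]
    · simp only [sgn_inr, dz, Gr.pdOddₗ_apply, Gr.parity_pdOdd, eps, par]
      simp

theorem dF_sgn (i j : Idx m n) (p : Fock m n) : dF i (sgn j p) = eps i j • sgn j (dF i p) := by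
  rw [dF_apply, dF_apply, dz_sgn, map_smul, eps_dual_left, smul_comm]

/-- The variables `z^j = ∑ z_i β^{ij}`. -/
def zup (j : Idx m n) : Fock m n := betaSign j • zvar (dual j)

theorem sum_betaInv_zvar (j : Idx m n) : ∑ i, betaInv i j • (zvar i : Fock m n) = zup j :=
  sum_betaInv_smul j zvar

theorem dF_zup_mul (i j : Idx m n) (p : Fock m n) :
    dF i (zup j * p) = (if i = j then p else 0) + eps i j • (zup j * dF i p) := by
  rw [zup, smul_mul_assoc, map_smul, dF_zvar_mul, smul_add, smul_mul_assoc,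
    smul_comm (betaSign j) (eps _ _), eps_dual_right]
  congr 1
  rw [beta_eq, smul_smul]
  by_cases h : i = j
  · subst h
    rw [if_pos rfl, betaSign_sq, one_smul, if_pos rfl]
  · rw [if_neg, mul_zero, zero_smul, if_neg h]
    intro h'
    apply h
    rw [← dual_dual i, ← h', dual_dual]

theorem mul_zup (p : Fock m n) (j : Idx m n) : p * zup j = zup j * sgn j p := by
  rw [zup, mul_smul_comm, mul_zvar, sgn_dual, smul_mul_assoc]

theorem zup_zup (i : Idx m n) :
    betaSign i • (zup (dual i) : Fock m n) = (-1 : ℂ) ^ par i • zvar i := by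
  rw [zup, dual_dual, smul_smul, betaSign_dual]
  congr 1
  linear_combination (-1) ^ par i * betaSign_sq i

theorem parity_zvar_mul (i : Idx m n) (p : Fock m n) :
    Gr.parity (zvar i * p) = (-1 : ℂ) ^ par i • (zvar i * Gr.parity p) := by
  rcases i with i | a
  · simp [zvar, Gr.parity_const_mul, par]
  · simp [zvar, Gr.parity_gen_mul, par]

/-! ### The symmetry `S_F` -/

theorem zup_anticomm (s t : Fin (2 * n)) : (zup (Sum.inr s) * zup (Sum.inr t) : Fock m n) =
    -(zup (Sum.inr t) * zup (Sum.inr s)) := by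
  simp only [zup, smul_mul_smul_comm, dual, zvar]
  rw [Gr.gen_mul_gen, smul_neg, mul_comm (betaSign _)]

/-- The product `θ^{s_k} ⋯ θ^{s_1}` for `S = {s_1 < ⋯ < s_k}`. -/
def revProd (S : Finset (Fin (2 * n))) : Fock m n :=
  ((S.sort (· ≤ ·)).reverse.map fun a => zup (Sum.inr a)).prod

theorem revProd_mul (S : Finset (Fin (2 * n))) (t : Fin (2 * n)) :
    revProd S * (zup (Sum.inr t) : Fock m n) =
      if t ∈ S then 0 else ((-1 : ℂ) ^ (S.filter fun s => s < t).card) •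
        revProd (insert t S) := by
  have h : ∀ U : Finset (Fin (2 * n)), (revProd U : Fock m n) = MulOpposite.unop
      (((U.sort (· ≤ ·)).map fun a => MulOpposite.op (zup (Sum.inr a) : Fock m n)).prod) := by
    intro U
    rw [MulOpposite.unop_list_prod, List.map_map, revProd, ← List.map_reverse]
    rfl
  have h2 := mul_sort_prod (fun a => MulOpposite.op (zup (Sum.inr a) : Fock m n))
    (fun s t => by rw [← MulOpposite.op_mul, ← MulOpposite.op_mul, zup_anticomm,
      MulOpposite.op_neg]) t S
  rw [h S, h (insert t S)]
  have h3 := congrArg MulOpposite.unop h2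
  rw [MulOpposite.unop_mul, MulOpposite.unop_op] at h3
  rw [h3]
  split_ifs <;> rfl

/-- `S_F` as a linear map. -/
def symFₗ : Fock m n →ₗ[ℂ] Fock m n where
  toFun := symF
  map_add' p q := by
    simp only [symF, Gr.add_apply, Gr.const_add, add_mul, Finset.sum_add_distrib]
  map_smul' c p := by
    simp only [symF, Finset.smul_sum, RingHom.id_apply, Gr.smul_apply]
    refine Finset.sum_congr rfl fun S _ => ?_
    rw [← smul_mul_assoc]
    congr 1
    ext1 T
    rw [Gr.smul_apply]
    simp only [Gr.const]
    split_ifs <;> simp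

theorem symFₗ_apply (p : Fock m n) : symFₗ p = symF p := rfl

theorem symF_single (S : Finset (Fin (2 * n))) (q : MvPolynomial (Fin m) ℂ) :
    symFₗ (Gr.single S q : Fock m n) = Gr.const q * revProd S := by
  rw [symFₗ_apply, symF, Finset.sum_eq_single S]
  · simp only [sum_betaInv_zvar]
    rw [revProd, Gr.single, if_pos rfl]
  · intro T _ hT
    rw [Gr.single, if_neg hT, Gr.const_zero, zero_mul]
  · simp

theorem symFₗ_one : symFₗ (1 : Fock m n) = 1 := by
  have h : (1 : Fock m n) = Gr.single ∅ 1 := by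
    ext1 S; rw [Gr.one_apply]; rfl
  rw [h, symF_single, Gr.const_one, one_mul, ← h]
  simp [revProd]

theorem symFₗ_zvar_mul (i : Idx m n) (p : Fock m n) :
    symFₗ (zvar i * p) = symFₗ p * zup i := by
  rcases i with i | t
  · have h : (zup (Sum.inl i) : Fock m n) = Gr.const (MvPolynomial.X i) := by
      simp [zup, betaSign, dual, zvar]
    rw [h, ← Gr.const_mul_comm, symFₗ_apply, symFₗ_apply, symF, symF, Finset.mul_sum]
    refine Finset.sum_congr rfl fun S _ => ?_
    rw [zvar, Gr.const_mul, ← Gr.const_mul_const, mul_assoc]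
  · rw [Gr.sum_single p, Finset.mul_sum, map_sum, map_sum, Finset.sum_mul]
    refine Finset.sum_congr rfl fun S _ => ?_
    rw [symF_single, mul_assoc, revProd_mul]
    by_cases ht : t ∈ S
    · rw [if_pos ht, mul_zero]
      have : (zvar (Sum.inr t) * Gr.single S (p S) : Fock m n) = 0 := by
        ext1 T
        rw [zvar, Gr.gen_mul_apply]
        split_ifs with hT
        · have : T.erase t ≠ S := by rintro rfl; simp at ht
          simp [Gr.single, this]
        · rfl
      rw [this, map_zero]
    · rw [if_neg ht]
      have h1 : (zvar (Sum.inr t) * Gr.single S (p S) : Fock m n) =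
          Gr.single (insert t S) ((-1) ^ (S.filter fun s => s < t).card * p S) := by
        rw [Gr.single_insert S t ht, ← mul_assoc, ← pow_add, ← two_mul]
        simp [zvar]
      rw [h1, symF_single, mul_smul_comm, ← smul_mul_assoc]
      congr 1
      ext1 T
      rw [Gr.smul_apply, Gr.const, Gr.const]
      split_ifs
      · rw [Algebra.smul_def, map_pow, map_neg, map_one]
      · rw [smul_zero]

theorem symFₗ_parity (p : Fock m n) : symFₗ (Gr.parity p) = Gr.parity (symFₗ p) := by
  induction p using Fock.induction with
  | h1 => rw [Gr.parity_one, symFₗ_one, Gr.parity_one]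
  | ha p q hp hq => simp only [map_add, hp, hq]
  | hs c p hp => simp only [map_smul, hp]
  | hz i p hp =>
    rw [parity_zvar_mul, map_smul, symFₗ_zvar_mul, symFₗ_zvar_mul, hp, mul_zup, mul_zup, zup,
      smul_mul_assoc, smul_mul_assoc, map_smul, parity_zvar_mul, par_dual, smul_comm]
    congr 3
    rcases i with i | a <;> rfl

theorem symFₗ_sgn (i : Idx m n) (p : Fock m n) : symFₗ (sgn i p) = sgn i (symFₗ p) := by
  rcases i with i | a
  · rfl
  · exact symFₗ_parity p

theorem symFₗ_mul_zvar (p : Fock m n) (j : Idx m n) : symFₗ (p * zvar j) = zup j * symFₗ p := by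
  rw [mul_zvar, symFₗ_zvar_mul, symFₗ_sgn, mul_zup, sgn_sgn]

theorem symFₗ_symFₗ (p : Fock m n) : symFₗ (symFₗ p) = Gr.parity p := by
  induction p using Fock.induction with
  | h1 => rw [Gr.parity_one, symFₗ_one, symFₗ_one]
  | ha p q hp hq => simp only [map_add, hp, hq]
  | hs c p hp => simp only [map_smul, hp]
  | hz i p hp =>
    rw [symFₗ_zvar_mul, zup, mul_smul_comm, map_smul, symFₗ_mul_zvar, hp, ← smul_mul_assoc,
      zup_zup, smul_mul_assoc, parity_zvar_mul]

theorem dF_symFₗ (i : Idx m n) (q : Fock m n) : dF i (symFₗ q) = sgn i (symFₗ (dz i q)) := by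
  induction q using Fock.induction with
  | h1 => rw [symFₗ_one, dz_one, dF_one, map_zero, map_zero]
  | ha p q hp hq => simp only [map_add, hp, hq]
  | hs c p hp => simp only [map_smul, hp]
  | hz j q hq =>
    rw [symFₗ_zvar_mul, mul_zup, dF_zup_mul, dF_sgn, mul_smul_comm, smul_smul, eps_mul_self,
      one_smul, ← mul_zup, hq, dz_zvar_mul, map_add, map_add, map_smul, map_smul, symFₗ_zvar_mul]
    congr 1
    · split_ifs with h
      · rw [h]
      · rw [map_zero, map_zero]
    · rw [mul_zup, mul_zup, zup, smul_mul_assoc, smul_mul_assoc, map_smul, sgn_zvar_mul,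
        eps_dual_right, smul_comm (eps i j), smul_smul (eps i j), eps_mul_self, one_smul]
      congr 2
      have : ∀ f : Fock m n, sgn j (sgn i f) = sgn i (sgn j f) := by
        intro f
        rcases i with i | a <;> rcases j with j | b <;> rfl
      rw [this]

end fock

/-! ### Gaussian superfunctions -/

section gaussians
variable {m n : ℕ}

/-- The restriction of `dual` to the odd indices. -/
def odual (a : Fin (2 * n)) : Fin (2 * n) :=
  if h : (a : ℕ) < n then ⟨a + n, by omega⟩ else ⟨a - n, by omega⟩

/-- The restriction of `betaSign` to the odd indices. -/
def osign (a : Fin (2 * n)) : ℂ := if (a : ℕ) < n then -1 else 1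

theorem dual_inr (a : Fin (2 * n)) : dual (Sum.inr a : Idx m n) = Sum.inr (odual a) := rfl

theorem betaSign_inr (a : Fin (2 * n)) : betaSign (Sum.inr a : Idx m n) = osign a := rfl

theorem odual_odual (a : Fin (2 * n)) : odual (odual a) = a := by
  have := dual_dual (Sum.inr a : Idx 0 n)
  simpa only [dual_inr, Sum.inr.injEq] using this

theorem osign_odual (a : Fin (2 * n)) : osign (odual a) = - osign a := by
  have := betaSign_dual (Sum.inr a : Idx 0 n)
  simpa only [dual_inr, betaSign_inr, par, pow_one, neg_one_mul] using this

theorem osign_sq (a : Fin (2 * n)) : osign a * osign a = 1 := betaSign_sq (Sum.inr a : Idx 0 n)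

theorem traceProd_eq {A : Type*} [Ring A] [Algebra ℂ A] (v w : Idx m n → A) :
    traceProd v w = ∑ j, betaSign j • (v (dual j) * w j) := by
  unfold traceProd
  refine Finset.sum_congr rfl fun j _ => ?_
  rw [sum_betaInv_smul, smul_mul_assoc]

variable {τ : Type*} [LinearOrder τ] [Fintype τ]

/-- The odd part of a trace product. -/
def oddTrace (e e' : Fin (2 * n) → τ) : Gr ℂ τ :=
  ∑ a, osign a • (Gr.gen (e (odual a)) * Gr.gen (e' a))

theorem oddTrace_empty (e e' : Fin (2 * n) → τ) : oddTrace e e' ∅ = 0 := by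
  rw [oddTrace, Gr.sum_apply]
  refine Finset.sum_eq_zero fun a _ => ?_
  rw [Gr.smul_apply, Gr.gen_mul_apply]
  simp

theorem parity_oddTrace (e e' : Fin (2 * n) → τ) : Gr.parity (oddTrace e e') = oddTrace e e' := by
  simp only [oddTrace, map_sum, map_smul, Gr.parity_gen_mul, Gr.parity_gen, mul_neg, neg_neg]

/-- The odd Gaussian `exp(c ∑ θ^a θ'_a)`. -/
def oddGauss (c : ℂ) (e e' : Fin (2 * n) → τ) : Gr ℂ τ := Gr.nilExp (c • oddTrace e e')

theorem oddGauss_empty (c : ℂ) (e e' : Fin (2 * n) → τ) : oddGauss c e e' ∅ = 1 :=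
  Gr.nilExp_empty (by rw [Gr.smul_apply, oddTrace_empty, smul_zero])

theorem parity_oddGauss (c : ℂ) (e e' : Fin (2 * n) → τ) :
    Gr.parity (oddGauss c e e') = oddGauss c e e' :=
  Gr.parity_nilExp (by rw [map_smul, parity_oddTrace])

theorem pdOdd_oddGauss (c : ℂ) (e e' : Fin (2 * n) → τ) (t : τ) :
    Gr.pdOdd t (oddGauss c e e') = c • (Gr.pdOdd t (oddTrace e e') * oddGauss c e e') := by
  rw [oddGauss, Gr.pdOdd_nilExp (by rw [Gr.smul_apply, oddTrace_empty, smul_zero])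
    (by rw [map_smul, parity_oddTrace]), Gr.pdOdd_smul, smul_mul_assoc]

theorem pdOdd_oddTrace (e e' : Fin (2 * n) → τ) (t : τ) :
    Gr.pdOdd t (oddTrace e e') =
      ∑ a, osign a • ((if e (odual a) = t then Gr.gen (e' a) else 0) -
        if e' a = t then Gr.gen (e (odual a)) else 0) := by
  rw [← Gr.pdOddₗ_apply, oddTrace, map_sum]
  refine Finset.sum_congr rfl fun a _ => ?_
  rw [map_smul, Gr.pdOddₗ_apply, Gr.pdOdd_gen_mul, Gr.pdOdd_gen, mul_ite, mul_one, mul_zero]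

theorem pdOdd_left_oddTrace {e e' : Fin (2 * n) → τ} (he : Function.Injective e)
    (hee : ∀ a b, e a ≠ e' b) (a : Fin (2 * n)) :
    Gr.pdOdd (e a) (oddTrace e e') = - osign a • Gr.gen (e' (odual a)) := by
  rw [pdOdd_oddTrace, Finset.sum_eq_single (odual a)]
  · rw [if_pos (by rw [odual_odual]), if_neg (fun h => hee _ _ h.symm), sub_zero, osign_odual]
  · intro b _ hb
    rw [if_neg, if_neg (fun h => hee _ _ h.symm), sub_zero, smul_zero]
    intro h
    exact hb (by rw [← he h, odual_odual])
  · simp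

theorem pdOdd_right_oddTrace {e e' : Fin (2 * n) → τ} (he : Function.Injective e')
    (hee : ∀ a b, e a ≠ e' b) (a : Fin (2 * n)) :
    Gr.pdOdd (e' a) (oddTrace e e') = - osign a • Gr.gen (e (odual a)) := by
  rw [pdOdd_oddTrace, Finset.sum_eq_single a]
  · rw [if_neg (hee _ _), if_pos rfl, zero_sub, smul_neg, neg_smul]
  · intro b _ hb
    rw [if_neg (hee _ _), if_neg (fun h => hb (he h)), sub_zero, smul_zero]
  · simp

theorem pdOdd_self_oddTrace {e : Fin (2 * n) → τ} (he : Function.Injective e) (a : Fin (2 * n)) :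
    Gr.pdOdd (e a) (oddTrace e e) = (-2 * osign a) • Gr.gen (e (odual a)) := by
  rw [pdOdd_oddTrace]
  simp only [smul_sub, Finset.sum_sub_distrib]
  rw [Finset.sum_eq_single (odual a), Finset.sum_eq_single a]
  · rw [if_pos (by rw [odual_odual]), if_pos rfl, osign_odual]
    module
  · intro b _ hb
    rw [if_neg (fun h => hb (he h)), smul_zero]
  · simp
  · intro b _ hb
    rw [if_neg, smul_zero]
    intro h
    exact hb (by rw [← he h, odual_odual])
  · simp

theorem pdOdd_other_oddTrace {e e' : Fin (2 * n) → τ} {t : τ} (he : ∀ a, e a ≠ t)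
    (he' : ∀ a, e' a ≠ t) : Gr.pdOdd t (oddTrace e e') = 0 := by
  rw [pdOdd_oddTrace]
  refine Finset.sum_eq_zero fun a _ => ?_
  rw [if_neg (he _), if_neg (he' _), sub_zero, smul_zero]

/-- The exponential of a trace product of coordinate functions is the product of an exponential
function of the even variables and a constant odd Gaussian. -/
theorem ev_sexp_traceProd {X : Type*} (c : ℂ) (v w : Idx m n → SFun X τ) (v₀ w₀ : Fin m → X → ℂ)
    (e e' : Fin (2 * n) → τ) (hv : ∀ i, v (Sum.inl i) = Gr.const (v₀ i))
    (hw : ∀ i, w (Sum.inl i) = Gr.const (w₀ i)) (hv' : ∀ a, v (Sum.inr a) = Gr.gen (e a))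
    (hw' : ∀ a, w (Sum.inr a) = Gr.gen (e' a)) (x : X) :
    Gr.ev x (sexp (c • traceProd v w)) =
      Complex.exp (c * ∑ i, v₀ i x * w₀ i x) • oddGauss c e e' := by
  have h : Gr.ev x (c • traceProd v w) =
      Gr.const (c * ∑ i, v₀ i x * w₀ i x) + c • oddTrace e e' := by
    have h1 : (Gr.const (c * ∑ i, v₀ i x * w₀ i x) : Gr ℂ τ) =
        c • ∑ i, Gr.const (v₀ i x * w₀ i x) := by
      rw [Gr.const_eq_smul, mul_smul, Finset.sum_smul]
      simp only [Gr.const_eq_smul]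
    rw [map_smul, traceProd_eq, map_sum, Fintype.sum_sum_type, smul_add, h1, oddTrace]
    congr 2
    · refine Finset.sum_congr rfl fun i _ => ?_
      rw [map_smul, map_mul]
      simp only [dual, betaSign, hv, hw, one_smul]
      rw [Gr.ev, Gr.mapAlg_const, Gr.mapAlg_const, Gr.const_mul_const]
      rfl
    · refine Finset.sum_congr rfl fun a _ => ?_
      rw [map_smul, map_mul, dual_inr, betaSign_inr, hv', hw', Gr.ev, Gr.mapAlg_gen, Gr.mapAlg_gen]
  have h0 : (c • traceProd v w) ∅ x = c * ∑ i, v₀ i x * w₀ i x := by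
    refine (Gr.ev_apply x (c • traceProd v w) ∅).symm.trans ?_
    rw [h, Gr.add_apply, Gr.smul_apply c (oddTrace e e'), oddTrace_empty, smul_zero, add_zero,
      Gr.const, if_pos rfl]
  rw [Gr.ev_sexp, h, h0, add_sub_cancel_left, oddGauss]

end gaussians

/-! ### Berezin integrals -/

section berezin
variable {R τ : Type*} [CommRing R] [LinearOrder τ]

/-- Iterated odd derivatives pick out one coefficient, up to a sign. -/
theorem foldl_pdOdd_apply (l : List τ) (hl : l.Nodup) (S : Finset τ) :
    ∃ k : ℕ, ∀ f : Gr R τ, l.foldl (fun g t => Gr.pdOdd t g) f S =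
      if Disjoint S l.toFinset then (-1) ^ k * f (S ∪ l.toFinset) else 0 := by
  induction l with
  | nil => exact ⟨0, fun f => by simp⟩
  | cons a l ih =>
    rw [List.nodup_cons] at hl
    obtain ⟨k, hk⟩ := ih hl.2
    refine ⟨k + ((S ∪ l.toFinset).filter fun s => s < a).card, fun f => ?_⟩
    rw [List.foldl_cons, hk]
    simp only [List.toFinset_cons, Finset.disjoint_insert_right, Gr.pdOdd]
    by_cases hS : Disjoint S l.toFinset
    · by_cases ha : a ∈ S
      · simp [hS, ha]
      · have h1 : a ∉ S ∪ l.toFinset := by simp [ha, hl.1]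
        simp only [hS, ha, h1, if_true, if_false, not_false_eq_true, and_self,
          Finset.union_insert, pow_add]
        ring
    · simp [hS]

theorem foldl_pdOdd_empty [Fintype τ] (l : List τ) (hl : l.Nodup) (hu : ∀ t, t ∈ l) :
    ∃ k : ℕ, ∀ f : Gr R τ,
      l.foldl (fun g t => Gr.pdOdd t g) f ∅ = (-1) ^ k * f Finset.univ := by
  obtain ⟨k, hk⟩ := foldl_pdOdd_apply (R := R) l hl ∅
  have huniv : l.toFinset = Finset.univ := by
    ext t; simp [hu t]
  refine ⟨k, fun f => ?_⟩
  have := hk f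
  simpa [huniv] using this

end berezin

section fockIntegral
variable {n : ℕ}

theorem oddFst_ne_oddSnd (a b : Fin (2 * n)) : oddFst n a ≠ oddSnd n b := by
  intro h
  have : (Sum.inl a : Fin (2 * n) ⊕ Fin (2 * n)) = Sum.inr b := toLex.injective h
  cases this

theorem odd2_cases (t : Odd2 n) : (∃ a, t = oddFst n a) ∨ ∃ a, t = oddSnd n a := by
  rcases h : ofLex t with a | a
  · exact Or.inl ⟨a, congrArg toLex h⟩
  · exact Or.inr ⟨a, congrArg toLex h⟩

theorem intC_eq {m : ℕ} : ∃ c : ℂ, c ≠ 0 ∧ ∀ f : SFun (Fin m → ℂ) (Odd2 n),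
    intC f = c * ∫ z, f Finset.univ z := by
  let l : List (Odd2 n) := (List.finRange (2 * n)).flatMap fun t => [oddFst n t, oddSnd n t]
  have hfold : ∀ (l' : List (Fin (2 * n))) (f : SFun (Fin m → ℂ) (Odd2 n)),
      l'.foldl (fun g t => Gr.pdOdd (oddSnd n t) (Gr.pdOdd (oddFst n t) g)) f =
      (l'.flatMap fun t => [oddFst n t, oddSnd n t]).foldl (fun g t => Gr.pdOdd t g) f := by
    intro l'
    induction l' with
    | nil => intro f; rfl
    | cons a l' ih => intro f; rw [List.foldl_cons, ih]; rfl
  have hnd : l.Nodup := by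
    rw [List.nodup_flatMap]
    refine ⟨fun t _ => ?_, ?_⟩
    · simp [oddFst_ne_oddSnd]
    · refine (List.nodup_finRange _).imp ?_
      intro a b hab
      simp [List.Disjoint, Function.onFun, hab, oddFst_ne_oddSnd, (oddFst_ne_oddSnd _ _).symm]
  have hmem : ∀ t, t ∈ l := by
    intro t
    simp only [l, List.mem_flatMap]
    rcases odd2_cases t with ⟨a, rfl⟩ | ⟨a, rfl⟩ <;> exact ⟨a, by simp, by simp⟩
  obtain ⟨k, hk⟩ := foldl_pdOdd_empty (R := (Fin m → ℂ) → ℂ) l hnd hmem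
  refine ⟨((Real.pi : ℂ) ^ (2 * n))⁻¹ * (-1) ^ k, mul_ne_zero (inv_ne_zero (pow_ne_zero _
    (by exact_mod_cast Real.pi_ne_zero))) (pow_ne_zero _ (by norm_num)), fun f => ?_⟩
  rw [intC, ← MeasureTheory.integral_const_mul]
  congr 1
  funext z
  rw [hfold]
  have := congrFun (hk f) z
  rw [show (List.finRange (2 * n)).flatMap (fun t => [oddFst n t, oddSnd n t]) = l from rfl, this,
    mul_assoc]
  simp

end fockIntegral

/-! ### The bosonic Fock product -/

section bosonic

theorem norm_gauss_mul_pow (a b : ℕ) (z : ℂ) :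
    ‖Complex.exp (-(z * (starRingEnd ℂ) z)) * (z ^ a * (starRingEnd ℂ) z ^ b)‖ =
      ‖z‖ ^ ((a + b : ℕ) : ℝ) * Real.exp (-‖z‖ ^ (2 : ℝ)) := by
  rw [norm_mul, norm_mul, norm_pow, norm_pow, RCLike.norm_conj, ← pow_add, Complex.norm_exp,
    Complex.mul_conj, Real.rpow_natCast, mul_comm, Complex.normSq_eq_norm_sq]
  congr 2
  norm_cast

theorem integrable_gauss_mul_pow (a b : ℕ) : Integrable fun z : ℂ =>
    Complex.exp (-(z * (starRingEnd ℂ) z)) * (z ^ a * (starRingEnd ℂ) z ^ b) := by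
  have h := Complex.integral_rpow_mul_exp_neg_rpow (p := 2) (q := ((a + b : ℕ) : ℝ))
    (by norm_num) (lt_of_lt_of_le (by norm_num) (Nat.cast_nonneg _))
  have h2 : Integrable fun z : ℂ => ‖z‖ ^ ((a + b : ℕ) : ℝ) * Real.exp (-‖z‖ ^ (2 : ℝ)) := by
    apply Integrable.of_integral_ne_zero
    rw [h]
    have : 0 < Real.Gamma ((((a + b : ℕ) : ℝ) + 2) / 2) := Real.Gamma_pos_of_pos (by positivity)
    have := Real.pi_pos
    positivity
  refine h2.mono' (by fun_prop) (Filter.Eventually.of_forall fun z => ?_)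
  exact (norm_gauss_mul_pow a b z).le

theorem integral_gauss_mul_pow_self (a : ℕ) : ∫ z : ℂ,
    Complex.exp (-(z * (starRingEnd ℂ) z)) * (z ^ a * (starRingEnd ℂ) z ^ a) =
      Real.pi * a.factorial := by
  have h := Complex.integral_rpow_mul_exp_neg_rpow (p := 2) (q := ((a + a : ℕ) : ℝ))
    (by norm_num) (lt_of_lt_of_le (by norm_num) (Nat.cast_nonneg _))
  have h1 : (2 * Real.pi / 2) * Real.Gamma ((((a + a : ℕ) : ℝ) + 2) / 2) =
      Real.pi * a.factorial := by
    rw [← Real.Gamma_nat_eq_factorial]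
    congr 2
    · ring
    · push_cast; ring
  rw [h1] at h
  have h2 : ∀ z : ℂ, Complex.exp (-(z * (starRingEnd ℂ) z)) * (z ^ a * (starRingEnd ℂ) z ^ a) =
      ((‖z‖ ^ ((a + a : ℕ) : ℝ) * Real.exp (-‖z‖ ^ (2 : ℝ)) : ℝ) : ℂ) := by
    intro z
    rw [← mul_pow, Complex.mul_conj, Complex.normSq_eq_norm_sq, Real.rpow_natCast]
    push_cast
    rw [mul_comm, ← pow_mul]
    congr 2
    · ring
    · norm_cast
  simp only [h2]
  rw [integral_complex_ofReal, h]
  push_cast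
  rfl

theorem integral_gauss_mul_pow_of_ne {a b : ℕ} (hab : a ≠ b) : ∫ z : ℂ,
    Complex.exp (-(z * (starRingEnd ℂ) z)) * (z ^ a * (starRingEnd ℂ) z ^ b) = 0 := by
  have hd : (a : ℝ) - b ≠ 0 := sub_ne_zero.2 (by exact_mod_cast hab)
  -- rotation by this angle changes the sign of the integrand
  let c : Circle := Circle.exp (Real.pi / (a - b))
  have hc1 : (c : ℂ) * (starRingEnd ℂ) (c : ℂ) = 1 := by
    rw [Complex.mul_conj, Circle.normSq_coe]; norm_num
  have hc : (c : ℂ) ^ a * (starRingEnd ℂ) (c : ℂ) ^ b = -1 := by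
    have h1 : (c : ℂ) = Complex.exp ((Real.pi / (a - b) : ℝ) * Complex.I) := Circle.coe_exp _
    have h2 : (starRingEnd ℂ) (c : ℂ) = Complex.exp (-((Real.pi / (a - b) : ℝ) * Complex.I)) := by
      rw [h1, ← Complex.exp_conj]
      simp
    rw [h2, h1, ← Complex.exp_nat_mul, ← Complex.exp_nat_mul, ← Complex.exp_add,
      ← Complex.exp_pi_mul_I]
    congr 1
    have hd' : (a : ℂ) - b ≠ 0 := by exact_mod_cast hd
    push_cast
    field_simp
    ring
  have key := (rotation c).measurePreserving.integral_comp
    (rotation c).toHomeomorph.measurableEmbedding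
    (fun z : ℂ => Complex.exp (-(z * (starRingEnd ℂ) z)) * (z ^ a * (starRingEnd ℂ) z ^ b))
  have h3 : ∀ z : ℂ, Complex.exp (-(rotation c z * (starRingEnd ℂ) (rotation c z))) *
      (rotation c z ^ a * (starRingEnd ℂ) (rotation c z) ^ b) =
      -(Complex.exp (-(z * (starRingEnd ℂ) z)) * (z ^ a * (starRingEnd ℂ) z ^ b)) := by
    intro z
    rw [rotation_apply, map_mul]
    have e1 : (c : ℂ) * z * ((starRingEnd ℂ) (c : ℂ) * (starRingEnd ℂ) z) =
        z * (starRingEnd ℂ) z := by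
      linear_combination (z * (starRingEnd ℂ) z) * hc1
    rw [e1, mul_pow, mul_pow]
    linear_combination (Complex.exp (-(z * (starRingEnd ℂ) z)) *
      (z ^ a * (starRingEnd ℂ) z ^ b)) * hc
  simp only [h3] at key
  rw [integral_neg] at key
  have := self_eq_neg.1 key.symm
  exact this

variable {σ : Type*} [Fintype σ]

/-- The product of the factorials of the exponents. -/
def multiFactorial (α : σ →₀ ℕ) : ℂ := ∏ i, ((α i).factorial : ℂ)

/-- The Fock product `∑_α α! f_α \bar{g_α}` of polynomials. -/
def polyFock (f g : MvPolynomial σ ℂ) : ℂ :=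
  onMonomials (fun α => multiFactorial α * (starRingEnd ℂ) (g.coeff α)) f

theorem polyFock_eq (f g : MvPolynomial σ ℂ) : polyFock f g =
    ∑ α ∈ f.support, f.coeff α * (multiFactorial α * (starRingEnd ℂ) (g.coeff α)) := by
  rw [polyFock, onMonomials_apply]; rfl

theorem polyFock_add_left (f f' g : MvPolynomial σ ℂ) :
    polyFock (f + f') g = polyFock f g + polyFock f' g := map_add _ _ _

theorem polyFock_smul_left (c : ℂ) (f g : MvPolynomial σ ℂ) :
    polyFock (c • f) g = c * polyFock f g := map_smul _ _ _

theorem polyFock_zero_left (g : MvPolynomial σ ℂ) : polyFock 0 g = 0 := map_zero _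

theorem polyFock_add_right (f g g' : MvPolynomial σ ℂ) :
    polyFock f (g + g') = polyFock f g + polyFock f g' := by
  simp only [polyFock_eq, ← Finset.sum_add_distrib, MvPolynomial.coeff_add, map_add]
  exact Finset.sum_congr rfl fun α _ => by ring

theorem polyFock_smul_right (c : ℂ) (f g : MvPolynomial σ ℂ) :
    polyFock f (c • g) = (starRingEnd ℂ) c * polyFock f g := by
  simp only [polyFock_eq, Finset.mul_sum, MvPolynomial.coeff_smul, smul_eq_mul, map_mul]
  exact Finset.sum_congr rfl fun α _ => by ring

theorem polyFock_monomial [DecidableEq σ] (α β : σ →₀ ℕ) (c d : ℂ) :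
    polyFock (MvPolynomial.monomial α c) (MvPolynomial.monomial β d) =
      if α = β then c * (multiFactorial α * (starRingEnd ℂ) d) else 0 := by
  rw [polyFock, onMonomials_monomial, MvPolynomial.coeff_monomial, smul_eq_mul]
  by_cases h : α = β
  · simp [h]
  · rw [if_neg (Ne.symm h), if_neg h]; simp

theorem conj_multiFactorial (α : σ →₀ ℕ) :
    (starRingEnd ℂ) (multiFactorial α) = multiFactorial α := by
  simp [multiFactorial]

theorem polyFock_conj (f g : MvPolynomial σ ℂ) :
    polyFock f g = (starRingEnd ℂ) (polyFock g f) := by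
  classical
  induction f using MvPolynomial.induction_on' with
  | add p q hp hq => rw [polyFock_add_left, hp, hq, polyFock_add_right, map_add]
  | monomial α c =>
    induction g using MvPolynomial.induction_on' with
    | add p q hp hq => rw [polyFock_add_right, hp, hq, polyFock_add_left, map_add]
    | monomial β d =>
      rw [polyFock_monomial, polyFock_monomial]
      by_cases h : α = β
      · subst h
        simp only [if_true, map_mul, conj_multiFactorial, Complex.conj_conj]
        ring
      · rw [if_neg h, if_neg (Ne.symm h), map_zero]

/-- Multiplication by a variable is adjoint to the partial derivative. -/
theorem polyFock_X_mul (i : σ) (f g : MvPolynomial σ ℂ) :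
    polyFock (MvPolynomial.X i * f) g = polyFock f (MvPolynomial.pderiv i g) := by
  classical
  induction f using MvPolynomial.induction_on' with
  | add p q hp hq => rw [mul_add, polyFock_add_left, hp, hq, polyFock_add_left]
  | monomial α c =>
    induction g using MvPolynomial.induction_on' with
    | add p q hp hq => rw [polyFock_add_right, hp, hq, map_add, polyFock_add_right]
    | monomial β d =>
      rw [mul_comm, MvPolynomial.X, MvPolynomial.monomial_mul, mul_one,
        MvPolynomial.pderiv_monomial, polyFock_monomial, polyFock_monomial]
      by_cases hβ : β i = 0
      · rw [if_neg, hβ]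
        · simp
        · rintro rfl
          simp at hβ
      · by_cases h : α + Finsupp.single i 1 = β
        · have h2 : α = β - Finsupp.single i 1 := by rw [← h]; simp
          have h3 : multiFactorial β = (β i : ℂ) * multiFactorial α := by
            rw [multiFactorial, multiFactorial, ← Finset.mul_prod_erase _ _ (Finset.mem_univ i),
              ← Finset.mul_prod_erase _ _ (Finset.mem_univ i), ← mul_assoc]
            congr 1
            · rw [← h]; simp [Nat.factorial_succ]
            · refine Finset.prod_congr rfl fun j hj => ?_
              rw [← h]
              have := (Finset.mem_erase.1 hj).1
              simp [Ne.symm this]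
          rw [if_pos h, if_pos h2, h, h3]
          rw [map_mul, Complex.conj_natCast]
          ring
        · rw [if_neg h, if_neg]
          intro h2
          apply h
          rw [h2, tsub_add_cancel_of_le]
          intro j
          by_cases hj : i = j
          · subst hj; simp; omega
          · simp [hj]

theorem polyFock_self (f : MvPolynomial σ ℂ) : polyFock f f =
    ((∑ α ∈ f.support, (∏ i, ((α i).factorial : ℝ)) * ‖f.coeff α‖ ^ 2 : ℝ) : ℂ) := by
  rw [polyFock_eq]
  push_cast
  refine Finset.sum_congr rfl fun α _ => ?_
  rw [multiFactorial, mul_left_comm, Complex.mul_conj, Complex.normSq_eq_norm_sq]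
  push_cast
  rfl

theorem polyFock_self_nonneg (f : MvPolynomial σ ℂ) : 0 ≤ (polyFock f f).re := by
  rw [polyFock_self, Complex.ofReal_re]
  positivity

theorem polyFock_definite (f : MvPolynomial σ ℂ) (h : (polyFock f f).re = 0) : f = 0 := by
  rw [polyFock_self, Complex.ofReal_re, Finset.sum_eq_zero_iff_of_nonneg] at h
  · ext α
    by_contra hα
    have h1 := h α (MvPolynomial.mem_support_iff.2 hα)
    have h2 : 0 < (∏ i, ((α i).factorial : ℝ)) :=
      Finset.prod_pos fun i _ => by exact_mod_cast (α i).factorial_pos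
    have h3 : ‖f.coeff α‖ ^ 2 = 0 := (mul_eq_zero.1 h1).resolve_left h2.ne'
    exact hα (by simpa using h3)
  · intros; positivity

/-- The bosonic Gaussian `exp(-∑ |z_i|²)`. -/
def gaussBos {m : ℕ} (z : Fin m → ℂ) : ℂ := Complex.exp (-∑ i, z i * (starRingEnd ℂ) (z i))

theorem integral_polyFock {m : ℕ} (f g : MvPolynomial (Fin m) ℂ) :
    Integrable (fun z : Fin m → ℂ => gaussBos z *
      (MvPolynomial.eval z f * (starRingEnd ℂ) (MvPolynomial.eval z g))) ∧
    ∫ z : Fin m → ℂ, gaussBos z *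
      (MvPolynomial.eval z f * (starRingEnd ℂ) (MvPolynomial.eval z g)) =
      (Real.pi : ℂ) ^ m * polyFock f g := by
  induction f using MvPolynomial.induction_on' with
  | add p q hp hq =>
    simp only [map_add, mul_add, add_mul]
    refine ⟨hp.1.add hq.1, ?_⟩
    rw [integral_add hp.1 hq.1, hp.2, hq.2, polyFock_add_left, mul_add]
  | monomial α c =>
    induction g using MvPolynomial.induction_on' with
    | add p q hp hq =>
      simp only [map_add, mul_add]
      refine ⟨hp.1.add hq.1, ?_⟩
      rw [integral_add hp.1 hq.1, hp.2, hq.2, polyFock_add_right, mul_add]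
    | monomial β d =>
      have h1 : ∀ z : Fin m → ℂ, gaussBos z * (MvPolynomial.eval z (MvPolynomial.monomial α c) *
          (starRingEnd ℂ) (MvPolynomial.eval z (MvPolynomial.monomial β d))) =
          (c * (starRingEnd ℂ) d) * ∏ i, (Complex.exp (-(z i * (starRingEnd ℂ) (z i))) *
            (z i ^ α i * (starRingEnd ℂ) (z i) ^ β i)) := by
        intro z
        rw [MvPolynomial.eval_monomial, MvPolynomial.eval_monomial, gaussBos,
          Finsupp.prod_fintype _ _ (fun i => pow_zero _),
          Finsupp.prod_fintype _ _ (fun i => pow_zero _), Finset.prod_mul_distrib,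
          Finset.prod_mul_distrib, ← Finset.sum_neg_distrib, Complex.exp_sum, map_mul, map_prod]
        simp only [map_pow]
        ring
      simp only [h1]
      constructor
      · refine Integrable.const_mul ?_ _
        exact Integrable.fintype_prod (f := fun (i : Fin m) (w : ℂ) =>
          Complex.exp (-(w * (starRingEnd ℂ) w)) * (w ^ α i * (starRingEnd ℂ) w ^ β i))
          (fun i => integrable_gauss_mul_pow (α i) (β i))
      · rw [integral_const_mul, integral_fintype_prod_volume_eq_prod (ι := Fin m)
          (f := fun (i : Fin m) (w : ℂ) =>
          Complex.exp (-(w * (starRingEnd ℂ) w)) * (w ^ α i * (starRingEnd ℂ) w ^ β i)),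
          polyFock_monomial]
        by_cases h : α = β
        · subst h
          simp only [integral_gauss_mul_pow_self, Finset.prod_mul_distrib, if_true,
            Finset.prod_const, Finset.card_univ, Fintype.card_fin, multiFactorial]
          ring
        · obtain ⟨i, hi⟩ : ∃ i, α i ≠ β i := by
            by_contra hh
            push Not at hh
            exact h (Finsupp.ext hh)
          rw [Finset.prod_eq_zero (Finset.mem_univ i) (integral_gauss_mul_pow_of_ne hi), if_neg h]
          simp

end bosonic

/-! ### The odd Fock pairing -/

section oddFock
variable {n : ℕ}

/-- The Gaussian factor `exp(-∑ θ^a θ̄_a)` of the Fock product. -/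
def fockKernel (n : ℕ) : Gr ℂ (Odd2 n) := oddGauss (-1) (oddFst n) (oddSnd n)

/-- The Berezin integral (up to normalization) in the Fock product. -/
def oddFock (x y : Gr ℂ (Fin (2 * n))) : ℂ :=
  (fockKernel n * Gr.relabel (oddFst n) x * Gr.relabel (oddSnd n) y) Finset.univ

theorem oddFock_add_left (x x' y : Gr ℂ (Fin (2 * n))) :
    oddFock (x + x') y = oddFock x y + oddFock x' y := by
  rw [oddFock, Gr.relabel_add, mul_add, add_mul, Gr.add_apply]; rfl

theorem oddFock_add_right (x y y' : Gr ℂ (Fin (2 * n))) :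
    oddFock x (y + y') = oddFock x y + oddFock x y' := by
  rw [oddFock, Gr.relabel_add, mul_add, Gr.add_apply]; rfl

theorem oddFock_smul_left (c : ℂ) (x y : Gr ℂ (Fin (2 * n))) :
    oddFock (c • x) y = c * oddFock x y := by
  rw [oddFock, Gr.relabel_smul, mul_smul_comm, smul_mul_assoc, Gr.smul_apply]; rfl

theorem oddFock_smul_right (c : ℂ) (x y : Gr ℂ (Fin (2 * n))) :
    oddFock x (c • y) = c * oddFock x y := by
  rw [oddFock, Gr.relabel_smul, mul_smul_comm, Gr.smul_apply]; rfl

/-- `oddFock` as a bilinear form. -/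
def oddFockₗ : Gr ℂ (Fin (2 * n)) →ₗ[ℂ] Gr ℂ (Fin (2 * n)) →ₗ[ℂ] ℂ :=
  LinearMap.mk₂ ℂ oddFock oddFock_add_left oddFock_smul_left oddFock_add_right oddFock_smul_right

theorem oddFock_eq_sum (x y : Gr ℂ (Fin (2 * n))) :
    oddFock x y = ∑ S, ∑ T, oddFock (Gr.single S 1) (Gr.single T 1) * (x S * y T) := by
  have hs : ∀ (S : Finset (Fin (2 * n))) (c : ℂ), (Gr.single S c : Gr ℂ (Fin (2 * n))) =
      c • Gr.single S 1 := by
    intro S c; ext T; rw [Gr.smul_apply]; simp only [Gr.single]; split_ifs <;> simp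
  conv_lhs => rw [Gr.sum_single x, Gr.sum_single y]
  change oddFockₗ _ _ = _
  simp only [map_sum, LinearMap.sum_apply]
  rw [Finset.sum_comm]
  refine Finset.sum_congr rfl fun S _ => Finset.sum_congr rfl fun T _ => ?_
  change oddFock _ _ = _
  rw [hs, hs T, oddFock_smul_left, oddFock_smul_right]
  ring

theorem pdOdd_univ {τ : Type*} [LinearOrder τ] [Fintype τ] (t : τ) (f : Gr ℂ τ) :
    Gr.pdOdd t f Finset.univ = 0 := by
  rw [Gr.pdOdd, if_pos (Finset.mem_univ t)]

theorem parity_fockKernel : Gr.parity (fockKernel n) = fockKernel n := parity_oddGauss _ _ _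

theorem oddFock_gen_mul (a : Fin (2 * n)) (x y : Gr ℂ (Fin (2 * n))) :
    oddFock (Gr.gen a * x) y = osign a * oddFock (Gr.parity x) (Gr.pdOdd (odual a) y) := by
  -- the Berezin integral of a derivative with respect to the conjugate variable vanishes
  have h := pdOdd_univ (oddSnd n (odual a))
    (fockKernel n * Gr.relabel (oddFst n) x * Gr.relabel (oddSnd n) y)
  have hk : Gr.pdOdd (oddSnd n (odual a)) (fockKernel n) =
      osign (odual a) • (Gr.gen (oddFst n a) * fockKernel n) := by
    rw [fockKernel, pdOdd_oddGauss, pdOdd_right_oddTrace (oddSnd n).injective oddFst_ne_oddSnd,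
      odual_odual, smul_mul_assoc]
    module
  have h1 : Gr.gen (oddFst n a) * fockKernel n = fockKernel n * Gr.gen (oddFst n a) :=
    (Gr.mul_comm_of_even parity_fockKernel _).symm
  rw [Gr.pdOdd_mul, Gr.pdOdd_mul, hk, h1, Gr.pdOdd_relabel_of_ne _ _ (fun s => oddFst_ne_oddSnd _ _),
    mul_zero, add_zero, Gr.parity_mul, parity_fockKernel, Gr.parity_relabel, Gr.pdOdd_relabel,
    smul_mul_assoc, smul_mul_assoc, mul_assoc (fockKernel n), ← Gr.relabel_gen_mul,
    Gr.add_apply, Gr.smul_apply] at h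
  change osign (odual a) * oddFock (Gr.gen a * x) y +
    oddFock (Gr.parity x) (Gr.pdOdd (odual a) y) = 0 at h
  have h2 := osign_sq a
  rw [osign_odual] at h
  linear_combination (-osign a) * h - oddFock (Gr.gen a * x) y * h2

theorem oddFock_one_gen_mul (a : Fin (2 * n)) (y : Gr ℂ (Fin (2 * n))) :
    oddFock 1 (Gr.gen a * y) = 0 := by
  have h := pdOdd_univ (oddFst n (odual a)) (fockKernel n * Gr.relabel (oddSnd n) y)
  have hk : Gr.pdOdd (oddFst n (odual a)) (fockKernel n) =
      osign (odual a) • (Gr.gen (oddSnd n a) * fockKernel n) := by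
    rw [fockKernel, pdOdd_oddGauss, pdOdd_left_oddTrace (oddFst n).injective oddFst_ne_oddSnd,
      odual_odual, smul_mul_assoc]
    module
  have h1 : Gr.gen (oddSnd n a) * fockKernel n = fockKernel n * Gr.gen (oddSnd n a) :=
    (Gr.mul_comm_of_even parity_fockKernel _).symm
  rw [Gr.pdOdd_mul, hk, h1, Gr.pdOdd_relabel_of_ne _ _ (fun s => (oddFst_ne_oddSnd _ _).symm),
    mul_zero, add_zero, smul_mul_assoc, mul_assoc, ← Gr.relabel_gen_mul, Gr.smul_apply] at h
  have h2 : oddFock 1 (Gr.gen a * y) =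
      (fockKernel n * Gr.relabel (oddSnd n) (Gr.gen a * y) : Gr ℂ (Odd2 n)) Finset.univ := by
    rw [oddFock, ← Gr.const_one, Gr.relabel_const, Gr.const_one, mul_one]
  rw [h2]
  have h3 := osign_sq (odual a)
  rw [smul_eq_mul] at h
  rcases mul_eq_zero.1 h with h4 | h4
  · rw [h4] at h3; simp at h3
  · exact h4

theorem oddFock_one (y : Gr ℂ (Fin (2 * n))) : oddFock 1 y = oddFock (n := n) 1 1 * y ∅ := by
  induction y using Gr.induction with
  | hc r =>
    rw [Gr.const_eq_smul, oddFock_smul_right, Gr.smul_apply, Gr.one_apply]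
    simp [mul_comm]
  | ha f g hf hg => rw [oddFock_add_right, hf, hg, Gr.add_apply, mul_add]
  | hg t f _ => rw [oddFock_one_gen_mul, Gr.gen_mul_apply]; simp

theorem oddFock_parity (x y : Gr ℂ (Fin (2 * n))) :
    oddFock (Gr.parity x) (Gr.parity y) = oddFock x y := by
  have key : fockKernel n * Gr.relabel (oddFst n) (Gr.parity x) *
      Gr.relabel (oddSnd n) (Gr.parity y) = Gr.parity (fockKernel n *
        Gr.relabel (oddFst n) x * Gr.relabel (oddSnd n) y) := by
    rw [Gr.parity_mul, Gr.parity_mul, parity_fockKernel, Gr.parity_relabel, Gr.parity_relabel]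
  rw [oddFock, key, Gr.parity_apply, oddFock]
  have : (Finset.univ : Finset (Odd2 n)).card = 2 * (2 * n) := by
    rw [Finset.card_univ, Fintype.card_lex, Fintype.card_sum, Fintype.card_fin]; ring
  rw [this, pow_mul]
  simp

theorem mul_single_apply {τ : Type*} [LinearOrder τ] (f : Gr ℂ τ) (S U : Finset τ) (hSU : S ⊆ U) :
    (f * Gr.single S 1 : Gr ℂ τ) U = (-1) ^ Gr.inv (U \ S) S * f (U \ S) := by
  rw [Gr.mul_apply, Finset.sum_eq_single (U \ S)]
  · rw [Finset.sdiff_sdiff_eq_self hSU, Gr.single, if_pos rfl, mul_one]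
  · intro T hT hT'
    have : U \ T ≠ S := by
      rintro rfl
      exact hT' (Finset.sdiff_sdiff_eq_self (Finset.mem_powerset.1 hT)).symm
    rw [Gr.single, if_neg this, mul_zero, mul_zero]
  · intro h; exact absurd (Finset.mem_powerset.2 Finset.sdiff_subset) h

theorem oddFock_one_one_ne : oddFock (n := n) 1 1 ≠ 0 := by
  intro h0
  -- if the total integral vanished, then so would the whole pairing
  have hall : ∀ x y : Gr ℂ (Fin (2 * n)), oddFock x y = 0 := by
    have : ∀ x : Gr ℂ (Fin (2 * n)), ∀ y, oddFock x y = 0 ∧ oddFock (Gr.parity x) y = 0 := by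
      intro x
      induction x using Gr.induction with
      | hc r =>
        intro y
        rw [Gr.parity_const, Gr.const_eq_smul, oddFock_smul_left, oddFock_one, h0]
        simp
      | ha f g hf hg =>
        intro y
        rw [oddFock_add_left, map_add, oddFock_add_left, (hf y).1, (hf y).2, (hg y).1, (hg y).2]
        simp
      | hg t f hf =>
        intro y
        have h1 : oddFock (Gr.gen t * f) y = 0 := by rw [oddFock_gen_mul, (hf _).2, mul_zero]
        refine ⟨h1, ?_⟩
        rw [Gr.parity_gen_mul, ← mul_neg, oddFock_gen_mul, map_neg, Gr.parity_parity,
          ← neg_one_smul ℂ f, oddFock_smul_left, (hf _).1, mul_zero, mul_zero]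
    exact fun x y => (this x y).1
  have h1 := hall (Gr.single Finset.univ 1) (Gr.single Finset.univ 1)
  set A := (Finset.univ : Finset (Fin (2 * n))).map (oddFst n).toEmbedding with hA
  set B := (Finset.univ : Finset (Fin (2 * n))).map (oddSnd n).toEmbedding with hB
  have hd : Disjoint A B := by
    rw [Finset.disjoint_left]
    intro t ht ht'
    obtain ⟨a, _, rfl⟩ := Finset.mem_map.1 ht
    obtain ⟨b, _, hb⟩ := Finset.mem_map.1 ht'
    exact oddFst_ne_oddSnd a b hb.symm
  have hrel : ∀ (e : Fin (2 * n) ↪o Odd2 n), Gr.relabel e (Gr.single Finset.univ (1 : ℂ)) =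
      Gr.single (Finset.univ.map e.toEmbedding) 1 := by
    intro e
    ext U
    by_cases h : ∃ S : Finset (Fin (2 * n)), S.map e.toEmbedding = U
    · obtain ⟨S, rfl⟩ := h
      rw [Gr.relabel_map]
      simp [Gr.single]
    · rw [Gr.relabel_of_not e _ U h, Gr.single, if_neg]
      rintro rfl; exact h ⟨_, rfl⟩
  have hUB : ∀ _ : DecidableEq (Odd2 n), Finset.univ \ B = A := by
    intro _
    ext t
    rw [Finset.mem_sdiff]
    rcases odd2_cases t with ⟨a, rfl⟩ | ⟨a, rfl⟩
    · have h2 : oddFst n a ∈ A := Finset.mem_map_of_mem _ (Finset.mem_univ a)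
      exact ⟨fun _ => h2, fun _ => ⟨Finset.mem_univ _, Finset.disjoint_left.1 hd h2⟩⟩
    · have h2 : oddSnd n a ∈ B := Finset.mem_map_of_mem _ (Finset.mem_univ a)
      exact ⟨fun h => absurd h2 h.2, fun h => absurd h2 (Finset.disjoint_left.1 hd h)⟩
  rw [oddFock, hrel, hrel, mul_single_apply _ _ _ (Finset.subset_univ _), ← hB, hUB, ← hA,
    mul_single_apply _ _ _ le_rfl, Finset.sdiff_self, fockKernel, oddGauss_empty] at h1
  simp at h1

end oddFock

/-! ### The Fock product -/

section fockForm
variable {m n : ℕ}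

theorem ev_gaussC (z : Fin m → ℂ) : Gr.ev z (gaussC m n) = gaussBos z • fockKernel n := by
  have h := ev_sexp_traceProd (-1) (zC (m := m) (n := n)) zbarC (fun i z => z i)
    (fun i z => (starRingEnd ℂ) (z i)) (oddFst n) (oddSnd n) (fun _ => rfl) (fun _ => rfl)
    (fun _ => rfl) (fun _ => rfl) z
  rw [gaussC, ← neg_one_smul ℂ (traceProd _ _), h, gaussBos, fockKernel, neg_one_mul]

/-- The complex conjugation on the Grassmann algebra. -/
def conjGr {τ : Type*} (x : Gr ℂ τ) : Gr ℂ τ := Gr.mapCoeff (starRingEnd ℂ) x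

theorem formF_eq_integral (p q : SFC m n) :
    formF p q = ((Real.pi : ℂ) ^ m * oddFock (n := n) 1 1)⁻¹ *
      ∫ z, gaussBos z * oddFock (Gr.ev z p) (conjGr (Gr.ev z q)) := by
  obtain ⟨c, hc, hint⟩ := intC_eq (m := m) (n := n)
  have h1 : ∀ z, gaussC m n Finset.univ z = gaussBos z * oddFock (n := n) 1 1 := by
    intro z
    refine (Gr.ev_apply z (gaussC m n) _).symm.trans ?_
    rw [ev_gaussC, Gr.smul_apply, oddFock, ← Gr.const_one, Gr.relabel_const,
      Gr.relabel_const, Gr.const_one, mul_one, mul_one]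
    rfl
  have h2 : ∀ z, (gaussC m n * Gr.relabel (oddFst n) p * Gr.relabel (oddSnd n) (conjFun q))
      Finset.univ z = gaussBos z * oddFock (Gr.ev z p) (conjGr (Gr.ev z q)) := by
    intro z
    refine (Gr.ev_apply z (gaussC m n * _ * _) _).symm.trans ?_
    rw [map_mul, map_mul, ev_gaussC, Gr.ev, Gr.mapAlg_relabel, Gr.mapAlg_relabel,
      smul_mul_assoc, smul_mul_assoc, Gr.smul_apply]
    rfl
  have h3 : ∫ z : Fin m → ℂ, gaussBos z = (Real.pi : ℂ) ^ m := by
    have := (integral_polyFock (1 : MvPolynomial (Fin m) ℂ) 1).2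
    rw [show (1 : MvPolynomial (Fin m) ℂ) = MvPolynomial.monomial 0 1 from rfl] at this
    classical
    rw [polyFock_monomial] at this
    simpa [multiFactorial] using this
  rw [formF, hint, hint]
  simp only [h1, h2]
  rw [integral_mul_const, h3, mul_inv, mul_mul_mul_comm, inv_mul_cancel₀ hc, one_mul]

/-- The Fock product of superpolynomials. -/
def fockForm (p q : Fock m n) : ℂ := formF (evalC p) (evalC q)

/-- Evaluation of the even variables of a superpolynomial. -/
def evalAt (z : Fin m → ℂ) : Fock m n →ₐ[ℂ] Gr ℂ (Fin (2 * n)) := Gr.mapAlg (MvPolynomial.aeval z)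

theorem ev_evalC (z : Fin m → ℂ) (p : Fock m n) : Gr.ev z (evalC p) = evalAt z p := by
  ext S
  rw [Gr.ev_apply, evalAt, Gr.mapAlg_apply, MvPolynomial.aeval_eq_eval]
  rfl

theorem parity_conjGr {τ : Type*} (x : Gr ℂ τ) : Gr.parity (conjGr x) = conjGr (Gr.parity x) := by
  ext S
  rw [Gr.parity_apply, conjGr, conjGr, Gr.mapCoeff, Gr.mapCoeff, Gr.parity_apply]
  simp

theorem conjGr_smul {τ : Type*} (c : ℂ) (x : Gr ℂ τ) :
    conjGr (c • x) = (starRingEnd ℂ) c • conjGr x := by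
  ext S
  rw [Gr.smul_apply, conjGr, conjGr, Gr.mapCoeff, Gr.mapCoeff, Gr.smul_apply]
  simp

theorem fockForm_eq_integral (p q : Fock m n) :
    fockForm p q = ((Real.pi : ℂ) ^ m * oddFock (n := n) 1 1)⁻¹ *
      ∫ z, gaussBos z * oddFock (evalAt z p) (conjGr (evalAt z q)) := by
  rw [fockForm, formF_eq_integral]
  simp only [ev_evalC]

theorem fockForm_eq_sum (p q : Fock m n) : fockForm p q =
    ∑ S, ∑ T, (oddFock (n := n) 1 1)⁻¹ * oddFock (Gr.single S 1) (Gr.single T 1) *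
      polyFock (p S) (q T) := by
  rw [fockForm, formF_eq_integral]
  have h : ∀ z : Fin m → ℂ, gaussBos z *
      oddFock (Gr.ev z (evalC p)) (conjGr (Gr.ev z (evalC q))) =
      ∑ S, ∑ T, oddFock (Gr.single S 1) (Gr.single T 1) * (gaussBos z *
        (MvPolynomial.eval z (p S) * (starRingEnd ℂ) (MvPolynomial.eval z (q T)))) := by
    intro z
    rw [oddFock_eq_sum, Finset.mul_sum]
    refine Finset.sum_congr rfl fun S _ => ?_
    rw [Finset.mul_sum]
    refine Finset.sum_congr rfl fun T _ => ?_
    rw [mul_left_comm]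
    rfl
  simp only [h]
  rw [integral_finsetSum, Finset.mul_sum]
  · refine Finset.sum_congr rfl fun S _ => ?_
    rw [integral_finsetSum, Finset.mul_sum]
    · refine Finset.sum_congr rfl fun T _ => ?_
      rw [integral_const_mul, (integral_polyFock _ _).2]
      have : (Real.pi : ℂ) ^ m ≠ 0 := pow_ne_zero _ (by exact_mod_cast Real.pi_ne_zero)
      have := oddFock_one_one_ne (n := n)
      field_simp
    · exact fun T _ => (integral_polyFock _ _).1.const_mul _
  · exact fun S _ => integrable_finsetSum _ fun T _ => (integral_polyFock _ _).1.const_mul _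

theorem fockForm_add_left (p p' q : Fock m n) :
    fockForm (p + p') q = fockForm p q + fockForm p' q := by
  simp only [fockForm_eq_sum, Gr.add_apply, polyFock_add_left, mul_add, Finset.sum_add_distrib]

theorem fockForm_add_right (p q q' : Fock m n) :
    fockForm p (q + q') = fockForm p q + fockForm p q' := by
  simp only [fockForm_eq_sum, Gr.add_apply, polyFock_add_right, mul_add, Finset.sum_add_distrib]

theorem fockForm_smul_left (c : ℂ) (p q : Fock m n) :
    fockForm (c • p) q = c * fockForm p q := by
  simp only [fockForm_eq_sum, Gr.smul_apply, polyFock_smul_left, Finset.mul_sum]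
  exact Finset.sum_congr rfl fun S _ => Finset.sum_congr rfl fun T _ => by ring

theorem fockForm_smul_right (c : ℂ) (p q : Fock m n) :
    fockForm p (c • q) = (starRingEnd ℂ) c * fockForm p q := by
  simp only [fockForm_eq_sum, Gr.smul_apply, polyFock_smul_right, Finset.mul_sum]
  exact Finset.sum_congr rfl fun S _ => Finset.sum_congr rfl fun T _ => by ring

theorem fockForm_parity (p q : Fock m n) :
    fockForm (Gr.parity p) (Gr.parity q) = fockForm p q := by
  have h : ∀ z : Fin m → ℂ, oddFock (evalAt z (Gr.parity p)) (conjGr (evalAt z (Gr.parity q))) =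
      oddFock (evalAt z p) (conjGr (evalAt z q)) := by
    intro z
    rw [evalAt, ← Gr.parity_mapAlg, ← Gr.parity_mapAlg, ← parity_conjGr, oddFock_parity]
  rw [fockForm_eq_integral, fockForm_eq_integral]
  simp only [h]

theorem fockForm_sgn (i : Idx m n) (p q : Fock m n) :
    fockForm (sgn i p) (sgn i q) = fockForm p q := by
  rcases i with i | a
  · rfl
  · exact fockForm_parity p q

/-- Multiplication by `z_i` is adjoint to `∂_i`. -/
theorem fockForm_zvar_mul (i : Idx m n) (p q : Fock m n) :
    fockForm (zvar i * p) q = fockForm (sgn i p) (dF i q) := by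
  rcases i with i | a
  · rw [fockForm_eq_sum, fockForm_eq_sum]
    refine Finset.sum_congr rfl fun S _ => Finset.sum_congr rfl fun T _ => ?_
    rw [sgn_inl, dF_apply, zvar, Gr.const_mul, polyFock_X_mul]
    simp [betaSign, dual, dz_inl_apply]
  · have h : ∀ z : Fin m → ℂ, oddFock (evalAt z (zvar (Sum.inr a) * p)) (conjGr (evalAt z q)) =
        oddFock (evalAt z (sgn (m := m) (Sum.inr a) p))
          (conjGr (evalAt z (dF (Sum.inr a) q))) := by
      intro z
      have h1 : osign a • Gr.pdOdd (odual a) (conjGr (evalAt z q)) =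
          conjGr (evalAt z (dF (Sum.inr a) q)) := by
        rw [dF_apply, betaSign_inr, dual_inr, map_smul, conjGr_smul,
          show (starRingEnd ℂ) (osign a) = osign a by simp only [osign]; split_ifs <;> simp]
        congr 1
        rw [dz, Gr.pdOddₗ_apply, evalAt, ← Gr.pdOdd_mapAlg]
        exact Gr.pdOdd_mapCoeff (starRingEnd ℂ) _ _
      rw [← h1, oddFock_smul_right, zvar, map_mul, sgn_inr, evalAt, Gr.mapAlg_gen,
        oddFock_gen_mul, Gr.parity_mapAlg]
    rw [fockForm_eq_integral, fockForm_eq_integral]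
    simp only [h]

/-- The product with the vacuum is evaluation at the origin. -/
theorem fockForm_one_left (q : Fock m n) :
    fockForm 1 q = (starRingEnd ℂ) (MvPolynomial.constantCoeff (q ∅)) := by
  classical
  have h1 : (1 : Gr ℂ (Fin (2 * n))) = Gr.single ∅ 1 := by
    ext S; rw [Gr.one_apply]; rfl
  have h2 : ∀ T : Finset (Fin (2 * n)), oddFock (Gr.single ∅ 1) (Gr.single T 1) =
      if T = ∅ then oddFock (n := n) 1 1 else 0 := by
    intro T
    rw [← h1, oddFock_one, Gr.single]
    by_cases h : T = ∅
    · simp [h]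
    · simp [h, Ne.symm h]
  rw [fockForm_eq_sum, Finset.sum_eq_single ∅, Finset.sum_eq_single ∅, h2, if_pos rfl,
    inv_mul_cancel₀ oddFock_one_one_ne, one_mul, Gr.one_apply, if_pos rfl]
  · change polyFock (MvPolynomial.monomial 0 1) _ = _
    rw [polyFock, onMonomials_monomial]
    simp [multiFactorial, MvPolynomial.constantCoeff_eq]
  · intro T _ hT; rw [h2, if_neg hT]; simp
  · simp
  · intro S _ hS
    refine Finset.sum_eq_zero fun T _ => ?_
    rw [Gr.one_apply, if_neg hS, polyFock_zero_left, mul_zero]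
  · simp

theorem polyFock_zero_right (f : MvPolynomial (Fin m) ℂ) : polyFock f 0 = 0 := by
  rw [polyFock_conj, polyFock_zero_left, map_zero]

/-! ### The inner product defined by `S_F` -/

/-- The standard inner product on superpolynomials, for which the monomials are orthogonal. -/
def fockInner (p q : Fock m n) : ℂ := ∑ S, polyFock (p S) (q S)

theorem fockInner_add_left (p p' q : Fock m n) :
    fockInner (p + p') q = fockInner p q + fockInner p' q := by
  simp only [fockInner, Gr.add_apply, polyFock_add_left, Finset.sum_add_distrib]

theorem fockInner_smul_left (c : ℂ) (p q : Fock m n) :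
    fockInner (c • p) q = c * fockInner p q := by
  simp only [fockInner, Gr.smul_apply, polyFock_smul_left, Finset.mul_sum]

theorem fockInner_conj (p q : Fock m n) : fockInner p q = (starRingEnd ℂ) (fockInner q p) := by
  simp only [fockInner, map_sum]
  exact Finset.sum_congr rfl fun S _ => polyFock_conj _ _

theorem fockInner_one_left (q : Fock m n) :
    fockInner 1 q = (starRingEnd ℂ) (MvPolynomial.constantCoeff (q ∅)) := by
  rw [fockInner, Finset.sum_eq_single ∅]
  · rw [Gr.one_apply, if_pos rfl, show (1 : MvPolynomial (Fin m) ℂ) =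
      MvPolynomial.monomial 0 1 from rfl, polyFock, onMonomials_monomial]
    simp [multiFactorial, MvPolynomial.constantCoeff_eq]
  · intro S _ hS; rw [Gr.one_apply, if_neg hS, polyFock_zero_left]
  · simp

theorem polyFock_neg_one_pow (k : ℕ) (f g : MvPolynomial (Fin m) ℂ) :
    polyFock ((-1) ^ k * f) g = polyFock f ((-1) ^ k * g) := by
  have h : ∀ f : MvPolynomial (Fin m) ℂ, (-1) ^ k * f = ((-1 : ℂ) ^ k) • f := by
    intro f; rw [Algebra.smul_def, map_pow, map_neg, map_one]
  rw [h, h, polyFock_smul_left, polyFock_smul_right]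
  simp

theorem fockInner_zvar_mul (i : Idx m n) (p q : Fock m n) :
    fockInner (zvar i * p) q = fockInner p (dz i q) := by
  rcases i with i | a
  · refine Finset.sum_congr rfl fun S _ => ?_
    rw [zvar, Gr.const_mul, polyFock_X_mul]; rfl
  · simp only [fockInner, zvar, dz, Gr.pdOddₗ_apply, Gr.gen_mul_apply, Gr.pdOdd]
    rw [← Finset.sum_filter_add_sum_filter_not Finset.univ (fun S => a ∈ S),
      ← Finset.sum_filter_add_sum_filter_not Finset.univ (fun S => a ∈ S) (fun S => polyFock (p S) _),
      add_comm (∑ S ∈ Finset.univ.filter (fun S => a ∈ S), polyFock (p S) _)]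
    congr 1
    · refine Finset.sum_bij' (fun S _ => S.erase a) (fun S _ => insert a S) ?_ ?_ ?_ ?_ ?_
      · intro S hS; simp
      · intro S hS; simp
      · intro S hS; exact Finset.insert_erase (Finset.mem_filter.1 hS).2
      · intro S hS; exact Finset.erase_insert (Finset.mem_filter.1 hS).2
      · intro S hS
        have hS' := (Finset.mem_filter.1 hS).2
        rw [if_pos hS', if_neg (Finset.notMem_erase a S), Finset.insert_erase hS',
          Gr.card_filter_erase a a S hS', if_neg (lt_irrefl a), add_zero, polyFock_neg_one_pow]
    · rw [Finset.sum_eq_zero, Finset.sum_eq_zero]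
      · intro S hS
        rw [if_pos (Finset.mem_filter.1 hS).2, polyFock_zero_right]
      · intro S hS
        rw [if_neg (Finset.mem_filter.1 hS).2, polyFock_zero_left]

theorem fockForm_symFₗ (p q : Fock m n) : fockForm p (symFₗ q) = fockInner p q := by
  induction p using Fock.induction generalizing q with
  | h1 =>
    have h : fockForm 1 (symFₗ q) = fockInner 1 q := by
      rw [fockForm_one_left]
      induction q using Fock.induction with
      | h1 =>
        rw [symFₗ_one, fockInner_one_left]
      | ha p q hp hq =>
        rw [map_add, Gr.add_apply, map_add, map_add, hp, hq, fockInner_conj, fockInner_conj 1 q,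
          fockInner_conj 1 (p + q), fockInner_add_left, map_add]
      | hs c p hp =>
        rw [map_smul, Gr.smul_apply, MvPolynomial.smul_eq_C_mul, map_mul,
          MvPolynomial.constantCoeff_C, map_mul, hp, fockInner_conj, fockInner_conj 1 (c • p),
          fockInner_smul_left, map_mul]
      | hz i p hp =>
        rw [fockInner_conj, fockInner_zvar_mul, dz_one, symFₗ_zvar_mul, mul_zup, zup,
          smul_mul_assoc, Gr.smul_apply]
        have : fockInner p (0 : Fock m n) = 0 := by
          rw [fockInner_conj, ← zero_smul ℂ (0 : Fock m n), fockInner_smul_left]; simp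
        rw [this, map_zero]
        rcases dual i with j | b
        · rw [zvar, Gr.const_mul, MvPolynomial.smul_eq_C_mul]
          simp
        · rw [zvar, Gr.gen_mul_apply]
          simp
    exact h
  | ha p p' hp hp' => rw [fockForm_add_left, hp, hp', fockInner_add_left]
  | hs c p hp => rw [fockForm_smul_left, hp, fockInner_smul_left]
  | hz i p hp => rw [fockForm_zvar_mul, dF_symFₗ, fockForm_sgn, hp, fockInner_zvar_mul]

theorem symFₗ_four (p : Fock m n) : symFₗ (symFₗ (symFₗ (symFₗ p))) = p := by
  rw [symFₗ_symFₗ, symFₗ_symFₗ, Gr.parity_parity]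

theorem fockForm_zup_mul_right (j : Idx m n) (p q : Fock m n) :
    fockForm q (zup j * p) = fockForm (dz j q) (sgn j p) := by
  have h1 : zup j * p = symFₗ (zvar j * sgn j (symFₗ (symFₗ (symFₗ p)))) := by
    rw [← mul_zvar, symFₗ_mul_zvar, symFₗ_four]
  have h2 : sgn j p = symFₗ (sgn j (symFₗ (symFₗ (symFₗ p)))) := by
    rw [symFₗ_sgn, symFₗ_four]
  rw [h1, h2, fockForm_symFₗ, fockForm_symFₗ, fockInner_conj, fockInner_zvar_mul, fockInner_conj,
    Complex.conj_conj]

theorem fockForm_zvar_mul_right (i : Idx m n) (p q : Fock m n) :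
    fockForm q (zvar i * p) = (-1) ^ par i * fockForm (dF i q) (sgn i p) := by
  have h1 : (zvar i : Fock m n) = ((-1) ^ par i * betaSign i) • zup (dual i) := by
    rw [mul_smul, zup_zup, smul_smul, ← pow_add, ← two_mul]; simp
  rw [h1, smul_mul_assoc, fockForm_smul_right, fockForm_zup_mul_right, dF_apply,
    fockForm_smul_left, sgn_dual, map_mul]
  have h2 : (starRingEnd ℂ) (betaSign i) = betaSign i := by
    rcases i with i | a
    · simp [betaSign]
    · simp only [betaSign]; split_ifs <;> simp
  rw [h2]
  simp [mul_assoc]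

/-- The Fock product is superhermitian. -/
theorem fockForm_conj (p q : Fock m n) :
    fockForm p q = (starRingEnd ℂ) (fockForm q (Gr.parity p)) := by
  have hpar : ∀ p : Fock m n, (∀ q, fockForm p q = (starRingEnd ℂ) (fockForm q (Gr.parity p))) →
      ∀ q, fockForm (Gr.parity p) q = (starRingEnd ℂ) (fockForm q (Gr.parity (Gr.parity p))) := by
    intro p hp q
    rw [Gr.parity_parity, ← Gr.parity_parity q, fockForm_parity, hp, fockForm_parity,
      Gr.parity_parity]
  induction p using Fock.induction generalizing q with
  | h1 =>
    have h := fockForm_symFₗ q 1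
    rw [symFₗ_one] at h
    rw [Gr.parity_one, fockForm_one_left, h, ← fockInner_conj, fockInner_one_left]
  | ha p p' hp hp' => rw [fockForm_add_left, hp, hp', map_add, fockForm_add_right, map_add]
  | hs c p hp =>
    rw [fockForm_smul_left, hp, map_smul, fockForm_smul_right, map_mul, Complex.conj_conj]
  | hz i p hp =>
    have hs : ∀ q, fockForm (sgn i p) q = (starRingEnd ℂ) (fockForm q (Gr.parity (sgn i p))) := by
      rcases i with i | a
      · exact hp
      · exact hpar p hp
    rw [fockForm_zvar_mul, parity_zvar_mul, fockForm_smul_right, fockForm_zvar_mul_right, hs]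
    have h3 : Gr.parity (sgn i p) = sgn i (Gr.parity p) := by rcases i with i | a <;> rfl
    rw [h3]
    simp [← mul_assoc, ← pow_add, ← two_mul]

end fockForm

/-! ### Superpolynomials and their partial derivatives -/

section superpoly
variable {σ τ : Type*} [Fintype σ] [LinearOrder τ] [Fintype τ]

/-- The variables of a superpolynomial algebra. -/
def SPoly.var : σ ⊕ τ → SPoly σ τ
  | Sum.inl i => Gr.const (MvPolynomial.X i)
  | Sum.inr t => Gr.gen t

theorem SPoly.induction' {P : SPoly σ τ → Prop} (h1 : P 1)
    (ha : ∀ p q, P p → P q → P (p + q)) (hs : ∀ (c : ℂ) p, P p → P (c • p))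
    (hv : ∀ u p, P p → P (SPoly.var u * p)) (p : SPoly σ τ) : P p :=
  SPoly.induction h1 ha hs (fun i p => hv (Sum.inl i) p) (fun t p => hv (Sum.inr t) p) p

/-- The parity of the variables of a superpolynomial algebra. -/
def SPoly.varPar : σ ⊕ τ → ℕ
  | Sum.inl _ => 0
  | Sum.inr _ => 1

/-- The partial derivatives on a superpolynomial algebra. -/
def SPoly.deriv : σ ⊕ τ → SPoly σ τ →ₗ[ℂ] SPoly σ τ
  | Sum.inl i =>
    { toFun := Gr.mapCoeff (MvPolynomial.pderiv i)
      map_add' := fun f g => by ext1 S; simp [Gr.mapCoeff]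
      map_smul' := fun c f => by ext1 S; simp [Gr.mapCoeff] }
  | Sum.inr a => Gr.pdOddₗ a

theorem SPoly.deriv_apply (u : σ ⊕ τ) (p : SPoly σ τ) :
    SPoly.deriv u p = pd (fun i q => MvPolynomial.pderiv i q) u p := by
  rcases u with i | t <;> rfl

theorem SPoly.deriv_one (u : σ ⊕ τ) : SPoly.deriv u (1 : SPoly σ τ) = 0 := by
  rcases u with i | a
  · ext1 S
    change MvPolynomial.pderiv i ((1 : SPoly σ τ) S) = 0
    rw [Gr.one_apply]
    split_ifs <;> simp
  · rw [← Gr.const_one]; exact Gr.pdOdd_const _ _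

theorem SPoly.deriv_var_mul [DecidableEq σ] (u v : σ ⊕ τ) (p : SPoly σ τ) :
    SPoly.deriv u (SPoly.var v * p) = (if u = v then p else 0) +
      ((-1 : ℂ) ^ (SPoly.varPar u * SPoly.varPar v)) • (SPoly.var v * SPoly.deriv u p) := by
  have hl : ∀ (i : σ) (p : SPoly σ τ) S, SPoly.deriv (Sum.inl i) p S =
    MvPolynomial.pderiv i (p S) := fun _ _ _ => rfl
  rcases u with i | a <;> rcases v with j | b
  · ext1 S
    rw [hl, Gr.add_apply, Gr.smul_apply]
    simp only [var, Gr.const_mul, Derivation.leibniz, hl, MvPolynomial.pderiv_X,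
      smul_eq_mul, varPar, mul_zero, pow_zero, one_smul, Sum.inl.injEq]
    by_cases h : i = j
    · subst h; simp; ring
    · simp [h]
  · ext1 S
    rw [hl, Gr.add_apply, Gr.smul_apply]
    simp only [var, Gr.gen_mul_apply, hl, varPar, reduceCtorEq, if_false]
    split_ifs <;> simp
  · simp only [deriv, var, Gr.pdOddₗ_apply, Gr.pdOdd_const_mul, varPar]
    simp
  · simp only [deriv, var, Gr.pdOddₗ_apply, Gr.pdOdd_gen_mul, varPar, Sum.inr.injEq, mul_one,
      pow_one, neg_smul, one_smul, ← sub_eq_add_neg, eq_comm (a := a)]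

/-- The derivatives supercommute. -/
theorem SPoly.deriv_deriv (u v : σ ⊕ τ) (p : SPoly σ τ) :
    SPoly.deriv u (SPoly.deriv v p) =
      ((-1 : ℂ) ^ (SPoly.varPar u * SPoly.varPar v)) • SPoly.deriv v (SPoly.deriv u p) := by
  classical
  induction p using SPoly.induction' with
  | h1 => simp only [SPoly.deriv_one, map_zero, smul_zero]
  | ha p q hp hq => simp only [map_add, hp, hq, smul_add]
  | hs c p hp => simp only [map_smul, hp, smul_comm c]
  | hv w p hp =>
    simp only [SPoly.deriv_var_mul, map_add, map_smul, apply_ite (SPoly.deriv u),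
      apply_ite (SPoly.deriv v), map_zero, hp, smul_add, mul_smul_comm, smul_smul]
    have e1 : ((-1 : ℂ) ^ (varPar v * varPar w)) • (if u = w then SPoly.deriv v p else 0) =
        ((-1 : ℂ) ^ (varPar u * varPar v)) • (if u = w then SPoly.deriv v p else 0) := by
      by_cases h : u = w
      · subst h; rw [mul_comm]
      · simp [h]
    have e2 : (if v = w then SPoly.deriv u p else 0 : SPoly σ τ) =
        ((-1 : ℂ) ^ (varPar u * varPar v) * (-1 : ℂ) ^ (varPar u * varPar w)) •
          (if v = w then SPoly.deriv u p else 0) := by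
      by_cases h : v = w
      · subst h; rw [← pow_add, ← two_mul]; simp
      · simp [h]
    rw [e1]
    conv_lhs => rw [e2]
    rw [mul_comm ((-1 : ℂ) ^ (varPar v * varPar w))]
    module

/-- Evaluation of a superpolynomial at the origin. -/
def SPoly.atZero : SPoly σ τ →ₐ[ℂ] ℂ :=
  AlgHom.ofLinearMap
    { toFun := fun p => MvPolynomial.constantCoeff (p ∅)
      map_add' := fun p q => by rw [Gr.add_apply, map_add]
      map_smul' := fun c p => by
        rw [Gr.smul_apply, MvPolynomial.smul_eq_C_mul, map_mul, MvPolynomial.constantCoeff_C]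
        rfl }
    (by
      change MvPolynomial.constantCoeff ((1 : SPoly σ τ) ∅) = 1
      rw [Gr.one_apply, if_pos rfl, map_one])
    (by
      intro p q
      change MvPolynomial.constantCoeff ((p * q : SPoly σ τ) ∅) = _
      rw [Gr.mul_apply]
      simp [Gr.inv])

theorem SPoly.atZero_apply (p : SPoly σ τ) :
    SPoly.atZero p = MvPolynomial.constantCoeff (p ∅) := rfl

end superpoly

/-! ### The folding map -/

section folding
variable {m n : ℕ}

/-- The product `z_i z_j`. -/
def zz (i j : Idx m n) : Fock m n := zvar i * zvar j

theorem parity_zz (i j : Idx m n) : Gr.parity (zz i j) = ((-1 : ℂ) ^ (par i + par j)) • zz i j := by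
  have h : Gr.parity (zvar j : Fock m n) = (-1 : ℂ) ^ par j • zvar j := by
    have := parity_zvar_mul j (1 : Fock m n)
    rwa [mul_one, Gr.parity_one, mul_one] at this
  rw [zz, parity_zvar_mul, h, mul_smul_comm, smul_smul, ← pow_add]

theorem parJ_inl (u : EvJ m n) : parJ (Sum.inl u : EvJ m n ⊕ OdJ m n) = 0 ∨
    parJ (Sum.inl u : EvJ m n ⊕ OdJ m n) = 2 := by
  rcases u with u | u
  · exact Or.inl rfl
  · exact Or.inr rfl

theorem neg_one_pow_parJ (u : EvJ m n ⊕ OdJ m n) :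
    (-1 : ℂ) ^ parJ u = (-1) ^ SPoly.varPar u := by
  rcases u with (u | u) | t <;> simp [parJ, pairOf, par, SPoly.varPar]

theorem even_parJ (u : EvJ m n ⊕ OdJ m n) : Even (parJ u) ↔ Even (SPoly.varPar u) := by
  rcases u with (u | u) | t <;> simp [parJ, pairOf, par, SPoly.varPar]

theorem fold_supercommuting : Supercommuting
    (fun u : EvJ m n => (zz (pairOf (Sum.inl u)).1 (pairOf (Sum.inl u)).2 : Fock m n))
    (fun t : OdJ m n => zz (pairOf (Sum.inr t)).1 (pairOf (Sum.inr t)).2) := by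
  have hev : ∀ u : EvJ m n,
      Gr.parity (zz (pairOf (Sum.inl u)).1 (pairOf (Sum.inl u)).2 : Fock m n) =
      zz (pairOf (Sum.inl u)).1 (pairOf (Sum.inl u)).2 := by
    intro u
    rw [parity_zz]
    have := neg_one_pow_parJ (Sum.inl u : EvJ m n ⊕ OdJ m n)
    rw [parJ] at this
    rw [this]
    simp [SPoly.varPar]
  have hod : ∀ t : OdJ m n,
      Gr.parity (zz (pairOf (Sum.inr t)).1 (pairOf (Sum.inr t)).2 : Fock m n) =
      ((-1 : ℂ) ^ 1) • zz (pairOf (Sum.inr t)).1 (pairOf (Sum.inr t)).2 := by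
    intro t
    rw [parity_zz]
    rfl
  refine ⟨fun u v => Gr.mul_comm_of_even (hev u) _, fun u t => Gr.mul_comm_of_even (hev u) _,
    fun s t => ?_⟩
  rw [Gr.mul_comm_of_parity (hod s), Function.iterate_one, hod t, pow_one, neg_one_smul, neg_mul]

/-- The folding map as an algebra morphism. -/
def foldAlg : PJ m n →ₐ[ℂ] Fock m n := substAlg fold_supercommuting

theorem foldAlg_apply (p : PJ m n) : foldAlg p = fold p := substAlg_apply _ p

theorem var_eq_ellP (u : EvJ m n ⊕ OdJ m n) :
    (SPoly.var u : PJ m n) = ellP (pairOf u).1 (pairOf u).2 := by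
  rcases u with (⟨u, hu⟩ | ⟨u, hu⟩) | t
  · simp [SPoly.var, ellP, pairOf, ell, hu]
  · simp [SPoly.var, ellP, pairOf, ell, hu]
  · rfl

theorem foldAlg_var (u : EvJ m n ⊕ OdJ m n) :
    foldAlg (SPoly.var u) = zz (pairOf u).1 (pairOf u).2 := by
  rcases u with u | t
  · exact substAlg_X fold_supercommuting u
  · exact substAlg_gen fold_supercommuting t

theorem foldAlg_ellP (i j : Idx m n) : foldAlg (ellP i j) = zz i j := by
  rcases i with i | a <;> rcases j with j | b
  · by_cases h : i ≤ j
    · have := foldAlg_var (m := m) (n := n) (Sum.inl (Sum.inl ⟨(i, j), h⟩))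
      rw [var_eq_ellP] at this; exact this
    · have h1 : (ellP (Sum.inl i) (Sum.inl j) : PJ m n) = ellP (Sum.inl j) (Sum.inl i) := by
        simp [ellP, ell, h, (not_le.1 h).le]
      have := foldAlg_var (m := m) (n := n) (Sum.inl (Sum.inl ⟨(j, i), (not_le.1 h).le⟩))
      rw [var_eq_ellP] at this
      rw [h1]
      refine this.trans ?_
      change zvar _ * zvar _ = zvar _ * zvar _
      rw [zvar_mul_zvar]; simp [eps, par, pairOf]
  · exact foldAlg_var (Sum.inr (toLex (i, b)))
  · refine (foldAlg_var (Sum.inr (toLex (j, a)))).trans ?_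
    change zvar _ * zvar _ = zvar _ * zvar _
    rw [zvar_mul_zvar]; simp [eps, par, pairOf]
  · rcases lt_trichotomy a b with h | h | h
    · have := foldAlg_var (m := m) (n := n) (Sum.inl (Sum.inr ⟨(a, b), h⟩))
      rw [var_eq_ellP] at this; exact this
    · subst h
      have h1 : (ellP (Sum.inr a) (Sum.inr a) : PJ m n) = 0 := by simp [ellP, ell]
      rw [h1, map_zero]
      exact (Gr.gen_mul_self a).symm
    · have h1 : (ellP (Sum.inr a) (Sum.inr b) : PJ m n) = - ellP (Sum.inr b) (Sum.inr a) := by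
        simp [ellP, ell, h, not_lt.2 h.le]
      have := foldAlg_var (m := m) (n := n) (Sum.inl (Sum.inr ⟨(b, a), h⟩))
      rw [var_eq_ellP] at this
      rw [h1, map_neg]
      refine (congrArg Neg.neg this).trans ?_
      change -(zvar _ * zvar _) = zvar _ * zvar _
      rw [zvar_mul_zvar]; simp [eps, par, pairOf]

/-! ### The folding map intertwines the Bessel operators with `∂_i ∂_j` -/

/-- The derivative `∂_i (z_k z_l)`. -/
def dzz (i k l : Idx m n) : Fock m n := beta i k • zvar l + (eps i k * beta i l) • zvar k

theorem dF_zz_mul (i k l : Idx m n) (g : Fock m n) :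
    dF i (zz k l * g) = dzz i k l * g + (eps i k * eps i l) • (zz k l * dF i g) := by
  rw [zz, mul_assoc, dF_zvar_mul, dF_zvar_mul, dzz]
  simp only [add_mul, mul_add, smul_mul_assoc, mul_smul_comm, smul_add, smul_smul, mul_assoc]
  abel

theorem parity_dzz (i k l : Idx m n) : Gr.parity (dzz i k l) =
    ((-1 : ℂ) ^ (par i + par k + par l)) • dzz i k l := by
  have h : ∀ j : Idx m n, Gr.parity (zvar j : Fock m n) = (-1 : ℂ) ^ par j • zvar j := by
    intro j
    have := parity_zvar_mul j (1 : Fock m n)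
    rwa [mul_one, Gr.parity_one, mul_one] at this
  have e1 : beta i k * (-1) ^ par l = (-1) ^ (par i + par k + par l) * beta i k := by
    by_cases hik : par i = par k
    · rw [← hik, ← two_mul, pow_add, pow_mul]; simp [mul_comm]
    · rw [beta_of_par_ne hik]; ring
  have e2 : beta i l * (-1) ^ par k = (-1) ^ (par i + par k + par l) * beta i l := by
    by_cases hil : par i = par l
    · rw [← hil, add_right_comm, ← two_mul, pow_add, pow_mul]; simp [mul_comm]
    · rw [beta_of_par_ne hil]; ring
  rw [dzz, map_add, map_smul, map_smul, h, h, smul_add, smul_smul, smul_smul, smul_smul, smul_smul,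
    mul_assoc, e1, e2]
  congr 2
  ring

theorem parity_iterate {R τ : Type*} [AddCommGroup R] [Module ℂ R] (c : ℕ) {x : Gr R τ} {k : ℕ}
    (hx : Gr.parity x = ((-1 : ℂ) ^ k) • x) : Gr.parity^[c] x = ((-1 : ℂ) ^ (c * k)) • x := by
  induction c with
  | zero => simp
  | succ c ih => rw [Function.iterate_succ_apply', ih, map_smul, hx, smul_smul, ← pow_add]; ring_nf

/-- Homogeneous elements supercommute. -/
theorem supercomm {x y : Fock m n} {a b : ℕ} (hx : Gr.parity x = ((-1 : ℂ) ^ a) • x)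
    (hy : Gr.parity y = ((-1 : ℂ) ^ b) • y) : x * y = ((-1 : ℂ) ^ (a * b)) • (y * x) := by
  rw [Gr.mul_comm_of_parity hx, parity_iterate a hy, smul_mul_assoc]

theorem neg_one_pow_congr' {a b : ℕ} (h : Even a ↔ Even b) : (-1 : ℂ) ^ a = (-1) ^ b := by
  rcases Nat.even_or_odd a with ha | ha
  · rw [ha.neg_one_pow, (h.1 ha).neg_one_pow]
  · rw [ha.neg_one_pow, Odd.neg_one_pow]
    rw [← Nat.not_even_iff_odd] at ha ⊢
    exact fun hb => ha (h.2 hb)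

/-- The derivative of a folded superpolynomial, by the chain rule. -/
theorem dF_foldAlg (i : Idx m n) (p : PJ m n) : dF i (foldAlg p) =
    ∑ u, dzz i (pairOf u).1 (pairOf u).2 * foldAlg (SPoly.deriv u p) := by
  induction p using SPoly.induction' with
  | h1 => simp only [SPoly.deriv_one, map_zero, mul_zero, Finset.sum_const_zero, map_one, dF_one]
  | ha p q hp hq => simp only [map_add, hp, hq, mul_add, Finset.sum_add_distrib]
  | hs c p hp => simp only [map_smul, hp, mul_smul_comm, Finset.smul_sum]
  | hv w p hp =>
    rw [map_mul, foldAlg_var, dF_zz_mul, hp, Finset.mul_sum, Finset.smul_sum]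
    simp only [SPoly.deriv_var_mul, map_add, map_smul, map_mul, foldAlg_var, mul_add,
      Finset.sum_add_distrib, apply_ite foldAlg, map_zero, mul_ite, mul_zero, Finset.sum_ite_eq',
      Finset.mem_univ, if_true]
    refine congrArg₂ _ rfl (Finset.sum_congr rfl fun u _ => ?_)
    rw [mul_smul_comm, ← mul_assoc, ← mul_assoc,
      supercomm (parity_zz _ _) (parity_dzz i (pairOf u).1 (pairOf u).2), smul_mul_assoc, smul_smul]
    refine congrArg (· • _) ?_
    rw [eps, eps, ← pow_add, ← pow_add]
    apply neg_one_pow_congr'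
    have h1 := even_parJ u
    have h2 := even_parJ w
    simp only [parJ] at h1 h2
    simp only [Nat.even_add, Nat.even_mul] at h1 h2 ⊢
    rw [← h1, ← h2]
    grind

theorem dF_dzz_mul (i j k l : Idx m n) (g : Fock m n) : dF i (dzz j k l * g) =
    (beta j k * beta i l + eps j k * beta j l * beta i k) • g +
      ((-1 : ℂ) ^ (par i * (par j + par k + par l))) • (dzz j k l * dF i g) := by
  have e1 : beta j k * eps i l = (-1) ^ (par i * (par j + par k + par l)) * beta j k := by
    by_cases h : par j = par k
    · rw [eps, ← h, mul_comm]
      congr 1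
      apply neg_one_pow_congr'
      simp only [Nat.even_add, Nat.even_mul]; tauto
    · rw [beta_of_par_ne h]; ring
  have e2 : beta j l * eps i k = (-1) ^ (par i * (par j + par k + par l)) * beta j l := by
    by_cases h : par j = par l
    · rw [eps, ← h, mul_comm]
      congr 1
      apply neg_one_pow_congr'
      simp only [Nat.even_add, Nat.even_mul]; tauto
    · rw [beta_of_par_ne h]; ring
  rw [dzz, add_mul, smul_mul_assoc, smul_mul_assoc, map_add, map_smul, map_smul, dF_zvar_mul,
    dF_zvar_mul, smul_add, smul_add, smul_smul, smul_smul, smul_smul, smul_smul, e1,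
    mul_assoc (eps j k) (beta j l) (eps i k), e2, add_mul, smul_mul_assoc, smul_mul_assoc]
  module

theorem dF_dF_foldAlg (i j : Idx m n) (p : PJ m n) : dF i (dF j (foldAlg p)) =
    ∑ u, (beta j (pairOf u).1 * beta i (pairOf u).2 +
      eps j (pairOf u).1 * beta j (pairOf u).2 * beta i (pairOf u).1) •
        foldAlg (SPoly.deriv u p) +
    ∑ u, ∑ v, ((-1 : ℂ) ^ (par i * (par j + parJ u))) •
      (dzz j (pairOf u).1 (pairOf u).2 * dzz i (pairOf v).1 (pairOf v).2 *
        foldAlg (SPoly.deriv v (SPoly.deriv u p))) := by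
  rw [dF_foldAlg, map_sum, ← Finset.sum_add_distrib]
  refine Finset.sum_congr rfl fun u _ => ?_
  rw [dF_dzz_mul, dF_foldAlg, Finset.mul_sum, Finset.smul_sum]
  refine congrArg₂ _ rfl (Finset.sum_congr rfl fun v _ => ?_)
  rw [parJ, add_assoc, mul_assoc]

end folding

/-! ### The Jordan superalgebra in terms of elementary supermatrices -/

section jordan
variable {m n : ℕ}

/-- The matrix `∑_k β_{jk} E_{ik}`; these matrices multiply by `elem_mul_elem`. -/
def elem (i j : Idx m n) : Matrix (Idx m n) (Idx m n) ℂ := ∑ k, Matrix.single i k (beta j k)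

theorem elem_apply (i j a b : Idx m n) : elem i j a b = if a = i then beta j b else 0 := by
  rw [elem, Matrix.sum_apply]
  by_cases h : a = i
  · subst h
    rw [Finset.sum_eq_single b]
    · simp
    · intro c _ hc; simp [hc]
    · simp
  · simp [h, Ne.symm h]

theorem elem_mul_elem (i j k l : Idx m n) : elem i j * elem k l = beta j k • elem i l := by
  ext a b
  rw [Matrix.mul_apply, Matrix.smul_apply, elem_apply]
  simp only [elem_apply, mul_ite, mul_zero, Finset.sum_ite_eq', Finset.mem_univ, if_true,
    smul_eq_mul, ite_mul, zero_mul]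

theorem ellMat_eq (i j : Idx m n) : ellMat i j = elem i j + eps i j • elem j i := by
  rw [ellMat, Finset.sum_add_distrib, elem, elem, Finset.smul_sum]
  simp only [Matrix.smul_single, smul_eq_mul, eps]

/-- Homogeneous supermatrices of parity `a` modulo two. -/
def IsHomog (a : ℕ) (X : Matrix (Idx m n) (Idx m n) ℂ) : Prop :=
  ∀ i j, ¬ Even (a + par i + par j) → X i j = 0

theorem IsHomog.add {a : ℕ} {X Y : Matrix (Idx m n) (Idx m n) ℂ} (hX : IsHomog a X)
    (hY : IsHomog a Y) : IsHomog a (X + Y) := fun i j h => by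
  rw [Matrix.add_apply, hX i j h, hY i j h, add_zero]

theorem IsHomog.smul {a : ℕ} {X : Matrix (Idx m n) (Idx m n) ℂ} (c : ℂ) (hX : IsHomog a X) :
    IsHomog a (c • X) := fun i j h => by
  rw [Matrix.smul_apply, hX i j h, smul_zero]

theorem IsHomog.mul {a b : ℕ} {X Y : Matrix (Idx m n) (Idx m n) ℂ} (hX : IsHomog a X)
    (hY : IsHomog b Y) : IsHomog (a + b) (X * Y) := fun i j h => by
  rw [Matrix.mul_apply]
  refine Finset.sum_eq_zero fun k _ => ?_
  by_cases h1 : Even (a + par i + par k)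
  · rw [hY k j, mul_zero]
    simp only [Nat.even_add] at h h1 ⊢
    grind
  · rw [hX i k h1, zero_mul]

theorem IsHomog.congr {a b : ℕ} {X : Matrix (Idx m n) (Idx m n) ℂ} (hX : IsHomog a X)
    (h : Even a ↔ Even b) : IsHomog b X := fun i j hij => by
  refine hX i j ?_
  simp only [Nat.even_add] at hij ⊢
  rwa [h]

theorem isHomog_elem (i j : Idx m n) : IsHomog (par i + par j) (elem i j) := fun a b h => by
  rw [elem_apply]
  split_ifs with hai
  · subst hai
    apply beta_of_par_ne
    intro hjb
    apply h
    rw [hjb]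
    simp only [Nat.even_add]
    grind
  · rfl

theorem isHomog_ellMat (i j : Idx m n) : IsHomog (par i + par j) (ellMat i j) := by
  rw [ellMat_eq]
  refine (isHomog_elem i j).add (((isHomog_elem j i).congr ?_).smul _)
  rw [add_comm]

theorem oddPart_of_isHomog {a : ℕ} {X : Matrix (Idx m n) (Idx m n) ℂ} (hX : IsHomog a X) :
    oddPart X = if Even a then 0 else X := by
  ext i j
  have hp : par i = par j ↔ Even (par i + par j) := by
    rcases i with i | i <;> rcases j with j | j <;> simp [par]
  rw [oddPart, Matrix.of_apply]
  by_cases ha : Even a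
  · rw [if_pos ha]
    split_ifs with h
    · rfl
    · refine hX i j ?_
      rw [hp, Nat.even_add] at h
      simp only [Nat.even_add]
      grind
  · rw [if_neg ha]
    split_ifs with h
    · refine (hX i j ?_).symm
      rw [hp, Nat.even_add] at h
      simp only [Nat.even_add]
      grind
    · rfl

/-- The Jordan product of homogeneous supermatrices. -/
theorem jordan_eq {a b : ℕ} {X Y : Matrix (Idx m n) (Idx m n) ℂ} (hX : IsHomog a X)
    (hY : IsHomog b Y) :
    jordan X Y = (1 / 2 : ℂ) • (X * Y + ((-1 : ℂ) ^ (a * b)) • (Y * X)) := by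
  rw [jordan, oddPart_of_isHomog hX, oddPart_of_isHomog hY]
  by_cases ha : Even a
  · rw [if_pos ha, mul_zero, sub_zero, Even.neg_one_pow (ha.mul_right b), one_smul]
  · by_cases hb : Even b
    · rw [if_pos hb, zero_mul, sub_zero, Even.neg_one_pow (hb.mul_left a), one_smul]
    · rw [if_neg ha, if_neg hb,
        Odd.neg_one_pow ((Nat.not_even_iff_odd.1 ha).mul (Nat.not_even_iff_odd.1 hb))]
      module

theorem IsHomog.jordan {a b : ℕ} {X Y : Matrix (Idx m n) (Idx m n) ℂ} (hX : IsHomog a X)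
    (hY : IsHomog b Y) : IsHomog (a + b) (jordan X Y) := by
  rw [jordan_eq hX hY]
  exact ((hX.mul hY).add (((hY.mul hX).congr (by rw [add_comm])).smul _)).smul _

theorem charL_add (X Y : Matrix (Idx m n) (Idx m n) ℂ) : charL (X + Y) = charL X + charL Y := by
  simp only [charL, Matrix.add_apply, mul_add, Finset.sum_add_distrib]

theorem charL_smul (c : ℂ) (X : Matrix (Idx m n) (Idx m n) ℂ) : charL (c • X) = c * charL X := by
  simp only [charL, Matrix.smul_apply, smul_eq_mul, Finset.mul_sum]
  exact Finset.sum_congr rfl fun i _ => by ring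

theorem charL_elem (i j : Idx m n) : charL (elem i j) = (-1 / 4) * beta i j := by
  rw [charL]
  simp only [elem_apply, mul_ite, mul_zero, Finset.sum_ite_eq', Finset.mem_univ, if_true]
  rw [← beta_symm]

theorem charL_jordan (i j k l : Idx m n) :
    (-2 : ℂ) * charL (jordan (ellMat i j) (ellMat k l)) =
      beta j k * beta i l + eps j k * beta j l * beta i k := by
  rw [jordan_eq (isHomog_ellMat i j) (isHomog_ellMat k l)]
  simp only [ellMat_eq, mul_add, add_mul, smul_mul_assoc, mul_smul_comm, elem_mul_elem, smul_add,
    charL_add, charL_smul, charL_elem]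
  rw [beta_symm k j, beta_symm l i, beta_symm l j, beta_symm k i]
  have z1 : ∀ (a : Fin m) (b : Fin (2 * n)), beta (Sum.inl a : Idx m n) (Sum.inr b) = 0 :=
    fun a b => beta_of_par_ne (by simp [par])
  have z2 : ∀ (a : Fin m) (b : Fin (2 * n)), beta (Sum.inr b : Idx m n) (Sum.inl a) = 0 :=
    fun a b => beta_of_par_ne (by simp [par])
  rcases i with i | i <;> rcases j with j | j <;> rcases k with k | k <;> rcases l with l | l <;>
    simp only [z1, z2, par, eps, mul_zero, zero_mul, add_zero, zero_add, pow_zero, mul_one, one_mul,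
      pow_one] <;> ring

theorem isHomog_basisMat (u : EvJ m n ⊕ OdJ m n) : IsHomog (parJ u) (basisMat u) :=
  isHomog_ellMat _ _

/-- `P̃_{u,v}(x) = ½ ((-1)^{|u||x|} u x v + (-1)^{|v|(|u| + |x|)} v x u)`. -/
theorem Ptilde_eq (u v x : EvJ m n ⊕ OdJ m n) : Ptilde u v x = (1 / 2 : ℂ) •
    (((-1 : ℂ) ^ (parJ u * parJ x)) • (basisMat u * basisMat x * basisMat v) +
      ((-1 : ℂ) ^ (parJ u * parJ v + parJ v * parJ x)) •
        (basisMat v * basisMat x * basisMat u)) := by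
  have hu := isHomog_basisMat u
  have hv := isHomog_basisMat v
  have hx := isHomog_basisMat x
  rw [Ptilde, jordan_eq hu (hv.jordan hx), jordan_eq hv (hu.jordan hx), jordan_eq (hu.jordan hv) hx,
    jordan_eq hv hx, jordan_eq hu hx, jordan_eq hu hv]
  simp only [mul_add, add_mul, smul_mul_assoc, mul_smul_comm, smul_add, smul_smul, mul_assoc,
    pow_add, mul_comm (parJ x), mul_comm (parJ v) (parJ u)]
  have sq : ∀ k : ℕ, ((-1 : ℂ) ^ k) * (-1) ^ k = 1 := fun k => by
    rw [← pow_add, ← two_mul, pow_mul]; simp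
  have h1 := sq (parJ u * parJ x)
  have h2 := sq (parJ v * parJ x)
  have h3 := sq (parJ u * parJ v)
  generalize (-1 : ℂ) ^ (parJ u * parJ x) = s1 at *
  generalize (-1 : ℂ) ^ (parJ v * parJ x) = s2 at *
  generalize (-1 : ℂ) ^ (parJ u * parJ v) = s3 at *
  generalize basisMat u * (basisMat v * basisMat x) = M1
  generalize basisMat u * (basisMat x * basisMat v) = M2
  generalize basisMat v * (basisMat u * basisMat x) = M3
  generalize basisMat v * (basisMat x * basisMat u) = M4
  generalize basisMat x * (basisMat u * basisMat v) = M5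
  generalize basisMat x * (basisMat v * basisMat u) = M6
  match_scalars
  all_goals first | ring1 | grind

end jordan


/-! ### The folding map and the Bessel operators -/

section bessel
variable {m n : ℕ}

/-- The image under the folding map of the linear superpolynomial belonging to a matrix. -/
def foldMat : Matrix (Idx m n) (Idx m n) ℂ →ₗ[ℂ] Fock m n where
  toFun X := ∑ i, ∑ k, ∑ j, ((1 / 2 : ℂ) * X i k * betaInv k j) • zz i j
  map_add' X Y := by
    simp only [Matrix.add_apply, mul_add, add_mul, add_smul, Finset.sum_add_distrib]
  map_smul' c X := by
    simp only [Matrix.smul_apply, smul_eq_mul, RingHom.id_apply, Finset.smul_sum, smul_smul]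
    refine Finset.sum_congr rfl fun i _ => Finset.sum_congr rfl fun k _ =>
      Finset.sum_congr rfl fun j _ => ?_
    congr 1
    ring

theorem foldAlg_linJ (X : Matrix (Idx m n) (Idx m n) ℂ) :
    foldAlg (linJ MvPolynomial.X X) = foldMat X := by
  simp only [linJ, map_sum, map_smul]
  refine Finset.sum_congr rfl fun i _ => Finset.sum_congr rfl fun k _ =>
    Finset.sum_congr rfl fun j _ => ?_
  rw [← foldAlg_ellP]
  rfl

theorem sum_beta_betaInv (j l : Idx m n) :
    ∑ k, beta j k * betaInv k l = if l = j then 1 else 0 := by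
  have h := sum_beta_smul j (fun k => betaInv k l)
  simp only [smul_eq_mul] at h
  rw [h, betaInv, beta_eq]
  by_cases hl : l = j
  · subst hl
    rw [if_pos rfl, if_pos rfl, betaSign_sq]
  · rw [if_neg hl, if_neg, mul_zero]
    intro h'
    exact hl (by rw [← dual_dual l, ← h', dual_dual])

theorem foldMat_elem (i j : Idx m n) : foldMat (elem i j) = (1 / 2 : ℂ) • zz i j := by
  change ∑ a, ∑ k, ∑ l, ((1 / 2 : ℂ) * elem i j a k * betaInv k l) • zz a l = _
  rw [Finset.sum_eq_single i]
  · rw [Finset.sum_comm, Finset.sum_eq_single j]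
    · rw [← Finset.sum_smul]
      congr 1
      simp only [elem_apply, if_true, mul_assoc, ← Finset.mul_sum, sum_beta_betaInv, mul_one]
    · intro l _ hl
      rw [← Finset.sum_smul]
      simp only [elem_apply, if_true, mul_assoc, ← Finset.mul_sum, sum_beta_betaInv, if_neg hl,
        mul_zero, zero_smul]
    · simp
  · intro a _ ha
    simp only [elem_apply, if_neg ha, mul_zero, zero_mul, zero_smul, Finset.sum_const_zero]
  · simp

theorem dzz_eq_left (i k l : Idx m n) : ((-1 : ℂ) ^ (par i * (par k + par l))) • dzz i k l =
    beta l i • zvar k + (eps k l * beta k i) • zvar l := by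
  rw [dzz, smul_add, smul_smul, smul_smul, add_comm, beta_symm l i, beta_symm k i]
  congr 2
  · by_cases h : par i = par l
    · rw [eps, ← h]; rcases i with i | i <;> rcases k with k | k <;> simp [par]
    · rw [beta_of_par_ne h]; ring
  · by_cases h : par i = par k
    · rw [eps, ← h]; rcases i with i | i <;> rcases l with l | l <;> simp [par]
    · rw [beta_of_par_ne h]; ring

theorem dzz_eq_right (i k l : Idx m n) : dzz i k l =
    beta i k • zvar l + (eps k l * beta i l) • zvar k := by
  rw [dzz]
  congr 2
  by_cases h : par i = par l
  · rw [eps, eps, h, mul_comm, mul_comm (par l), mul_comm]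
  · rw [beta_of_par_ne h]; ring

theorem foldMat_ell_elem_ell (i j k l p q : Idx m n) :
    foldMat (ellMat k l * elem i j * ellMat p q) =
      ((1 / 2 : ℂ) * (-1 : ℂ) ^ (par i * (par k + par l))) • (dzz i k l * dzz j p q) := by
  rw [mul_smul, ← smul_mul_assoc, dzz_eq_left, dzz_eq_right j p q, ellMat_eq, ellMat_eq]
  simp only [mul_add, add_mul, smul_mul_assoc, mul_smul_comm, elem_mul_elem, smul_add, map_add,
    map_smul, foldMat_elem, zz, smul_smul]
  module

theorem foldMat_ell_ell_ell (i j k l p q : Idx m n) :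
    foldMat (ellMat k l * ellMat i j * ellMat p q) = (1 / 2 : ℂ) •
      (((-1 : ℂ) ^ (par i * (par k + par l))) • (dzz i k l * dzz j p q) +
        (eps i j * (-1 : ℂ) ^ (par j * (par k + par l))) • (dzz j k l * dzz i p q)) := by
  rw [ellMat_eq i j, mul_add, add_mul, mul_smul_comm, smul_mul_assoc, map_add, map_smul,
    foldMat_ell_elem_ell, foldMat_ell_elem_ell]
  module

theorem foldMat_Ptilde (u v x : EvJ m n ⊕ OdJ m n) {i j : Idx m n} (hx : pairOf x = (i, j)) :
    foldMat (Ptilde u v x) = (1 / 2 : ℂ) •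
      (((-1 : ℂ) ^ (par i * (par j + parJ u))) •
          (dzz j (pairOf u).1 (pairOf u).2 * dzz i (pairOf v).1 (pairOf v).2) +
        ((-1 : ℂ) ^ (parJ u * parJ v + par i * (par j + parJ v))) •
          (dzz j (pairOf v).1 (pairOf v).2 * dzz i (pairOf u).1 (pairOf u).2)) := by
  rw [Ptilde_eq, map_smul, map_add, map_smul, map_smul]
  simp only [basisMat, hx, foldMat_ell_ell_ell]
  have hp : parJ x = par i + par j := by rw [parJ, hx]
  rw [supercomm (parity_dzz i (pairOf u).1 (pairOf u).2) (parity_dzz j (pairOf v).1 (pairOf v).2),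
    supercomm (parity_dzz i (pairOf v).1 (pairOf v).2) (parity_dzz j (pairOf u).1 (pairOf u).2), hp]
  have e1 : par i + par (pairOf u).1 + par (pairOf u).2 = par i + parJ u := by rw [parJ, add_assoc]
  have e2 : par i + par (pairOf v).1 + par (pairOf v).2 = par i + parJ v := by rw [parJ, add_assoc]
  have e3 : par j + par (pairOf u).1 + par (pairOf u).2 = par j + parJ u := by rw [parJ, add_assoc]
  have e4 : par j + par (pairOf v).1 + par (pairOf v).2 = par j + parJ v := by rw [parJ, add_assoc]
  have e5 : par (pairOf u).1 + par (pairOf u).2 = parJ u := rfl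
  have e6 : par (pairOf v).1 + par (pairOf v).2 = parJ v := rfl
  rw [e1, e2, e3, e4, e5, e6]
  generalize dzz j (pairOf v).1 (pairOf v).2 * dzz i (pairOf u).1 (pairOf u).2 = M
  generalize dzz j (pairOf u).1 (pairOf u).2 * dzz i (pairOf v).1 (pairOf v).2 = N
  have sq : ∀ k : ℕ, ((-1 : ℂ) ^ k) * (-1) ^ k = 1 := fun k => by
    rw [← pow_add, ← two_mul, pow_mul]; simp
  have h1 := sq (par i * par j)
  have h2 := sq (par i * parJ u)
  have h3 := sq (par i * parJ v)
  have h4 := sq (par j * parJ u)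
  have h5 := sq (par j * parJ v)
  have h6 := sq (parJ u * parJ v)
  simp only [eps, mul_add, add_mul, pow_add, mul_comm (parJ u) (par i), mul_comm (parJ u) (par j),
    mul_comm (parJ v) (par i), mul_comm (parJ v) (par j),
    mul_comm (parJ v) (parJ u)]
  generalize (-1 : ℂ) ^ (par i * par j) = s1 at *
  generalize (-1 : ℂ) ^ (par i * parJ u) = s2 at *
  generalize (-1 : ℂ) ^ (par i * parJ v) = s3 at *
  generalize (-1 : ℂ) ^ (par j * parJ u) = s4 at *
  generalize (-1 : ℂ) ^ (par j * parJ v) = s5 at *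
  generalize (-1 : ℂ) ^ (parJ u * parJ v) = s6 at *
  clear sq hx hp e1 e2 e3 e4 e5 e6
  match_scalars <;> grind

/-- The Bessel operators as linear maps on superpolynomials. -/
def besselₗ (x : EvJ m n ⊕ OdJ m n) : PJ m n →ₗ[ℂ] PJ m n :=
  ∑ u, ((-2 : ℂ) * charL (jordan (basisMat x) (basisMat u))) • SPoly.deriv u +
    ∑ u, ∑ v, LinearMap.mulLeft ℂ (linJ MvPolynomial.X (Ptilde u v x) : PJ m n) ∘ₗ
      SPoly.deriv v ∘ₗ SPoly.deriv u

theorem besselₗ_apply (x : EvJ m n ⊕ OdJ m n) (p : PJ m n) : besselₗ x p = besselP x p := by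
  simp only [besselₗ, besselP, bessel, LinearMap.add_apply, LinearMap.sum_apply,
    LinearMap.smul_apply, LinearMap.comp_apply, LinearMap.mulLeft_apply, SPoly.deriv_apply]

/-- The folding map intertwines the Bessel operator of `ℓ_{ij}` with `∂_i ∂_j`. -/
theorem foldAlg_besselₗ (x : EvJ m n ⊕ OdJ m n) (p : PJ m n) :
    foldAlg (besselₗ x p) = dF (pairOf x).1 (dF (pairOf x).2 (foldAlg p)) := by
  obtain ⟨i, j, hx⟩ : ∃ i j, pairOf x = (i, j) := ⟨_, _, rfl⟩
  rw [dF_dF_foldAlg, hx]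
  simp only [besselₗ, LinearMap.add_apply, LinearMap.sum_apply,
    LinearMap.smul_apply, LinearMap.comp_apply, LinearMap.mulLeft_apply, map_add, map_sum,
    map_smul, map_mul, foldAlg_linJ, foldMat_Ptilde _ _ x hx]
  refine congrArg₂ _ (Finset.sum_congr rfl fun u _ => ?_) ?_
  · rw [basisMat, basisMat, charL_jordan, hx]
  · set S := ∑ u, ∑ v, ((-1 : ℂ) ^ (par i * (par j + parJ u))) •
      (dzz j (pairOf u).1 (pairOf u).2 * dzz i (pairOf v).1 (pairOf v).2 *
        foldAlg (SPoly.deriv v (SPoly.deriv u p))) with hS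
    have h : ∑ u, ∑ v, ((-1 : ℂ) ^ (parJ u * parJ v + par i * (par j + parJ v))) •
        (dzz j (pairOf v).1 (pairOf v).2 * dzz i (pairOf u).1 (pairOf u).2 *
          foldAlg (SPoly.deriv v (SPoly.deriv u p))) = S := by
      rw [Finset.sum_comm, hS]
      refine Finset.sum_congr rfl fun u _ => Finset.sum_congr rfl fun v _ => ?_
      rw [SPoly.deriv_deriv u v, map_smul, mul_smul_comm, smul_smul]
      congr 1
      rw [← pow_add]
      apply neg_one_pow_congr'
      have h1 := even_parJ u
      have h2 := even_parJ v
      simp only [Nat.even_add, Nat.even_mul, ← h1, ← h2]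
      grind
    have h2 : S = (1 / 2 : ℂ) • S + (1 / 2 : ℂ) • S := by module
    rw [h2]
    nth_rewrite 2 [← h]
    rw [hS]
    simp only [Finset.smul_sum, ← Finset.sum_add_distrib, smul_mul_assoc, add_mul, smul_add]

end bessel


/-! ### The Bessel-Fischer product is the Fock product of the folded superpolynomials -/

section conj
variable {σ τ : Type*} [Fintype σ] [LinearOrder τ] [Fintype τ]

theorem conjPoly_add (p q : SPoly σ τ) : conjPoly (p + q) = conjPoly p + conjPoly q :=
  Gr.mapCoeff_add _ p q

theorem conjPoly_mul (p q : SPoly σ τ) : conjPoly (p * q) = conjPoly p * conjPoly q :=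
  Gr.mapCoeff_mul _ p q

theorem conjPoly_smul (c : ℂ) (p : SPoly σ τ) :
    conjPoly (c • p) = (starRingEnd ℂ) c • conjPoly p := by
  ext1 S
  refine Eq.trans ?_ (Gr.smul_apply _ (conjPoly p) S).symm
  change MvPolynomial.map _ ((c • p) S) = _ • MvPolynomial.map _ (p S)
  rw [Gr.smul_apply, MvPolynomial.smul_eq_C_mul, map_mul, MvPolynomial.map_C,
    MvPolynomial.smul_eq_C_mul]

theorem conjPoly_one : conjPoly (1 : SPoly σ τ) = 1 := by
  rw [← Gr.const_one, conjPoly, Gr.mapCoeff_const, map_one]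

theorem conjPoly_var (u : σ ⊕ τ) : conjPoly (SPoly.var u : SPoly σ τ) = SPoly.var u := by
  rcases u with i | t
  · exact (Gr.mapCoeff_const _ _).trans (by rw [MvPolynomial.map_X]; rfl)
  · exact Gr.mapCoeff_gen _ t

theorem conjPoly_conjPoly (p : SPoly σ τ) : conjPoly (conjPoly p) = p := by
  ext1 S
  change MvPolynomial.map (starRingEnd ℂ) (MvPolynomial.map (starRingEnd ℂ) (p S)) = p S
  rw [MvPolynomial.map_map]
  have : (starRingEnd ℂ).comp (starRingEnd ℂ) = RingHom.id ℂ := by ext x; simp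
  rw [this, MvPolynomial.map_id]

theorem conjPoly_zero : conjPoly (0 : SPoly σ τ) = 0 := by
  ext1 S; exact map_zero _

end conj

section besselFischer
variable {m n : ℕ}

theorem zvar_eq_var (i : Idx m n) : (zvar i : Fock m n) = SPoly.var i := by
  rcases i with i | a <;> rfl

theorem conjPoly_zvar (i : Idx m n) : conjPoly (zvar i : Fock m n) = zvar i := by
  rw [zvar_eq_var, conjPoly_var]

theorem conjPoly_dF (i : Idx m n) (p : Fock m n) : conjPoly (dF i p) = dF i (conjPoly p) := by
  induction p using Fock.induction with
  | h1 => rw [dF_one, conjPoly_one, dF_one, conjPoly_zero]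
  | ha p q hp hq => rw [map_add, conjPoly_add, hp, hq, conjPoly_add, map_add]
  | hs c p hp => rw [map_smul, conjPoly_smul, hp, conjPoly_smul, map_smul]
  | hz j p hp =>
    rw [dF_zvar_mul, conjPoly_add, conjPoly_smul, conjPoly_smul, conjPoly_mul, hp, conjPoly_mul,
      conjPoly_zvar, dF_zvar_mul, conj_beta, eps]
    simp

theorem conjPoly_foldAlg (p : PJ m n) : conjPoly (foldAlg p) = foldAlg (conjPoly p) := by
  induction p using SPoly.induction' with
  | h1 => rw [map_one, conjPoly_one, conjPoly_one, map_one]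
  | ha p q hp hq => rw [map_add, conjPoly_add, hp, hq, conjPoly_add, map_add]
  | hs c p hp => rw [map_smul, conjPoly_smul, hp, conjPoly_smul, map_smul]
  | hv u p hp =>
    rw [map_mul, conjPoly_mul, hp, conjPoly_mul, conjPoly_var, map_mul, foldAlg_var, zz,
      conjPoly_mul, conjPoly_zvar, conjPoly_zvar]

theorem fockForm_mul_zvar (p q : Fock m n) (i : Idx m n) :
    fockForm (p * zvar i) q = fockForm p (dF i q) := by
  rw [mul_zvar, fockForm_zvar_mul, sgn_sgn]

theorem dF_dF (i j : Idx m n) (p : Fock m n) : dF i (dF j p) = eps i j • dF j (dF i p) := by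
  have hd : ∀ (i : Idx m n) (p : Fock m n), dz i p = SPoly.deriv i p := by
    rintro (i | a) p <;> rfl
  have hp : ∀ i : Idx m n, SPoly.varPar i = par i := by rintro (i | a) <;> rfl
  simp only [dF_apply, map_smul, hd]
  rw [SPoly.deriv_deriv, hp, hp, par_dual, par_dual, eps]
  module

/-- The operator `∂_i ∂_j` that corresponds to the Bessel operator of `ℓ_{ij}`. -/
def ddF (u : EvJ m n ⊕ OdJ m n) : Module.End ℂ (Fock m n) :=
  dF (pairOf u).1 ∘ₗ dF (pairOf u).2

theorem ddF_comm (u v : EvJ m n ⊕ OdJ m n) :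
    ddF u * ddF v = ((-1 : ℂ) ^ (parJ u * parJ v)) • (ddF v * ddF u) := by
  ext1 p
  change dF (pairOf u).1 (dF (pairOf u).2 (dF (pairOf v).1 (dF (pairOf v).2 p))) =
    ((-1 : ℂ) ^ (parJ u * parJ v)) •
      dF (pairOf v).1 (dF (pairOf v).2 (dF (pairOf u).1 (dF (pairOf u).2 p)))
  rw [dF_dF (pairOf u).2 (pairOf v).1, map_smul, dF_dF (pairOf u).1 (pairOf v).1,
    dF_dF (pairOf u).2 (pairOf v).2, map_smul, map_smul,
    dF_dF (pairOf u).1 (pairOf v).2, map_smul]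
  simp only [smul_smul, eps, ← pow_add]
  congr 1
  apply neg_one_pow_congr'
  simp only [parJ, Nat.even_add, Nat.even_mul]
  grind

theorem ddF_supercommuting : Supercommuting (fun u : EvJ m n => ddF (Sum.inl u : EvJ m n ⊕ OdJ m n))
    (fun t : OdJ m n => ddF (Sum.inr t : EvJ m n ⊕ OdJ m n)) := by
  have he : ∀ (u : EvJ m n) v, Even (parJ (Sum.inl u : EvJ m n ⊕ OdJ m n) * v) := fun u v => by
    rcases parJ_inl u with h | h <;> simp [h]
  refine ⟨fun u v => ?_, fun u t => ?_, fun s t => ?_⟩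
  · rw [ddF_comm, (he u _).neg_one_pow, one_smul]
  · rw [ddF_comm, (he u _).neg_one_pow, one_smul]
  · rw [ddF_comm]
    simp [parJ, pairOf, par]

theorem fockForm_mul_foldAlg (p : PJ m n) (x r : Fock m n) :
    fockForm (x * foldAlg p) (conjPoly r) =
      fockForm x (conjPoly (substAlg (ddF_supercommuting (m := m) (n := n)) p r)) := by
  induction p using SPoly.induction' generalizing x with
  | h1 => rw [map_one, mul_one, map_one]; rfl
  | ha p q hp hq =>
    rw [map_add, mul_add, fockForm_add_left, hp, hq, map_add, LinearMap.add_apply, conjPoly_add,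
      fockForm_add_right]
  | hs c p hp =>
    rw [map_smul, mul_smul_comm, fockForm_smul_left, hp, map_smul, LinearMap.smul_apply,
      conjPoly_smul, fockForm_smul_right, Complex.conj_conj]
  | hv u p hp =>
    have hu : substAlg (ddF_supercommuting (m := m) (n := n)) (SPoly.var u) = ddF u := by
      rcases u with u | t
      · exact substAlg_X _ u
      · exact substAlg_gen _ t
    rw [map_mul, foldAlg_var, ← mul_assoc, hp, zz, ← mul_assoc, fockForm_mul_zvar,
      fockForm_mul_zvar, map_mul, hu]
    change _ = fockForm x (conjPoly (dF _ (dF _ _)))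
    rw [conjPoly_dF, conjPoly_dF]

theorem map_list_prod_apply {ι A B : Type*} [AddCommGroup A] [Module ℂ A] [AddCommGroup B]
    [Module ℂ B] (f : A →ₗ[ℂ] B) {P : ι → Module.End ℂ A} {Q : ι → Module.End ℂ B}
    (h : ∀ i a, f (P i a) = Q i (f a)) (l : List ι) (a : A) :
    f ((l.map P).prod a) = (l.map Q).prod (f a) := by
  induction l generalizing a with
  | nil => rfl
  | cons i l ih =>
    rw [List.map_cons, List.map_cons, List.prod_cons, List.prod_cons, Module.End.mul_apply,
      Module.End.mul_apply, h, ih]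

theorem map_word {σ τ A B : Type*} [Fintype σ] [LinearOrder τ] [AddCommGroup A] [Module ℂ A]
    [AddCommGroup B] [Module ℂ B] (f : A →ₗ[ℂ] B) {φ₀ : σ → Module.End ℂ A}
    {φ₁ : τ → Module.End ℂ A} {ψ₀ : σ → Module.End ℂ B} {ψ₁ : τ → Module.End ℂ B}
    (h₀ : ∀ i a, f (φ₀ i a) = ψ₀ i (f a)) (h₁ : ∀ t a, f (φ₁ t a) = ψ₁ t (f a))
    (α : σ →₀ ℕ) (S : Finset τ) (a : A) :
    f (word φ₀ φ₁ α S a) = word ψ₀ ψ₁ α S (f a) := by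
  rw [word, word, Module.End.mul_apply, Module.End.mul_apply,
    map_list_prod_apply f (Q := fun i => ψ₀ i ^ α i) ?_, map_list_prod_apply f h₁]
  intro i a
  generalize α i = k
  induction k generalizing a with
  | zero => rfl
  | succ k ih => rw [pow_succ, pow_succ, Module.End.mul_apply, Module.End.mul_apply, ih, h₀]

theorem map_substₗ {σ τ A B : Type*} [Fintype σ] [LinearOrder τ] [Fintype τ] [AddCommGroup A]
    [Module ℂ A] [AddCommGroup B] [Module ℂ B] (f : A →ₗ[ℂ] B) {φ₀ : σ → Module.End ℂ A}
    {φ₁ : τ → Module.End ℂ A} {ψ₀ : σ → Module.End ℂ B} {ψ₁ : τ → Module.End ℂ B}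
    (h₀ : ∀ i a, f (φ₀ i a) = ψ₀ i (f a)) (h₁ : ∀ t a, f (φ₁ t a) = ψ₁ t (f a))
    (p : SPoly σ τ) (a : A) : f (substₗ φ₀ φ₁ p a) = substₗ ψ₀ ψ₁ p (f a) := by
  rw [substₗ_apply, substₗ_apply, subst, subst, LinearMap.sum_apply, LinearMap.sum_apply, map_sum]
  refine Finset.sum_congr rfl fun S _ => ?_
  rw [LinearMap.sum_apply, LinearMap.sum_apply, map_sum]
  refine Finset.sum_congr rfl fun α _ => ?_
  rw [LinearMap.smul_apply, LinearMap.smul_apply, map_smul, map_word f h₀ h₁]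

theorem atZero_zvar (i : Idx m n) : SPoly.atZero (zvar i : Fock m n) = 0 := by
  rcases i with i | a
  · simp [SPoly.atZero_apply, zvar, Gr.const]
  · simp [SPoly.atZero_apply, zvar, Gr.gen, (Finset.singleton_ne_empty a).symm]

theorem atZero_foldAlg (p : PJ m n) : SPoly.atZero (foldAlg p) = SPoly.atZero p := by
  have h : (SPoly.atZero (σ := Fin m) (τ := Fin (2 * n))).comp foldAlg =
      SPoly.atZero (σ := EvJ m n) (τ := OdJ m n) := by
    refine SPoly.algHom_ext (fun u => ?_) (fun t => ?_)
    · refine (congrArg SPoly.atZero (foldAlg_var (Sum.inl u))).trans ?_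
      rw [zz, map_mul, atZero_zvar, zero_mul]
      simp [SPoly.atZero_apply, Gr.const]
    · refine (congrArg SPoly.atZero (foldAlg_var (Sum.inr t))).trans ?_
      rw [zz, map_mul, atZero_zvar, zero_mul]
      simp [SPoly.atZero_apply, Gr.gen, (Finset.singleton_ne_empty t).symm]
  exact congrArg (fun f => f p) h

theorem atZero_conjPoly {σ τ : Type*} [Fintype σ] [LinearOrder τ] [Fintype τ] (p : SPoly σ τ) :
    SPoly.atZero (conjPoly p) = (starRingEnd ℂ) (SPoly.atZero p) := by
  rw [SPoly.atZero_apply, SPoly.atZero_apply]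
  exact MvPolynomial.constantCoeff_map _ _

/-- The Bessel-Fischer product of `p` and `q` is the Fock product of their images under the
folding map. -/
theorem besselFischer_eq (p q : PJ m n) :
    besselFischer p q = fockForm (foldAlg p) (foldAlg q) := by
  have h1 : besselFischer p q = SPoly.atZero
      (substₗ (fun u => besselₗ (Sum.inl u)) (fun t => besselₗ (Sum.inr t)) p (conjPoly q)) := by
    rw [← substOp_eq, besselFischer, SPoly.atZero_apply]
    have h : ∀ x : EvJ m n ⊕ OdJ m n, (besselP x : PJ m n → PJ m n) = besselₗ x :=
      fun x => funext fun p => (besselₗ_apply x p).symm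
    refine congrArg (fun r : PJ m n => MvPolynomial.constantCoeff (r ∅)) ?_
    simp only [h]
  rw [h1, ← atZero_foldAlg]
  have h2 := map_substₗ (foldAlg (m := m) (n := n)).toLinearMap
    (φ₀ := fun u : EvJ m n => besselₗ (Sum.inl u)) (φ₁ := fun t : OdJ m n => besselₗ (Sum.inr t))
    (ψ₀ := fun u => ddF (Sum.inl u)) (ψ₁ := fun t => ddF (Sum.inr t))
    (fun u a => foldAlg_besselₗ _ a) (fun t a => foldAlg_besselₗ _ a) p (conjPoly q)
  refine (congrArg SPoly.atZero h2).trans ?_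
  have h3 := fockForm_mul_foldAlg p 1 (foldAlg (conjPoly q))
  rw [one_mul, fockForm_one_left, conjPoly_foldAlg, conjPoly_conjPoly] at h3
  rw [h3]
  refine Eq.trans ?_ (congrArg (starRingEnd ℂ) (atZero_conjPoly _)).symm
  rw [Complex.conj_conj]
  rfl

end besselFischer


/-! ### The kernel of the folding map -/

section kernel
variable {m n : ℕ}

theorem ellP_symm (i j : Idx m n) : (ellP i j : PJ m n) = eps i j • ellP j i := by
  rcases i with i | a <;> rcases j with j | b
  · rcases lt_trichotomy i j with h | h | h
    · simp [ellP, ell, eps, par, h.le, not_le.2 h]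
    · subst h; simp [eps, par]
    · simp [ellP, ell, eps, par, h.le, not_le.2 h]
  · simp [ellP, ell, eps, par]
  · simp [ellP, ell, eps, par]
  · rcases lt_trichotomy a b with h | h | h
    · simp [ellP, ell, eps, par, h, not_lt.2 h.le]
    · subst h; simp [ellP, ell]
    · simp [ellP, ell, eps, par, h, not_lt.2 h.le]

theorem parity_ellP (i j : Idx m n) :
    Gr.parity (ellP i j : PJ m n) = ((-1 : ℂ) ^ (par i + par j)) • ellP i j := by
  rcases i with i | a <;> rcases j with j | b
  · rcases le_or_gt i j with h | h
    · simp [ellP, ell, par, h, Gr.parity_const]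
    · simp [ellP, ell, par, not_le.2 h, Gr.parity_const]
  · simp [ellP, ell, par, Gr.parity_gen]
  · simp [ellP, ell, par, Gr.parity_gen]
  · rcases lt_trichotomy a b with h | h | h
    · simp [ellP, ell, par, h, Gr.parity_const]
    · subst h; simp [ellP, ell]
    · simp [ellP, ell, par, h, not_lt.2 h.le, Gr.parity_const]

/-- The generators of the ideal `ℐ`. -/
def minorJ (i j k l : Idx m n) : PJ m n :=
  ellP i j * ellP k l - ((-1 : ℂ) ^ (par k * par j)) • (ellP i k * ellP j l)

theorem parity_minorJ (i j k l : Idx m n) : Gr.parity (minorJ i j k l) =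
    ((-1 : ℂ) ^ (par i + par j + par k + par l)) • minorJ i j k l := by
  rw [minorJ, map_sub, map_smul, Gr.parity_mul, Gr.parity_mul]
  simp only [parity_ellP, smul_mul_assoc, mul_smul_comm, smul_smul, smul_sub, ← pow_add]
  congr 2 <;> ring_nf

theorem mul_mem_idealJ (p : PJ m n) {f : PJ m n} (hf : f ∈ idealJ m n) : p * f ∈ idealJ m n := by
  induction hf using Submodule.span_induction with
  | mem f hf =>
    obtain ⟨q, i, j, k, l, rfl⟩ := hf
    exact Submodule.subset_span ⟨p * q, i, j, k, l, (mul_assoc _ _ _).symm⟩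
  | zero => rw [mul_zero]; exact Submodule.zero_mem _
  | add f g _ _ hf hg => rw [mul_add]; exact Submodule.add_mem _ hf hg
  | smul c f _ hf => rw [mul_smul_comm]; exact Submodule.smul_mem _ _ hf

theorem minorJ_mul_mem_idealJ (i j k l : Idx m n) (p : PJ m n) :
    minorJ i j k l * p ∈ idealJ m n := by
  rw [Gr.mul_comm_of_parity (parity_minorJ i j k l)]
  exact Submodule.subset_span ⟨_, i, j, k, l, rfl⟩

theorem foldAlg_of_mem_idealJ {p : PJ m n} (hp : p ∈ idealJ m n) : foldAlg p = 0 := by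
  induction hp using Submodule.span_induction with
  | mem f hf =>
    obtain ⟨q, i, j, k, l, rfl⟩ := hf
    rw [map_mul, map_sub, map_smul, map_mul, map_mul, foldAlg_ellP, foldAlg_ellP, foldAlg_ellP,
      foldAlg_ellP]
    have : zz i j * zz k l - ((-1 : ℂ) ^ (par k * par j)) • (zz i k * zz j l : Fock m n) = 0 := by
      simp only [zz, mul_assoc]
      rw [← mul_assoc (zvar k), zvar_mul_zvar k j, smul_mul_assoc, mul_smul_comm, smul_smul,
        eps, ← pow_add, ← two_mul, pow_mul, neg_one_sq, one_pow, one_smul, mul_assoc, sub_self]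
    rw [this, mul_zero]
  | zero => exact map_zero _
  | add f g _ _ hf hg => rw [map_add, hf, hg, add_zero]
  | smul c f _ hf => rw [map_smul, hf, smul_zero]

/-- Multiplication by a superpolynomial on `𝒫(J)/ℐ`. -/
def mulQuot (p : PJ m n) : MinFock m n →ₗ[ℂ] MinFock m n :=
  (idealJ m n).mapQ (idealJ m n) (LinearMap.mulLeft ℂ p) fun _ hf => mul_mem_idealJ p hf

theorem mulQuot_mk (p q : PJ m n) :
    mulQuot p ((idealJ m n).mkQ q) = (idealJ m n).mkQ (p * q) := rfl

theorem mulQuot_symm (i j : Idx m n) (x : MinFock m n) :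
    mulQuot (ellP i j) x = eps i j • mulQuot (ellP j i) x := by
  obtain ⟨q, rfl⟩ := (idealJ m n).mkQ_surjective x
  rw [mulQuot_mk, mulQuot_mk, ellP_symm, smul_mul_assoc, map_smul]

theorem mulQuot_mulQuot (i j k l : Idx m n) (x : MinFock m n) :
    mulQuot (ellP i j) (mulQuot (ellP k l) x) =
      ((-1 : ℂ) ^ (par k * par j)) • mulQuot (ellP i k) (mulQuot (ellP j l) x) := by
  obtain ⟨q, rfl⟩ := (idealJ m n).mkQ_surjective x
  simp only [mulQuot_mk]
  rw [← map_smul, ← sub_eq_zero, ← map_sub, ← mul_assoc, ← mul_assoc, ← smul_mul_assoc, ← sub_mul]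
  exact (Submodule.Quotient.mk_eq_zero _).2 (minorJ_mul_mem_idealJ i j k l q)

/-- The vectors `v` with `ℓ_{li} v_k = (-1)^{|i||k|} ℓ_{lk} v_i`; they behave like `v_k = z_k q` for
an element `q` of the missing half of odd degree of `𝒫(ℂ^{m|2n})`. -/
def oddHalf (m n : ℕ) : Submodule ℂ (Idx m n → MinFock m n) where
  carrier := {v | ∀ i k l, mulQuot (ellP l i) (v k) = eps i k • mulQuot (ellP l k) (v i)}
  add_mem' := fun hv hw i k l => by
    rw [Pi.add_apply, Pi.add_apply, map_add, hv, hw, map_add, smul_add]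
  zero_mem' := fun i k l => by simp
  smul_mem' := fun c v hv i k l => by
    rw [Pi.smul_apply, Pi.smul_apply, map_smul, hv, map_smul, smul_comm]

/-- The action of the variable `z_i` on the sum of `𝒫(J)/ℐ` and its odd counterpart. It makes this
sum a module over `𝒫(ℂ^{m|2n})` on which `ℓ_{ij}` acts as `z_i z_j`, so that a superpolynomial in
the kernel of the folding map annihilates `1 ∈ 𝒫(J)/ℐ`. -/
def unfold (i : Idx m n) : Module.End ℂ (MinFock m n × oddHalf m n) where
  toFun x := (x.2.1 i, ⟨fun k => mulQuot (ellP k i) x.1, fun j k l => by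
    rw [mulQuot_mulQuot, eps, mul_comm (par j)]⟩)
  map_add' x y := by
    refine Prod.ext rfl (Subtype.ext (funext fun k => ?_))
    exact map_add _ _ _
  map_smul' c x := by
    refine Prod.ext rfl (Subtype.ext (funext fun k => ?_))
    exact map_smul _ _ _

theorem unfold_unfold_fst (i j : Idx m n) (x : MinFock m n × oddHalf m n) :
    (unfold i (unfold j x)).1 = mulQuot (ellP i j) x.1 := rfl

theorem unfold_comm (i j : Idx m n) :
    unfold i * unfold j = eps i j • (unfold (m := m) (n := n) j * unfold i) := by
  refine LinearMap.ext fun x => ?_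
  refine Prod.ext (mulQuot_symm i j x.1) (Subtype.ext (funext fun k => ?_))
  exact x.2.2 i j k

theorem unfold_supercommuting : Supercommuting (fun i : Fin m => unfold (n := n) (Sum.inl i))
    (fun a : Fin (2 * n) => unfold (m := m) (Sum.inr a)) := by
  refine ⟨fun i j => ?_, fun i a => ?_, fun a b => ?_⟩
  · rw [unfold_comm]; simp [eps, par]
  · rw [unfold_comm]; simp [eps, par]
  · rw [unfold_comm, eps, par, par, mul_one, pow_one]
    exact neg_one_smul ℂ
      (unfold (Sum.inr b) * unfold (Sum.inr a) : Module.End ℂ (MinFock m n × oddHalf m n))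

theorem substAlg_unfold_foldAlg (p : PJ m n) (x : MinFock m n × oddHalf m n) :
    (substAlg (unfold_supercommuting (m := m) (n := n)) (foldAlg p) x).1 = mulQuot p x.1 := by
  have hz : ∀ i : Idx m n,
      substAlg (unfold_supercommuting (m := m) (n := n)) (zvar i) = unfold i := by
    rintro (i | a)
    · exact substAlg_X _ i
    · exact substAlg_gen _ a
  induction p using SPoly.induction' generalizing x with
  | h1 =>
    obtain ⟨q, hq⟩ := (idealJ m n).mkQ_surjective x.1
    rw [map_one, map_one, ← hq, mulQuot_mk, one_mul, hq]
    rfl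
  | ha p q hp hq =>
    obtain ⟨r, hr⟩ := (idealJ m n).mkQ_surjective x.1
    rw [map_add, map_add, LinearMap.add_apply, Prod.fst_add, hp, hq, ← hr, mulQuot_mk, mulQuot_mk,
      mulQuot_mk, add_mul, map_add]
  | hs c p hp =>
    obtain ⟨r, hr⟩ := (idealJ m n).mkQ_surjective x.1
    rw [map_smul, map_smul, LinearMap.smul_apply, Prod.smul_fst, hp, ← hr, mulQuot_mk,
      mulQuot_mk, smul_mul_assoc, map_smul]
  | hv u p hp =>
    rw [map_mul, map_mul, foldAlg_var, zz, map_mul, hz, hz]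
    refine (unfold_unfold_fst _ _ _).trans ?_
    rw [hp, ← var_eq_ellP]
    obtain ⟨r, hr⟩ := (idealJ m n).mkQ_surjective x.1
    rw [← hr, mulQuot_mk, mulQuot_mk, mulQuot_mk, mul_assoc]

/-- The kernel of the folding map is the ideal `ℐ`. -/
theorem foldAlg_eq_zero_iff (p : PJ m n) : foldAlg p = 0 ↔ p ∈ idealJ m n := by
  refine ⟨fun h => ?_, foldAlg_of_mem_idealJ⟩
  have h1 := substAlg_unfold_foldAlg p ((idealJ m n).mkQ 1, 0)
  rw [h, map_zero, mulQuot_mk, mul_one] at h1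
  exact (Submodule.Quotient.mk_eq_zero _).1 h1.symm

end kernel

/-! ### The range of the folding map -/

section range
variable {m n : ℕ}

/-- The change of sign of all variables, on superpolynomials. -/
def negVars : Fock m n →ₗ[ℂ] Fock m n :=
  Gr.parity ∘ₗ (Gr.mapAlg (MvPolynomial.aeval fun i => -MvPolynomial.X i)).toLinearMap

theorem negVars_eq (p : Fock m n) : negVars p =
    Gr.parity (Gr.mapAlg (MvPolynomial.aeval fun i => -MvPolynomial.X i) p) := rfl

theorem negVars_one : negVars (1 : Fock m n) = 1 := by
  rw [negVars_eq, map_one, Gr.parity_one]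

theorem negVars_zvar_mul (i : Idx m n) (p : Fock m n) :
    negVars (zvar i * p) = -(zvar i * negVars p) := by
  rw [negVars_eq, negVars_eq, map_mul]
  rcases i with i | a
  · rw [zvar, Gr.mapAlg_const, MvPolynomial.aeval_X, Gr.parity_mul, Gr.parity_const]
    have : (Gr.const (-MvPolynomial.X i) : Fock m n) = -Gr.const (MvPolynomial.X i) := by
      ext1 S
      rw [Gr.neg_apply, Gr.const, Gr.const]; split_ifs <;> simp
    rw [this, neg_mul]
  · rw [zvar, Gr.mapAlg_gen, Gr.parity_gen_mul]

theorem coeff_aeval_neg (f : MvPolynomial (Fin m) ℂ) (α : Fin m →₀ ℕ) :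
    (MvPolynomial.aeval (fun i => -MvPolynomial.X i : Fin m → MvPolynomial (Fin m) ℂ) f).coeff α =
      (-1) ^ α.degree * f.coeff α := by
  classical
  induction f using MvPolynomial.induction_on' with
  | monomial u c =>
    have : MvPolynomial.aeval (fun i => -MvPolynomial.X i : Fin m → MvPolynomial (Fin m) ℂ)
        (MvPolynomial.monomial u c) = MvPolynomial.C ((-1) ^ u.degree) * MvPolynomial.monomial u c := by
      rw [MvPolynomial.aeval_monomial, MvPolynomial.monomial_eq, Finsupp.prod, Finsupp.prod,
        Finsupp.degree_apply]
      simp only [neg_pow (MvPolynomial.X _ : MvPolynomial (Fin m) ℂ)]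
      rw [Finset.prod_mul_distrib, Finset.prod_pow_eq_pow_sum, map_pow, map_neg, map_one]
      simp only [MvPolynomial.algebraMap_eq]
      ring
    rw [this, MvPolynomial.coeff_C_mul, MvPolynomial.coeff_monomial]
    split_ifs with h
    · rw [h]
    · rw [mul_zero, mul_zero]
  | add p q hp hq => rw [map_add, MvPolynomial.coeff_add, hp, hq, MvPolynomial.coeff_add, mul_add]

theorem mem_fockEven_iff (p : Fock m n) : p ∈ fockEven m n ↔ negVars p = p := by
  have hc : ∀ (S : Finset (Fin (2 * n))) (α : Fin m →₀ ℕ), (negVars p S).coeff α =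
      (-1) ^ (α.degree + S.card) * (p S).coeff α := by
    intro S α
    rw [negVars_eq, Gr.parity_apply]
    rw [MvPolynomial.coeff_smul, Gr.mapAlg_apply, coeff_aeval_neg, smul_eq_mul]
    ring
  constructor
  · intro h
    ext1 S
    ext α
    rw [hc]
    by_cases he : Even (α.degree + S.card)
    · rw [he.neg_one_pow, one_mul]
    · rw [h S α he, mul_zero]
  · intro h S α he
    have h1 := hc S α
    rw [h, (Nat.not_even_iff_odd.1 he).neg_one_pow] at h1
    linear_combination (1 / 2 : ℂ) * h1

theorem foldAlg_mem_fockEven (p : PJ m n) : foldAlg p ∈ fockEven m n := by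
  rw [mem_fockEven_iff]
  induction p using SPoly.induction' with
  | h1 => rw [map_one, negVars_one]
  | ha p q hp hq => rw [map_add, map_add, hp, hq]
  | hs c p hp => rw [map_smul, map_smul, hp]
  | hv u p hp =>
    rw [map_mul, foldAlg_var, zz, mul_assoc, negVars_zvar_mul, negVars_zvar_mul, hp]
    rw [mul_neg, neg_neg]

theorem add_negVars_mem_range (p : Fock m n) :
    p + negVars p ∈ (foldAlg (m := m) (n := n)).range ∧
      ∀ i, zvar i * (p - negVars p) ∈ (foldAlg (m := m) (n := n)).range := by
  induction p using Fock.induction with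
  | h1 =>
    rw [negVars_one]
    refine ⟨add_mem (one_mem _) (one_mem _), fun i => ?_⟩
    rw [sub_self, mul_zero]
    exact zero_mem _
  | ha p q hp hq =>
    rw [map_add, add_add_add_comm, add_sub_add_comm]
    exact ⟨add_mem hp.1 hq.1, fun i => by rw [mul_add]; exact add_mem (hp.2 i) (hq.2 i)⟩
  | hs c p hp =>
    rw [map_smul, ← smul_add, ← smul_sub]
    exact ⟨Subalgebra.smul_mem _ hp.1 c, fun i => by
      rw [mul_smul_comm]; exact Subalgebra.smul_mem _ (hp.2 i) c⟩
  | hz j p hp =>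
    rw [negVars_zvar_mul, sub_neg_eq_add, ← sub_eq_add_neg, ← mul_sub, ← mul_add]
    refine ⟨hp.2 j, fun i => ?_⟩
    rw [← mul_assoc]
    exact mul_mem ⟨ellP i j, foldAlg_ellP i j⟩ hp.1

/-- The range of the folding map consists of the superpolynomials of even degree. -/
theorem exists_foldAlg_eq {p : Fock m n} (hp : p ∈ fockEven m n) : ∃ q, foldAlg q = p := by
  rw [mem_fockEven_iff] at hp
  obtain ⟨q, hq⟩ := (add_negVars_mem_range p).1
  refine ⟨(1 / 2 : ℂ) • q, ?_⟩
  rw [map_smul]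
  refine (congrArg _ hq).trans ?_
  rw [hp]
  module

end range


/-! ### Products of superpolynomials and exponentials of polynomials -/

section exponential
variable {σ τ : Type*} [Fintype σ] [DecidableEq σ] [LinearOrder τ] [Fintype τ]

/-- The value of a polynomial at a real point. -/
def evalReal (x : σ → ℝ) : MvPolynomial σ ℂ →ₐ[ℂ] ℂ := MvPolynomial.aeval fun i => (x i : ℂ)

/-- Superpolynomials as superfunctions of real even variables, as an algebra morphism. -/
def evalRAlg : SPoly σ τ →ₐ[ℂ] SFun (σ → ℝ) τ :=
  Gr.mapAlg (AlgHom.pi evalReal)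

theorem evalRAlg_apply (p : SPoly σ τ) : evalRAlg p = evalR p := by
  ext S x
  rfl

theorem evalR_apply (p : SPoly σ τ) (S : Finset τ) (x : σ → ℝ) :
    evalR p S x = evalReal x (p S) := rfl

theorem evalRAlg_injective : Function.Injective (evalRAlg (σ := σ) (τ := τ)) := by
  rw [injective_iff_map_eq_zero]
  intro p hp
  ext1 S
  have h : ∀ x : σ → ℝ, evalReal x (p S) = 0 := fun x => congrFun (congrFun hp S) x
  -- a polynomial vanishes if it vanishes on the infinite grid of real points
  refine MvPolynomial.funext_set (fun _ => Set.range (fun r : ℝ => (r : ℂ)))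
    (fun i => Set.infinite_range_of_injective Complex.ofReal_injective) fun z hz => ?_
  choose y hy using fun i => hz i (Set.mem_univ i)
  have : z = fun i => (y i : ℂ) := funext fun i => (hy i).symm
  rw [this, Gr.zero_apply, map_zero]
  exact h y

theorem hasDerivAt_evalReal (q : MvPolynomial σ ℂ) (i : σ) (x : σ → ℝ) :
    HasDerivAt (fun s : ℝ => evalReal (Function.update x i s) q)
      (evalReal x (MvPolynomial.pderiv i q)) (x i) := by
  induction q using MvPolynomial.induction_on with
  | C a =>
    simp only [evalReal, MvPolynomial.algHom_C, MvPolynomial.pderiv_C, map_zero]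
    exact hasDerivAt_const _ _
  | add p q hp hq =>
    simp only [map_add]
    exact hp.add hq
  | mul_X p j hp =>
    have hX : HasDerivAt (fun s : ℝ => ((Function.update x i s j : ℝ) : ℂ))
        (if i = j then 1 else 0) (x i) := by
      by_cases h : i = j
      · subst h
        simp only [Function.update_self, if_true]
        exact Complex.ofRealCLM.hasDerivAt
      · simp only [Function.update_of_ne (Ne.symm h), if_neg h]
        exact hasDerivAt_const _ _
    have h := hp.mul hX
    rw [Function.update_eq_self] at h
    simp only [evalReal, map_mul, MvPolynomial.aeval_X, Derivation.leibniz, smul_eq_mul,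
      map_add] at h ⊢
    refine h.congr_deriv ?_
    by_cases hij : i = j
    · subst hij
      rw [MvPolynomial.pderiv_X_self, if_pos rfl, map_one]
      ring
    · rw [MvPolynomial.pderiv_X_of_ne (Ne.symm hij), if_neg hij, map_zero]
      ring

/-- The function `exp(L)` for a polynomial `L`. -/
def expPoly (L : MvPolynomial σ ℂ) : SFun (σ → ℝ) τ := Gr.const fun x => Complex.exp (evalReal x L)

theorem expPoly_mul_apply (L : MvPolynomial σ ℂ) (f : SFun (σ → ℝ) τ) (S : Finset τ) (x : σ → ℝ) :
    (expPoly L * f : SFun (σ → ℝ) τ) S x = Complex.exp (evalReal x L) * f S x :=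
  congrFun (Gr.const_mul _ f S) x

/-- The derivative of the exponent `L` in the variable `u`. -/
def derivExponent (L : MvPolynomial σ ℂ) : σ ⊕ τ → SPoly σ τ
  | Sum.inl i => Gr.const (MvPolynomial.pderiv i L)
  | Sum.inr _ => 0

theorem pd_expPoly_mul (L : MvPolynomial σ ℂ) (u : σ ⊕ τ) (p : SPoly σ τ) :
    pd pdFun u (expPoly L * evalR p) =
      expPoly L * evalR (SPoly.deriv u p + derivExponent L u * p) := by
  rcases u with i | t
  · ext S x
    rw [expPoly_mul_apply, evalR_apply]
    have h1 : (SPoly.deriv (Sum.inl i) p + derivExponent L (Sum.inl i) * p : SPoly σ τ) S =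
        MvPolynomial.pderiv i (p S) + MvPolynomial.pderiv i L * p S :=
      congrArg₂ (· + ·) rfl (Gr.const_mul _ p S)
    rw [h1]
    have h2 := ((hasDerivAt_evalReal L i x).cexp.mul (hasDerivAt_evalReal (p S) i x)).deriv
    rw [Function.update_eq_self] at h2
    have h3 : (fun s : ℝ => (expPoly L * evalR p : SFun (σ → ℝ) τ) S (Function.update x i s)) =
        (fun s : ℝ => Complex.exp (evalReal (Function.update x i s) L)) *
          fun s : ℝ => evalReal (Function.update x i s) (p S) := by
      funext s
      exact expPoly_mul_apply _ _ _ _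
    change deriv (fun s : ℝ => (expPoly L * evalR p : SFun (σ → ℝ) τ) S (Function.update x i s))
      (x i) = _
    rw [h3, h2, map_add, map_mul]
    ring
  · change Gr.pdOdd t _ = _
    rw [expPoly, Gr.pdOdd_const_mul]
    change _ = _ * evalR (Gr.pdOdd t p + 0 * p)
    rw [zero_mul, add_zero, ← evalRAlg_apply, ← evalRAlg_apply]
    exact congrArg _ (Gr.pdOdd_mapAlg _ t p)

theorem expPoly_mul_comm (L : MvPolynomial σ ℂ) (f : SFun (σ → ℝ) τ) :
    expPoly L * f = f * expPoly L := Gr.const_mul_comm _ _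

theorem expPoly_mul_injective (L : MvPolynomial σ ℂ) :
    Function.Injective fun f : SFun (σ → ℝ) τ => expPoly L * f := by
  intro f g h
  ext S x
  have h1 := congrFun (congrFun h S) x
  change (expPoly L * f : SFun (σ → ℝ) τ) S x = (expPoly L * g : SFun (σ → ℝ) τ) S x at h1
  rw [expPoly_mul_apply, expPoly_mul_apply] at h1
  exact mul_left_cancel₀ (Complex.exp_ne_zero _) h1

end exponential

/-! ### The Gaussian superfunction and the Schrödinger model -/

section schrodinger
variable {m n : ℕ}

theorem dF_mul (i : Idx m n) (p q : Fock m n) :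
    dF i (p * q) = dF i p * q + sgn i p * dF i q := by
  induction p using Fock.induction with
  | h1 => rw [one_mul, dF_one, zero_mul, zero_add, sgn_one, one_mul]
  | ha p p' hp hp' => rw [add_mul, map_add, hp, hp', map_add, map_add]; noncomm_ring
  | hs c p hp =>
    rw [smul_mul_assoc, map_smul, hp, map_smul, map_smul, smul_mul_assoc, smul_mul_assoc, smul_add]
  | hz j p hp =>
    rw [mul_assoc, dF_zvar_mul, hp, dF_zvar_mul, sgn_zvar_mul]
    simp only [mul_add, add_mul, smul_mul_assoc, smul_add, mul_assoc]
    abel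

/-- The odd part of the Gaussian superfunction `exp(-R²)`. -/
def oddGaussian (n : ℕ) : Gr ℂ (Fin (2 * n)) := oddGauss (-1) id id

/-- The odd part of `exp(-R²)`, as a superpolynomial. -/
def gaussPoly (m n : ℕ) : Fock m n :=
  Gr.mapAlg (Algebra.ofId ℂ (MvPolynomial (Fin m) ℂ)) (oddGaussian n)

/-- The exponent of the even part of `exp(-R²)`. -/
def gaussExponent (m : ℕ) : MvPolynomial (Fin m) ℂ := -∑ i, MvPolynomial.X i * MvPolynomial.X i

theorem pdOdd_oddGaussian (a : Fin (2 * n)) :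
    Gr.pdOdd a (oddGaussian n) = (2 * osign a) • (Gr.gen (odual a) * oddGaussian n) := by
  rw [oddGaussian, pdOdd_oddGauss]
  have := pdOdd_self_oddTrace (e := (id : Fin (2 * n) → _)) Function.injective_id a
  rw [id, id] at this
  rw [this, smul_mul_assoc, smul_smul]
  congr 1
  ring

theorem parity_gaussPoly : Gr.parity (gaussPoly m n) = gaussPoly m n := by
  rw [gaussPoly, Gr.parity_mapAlg, oddGaussian, parity_oddGauss]

theorem dF_inr_gaussPoly (a : Fin (2 * n)) :
    dF (Sum.inr a) (gaussPoly m n) = (-2 : ℂ) • (zvar (Sum.inr a) * gaussPoly m n) := by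
  change osign a • Gr.pdOdd (odual a) (gaussPoly m n) = _
  rw [gaussPoly, Gr.pdOdd_mapAlg, pdOdd_oddGaussian, odual_odual, osign_odual, map_smul, map_mul,
    Gr.mapAlg_gen, smul_smul]
  refine congrArg₂ (· • ·) ?_ rfl
  linear_combination (-2 : ℂ) * osign_sq a

theorem dF_inl_gaussPoly (i : Fin m) : dF (Sum.inl i) (gaussPoly m n) = 0 := by
  rw [dF_apply]
  have : dz (dual (Sum.inl i)) (gaussPoly m n) = 0 := by
    ext1 S
    refine (dz_inl_apply i _ S).trans ?_
    rw [gaussPoly, Gr.mapAlg_apply, Algebra.ofId_apply, MvPolynomial.algebraMap_eq,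
      MvPolynomial.pderiv_C]
    rfl
  rw [this, smul_zero]

theorem gauss_eq : gauss m n = expPoly (gaussExponent m) * evalR (gaussPoly m n) := by
  refine Gr.ext_ev fun x => ?_
  have h := ev_sexp_traceProd (-1) (xvar (m := m) (n := n)) xvar (fun i x => (x i : ℂ))
    (fun i x => (x i : ℂ)) id id (fun _ => rfl) (fun _ => rfl) (fun _ => rfl) (fun _ => rfl) x
  rw [gauss, ← neg_one_smul ℂ (traceProd _ _), h]
  ext1 S
  refine Eq.trans (Gr.smul_apply _ _ S) (Eq.trans ?_ (Gr.ev_apply x _ S).symm)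
  rw [expPoly_mul_apply, evalR_apply, gaussPoly, Gr.mapAlg_apply, Algebra.ofId_apply,
    MvPolynomial.algebraMap_eq, evalReal, MvPolynomial.aeval_C, smul_eq_mul]
  refine congrArg₂ _ ?_ rfl
  simp [gaussExponent]

/-- The superfunction `p exp(-R²)`. -/
def schroMap : Fock m n →ₗ[ℂ] SFR m n :=
  LinearMap.mulRight ℂ (gauss m n) ∘ₗ evalRAlg.toLinearMap

theorem schroMap_apply (p : Fock m n) : schroMap p = evalR p * gauss m n := by
  rw [← evalRAlg_apply]; rfl

theorem schroMap_eq (p : Fock m n) :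
    schroMap p = expPoly (gaussExponent m) * evalR (p * gaussPoly m n) := by
  rw [schroMap_apply, gauss_eq, ← mul_assoc, ← expPoly_mul_comm, mul_assoc, ← evalRAlg_apply,
    ← evalRAlg_apply, ← evalRAlg_apply, map_mul]

theorem schroMap_one : schroMap (1 : Fock m n) = gauss m n := by
  rw [schroMap_apply, ← evalRAlg_apply, map_one, one_mul]

theorem xvar_eq (i : Idx m n) : xvar i = evalR (zvar i : Fock m n) := by
  rw [← evalRAlg_apply]
  rcases i with i | a
  · rw [zvar, evalRAlg, Gr.mapAlg_const]
    refine congrArg Gr.const (funext fun x => ?_)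
    exact (MvPolynomial.aeval_X (R := ℂ) (fun i => ((x i : ℝ) : ℂ)) i).symm
  · rw [zvar, evalRAlg, Gr.mapAlg_gen]; rfl

theorem xvar_mul_schroMap (i : Idx m n) (p : Fock m n) :
    xvar i * schroMap p = schroMap (zvar i * p) := by
  rw [schroMap_apply, schroMap_apply, xvar_eq, ← mul_assoc, ← evalRAlg_apply, ← evalRAlg_apply,
    ← evalRAlg_apply, map_mul]

theorem dR_eq (i : Idx m n) (f : SFR m n) : dR i f = betaSign i • pd pdFun (dual i) f :=
  sum_beta_smul i _

theorem dR_schroMap (i : Idx m n) (p : Fock m n) :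
    dR i (schroMap p) = schroMap (dF i p - (2 : ℂ) • (zvar i * p)) := by
  rw [dR_eq, schroMap_eq, schroMap_eq, pd_expPoly_mul, ← mul_smul_comm]
  refine congrArg₂ _ rfl ?_
  rw [← evalRAlg_apply, ← evalRAlg_apply, ← map_smul]
  refine congrArg _ ?_
  rw [smul_add]
  have hd : betaSign i • SPoly.deriv (dual i) (p * gaussPoly m n) = dF i (p * gaussPoly m n) := by
    rcases i with i | a <;> rfl
  rw [hd, dF_mul, sub_mul]
  rcases i with i | a
  · have h1 : derivExponent (gaussExponent m) (dual (Sum.inl i : Idx m n)) =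
        (-2 : ℂ) • zvar (Sum.inl i) := by
      change (Gr.const (MvPolynomial.pderiv i (gaussExponent m)) : Fock m n) =
        (-2 : ℂ) • Gr.const (MvPolynomial.X i)
      ext1 S
      refine Eq.trans ?_ (Gr.smul_apply (-2 : ℂ)
        (Gr.const (MvPolynomial.X i) : Fock m n) S).symm
      have : MvPolynomial.pderiv i (gaussExponent m) = (-2 : ℂ) • MvPolynomial.X i := by
        rw [gaussExponent, map_neg, map_sum, Finset.sum_eq_single i]
        · rw [Derivation.leibniz, MvPolynomial.pderiv_X_self]
          simp only [smul_eq_mul, mul_one]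
          module
        · intro j _ hj
          rw [Derivation.leibniz, MvPolynomial.pderiv_X_of_ne hj]
          simp
        · simp
      rw [Gr.const, Gr.const, this]
      split_ifs <;> simp
    rw [h1, dF_inl_gaussPoly, mul_zero, add_zero, smul_mul_assoc, smul_mul_assoc, mul_assoc]
    have h2 : betaSign (Sum.inl i : Idx m n) = 1 := rfl
    rw [h2]
    module
  · have h1 : derivExponent (gaussExponent m) (dual (Sum.inr a : Idx m n)) = 0 := rfl
    rw [h1, dF_inr_gaussPoly, zero_mul, smul_zero, add_zero, mul_smul_comm, ← mul_assoc,
      mul_zvar, sgn_sgn, smul_mul_assoc]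
    module

end schrodinger


/-! ### The inverse Segal-Bargmann transform in terms of creation operators -/

section hermite
variable {m n : ℕ}

/-- The creation operators: `2 z_i - ½ ∂_i` corresponds to the operator `x_i - ½ ∂_i` under
`p ↦ p exp(-R²)`. -/
def creation (i : Idx m n) : Module.End ℂ (Fock m n) :=
  (2 : ℂ) • LinearMap.mulLeft ℂ (zvar i) - (1 / 2 : ℂ) • dF i

theorem creation_apply (i : Idx m n) (p : Fock m n) :
    creation i p = (2 : ℂ) • (zvar i * p) - (1 / 2 : ℂ) • dF i p := rfl

theorem beta_eps_symm (i j : Idx m n) : beta i j = eps i j * beta j i := by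
  rw [beta_symm i j]
  by_cases h : par j = par i
  · rw [eps, h]
    rcases i with i | i <;> simp [par]
  · rw [beta_of_par_ne h, mul_zero, mul_zero]

theorem creation_comm (i j : Idx m n) :
    creation i * creation j = eps i j • (creation (m := m) (n := n) j * creation i) := by
  refine LinearMap.ext fun p => ?_
  change creation i (creation j p) = eps i j • creation j (creation i p)
  simp only [creation_apply, map_sub, map_smul, dF_zvar_mul]
  rw [dF_dF i j, ← mul_assoc, ← mul_assoc, zvar_mul_zvar i j, beta_eps_symm i j, eps_comm j i]
  have h := eps_mul_self i j
  simp only [smul_mul_assoc]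
  generalize zvar j * zvar i * p = A
  generalize zvar i * dF j p = B
  generalize zvar j * dF i p = C
  generalize dF j (dF i p) = D
  match_scalars
  all_goals first | ring1 | linear_combination h

theorem creation_supercommuting : Supercommuting (fun i : Fin m => creation (n := n) (Sum.inl i))
    (fun a : Fin (2 * n) => creation (m := m) (Sum.inr a)) := by
  refine ⟨fun i j => ?_, fun i a => ?_, fun a b => ?_⟩
  · rw [creation_comm]; simp [eps, par]
  · rw [creation_comm]; simp [eps, par]
  · rw [creation_comm, eps, par, par, mul_one, pow_one]
    exact neg_one_smul ℂ (creation (Sum.inr b) * creation (Sum.inr a) : Module.End ℂ (Fock m n))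

/-- The map that takes a product of variables to the product of the creation operators applied
to `1` (a Hermite superpolynomial). -/
def hermite : Fock m n →ₗ[ℂ] Fock m n :=
  LinearMap.applyₗ (1 : Fock m n) ∘ₗ
    (substAlg (creation_supercommuting (m := m) (n := n))).toLinearMap

theorem hermite_one : hermite (1 : Fock m n) = 1 := by
  change substAlg (creation_supercommuting (m := m) (n := n)) 1 (1 : Fock m n) = 1
  rw [map_one (substAlg (creation_supercommuting (m := m) (n := n)))]; rfl

theorem hermite_zvar_mul (i : Idx m n) (p : Fock m n) :
    hermite (zvar i * p) = creation i (hermite p) := by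
  have hz : substAlg (creation_supercommuting (m := m) (n := n)) (zvar i) = creation i := by
    rcases i with i | a
    · exact substAlg_X _ i
    · exact substAlg_gen _ a
  change substAlg (creation_supercommuting (m := m) (n := n)) (zvar i * p) (1 : Fock m n) = _
  rw [map_mul, hz]
  rfl

theorem hermite_dF (i : Idx m n) (p : Fock m n) :
    hermite (dF i p) = (1 / 2 : ℂ) • dF i (hermite p) := by
  induction p using Fock.induction with
  | h1 => rw [dF_one, hermite_one, dF_one, map_zero, smul_zero]
  | ha p q hp hq => rw [map_add, map_add, hp, hq, map_add, map_add, smul_add]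
  | hs c p hp => rw [map_smul, map_smul, hp, map_smul, map_smul, smul_comm]
  | hz j p hp =>
    rw [dF_zvar_mul, map_add, map_smul, map_smul, hermite_zvar_mul, hp, hermite_zvar_mul]
    simp only [creation_apply, map_sub, map_smul, dF_zvar_mul]
    rw [dF_dF i j]
    module

theorem parity_dF (j : Idx m n) (p : Fock m n) :
    Gr.parity (dF j p) = ((-1 : ℂ) ^ par j) • dF j (Gr.parity p) := by
  induction p using Fock.induction with
  | h1 => rw [dF_one, map_zero, Gr.parity_one, dF_one, smul_zero]
  | ha p q hp hq => rw [map_add, map_add, hp, hq, map_add, map_add, smul_add]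
  | hs c p hp => rw [map_smul, map_smul, hp, map_smul, map_smul, smul_comm]
  | hz i p hp =>
    have h : beta j i = (-1) ^ par j * ((-1) ^ par i * beta j i) := by
      by_cases h : par j = par i
      · rw [h, ← mul_assoc, ← pow_add, ← two_mul, pow_mul]; simp
      · rw [beta_of_par_ne h]; ring
    rw [dF_zvar_mul, map_add, map_smul, map_smul, parity_zvar_mul, hp, parity_zvar_mul, map_smul,
      dF_zvar_mul, mul_smul_comm, smul_add, smul_add]
    have h' : ((-1 : ℂ) ^ par j) • ((-1 : ℂ) ^ par i) • beta j i • Gr.parity p =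
        beta j i • Gr.parity p := by
      rw [smul_smul, smul_smul, mul_assoc, ← h]
    rw [h']
    module

theorem hermite_parity (p : Fock m n) : hermite (Gr.parity p) = Gr.parity (hermite p) := by
  induction p using Fock.induction with
  | h1 => rw [Gr.parity_one, hermite_one, Gr.parity_one]
  | ha p q hp hq => rw [map_add, map_add, hp, hq, map_add, map_add]
  | hs c p hp => rw [map_smul, map_smul, hp, map_smul, map_smul]
  | hz j p hp =>
    rw [parity_zvar_mul, map_smul, hermite_zvar_mul, hp, hermite_zvar_mul, creation_apply,
      creation_apply, map_sub, map_smul, map_smul, parity_zvar_mul, parity_dF]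
    module

theorem hermite_negVars (p : Fock m n) : hermite (negVars p) = negVars (hermite p) := by
  have hd : ∀ (j : Idx m n) (q : Fock m n), negVars (dF j q) = -dF j (negVars q) := by
    intro j q
    induction q using Fock.induction with
    | h1 => rw [dF_one, map_zero, negVars_one, dF_one, neg_zero]
    | ha p q hp hq => rw [map_add, map_add, hp, hq, map_add, map_add, neg_add]
    | hs c p hp => rw [map_smul, map_smul, hp, map_smul, map_smul, smul_neg]
    | hz i p hp =>
      rw [dF_zvar_mul, map_add, map_smul, map_smul, negVars_zvar_mul, hp, negVars_zvar_mul, map_neg,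
        dF_zvar_mul]
      simp only [mul_neg, neg_neg, neg_add]
  induction p using Fock.induction with
  | h1 => rw [negVars_one, hermite_one, negVars_one]
  | ha p q hp hq => rw [map_add, map_add, hp, hq, map_add, map_add]
  | hs c p hp => rw [map_smul, map_smul, hp, map_smul, map_smul]
  | hz j p hp =>
    rw [negVars_zvar_mul, map_neg, hermite_zvar_mul, hp, hermite_zvar_mul, creation_apply,
      creation_apply, map_sub, map_smul, map_smul, negVars_zvar_mul, hd]
    module

theorem hermite_surjective : Function.Surjective (hermite (m := m) (n := n)) := by
  intro p
  induction p using Fock.induction with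
  | h1 => exact ⟨1, hermite_one⟩
  | ha p q hp hq =>
    obtain ⟨p', rfl⟩ := hp
    obtain ⟨q', rfl⟩ := hq
    exact ⟨p' + q', map_add _ _ _⟩
  | hs c p hp =>
    obtain ⟨p', rfl⟩ := hp
    exact ⟨c • p', map_smul _ _ _⟩
  | hz i p hp =>
    obtain ⟨p', rfl⟩ := hp
    refine ⟨(1 / 2 : ℂ) • (zvar i * p' + dF i p'), ?_⟩
    rw [map_smul, map_add, hermite_zvar_mul, hermite_dF, creation_apply]
    module

/-- The inverse of the Segal-Bargmann transform: it takes `1` to `exp(-R²)` and intertwines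
multiplication by `z_i` with `x_i - ½ ∂_i`. -/
def invSB : Fock m n →ₗ[ℂ] SFR m n := schroMap ∘ₗ hermite

theorem invSB_apply (p : Fock m n) : invSB p = schroMap (hermite p) := rfl

end hermite

/-! ### The metaplectic Schrödinger model consists of all `p exp(-R²)` -/

section model
variable {m n : ℕ}

theorem schrodingerModel_le : schrodingerModel m n ≤ LinearMap.range (schroMap (m := m) (n := n)) := by
  refine sInf_le ⟨⟨1, schroMap_one⟩, fun i _ => ⟨zvar i * 1, ?_⟩, ?_, ?_⟩
  · rw [← xvar_mul_schroMap, schroMap_one]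
  · rintro i j _ ⟨p, rfl⟩
    refine ⟨zvar i * (zvar j * p), ?_⟩
    rw [← xvar_mul_schroMap, ← xvar_mul_schroMap, mul_assoc]
  · rintro i j _ ⟨p, rfl⟩
    rw [dR_schroMap, dR_schroMap]
    exact ⟨_, rfl⟩

/-- From `z_k` one reaches `z_i`, for every `i` that is not dual to `k`, by applying `∂_i` and the
derivative that is dual to `z_k`; for an even `k` this includes `i = k`. -/
theorem schroMap_zvar_mem {N : Submodule ℂ (SFR m n)}
    (hx : ∀ i j, ∀ f ∈ N, xvar i * xvar j * f ∈ N) (hd : ∀ i j, ∀ f ∈ N, dR i (dR j f) ∈ N)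
    {i k : Idx m n} (hk : schroMap (zvar k) ∈ N) (hik : i ≠ dual k ∨ par k = 0) :
    schroMap (zvar i) ∈ N := by
  have h1 := hd i (dual k) _ hk
  have h2 := hx i (dual k) _ hk
  rw [mul_assoc, xvar_mul_schroMap, xvar_mul_schroMap] at h2
  rw [dR_schroMap, dR_schroMap] at h1
  have hz : ∀ i j : Idx m n, dF i (zvar j) = beta i j • (1 : Fock m n) := fun i j => by
    have := dF_zvar_mul i j (1 : Fock m n)
    rwa [mul_one, dF_one, mul_zero, smul_zero, add_zero] at this
  have h3 : dF i (dF (dual k) (zvar k) - (2 : ℂ) • (zvar (dual k) * zvar k)) -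
      (2 : ℂ) • (zvar i * (dF (dual k) (zvar k) - (2 : ℂ) • (zvar (dual k) * zvar k))) =
      (4 : ℂ) • (zvar i * (zvar (dual k) * zvar k)) - (2 * beta i (dual k)) • zvar k -
      ((2 : ℂ) • (beta (dual k) k • zvar i + (eps i (dual k) * beta i k) • zvar (dual k))) := by
    rw [map_sub, map_smul, dF_zvar_mul, hz, hz, map_smul, dF_one, mul_sub, mul_smul_comm,
      mul_smul_comm, mul_one, mul_smul_comm, mul_one]
    module
  rw [h3, map_sub, map_sub, map_smul, map_smul] at h1
  have h4 : schroMap ((2 : ℂ) • (beta (dual k) k • zvar i +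
      (eps i (dual k) * beta i k) • zvar (dual k))) ∈ N := by
    have h5 := N.sub_mem (N.sub_mem (N.smul_mem 4 h2) (N.smul_mem (2 * beta i (dual k)) hk)) h1
    rwa [sub_sub_cancel] at h5
  obtain ⟨c, hc, h6⟩ : ∃ c : ℂ, c ≠ 0 ∧ (2 : ℂ) • (beta (dual k) k • zvar i +
      (eps i (dual k) * beta i k) • zvar (dual k)) = c • (zvar i : Fock m n) := by
    have hb : beta (dual k) k ≠ 0 := by
      rw [beta_eq, dual_dual, if_pos rfl]
      intro h
      have := betaSign_sq (dual k)
      rw [h, zero_mul] at this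
      exact zero_ne_one this
    by_cases h : i = dual k
    · have hp := hik.resolve_left (fun h' => h' h)
      refine ⟨4 * beta (dual k) k, mul_ne_zero (by norm_num) hb, ?_⟩
      rw [h, eps, par_dual, hp, mul_zero, pow_zero, one_mul]
      module
    · refine ⟨2 * beta (dual k) k, mul_ne_zero (by norm_num) hb, ?_⟩
      have : beta i k = 0 := by
        rw [beta_eq, if_neg]
        intro h'
        exact h (by rw [h', dual_dual])
      rw [this]
      module
  rw [h6, map_smul] at h4
  exact (N.smul_mem_iff hc).1 h4

theorem schroMap_zvar_mem_schrodingerModel (hmn : (m, n) ≠ (0, 1)) (i : Idx m n) :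
    schroMap (zvar i) ∈ schrodingerModel m n := by
  refine Submodule.mem_sInf.2 fun N hN => ?_
  obtain ⟨-, h1, hx, hd⟩ := hN
  have hfirst : ∀ k, IsFirst k → schroMap (zvar k : Fock m n) ∈ N := fun k hk => by
    have := h1 k hk
    rwa [← schroMap_one, xvar_mul_schroMap, mul_one] at this
  by_cases hm : 0 < m
  · exact schroMap_zvar_mem hx hd (hfirst (Sum.inl ⟨0, hm⟩) rfl) (Or.inr rfl)
  · have hm0 : m = 0 := by omega
    subst hm0
    rcases i with i | a
    · exact i.elim0
    have ha := a.2
    have hn : 2 ≤ n := by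
      by_contra hn
      exact hmn (by rw [show n = 1 by omega])
    -- the odd variable `z_1` yields all variables except its dual, which is reached from `z_2`
    have h0 := hfirst (Sum.inr ⟨0, by omega⟩) ⟨rfl, rfl⟩
    by_cases h : (Sum.inr a : Idx 0 n) = dual (Sum.inr ⟨0, by omega⟩)
    · refine schroMap_zvar_mem (k := Sum.inr ⟨1, by omega⟩) hx hd
        (schroMap_zvar_mem hx hd h0 (Or.inl ?_)) (Or.inl ?_)
      · rw [dual_inr, odual, dif_pos (by simp; omega)]
        intro h'
        have := congrArg Fin.val (Sum.inr_injective h')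
        simp at this
        omega
      · rw [h, dual_inr, dual_inr, odual, odual, dif_pos (by simp; omega), dif_pos (by simp; omega)]
        intro h'
        have := congrArg Fin.val (Sum.inr_injective h')
        simp at this
    · exact schroMap_zvar_mem hx hd h0 (Or.inl h)

/-- The metaplectic Schrödinger model consists of all superfunctions `p exp(-R²)`. -/
theorem schrodingerModel_eq (hmn : (m, n) ≠ (0, 1)) :
    schrodingerModel m n = LinearMap.range (schroMap (m := m) (n := n)) := by
  refine le_antisymm schrodingerModel_le ?_
  rintro _ ⟨p, rfl⟩
  have hx : ∀ i j, ∀ f ∈ schrodingerModel m n, xvar i * xvar j * f ∈ schrodingerModel m n :=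
    fun i j f hf => Submodule.mem_sInf.2 fun N hN => hN.2.2.1 i j f (Submodule.mem_sInf.1 hf N hN)
  suffices h : schroMap p ∈ schrodingerModel m n ∧
      ∀ i, schroMap (zvar i * p) ∈ schrodingerModel m n from h.1
  induction p using Fock.induction with
  | h1 =>
    refine ⟨?_, fun i => by rw [mul_one]; exact schroMap_zvar_mem_schrodingerModel hmn i⟩
    rw [schroMap_one]
    exact Submodule.mem_sInf.2 fun N hN => hN.1
  | ha p q hp hq =>
    refine ⟨by rw [map_add]; exact add_mem hp.1 hq.1, fun i => ?_⟩
    rw [mul_add, map_add]; exact add_mem (hp.2 i) (hq.2 i)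
  | hs c p hp =>
    refine ⟨by rw [map_smul]; exact Submodule.smul_mem _ c hp.1, fun i => ?_⟩
    rw [mul_smul_comm, map_smul]; exact Submodule.smul_mem _ c (hp.2 i)
  | hz j p hp =>
    refine ⟨hp.2 j, fun i => ?_⟩
    rw [← xvar_mul_schroMap, ← xvar_mul_schroMap, ← mul_assoc]
    exact hx i j _ hp.1

theorem range_invSB (hmn : (m, n) ≠ (0, 1)) :
    LinearMap.range (invSB (m := m) (n := n)) = schrodingerModel m n := by
  rw [schrodingerModel_eq hmn, invSB, LinearMap.range_comp_of_range_eq_top _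
    (LinearMap.range_eq_top.2 hermite_surjective)]

end model


/-! ### Odd Gaussians -/

namespace Gr

section pull
variable {R τ τ' : Type*} [CommRing R] [LinearOrder τ] [LinearOrder τ'] [Algebra ℂ R]

/-- The coefficients of the monomials in the odd variables in the range of `e`: the operation of
setting the other odd variables to zero. -/
def pull (e : τ ↪o τ') : Gr R τ' →ₗ[ℂ] Gr R τ where
  toFun F S := F (S.map e.toEmbedding)
  map_add' _ _ := rfl
  map_smul' _ _ := rfl

theorem pull_apply (e : τ ↪o τ') (F : Gr R τ') (S : Finset τ) :
    pull e F S = F (S.map e.toEmbedding) := rfl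

theorem filter_map_lt (e : τ ↪o τ') (S : Finset τ) (a : τ) :
    (S.map e.toEmbedding).filter (fun s => s < e a) =
      (S.filter fun s => s < a).map e.toEmbedding := by
  rw [Finset.filter_map]
  congr 1
  ext s
  simp

theorem pull_gen_mul (e : τ ↪o τ') (a : τ) (F : Gr R τ') :
    pull e (gen (e a) * F) = gen a * pull e F := by
  ext1 S
  refine (gen_mul_apply (e a) F _).trans (Eq.trans ?_ (gen_mul_apply a (pull e F) S).symm)
  have h : e a ∈ S.map e.toEmbedding ↔ a ∈ S := Finset.mem_map' e.toEmbedding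
  rw [filter_map_lt, Finset.card_map]
  simp only [h, pull_apply]
  rw [Finset.map_erase]
  rfl

theorem pull_gen_mul_of_ne (e : τ ↪o τ') {t : τ'} (ht : ∀ a, e a ≠ t) (F : Gr R τ') :
    pull e (gen t * F) = 0 := by
  ext1 S
  refine (gen_mul_apply t F _).trans ?_
  rw [if_neg]
  · rfl
  · intro h
    obtain ⟨a, -, ha⟩ := Finset.mem_map.1 h
    exact ht a ha

theorem pull_pdOdd (e : τ ↪o τ') (a : τ) (F : Gr R τ') :
    pull e (pdOdd (e a) F) = pdOdd a (pull e F) := by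
  ext1 S
  change (if e a ∈ S.map e.toEmbedding then 0 else _) = if a ∈ S then 0 else _
  have h : e a ∈ S.map e.toEmbedding ↔ a ∈ S := Finset.mem_map' e.toEmbedding
  rw [filter_map_lt, Finset.card_map]
  simp only [h, pull_apply]
  rw [Finset.map_insert]
  rfl

theorem pdOdd_pdOdd [Fintype τ] (s t : τ) (f : Gr R τ) :
    pdOdd s (pdOdd t f) = -pdOdd t (pdOdd s f) := by
  simp only [← pdOddₗ_apply]
  induction f using Gr.induction with
  | hc r =>
    simp only [pdOddₗ_apply, pdOdd_const]
    rw [← pdOddₗ_apply, ← pdOddₗ_apply, map_zero, map_zero, neg_zero]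
  | ha f g hf hg => rw [map_add, map_add, hf, hg, map_add, map_add, neg_add]
  | hg u f hf =>
    rw [pdOddₗ_apply t, pdOddₗ_apply s (gen u * f), pdOdd_gen_mul, pdOdd_gen_mul, map_sub, map_sub,
      pdOddₗ_apply s (gen u * _), pdOddₗ_apply t (gen u * _), pdOdd_gen_mul, pdOdd_gen_mul,
      ← pdOddₗ_apply s (pdOdd t f), ← pdOddₗ_apply t f, hf, mul_neg]
    simp only [apply_ite (pdOddₗ s), apply_ite (pdOddₗ t), map_zero, pdOddₗ_apply]
    abel

end pull

/-- An element of a Grassmann algebra is determined by its derivatives and its scalar part. -/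
theorem eq_const_of_pdOdd {τ : Type*} [LinearOrder τ] {x : Gr ℂ τ}
    (h : ∀ a, pdOdd a x = 0) : x = x ∅ • 1 := by
  ext1 S
  rw [smul_apply, one_apply]
  split_ifs with hS
  · rw [hS]; simp
  · obtain ⟨a, ha⟩ := Finset.nonempty_iff_ne_empty.2 hS
    have := congrFun (h a) (S.erase a)
    rw [pdOdd, if_neg (Finset.notMem_erase a S), Finset.insert_erase ha] at this
    rw [smul_zero]
    exact (mul_eq_zero.1 this).resolve_left (pow_ne_zero _ (by norm_num))

end Gr

section oddGaussian
variable {n : ℕ}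

/-- The differential equation of the odd Gaussian `exp(-c/2 θ • θ)`. -/
def IsOddGaussian (c : ℂ) (x : Gr ℂ (Fin (2 * n))) : Prop :=
  ∀ a, Gr.pdOdd a x = (c * osign a) • (Gr.gen (odual a) * x)

theorem isOddGaussian_oddGauss (c : ℂ) : IsOddGaussian (n := n) (-2 * c) (oddGauss c id id) := by
  intro a
  rw [pdOdd_oddGauss]
  have := pdOdd_self_oddTrace (e := (id : Fin (2 * n) → _)) Function.injective_id a
  rw [id, id] at this
  rw [this, smul_mul_assoc, smul_smul]
  congr 1
  ring

theorem odual_ne (a : Fin (2 * n)) : odual a ≠ a := by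
  intro h
  have h1 := osign_odual a
  have h2 := osign_sq a
  rw [h] at h1
  have h3 : osign a = 0 := by linear_combination (1 / 2 : ℂ) * h1
  rw [h3, mul_zero] at h2
  exact zero_ne_one h2

/-- The coefficients of an odd Gaussian satisfy a recursion that removes a dual pair of odd
variables from a monomial. -/
theorem IsOddGaussian.recursion {c : ℂ} {x : Gr ℂ (Fin (2 * n))} (hx : IsOddGaussian c x)
    {a : Fin (2 * n)} {S : Finset (Fin (2 * n))} (ha : a ∈ S) :
    ∃ k l : ℕ, (-1) ^ k * x S = c * osign a * (if odual a ∈ S.erase a then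
      (-1) ^ l * x ((S.erase a).erase (odual a)) else 0) := by
  refine ⟨((S.erase a).filter fun s => s < a).card,
    ((S.erase a).filter fun s => s < odual a).card, ?_⟩
  have h := congrFun (hx a) (S.erase a)
  rw [Gr.pdOdd, if_neg (Finset.notMem_erase a S), Finset.insert_erase ha] at h
  rw [h]
  refine (Gr.smul_apply _ _ _).trans ?_
  rw [Gr.gen_mul_apply, smul_eq_mul]

theorem IsOddGaussian.ext {c : ℂ} {x y : Gr ℂ (Fin (2 * n))} (hx : IsOddGaussian c x)
    (hy : IsOddGaussian c y) (h : x ∅ = y ∅) : x = y := by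
  have key : ∀ k : ℕ, ∀ S : Finset (Fin (2 * n)), S.card = k → x S = y S := by
    intro k
    induction k using Nat.strong_induction_on with
    | _ k ih =>
      intro S hS
      by_cases hS0 : S = ∅
      · rw [hS0, h]
      · obtain ⟨a, ha⟩ := Finset.nonempty_iff_ne_empty.2 hS0
        have h1 := congrFun (hx a) (S.erase a)
        have h2 := congrFun (hy a) (S.erase a)
        rw [Gr.pdOdd, if_neg (Finset.notMem_erase a S), Finset.insert_erase ha] at h1 h2
        have h3 : (Gr.gen (odual a) * x : Gr ℂ _) (S.erase a) =
            (Gr.gen (odual a) * y : Gr ℂ _) (S.erase a) := by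
          rw [Gr.gen_mul_apply, Gr.gen_mul_apply]
          split_ifs with hb
          · rw [ih _ _ _ rfl]
            rw [Finset.card_erase_of_mem hb, Finset.card_erase_of_mem ha, hS]
            have : 0 < S.card := Finset.card_pos.2 ⟨a, ha⟩
            omega
          · rfl
        rw [Gr.smul_apply (c * osign a) (Gr.gen (odual a) * x), h3] at h1
        rw [Gr.smul_apply (c * osign a) (Gr.gen (odual a) * y), ← h1] at h2
        exact (mul_left_cancel₀ (pow_ne_zero _ (by norm_num)) h2).symm
  ext1 S
  exact key _ S rfl

/-- The Berezin integral of an odd Gaussian does not vanish. -/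
theorem IsOddGaussian.apply_univ_ne {c : ℂ} (hc : c ≠ 0) {x : Gr ℂ (Fin (2 * n))}
    (hx : IsOddGaussian c x) (h : x ∅ ≠ 0) : x Finset.univ ≠ 0 := by
  have key : ∀ k : ℕ, ∀ S : Finset (Fin (2 * n)), S.card = k → (∀ a ∈ S, odual a ∈ S) →
      x S ≠ 0 := by
    intro k
    induction k using Nat.strong_induction_on with
    | _ k ih =>
      intro S hS hd
      by_cases hS0 : S = ∅
      · rwa [hS0]
      · obtain ⟨a, ha⟩ := Finset.nonempty_iff_ne_empty.2 hS0
        have hb : odual a ∈ S.erase a := Finset.mem_erase.2 ⟨odual_ne a, hd a ha⟩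
        obtain ⟨k', l, hkl⟩ := hx.recursion ha
        rw [if_pos hb] at hkl
        intro h0
        rw [h0, mul_zero] at hkl
        have ho : osign a ≠ 0 := fun h => by
          have := osign_sq a
          rw [h, mul_zero] at this
          exact zero_ne_one this
        have h1 := (mul_eq_zero.1 hkl.symm).resolve_left (mul_ne_zero hc ho)
        refine ih _ ?_ _ rfl ?_ ((mul_eq_zero.1 h1).resolve_left (pow_ne_zero _ (by norm_num)))
        · rw [Finset.card_erase_of_mem hb, Finset.card_erase_of_mem ha, hS]
          have : 0 < S.card := Finset.card_pos.2 ⟨a, ha⟩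
          omega
        · intro b hbS
          simp only [Finset.mem_erase] at hbS ⊢
          refine ⟨fun h' => hbS.2.1 ?_, fun h' => hbS.1 ?_, hd b hbS.2.2⟩
          · rw [← odual_odual b, h', odual_odual]
          · rw [← h', odual_odual]
  exact key _ _ rfl fun _ _ => Finset.mem_univ _

theorem isOddGaussian_oddGaussian : IsOddGaussian 2 (oddGaussian n) := pdOdd_oddGaussian

theorem oddGaussian_empty : oddGaussian n ∅ = 1 := oddGauss_empty _ _ _

theorem parity_oddGaussian : Gr.parity (oddGaussian n) = oddGaussian n := parity_oddGauss _ _ _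

theorem conjGr_oddGaussian : conjGr (oddGaussian n) = oddGaussian n := by
  refine IsOddGaussian.ext (c := 2) (fun a => ?_) isOddGaussian_oddGaussian ?_
  · have h : (starRingEnd ℂ) (2 * osign a) = 2 * osign a := by
      rw [osign, map_mul, map_ofNat]; split_ifs <;> simp
    rw [conjGr, Gr.pdOdd_mapCoeff, pdOdd_oddGaussian]
    refine (conjGr_smul _ _).trans ?_
    rw [h]
    refine congrArg _ ?_
    rw [conjGr, Gr.mapCoeff_mul, Gr.mapCoeff_gen]
  · change (starRingEnd ℂ) (oddGaussian n ∅) = _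
    rw [oddGaussian_empty, map_one]

theorem mul_empty {τ : Type*} [LinearOrder τ] (x y : Gr ℂ τ) : (x * y : Gr ℂ τ) ∅ = x ∅ * y ∅ := by
  rw [Gr.mul_apply]
  simp [Gr.inv]

theorem oddGaussian_mul_self : oddGaussian n * oddGaussian n = oddGauss (-2) id id := by
  have h4 : IsOddGaussian (n := n) 4 (oddGauss (-2) id id) := by
    have := isOddGaussian_oddGauss (n := n) (-2)
    norm_num at this
    exact this
  refine IsOddGaussian.ext (c := 4) (fun a => ?_) h4 ?_
  · rw [Gr.pdOdd_mul, parity_oddGaussian, pdOdd_oddGaussian, mul_smul_comm, ← mul_assoc,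
      Gr.mul_comm_of_even parity_oddGaussian (Gr.gen _), smul_mul_assoc, mul_assoc]
    module
  · rw [mul_empty, oddGaussian_empty, oddGauss_empty, mul_one]

theorem isUnit_oddGaussian : IsUnit (oddGaussian n) := by
  have h0 : (oddGaussian n - 1) ∅ = 0 := by
    rw [Gr.sub_apply, oddGaussian_empty, Gr.one_apply, if_pos rfl, sub_self]
  have h : IsNilpotent (oddGaussian n - 1) := by
    refine ⟨Fintype.card (Fin (2 * n)) + 1, ?_⟩
    ext1 S
    refine Gr.pow_apply_of_card_lt h0 _ S ?_
    exact Nat.lt_succ_of_le (Finset.card_le_univ S)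
  have := h.isUnit_one_add
  rwa [add_sub_cancel] at this

end oddGaussian

/-! ### The odd part of the Segal-Bargmann transform -/

section oddSB
variable {n : ℕ}

/-- The Berezin integral over the second copy of the odd variables, with values in the Grassmann
algebra of both copies, for the list `l` of variables. -/
def berezinSnd {R : Type*} [CommRing R] [Algebra ℂ R] :
    List (Fin (2 * n)) → (Gr R (Odd2 n) →ₗ[ℂ] Gr R (Odd2 n))
  | [] => LinearMap.id
  | a :: l => berezinSnd l ∘ₗ Gr.pdOddₗ (oddSnd n a)

section general
variable {R : Type*} [CommRing R] [Algebra ℂ R]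

theorem foldl_pdOdd_oddSnd (l : List (Fin (2 * n))) (F : Gr R (Odd2 n)) :
    l.foldl (fun g t => Gr.pdOdd (oddSnd n t) g) F = berezinSnd l F := by
  induction l generalizing F with
  | nil => rfl
  | cons a l ih => rw [List.foldl_cons, ih]; rfl

theorem berezinSnd_cons (a : Fin (2 * n)) (l : List (Fin (2 * n))) (F : Gr R (Odd2 n)) :
    berezinSnd (a :: l) F = berezinSnd l (Gr.pdOdd (oddSnd n a) F) := rfl

theorem berezinSnd_pdOdd_snd (l : List (Fin (2 * n))) {b : Fin (2 * n)} (hb : b ∈ l)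
    (F : Gr R (Odd2 n)) : berezinSnd l (Gr.pdOdd (oddSnd n b) F) = 0 := by
  induction l generalizing F with
  | nil => simp at hb
  | cons a l ih =>
    rw [berezinSnd_cons]
    rcases List.mem_cons.1 hb with rfl | hb
    · have h := Gr.pdOdd_pdOdd (oddSnd n b) (oddSnd n b) F
      have h2 : Gr.pdOdd (oddSnd n b) (Gr.pdOdd (oddSnd n b) F) = 0 := by
        have h3 : (2 : ℂ) • Gr.pdOdd (oddSnd n b) (Gr.pdOdd (oddSnd n b) F) = 0 := by
          rw [two_smul]; nth_rewrite 1 [h]; rw [neg_add_cancel]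
        exact (smul_eq_zero_iff_right two_ne_zero).1 h3
      rw [h2, map_zero]
    · rw [Gr.pdOdd_pdOdd, map_neg, ih hb, neg_zero]

theorem berezinSnd_gen_fst_mul (l : List (Fin (2 * n))) (a : Fin (2 * n)) (F : Gr R (Odd2 n)) :
    berezinSnd l (Gr.gen (oddFst n a) * F) =
      ((-1 : ℂ) ^ l.length) • (Gr.gen (oddFst n a) * berezinSnd l F) := by
  induction l generalizing F with
  | nil => simp [berezinSnd]
  | cons b l ih =>
    rw [berezinSnd_cons, Gr.pdOdd_gen_mul, if_neg (oddFst_ne_oddSnd a b), zero_sub, map_neg, ih,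
      berezinSnd_cons, List.length_cons, pow_succ]
    module

theorem berezinSnd_pdOdd_fst (l : List (Fin (2 * n))) (a : Fin (2 * n)) (F : Gr R (Odd2 n)) :
    berezinSnd l (Gr.pdOdd (oddFst n a) F) =
      ((-1 : ℂ) ^ l.length) • Gr.pdOdd (oddFst n a) (berezinSnd l F) := by
  induction l generalizing F with
  | nil => simp [berezinSnd]
  | cons b l ih =>
    rw [berezinSnd_cons, Gr.pdOdd_pdOdd, map_neg, ih, berezinSnd_cons, List.length_cons, pow_succ]
    module

theorem pull_snd_berezinSnd (l : List (Fin (2 * n))) (F : Gr R (Odd2 n)) :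
    Gr.pull (oddSnd n) (berezinSnd l F) =
      l.foldl (fun g t => Gr.pdOdd t g) (Gr.pull (oddSnd n) F) := by
  induction l generalizing F with
  | nil => rfl
  | cons b l ih => rw [berezinSnd_cons, ih, Gr.pull_pdOdd, List.foldl_cons]

end general

/-- The odd part of the kernel `exp(2 z • x) exp(-R_x²)`. -/
def oddKernel (n : ℕ) : Gr ℂ (Odd2 n) :=
  oddGauss 2 (oddFst n) (oddSnd n) * oddGauss (-1) (oddSnd n) (oddSnd n)

theorem parity_oddKernel : Gr.parity (oddKernel n) = oddKernel n := by
  rw [oddKernel, Gr.parity_mul, parity_oddGauss, parity_oddGauss]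

theorem oddSnd_injective : Function.Injective (oddSnd n) := (oddSnd n).injective

theorem oddFst_injective : Function.Injective (oddFst n) := (oddFst n).injective

theorem pdOdd_snd_oddKernel (b : Fin (2 * n)) : Gr.pdOdd (oddSnd n b) (oddKernel n) =
    (-2 * osign b) • (Gr.gen (oddFst n (odual b)) * oddKernel n) +
      (2 * osign b) • (Gr.gen (oddSnd n (odual b)) * oddKernel n) := by
  have hE : Gr.parity (oddGauss 2 (oddFst n) (oddSnd n)) = oddGauss 2 (oddFst n) (oddSnd n) :=
    parity_oddGauss _ _ _
  rw [oddKernel, Gr.pdOdd_mul, hE, pdOdd_oddGauss, pdOdd_oddGauss,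
    pdOdd_right_oddTrace oddSnd_injective oddFst_ne_oddSnd, pdOdd_self_oddTrace oddSnd_injective]
  simp only [smul_mul_assoc, mul_smul_comm, smul_smul, ← mul_assoc]
  rw [Gr.mul_comm_of_even hE (Gr.gen _)]
  module

theorem pdOdd_fst_oddKernel (a : Fin (2 * n)) : Gr.pdOdd (oddFst n a) (oddKernel n) =
    (-2 * osign a) • (Gr.gen (oddSnd n (odual a)) * oddKernel n) := by
  rw [oddKernel, Gr.pdOdd_mul, pdOdd_oddGauss, pdOdd_oddGauss,
    pdOdd_left_oddTrace oddFst_injective oddFst_ne_oddSnd,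
    pdOdd_other_oddTrace (fun b => (oddFst_ne_oddSnd a b).symm)
      (fun b => (oddFst_ne_oddSnd a b).symm)]
  simp only [smul_mul_assoc, smul_smul, mul_assoc, zero_mul, smul_zero, mul_zero, add_zero]
  congr 1
  ring

/-- The odd part of the integral `∫ exp(2 z • x) exp(-R_x²) y(x) dx`. -/
def oddInt : Gr ℂ (Fin (2 * n)) →ₗ[ℂ] Gr ℂ (Fin (2 * n)) where
  toFun y := ((Real.pi : ℂ) ^ n)⁻¹ • Gr.pull (oddFst n)
    (berezinSnd (List.finRange (2 * n)) (oddKernel n * Gr.relabel (oddSnd n) y))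
  map_add' x y := by rw [Gr.relabel_add, mul_add, map_add, map_add, smul_add]
  map_smul' c x := by
    rw [Gr.relabel_smul, mul_smul_comm, map_smul, map_smul, smul_comm, RingHom.id_apply]

theorem oddInt_apply (y : Gr ℂ (Fin (2 * n))) : oddInt y = ((Real.pi : ℂ) ^ n)⁻¹ •
    Gr.pull (oddFst n)
      (berezinSnd (List.finRange (2 * n)) (oddKernel n * Gr.relabel (oddSnd n) y)) := rfl

theorem neg_one_pow_length : (-1 : ℂ) ^ (List.finRange (2 * n)).length = 1 := by
  rw [List.length_finRange, pow_mul]; simp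

/-- Integration by parts in an odd variable. -/
theorem oddInt_creation (a : Fin (2 * n)) (y : Gr ℂ (Fin (2 * n))) :
    oddInt (Gr.gen a * y - (1 / 2 * osign a : ℂ) • Gr.pdOdd (odual a) y) =
      Gr.gen a * oddInt y := by
  have h := berezinSnd_pdOdd_snd (List.finRange (2 * n)) (List.mem_finRange (odual a))
    (oddKernel n * Gr.relabel (oddSnd n) y)
  rw [Gr.pdOdd_mul, parity_oddKernel, pdOdd_snd_oddKernel, odual_odual, osign_odual,
    Gr.pdOdd_relabel, add_mul, smul_mul_assoc, smul_mul_assoc, mul_assoc, mul_assoc, map_add,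
    map_add, map_smul, map_smul, berezinSnd_gen_fst_mul, neg_one_pow_length, one_smul] at h
  rw [oddInt_apply, oddInt_apply, mul_smul_comm, ← Gr.pull_gen_mul]
  refine congrArg _ (congrArg _ ?_)
  have hr : Gr.relabel (oddSnd n) (Gr.gen a * y - (1 / 2 * osign a : ℂ) • Gr.pdOdd (odual a) y) =
      Gr.gen (oddSnd n a) * Gr.relabel (oddSnd n) y -
        (1 / 2 * osign a : ℂ) • Gr.relabel (oddSnd n) (Gr.pdOdd (odual a) y) := by
    rw [sub_eq_add_neg, ← neg_smul, Gr.relabel_add, Gr.relabel_smul, Gr.relabel_gen_mul]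
    module
  rw [hr, mul_sub, map_sub, mul_smul_comm, map_smul, ← mul_assoc,
    Gr.mul_comm_of_even parity_oddKernel (Gr.gen _), mul_assoc]
  generalize berezinSnd (List.finRange (2 * n))
    (Gr.gen (oddSnd n a) * (oddKernel n * Gr.relabel (oddSnd n) y)) = A at h ⊢
  generalize Gr.gen (oddFst n a) * berezinSnd (List.finRange (2 * n))
    (oddKernel n * Gr.relabel (oddSnd n) y) = B at h ⊢
  generalize berezinSnd (List.finRange (2 * n))
    (oddKernel n * Gr.relabel (oddSnd n) (Gr.pdOdd (odual a) y)) = C at h ⊢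
  have hs := osign_sq a
  have h2 : C = (2 * osign a) • (A - B) := by
    rw [← sub_eq_zero, ← h]; module
  rw [h2, smul_smul]
  have : (1 / 2 * osign a * (2 * osign a) : ℂ) = 1 := by linear_combination hs
  rw [this, one_smul, sub_sub_cancel]

theorem pdOdd_oddInt (a : Fin (2 * n)) (y : Gr ℂ (Fin (2 * n))) :
    Gr.pdOdd a (oddInt y) = (-2 * osign a) • oddInt (Gr.gen (odual a) * y) := by
  rw [oddInt_apply, oddInt_apply, Gr.pdOdd_smul, ← Gr.pull_pdOdd]
  have h := berezinSnd_pdOdd_fst (List.finRange (2 * n)) a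
    (oddKernel n * Gr.relabel (oddSnd n) y)
  rw [neg_one_pow_length, one_smul] at h
  rw [← h, Gr.pdOdd_mul, pdOdd_fst_oddKernel,
    Gr.pdOdd_relabel_of_ne _ _ (fun b => (oddFst_ne_oddSnd a b).symm), mul_zero, add_zero,
    Gr.relabel_gen_mul, smul_mul_assoc, map_smul, map_smul, ← mul_assoc (oddKernel n),
    Gr.mul_comm_of_even parity_oddKernel (Gr.gen _), smul_comm]

/-- The odd part of the Segal-Bargmann transform, up to a constant. -/
def oddSB : Gr ℂ (Fin (2 * n)) →ₗ[ℂ] Gr ℂ (Fin (2 * n)) :=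
  LinearMap.mulLeft ℂ (oddGauss (-(1 / 2)) id id) ∘ₗ oddInt

theorem oddSB_apply (y : Gr ℂ (Fin (2 * n))) :
    oddSB y = oddGauss (-(1 / 2)) id id * oddInt y := rfl

theorem oddSB_creation (a : Fin (2 * n)) (y : Gr ℂ (Fin (2 * n))) :
    oddSB (Gr.gen a * y - (1 / 2 * osign a : ℂ) • Gr.pdOdd (odual a) y) =
      Gr.gen a * oddSB y := by
  rw [oddSB_apply, oddInt_creation, oddSB_apply, ← mul_assoc, ← mul_assoc,
    Gr.mul_comm_of_even (parity_oddGauss _ _ _) (Gr.gen _)]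

theorem oddSB_oddGaussian : oddSB (oddGaussian n) = (oddInt (oddGaussian n) ∅) • 1 := by
  have h : ∀ a, Gr.pdOdd a (oddSB (oddGaussian n)) = 0 := by
    intro a
    have hp : Gr.parity (oddGauss (-(1 / 2)) id id : Gr ℂ (Fin (2 * n))) =
      oddGauss (-(1 / 2)) id id := parity_oddGauss _ _ _
    have h1 := isOddGaussian_oddGauss (n := n) (-(1 / 2)) a
    have h2 := oddSB_creation (odual a) (oddGaussian n)
    rw [odual_odual, pdOdd_oddGaussian, osign_odual, smul_smul] at h2
    have h3 : (1 / 2 * -osign a * (2 * osign a) : ℂ) = -1 := by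
      linear_combination -osign_sq a
    rw [h3, neg_one_smul, sub_neg_eq_add, ← two_smul ℂ, map_smul] at h2
    rw [oddSB_apply, Gr.pdOdd_mul, hp, h1, pdOdd_oddInt, mul_smul_comm, smul_mul_assoc,
      mul_assoc (Gr.gen _), ← oddSB_apply, ← oddSB_apply, ← h2]
    module
  rw [Gr.eq_const_of_pdOdd h, oddSB_apply, mul_empty, oddGauss_empty, one_mul]

/-- Setting the odd variables `z` to zero in the kernel `exp(2 z • x)` gives `1`. -/
theorem pull_snd_oddKernel_mul (y : Gr ℂ (Fin (2 * n))) :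
    Gr.pull (oddSnd n) (oddKernel n * Gr.relabel (oddSnd n) y) = y * oddGaussian n := by
  induction y using Gr.induction with
  | hc r =>
    have h1 : Gr.pull (oddSnd n) (oddKernel n) = oddGaussian n := by
      refine IsOddGaussian.ext (c := 2) (fun a => ?_) isOddGaussian_oddGaussian ?_
      · rw [← Gr.pull_pdOdd, pdOdd_snd_oddKernel, map_add, map_smul, map_smul, Gr.pull_gen_mul,
          Gr.pull_gen_mul_of_ne _ (fun b => (oddFst_ne_oddSnd _ b).symm), smul_zero, zero_add]
      · rw [Gr.pull_apply, Finset.map_empty, oddKernel, mul_empty, oddGauss_empty, oddGauss_empty,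
          oddGaussian_empty, mul_one]
    rw [Gr.relabel_const, ← Gr.const_mul_comm, Gr.const_mul_eq_smul, map_smul, h1,
      Gr.const_mul_eq_smul]
  | ha f g hf hg => rw [Gr.relabel_add, mul_add, map_add, hf, hg, add_mul]
  | hg t f hf =>
    rw [Gr.relabel_gen_mul, ← mul_assoc, Gr.mul_comm_of_even parity_oddKernel (Gr.gen _),
      mul_assoc, Gr.pull_gen_mul, hf, mul_assoc]

theorem oddInt_empty (y : Gr ℂ (Fin (2 * n))) : oddInt y ∅ = ((Real.pi : ℂ) ^ n)⁻¹ *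
    ((List.finRange (2 * n)).foldl (fun g t => Gr.pdOdd t g) (y * oddGaussian n)) ∅ := by
  rw [← pull_snd_oddKernel_mul, ← pull_snd_berezinSnd, oddInt_apply]
  rfl

end oddSB


/-! ### Gaussian integrals of polynomials -/

section bosonicSB
variable {m : ℕ}

theorem integrable_exp_mul_pow (w : ℂ) (k : ℕ) :
    Integrable fun x : ℝ => Complex.exp (2 * w * x - 2 * x ^ 2) * (x : ℂ) ^ k := by
  have hb : (-2 : ℂ).re < 0 := by norm_num
  have h1 := (integrable_cexp_quadratic' hb (2 * w + 1) 0).norm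
  have h2 := (integrable_cexp_quadratic' hb (2 * w - 1) 0).norm
  refine ((h1.add h2).const_mul (k.factorial : ℝ)).mono' (by fun_prop)
    (Filter.Eventually.of_forall fun x => ?_)
  have h3 : |x| ^ k ≤ k.factorial * Real.exp |x| := by
    have := Real.pow_div_factorial_le_exp |x| (abs_nonneg x) k
    rwa [div_le_iff₀ (by positivity), mul_comm] at this
  have h4 : Real.exp |x| ≤ Real.exp x + Real.exp (-x) := by
    rcases abs_cases x with ⟨h, -⟩ | ⟨h, -⟩ <;> rw [h] <;>
      linarith [Real.exp_pos x, Real.exp_pos (-x)]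
  simp only [Pi.add_apply]
  have e1 : Complex.exp (-2 * x ^ 2 + (2 * w + 1) * x + 0) =
      Complex.exp (2 * w * x - 2 * x ^ 2) * Complex.exp x := by
    rw [← Complex.exp_add]; congr 1; ring
  have e2 : Complex.exp (-2 * x ^ 2 + (2 * w - 1) * x + 0) =
      Complex.exp (2 * w * x - 2 * x ^ 2) * Complex.exp ((-x : ℝ) : ℂ) := by
    rw [← Complex.exp_add]; congr 1; push_cast; ring
  rw [e1, e2, norm_mul, norm_mul, norm_mul, norm_pow, ← Complex.ofReal_exp, ← Complex.ofReal_exp,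
    Complex.norm_real, Complex.norm_real, Complex.norm_real, Real.norm_eq_abs, Real.norm_eq_abs,
    Real.norm_eq_abs, abs_of_pos (Real.exp_pos _), abs_of_pos (Real.exp_pos _), ← mul_add,
    mul_left_comm]
  exact mul_le_mul_of_nonneg_left
    (h3.trans (mul_le_mul_of_nonneg_left h4 (by positivity))) (norm_nonneg _)

/-- The exponent `2 ∑ z_i x_i - 2 ∑ x_i²`. -/
def bosExponent (z : Fin m → ℂ) : MvPolynomial (Fin m) ℂ :=
  ∑ i, (MvPolynomial.C (2 * z i) * MvPolynomial.X i -
    (2 : ℂ) • (MvPolynomial.X i * MvPolynomial.X i))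

theorem evalReal_X (x : Fin m → ℝ) (i : Fin m) : evalReal x (MvPolynomial.X i) = (x i : ℂ) :=
  MvPolynomial.aeval_X (R := ℂ) (fun i => ((x i : ℝ) : ℂ)) i

theorem evalReal_C (x : Fin m → ℝ) (c : ℂ) : evalReal x (MvPolynomial.C c) = c :=
  MvPolynomial.aeval_C _ _

theorem evalReal_bosExponent (z : Fin m → ℂ) (x : Fin m → ℝ) :
    evalReal x (bosExponent z) = ∑ i, (2 * z i * x i - 2 * (x i : ℂ) ^ 2) := by
  rw [bosExponent, map_sum]
  refine Finset.sum_congr rfl fun i _ => ?_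
  simp only [map_sub, map_mul, map_smul, evalReal_X, evalReal_C, smul_eq_mul]
  ring

theorem pderiv_bosExponent (z : Fin m → ℂ) (i : Fin m) :
    MvPolynomial.pderiv i (bosExponent z) =
      MvPolynomial.C (2 * z i) - (4 : ℂ) • MvPolynomial.X i := by
  rw [bosExponent, map_sum, Finset.sum_eq_single i]
  · rw [map_sub, Derivation.leibniz, Derivation.map_smul, Derivation.leibniz, MvPolynomial.pderiv_X_self,
      MvPolynomial.pderiv_C]
    simp only [smul_eq_mul, mul_one, mul_zero, add_zero]
    module
  · intro j _ hj
    rw [map_sub, Derivation.leibniz, Derivation.map_smul, Derivation.leibniz, MvPolynomial.pderiv_X_of_ne hj,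
      MvPolynomial.pderiv_C]
    simp
  · simp

theorem integrable_bosExponent (z : Fin m → ℂ) (f : MvPolynomial (Fin m) ℂ) :
    Integrable fun x : Fin m → ℝ => Complex.exp (evalReal x (bosExponent z)) * evalReal x f := by
  induction f using MvPolynomial.induction_on' with
  | add p q hp hq =>
    simp only [map_add, mul_add]
    exact hp.add hq
  | monomial α c =>
    have h1 : ∀ x : Fin m → ℝ, Complex.exp (evalReal x (bosExponent z)) *
        evalReal x (MvPolynomial.monomial α c) =
        c * ∏ i, (Complex.exp (2 * z i * x i - 2 * (x i : ℂ) ^ 2) * (x i : ℂ) ^ α i) := by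
      intro x
      rw [evalReal_bosExponent, Complex.exp_sum, Finset.prod_mul_distrib, evalReal,
        MvPolynomial.aeval_monomial, Finsupp.prod_fintype _ _ (fun i => pow_zero _)]
      simp only [Algebra.algebraMap_self, RingHom.id_apply]
      ring
    simp only [h1]
    exact (Integrable.fintype_prod (f := fun (i : Fin m) (t : ℝ) =>
      Complex.exp (2 * z i * t - 2 * (t : ℂ) ^ 2) * (t : ℂ) ^ α i)
      (fun i => integrable_exp_mul_pow (z i) (α i))).const_mul _

/-- The integral `∫ exp(2 z • x - 2 x • x) f(x) dx` over the even variables. -/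
def bosInt (z : Fin m → ℂ) : MvPolynomial (Fin m) ℂ →ₗ[ℂ] ℂ where
  toFun f := ∫ x : Fin m → ℝ, Complex.exp (evalReal x (bosExponent z)) * evalReal x f
  map_add' f g := by
    simp only [map_add, mul_add]
    exact integral_add (integrable_bosExponent z f) (integrable_bosExponent z g)
  map_smul' c f := by
    simp only [map_smul, smul_eq_mul, mul_left_comm _ c, RingHom.id_apply]
    exact integral_const_mul _ _

theorem bosInt_apply (z : Fin m → ℂ) (f : MvPolynomial (Fin m) ℂ) : bosInt z f =
    ∫ x : Fin m → ℝ, Complex.exp (evalReal x (bosExponent z)) * evalReal x f := rfl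

theorem hasLineDerivAt_exp_mul (L f : MvPolynomial (Fin m) ℂ) (i : Fin m) (x : Fin m → ℝ) :
    HasLineDerivAt ℝ (fun x : Fin m → ℝ => Complex.exp (evalReal x L) * evalReal x f)
      (Complex.exp (evalReal x L) *
        evalReal x (MvPolynomial.pderiv i L * f + MvPolynomial.pderiv i f)) x (Pi.single i 1) := by
  have h := (hasDerivAt_evalReal L i x).cexp.mul (hasDerivAt_evalReal f i x)
  rw [Function.update_eq_self] at h
  have h0 : x i = x i + 0 := (add_zero _).symm
  have h2 := HasDerivAt.comp_const_add (x i) 0 (h0 ▸ h)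
  rw [HasLineDerivAt]
  have e : ∀ t : ℝ, x + t • Pi.single i (1 : ℝ) = Function.update x i (x i + t) := by
    intro t
    ext j
    by_cases hj : j = i
    · subst hj; simp
    · simp [hj]
  simp only [e]
  refine h2.congr_deriv ?_
  rw [map_add, map_mul]
  ring

theorem bosInt_parts (z : Fin m → ℂ) (i : Fin m) (f : MvPolynomial (Fin m) ℂ) :
    bosInt z (MvPolynomial.pderiv i (bosExponent z) * f + MvPolynomial.pderiv i f) = 0 := by
  have h := integral_bilinear_hasLineDerivAt_right_eq_neg_left_of_integrable
    (μ := (volume : Measure (Fin m → ℝ))) (f := fun _ => (1 : ℂ)) (f' := fun _ => (0 : ℂ))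
    (B := ContinuousLinearMap.mul ℝ ℂ) (v := Pi.single i (1 : ℝ))
    (g := fun x : Fin m → ℝ => Complex.exp (evalReal x (bosExponent z)) * evalReal x f)
    (g' := fun x : Fin m → ℝ => Complex.exp (evalReal x (bosExponent z)) *
      evalReal x (MvPolynomial.pderiv i (bosExponent z) * f + MvPolynomial.pderiv i f))
    (by simp)
    ((integrable_bosExponent z _).congr (Filter.Eventually.of_forall fun x => (one_mul _).symm))
    ((integrable_bosExponent z f).congr (Filter.Eventually.of_forall fun x => (one_mul _).symm))
    (fun x _ => hasDerivAt_const _ _) (fun x _ => hasLineDerivAt_exp_mul _ _ _ _)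
  simpa [bosInt_apply] using h

theorem bosInt_creation (z : Fin m → ℂ) (i : Fin m) (f : MvPolynomial (Fin m) ℂ) :
    bosInt z ((2 : ℂ) • (MvPolynomial.X i * f) - (1 / 2 : ℂ) • MvPolynomial.pderiv i f) =
      z i * bosInt z f := by
  have h := bosInt_parts z i f
  rw [pderiv_bosExponent, sub_mul, MvPolynomial.C_mul', smul_mul_assoc, map_add, map_sub, map_smul,
    map_smul, smul_eq_mul, smul_eq_mul] at h
  rw [map_sub, map_smul, map_smul, smul_eq_mul, smul_eq_mul]
  linear_combination (-1 / 2 : ℂ) * h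

theorem bosInt_one (z : Fin m → ℂ) : bosInt z 1 =
    ((Real.pi : ℂ) / 2) ^ (Fintype.card (Fin m) / 2 : ℂ) * Complex.exp ((1 / 2) * ∑ i, z i * z i) := by
  have h := GaussianFourier.integral_cexp_neg_mul_sum_add (ι := Fin m) (b := 2) (by norm_num)
    (fun i => 2 * z i)
  rw [bosInt_apply]
  refine Eq.trans (integral_congr_ae (Filter.Eventually.of_forall fun x => ?_)) (h.trans ?_)
  · simp only [map_one, mul_one]
    rw [evalReal_bosExponent, Finset.mul_sum, ← Finset.sum_add_distrib]
    refine congrArg _ (Finset.sum_congr rfl fun i _ => ?_)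
    ring
  · congr 2
    rw [Finset.sum_div, Finset.mul_sum]
    refine Finset.sum_congr rfl fun i _ => ?_
    ring

theorem bosInt_zero_one_ne : bosInt (m := m) 0 1 ≠ 0 := by
  rw [bosInt_one]
  refine mul_ne_zero ?_ (Complex.exp_ne_zero _)
  rw [Ne, Complex.cpow_eq_zero_iff]
  simp [Real.pi_ne_zero]

theorem bosInt_one' (z : Fin m → ℂ) :
    bosInt z 1 = bosInt (m := m) 0 1 * Complex.exp ((1 / 2) * ∑ i, z i * z i) := by
  rw [bosInt_one, bosInt_one (m := m) 0]
  simp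

end bosonicSB

/-! ### The Segal-Bargmann transform on the Schrödinger model -/

namespace Gr

section mapLinear
variable {R R' τ : Type*} [CommRing R] [CommRing R'] [LinearOrder τ] [Algebra ℂ R] [Algebra ℂ R']

/-- Apply a linear map to all coefficients. -/
def mapₗ (φ : R →ₗ[ℂ] R') : Gr R τ →ₗ[ℂ] Gr R' τ where
  toFun f S := φ (f S)
  map_add' f g := funext fun S => φ.map_add (f S) (g S)
  map_smul' c f := funext fun S => φ.map_smul c (f S)

theorem mapₗ_apply (φ : R →ₗ[ℂ] R') (f : Gr R τ) (S : Finset τ) : mapₗ φ f S = φ (f S) := rfl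

theorem map_neg_one_pow_mul (φ : R →ₗ[ℂ] R') (k : ℕ) (r : R) :
    φ ((-1) ^ k * r) = (-1) ^ k * φ r := by
  rcases Nat.even_or_odd k with h | h <;> simp [h.neg_one_pow]

theorem mapₗ_gen_mul (φ : R →ₗ[ℂ] R') (t : τ) (f : Gr R τ) :
    mapₗ φ (gen t * f) = gen t * mapₗ φ f := by
  ext1 S
  rw [gen_mul_apply, mapₗ_apply, gen_mul_apply]
  split_ifs
  · rw [map_neg_one_pow_mul]; rfl
  · exact map_zero φ

theorem pdOdd_mapₗ (φ : R →ₗ[ℂ] R') (t : τ) (f : Gr R τ) :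
    pdOdd t (mapₗ φ f) = mapₗ φ (pdOdd t f) := by
  ext1 S
  rw [mapₗ_apply, pdOdd, pdOdd]
  split_ifs
  · exact (map_zero φ).symm
  · rw [map_neg_one_pow_mul]; rfl

/-- A linear functional on a Grassmann algebra is a combination of the coefficient functionals. -/
theorem apply_eq_sum [Fintype τ] (φ : Gr ℂ τ →ₗ[ℂ] ℂ) (y : Gr ℂ τ) :
    φ y = ∑ U, y U * φ (single U 1) := by
  conv_lhs => rw [sum_single y]
  rw [map_sum]
  refine Finset.sum_congr rfl fun U _ => ?_
  have : (single U (y U) : Gr ℂ τ) = y U • single U 1 := by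
    ext1 T
    refine Eq.trans ?_ (smul_apply _ _ _).symm
    simp only [single]
    split_ifs <;> simp
  rw [this, map_smul, smul_eq_mul]

end mapLinear

theorem ev_foldl_pdOdd {X τ ι : Type*} [LinearOrder τ] [Fintype τ] (e : ι → τ) (l : List ι)
    (x : X) (F : SFun X τ) : ev x (l.foldl (fun g t => pdOdd (e t) g) F) =
      l.foldl (fun g t => pdOdd (e t) g) (ev x F) := by
  induction l generalizing F with
  | nil => rfl
  | cons a l ih => rw [List.foldl_cons, ih, List.foldl_cons, ev, pdOdd_mapAlg]

theorem foldl_pdOdd_smul {τ ι : Type*} [LinearOrder τ] [Fintype τ] (e : ι → τ) (l : List ι)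
    (c : ℂ) (F : Gr ℂ τ) : l.foldl (fun g t => pdOdd (e t) g) (c • F) =
      c • l.foldl (fun g t => pdOdd (e t) g) F := by
  induction l generalizing F with
  | nil => rfl
  | cons a l ih => rw [List.foldl_cons, pdOdd_smul, ih, List.foldl_cons]

end Gr

section transform
variable {m n : ℕ}

/-- The value of a superpolynomial at a real point of the even variables. -/
def evalRealAt (x : Fin m → ℝ) : Fock m n →ₐ[ℂ] Gr ℂ (Fin (2 * n)) := Gr.mapAlg (evalReal x)

theorem ev_evalR (x : Fin m → ℝ) (p : Fock m n) : Gr.ev x (evalR p) = evalRealAt x p := rfl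

theorem evalRealAt_gaussPoly (x : Fin m → ℝ) :
    evalRealAt x (gaussPoly m n) = oddGaussian n := by
  ext1 S
  exact (evalReal x).commutes _

theorem ev_expPoly_mul (L : MvPolynomial (Fin m) ℂ) (x : Fin m → ℝ) (f : SFR m n) :
    Gr.ev x (expPoly L * f) = Complex.exp (evalReal x L) • Gr.ev x f := by
  ext1 S
  exact expPoly_mul_apply L f S x

theorem ev_schroMap (x : Fin m → ℝ) (p : Fock m n) :
    Gr.ev x (schroMap p) =
      Complex.exp (evalReal x (gaussExponent m)) • evalRealAt x (p * gaussPoly m n) := by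
  rw [schroMap_eq, ev_expPoly_mul, ev_evalR]

theorem ev_integrandSB (z : Fin m → ℂ) (x : Fin m → ℝ) (p : Fock m n) :
    Gr.ev (z, x) (integrandSB (schroMap p)) = Complex.exp (evalReal x (bosExponent z)) •
      (oddKernel n * Gr.relabel (oddSnd n) (evalRealAt x (p * gaussPoly m n))) := by
  have h1 := ev_sexp_traceProd 2 (zK (m := m) (n := n)) xK (fun i p => p.1 i)
    (fun i p => (p.2 i : ℂ)) (oddFst n) (oddSnd n) (fun _ => rfl) (fun _ => rfl) (fun _ => rfl)
    (fun _ => rfl) (z, x)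
  have h2 := ev_sexp_traceProd (-1) (xK (m := m) (n := n)) xK (fun i p => (p.2 i : ℂ))
    (fun i p => (p.2 i : ℂ)) (oddSnd n) (oddSnd n) (fun _ => rfl) (fun _ => rfl) (fun _ => rfl)
    (fun _ => rfl) (z, x)
  have h3 : Gr.ev (z, x) (Gr.relabel (oddSnd n) (Gr.mapCoeff
      (fun g (p : (Fin m → ℂ) × (Fin m → ℝ)) => g p.2) (schroMap p))) =
      Gr.relabel (oddSnd n) (Gr.ev x (schroMap p)) :=
    Gr.mapAlg_relabel _ (oddSnd n) _
  rw [integrandSB, map_mul, map_mul, h1, ← neg_one_smul ℂ (traceProd _ _), h2, h3, ev_schroMap,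
    Gr.relabel_smul, smul_mul_smul_comm, smul_mul_smul_comm, ← Complex.exp_add, ← Complex.exp_add,
    oddKernel]
  congr 2
  rw [evalReal_bosExponent, gaussExponent, map_neg, map_sum, Finset.mul_sum, Finset.mul_sum,
    ← Finset.sum_neg_distrib, ← Finset.sum_add_distrib, ← Finset.sum_add_distrib]
  refine Finset.sum_congr rfl fun i _ => ?_
  rw [map_mul, evalReal_X]
  ring

/-- The integral over the even variables commutes with linear functionals on the Grassmann algebra
of the odd variables. -/
theorem integral_apply (z : Fin m → ℂ) (p : Fock m n) (φ : Gr ℂ (Fin (2 * n)) →ₗ[ℂ] ℂ) :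
    ∫ x, Complex.exp (evalReal x (bosExponent z)) * φ (evalRealAt x p) =
      φ (Gr.mapₗ (bosInt z) p) := by
  have h : ∀ x, Complex.exp (evalReal x (bosExponent z)) * φ (evalRealAt x p) =
      ∑ U, (Complex.exp (evalReal x (bosExponent z)) * evalReal x (p U)) *
        φ (Gr.single U 1) := by
    intro x
    rw [Gr.apply_eq_sum, Finset.mul_sum]
    exact Finset.sum_congr rfl fun U _ => (mul_assoc _ _ _).symm
  simp only [h]
  rw [integral_finsetSum _ fun U _ => (integrable_bosExponent z (p U)).mul_const _,
    Gr.apply_eq_sum φ (Gr.mapₗ _ p)]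
  exact Finset.sum_congr rfl fun U _ => integral_mul_const _ _

theorem ev_intSB (z : Fin m → ℂ) (p : Fock m n) :
    Gr.ev z (intSB (schroMap p)) = oddInt (Gr.mapₗ (bosInt z) (p * gaussPoly m n)) := by
  ext1 S
  refine Eq.trans ?_ (integral_apply z (p * gaussPoly m n) (Gr.coeffₗ S ∘ₗ oddInt))
  refine integral_congr_ae (Filter.Eventually.of_forall fun x => ?_)
  change ((Real.pi : ℂ) ^ n)⁻¹ * Gr.ev (z, x) ((List.finRange (2 * n)).foldl
    (fun g t => Gr.pdOdd (oddSnd n t) g) (integrandSB (schroMap p)))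
      (S.map (oddFst n).toEmbedding) = Complex.exp (evalReal x (bosExponent z)) *
        oddInt (evalRealAt x (p * gaussPoly m n)) S
  rw [Gr.ev_foldl_pdOdd, ev_integrandSB, foldl_pdOdd_oddSnd, map_smul, oddInt_apply,
    Gr.smul_apply _ (Gr.pull _ _), Gr.smul_apply, smul_eq_mul, smul_eq_mul, mul_left_comm]
  rfl

/-- The superfunction `e^{-½ z•z} ∫ e^{2 z•x - R²} p e^{-R²} dx` at the point `z`. -/
def sbAt (z : Fin m → ℂ) : Fock m n →ₗ[ℂ] Gr ℂ (Fin (2 * n)) :=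
  Complex.exp (-(1 / 2) * ∑ i, z i * z i) • (oddSB ∘ₗ Gr.mapₗ (bosInt z) ∘ₗ
    LinearMap.mulRight ℂ (gaussPoly m n))

theorem sbAt_apply (z : Fin m → ℂ) (p : Fock m n) :
    sbAt z p = Complex.exp (-(1 / 2) * ∑ i, z i * z i) •
      oddSB (Gr.mapₗ (bosInt z) (p * gaussPoly m n)) := rfl

theorem ev_SB (z : Fin m → ℂ) (p : Fock m n) :
    Gr.ev z (SB (schroMap p)) = (omega m n)⁻¹ • sbAt z p := by
  have h1 := ev_sexp_traceProd (-(1 / 2)) (zS (m := m) (n := n)) zS (fun i p => p i)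
    (fun i p => p i) id id ?_ ?_ ?_ ?_ z
  · rw [SB, map_smul, map_mul, h1, ev_intSB, sbAt_apply, oddSB_apply, smul_mul_assoc]
  · intro i
    exact (Gr.mapCoeff_const (RingHom.pi fun z : Fin m → ℂ => MvPolynomial.eval z) _).trans
      (congrArg _ (funext fun z => MvPolynomial.eval_X i))
  · intro i
    exact (Gr.mapCoeff_const (RingHom.pi fun z : Fin m → ℂ => MvPolynomial.eval z) _).trans
      (congrArg _ (funext fun z => MvPolynomial.eval_X i))
  · intro i
    exact Gr.mapCoeff_gen (RingHom.pi fun z : Fin m → ℂ => MvPolynomial.eval z) _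
  · intro i
    exact Gr.mapCoeff_gen (RingHom.pi fun z : Fin m → ℂ => MvPolynomial.eval z) _

theorem creation_mul_gaussPoly_inl (i : Fin m) (p : Fock m n) :
    creation (Sum.inl i) p * gaussPoly m n =
      (2 : ℂ) • (zvar (Sum.inl i) * (p * gaussPoly m n)) -
        (1 / 2 : ℂ) • dF (Sum.inl i) (p * gaussPoly m n) := by
  rw [dF_mul, dF_inl_gaussPoly, mul_zero, add_zero, creation_apply, sub_mul, smul_mul_assoc,
    smul_mul_assoc, mul_assoc]

theorem creation_mul_gaussPoly_inr (a : Fin (2 * n)) (p : Fock m n) :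
    creation (Sum.inr a) p * gaussPoly m n =
      zvar (Sum.inr a) * (p * gaussPoly m n) -
        (1 / 2 : ℂ) • dF (Sum.inr a) (p * gaussPoly m n) := by
  rw [dF_mul, dF_inr_gaussPoly, creation_apply, sub_mul, smul_mul_assoc, smul_mul_assoc,
    mul_smul_comm, ← mul_assoc (sgn _ p), mul_zvar, sgn_sgn]
  simp only [mul_assoc]
  module

/-- The Segal-Bargmann transform takes the creation operators to multiplication by the variables;
this is integration by parts in the even and in the odd variables. -/
theorem sbAt_creation (z : Fin m → ℂ) (i : Idx m n) (p : Fock m n) :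
    sbAt z (creation i p) = evalAt z (zvar i) * sbAt z p := by
  rcases i with i | a
  · have h : Gr.mapₗ (bosInt z) (creation (Sum.inl i) p * gaussPoly m n) =
        z i • Gr.mapₗ (bosInt z) (p * gaussPoly m n) := by
      rw [creation_mul_gaussPoly_inl]
      ext1 S
      refine Eq.trans ?_ (bosInt_creation z i ((p * gaussPoly m n) S))
      have h1 : ((2 : ℂ) • (zvar (Sum.inl i) * (p * gaussPoly m n)) -
          (1 / 2 : ℂ) • dF (Sum.inl i) (p * gaussPoly m n) : Fock m n) S =
          (2 : ℂ) • (MvPolynomial.X i * (p * gaussPoly m n) S) -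
            (1 / 2 : ℂ) • MvPolynomial.pderiv i ((p * gaussPoly m n) S) := by
        rw [Gr.sub_apply, Gr.smul_apply, Gr.smul_apply, zvar, Gr.const_mul, dF_apply,
          Gr.smul_apply, dual, dz_inl_apply, betaSign, one_smul]
      rw [Gr.mapₗ_apply, h1]
    have h2 : evalAt z (zvar (Sum.inl i) : Fock m n) = Gr.const (z i) :=
      (Gr.mapAlg_const _ _).trans (congrArg _ (MvPolynomial.aeval_X _ _))
    rw [sbAt_apply, h, map_smul, h2, Gr.const_mul_eq_smul, smul_comm]
    rfl
  · have h : Gr.mapₗ (bosInt z) (creation (Sum.inr a) p * gaussPoly m n) =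
        Gr.gen a * Gr.mapₗ (bosInt z) (p * gaussPoly m n) - (1 / 2 * osign a : ℂ) •
          Gr.pdOdd (odual a) (Gr.mapₗ (bosInt z) (p * gaussPoly m n)) := by
      rw [creation_mul_gaussPoly_inr, map_sub, map_smul, dF_apply, map_smul, smul_smul,
        Gr.pdOdd_mapₗ, ← Gr.mapₗ_gen_mul]
      rfl
    have h2 : evalAt z (zvar (Sum.inr a) : Fock m n) = Gr.gen a := Gr.mapAlg_gen _ _
    rw [sbAt_apply, h, oddSB_creation, h2, sbAt_apply, mul_smul_comm]

theorem mapₗ_gaussPoly (z : Fin m → ℂ) :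
    Gr.mapₗ (bosInt z) (gaussPoly m n) = bosInt z 1 • oddGaussian n := by
  ext1 S
  refine Eq.trans ?_ (Gr.smul_apply _ _ _).symm
  rw [Gr.mapₗ_apply, gaussPoly, Gr.mapAlg_apply, Algebra.ofId_apply, Algebra.algebraMap_eq_smul_one,
    map_smul, smul_eq_mul, smul_eq_mul, mul_comm]

theorem sbAt_one (z : Fin m → ℂ) :
    sbAt z (1 : Fock m n) = (bosInt (m := m) 0 1 * oddInt (oddGaussian n) ∅) • 1 := by
  rw [sbAt_apply, one_mul, mapₗ_gaussPoly, map_smul, oddSB_oddGaussian, bosInt_one', smul_smul,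
    smul_smul]
  congr 1
  have h : Complex.exp (-(1 / 2) * ∑ i, z i * z i) *
      Complex.exp ((1 / 2) * ∑ i, z i * z i) = 1 := by
    rw [← Complex.exp_add, neg_mul, neg_add_cancel, Complex.exp_zero]
  generalize (oddInt (oddGaussian n) : Gr ℂ _) ∅ = c
  linear_combination (bosInt (m := m) 0 1 * c) * h

theorem omega_eq : omega m n = bosInt (m := m) 0 1 * oddInt (oddGaussian n) ∅ := by
  have h : ∀ x : Fin m → ℝ, Gr.ev x (sexp (-(2 : ℂ) • traceProd (xvar (m := m) (n := n)) xvar)) =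
      Complex.exp (evalReal x (bosExponent 0)) • oddGauss (-2) id id := by
    intro x
    rw [ev_sexp_traceProd (-2) (xvar (m := m) (n := n)) xvar (fun i x => (x i : ℂ))
      (fun i x => (x i : ℂ)) id id (fun _ => rfl) (fun _ => rfl) (fun _ => rfl) (fun _ => rfl) x]
    congr 2
    rw [evalReal_bosExponent, Finset.mul_sum]
    exact Finset.sum_congr rfl fun i _ => by simp; ring
  rw [oddInt_empty, oddGaussian_mul_self, omega, intR, bosInt_apply, ← integral_mul_const]
  refine integral_congr_ae (Filter.Eventually.of_forall fun x => ?_)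
  change ((Real.pi : ℂ) ^ n)⁻¹ * Gr.ev x ((List.finRange (2 * n)).foldl
    (fun g t => Gr.pdOdd (id t) g) _) ∅ = _
  have h1 : evalReal x (1 : MvPolynomial (Fin m) ℂ) = 1 := map_one _
  rw [Gr.ev_foldl_pdOdd, h, Gr.foldl_pdOdd_smul, Gr.smul_apply, smul_eq_mul, mul_left_comm]
  refine Eq.trans ?_ (congrArg₂ _ ((mul_one _).symm.trans (congrArg _ h1.symm)) rfl)
  rfl

theorem oddInt_oddGaussian_ne : oddInt (oddGaussian n) ∅ ≠ 0 := by
  obtain ⟨k, hk⟩ := foldl_pdOdd_empty (R := ℂ) (List.finRange (2 * n)) (List.nodup_finRange _)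
    List.mem_finRange
  rw [oddInt_empty, hk, oddGaussian_mul_self]
  have h4 : IsOddGaussian (n := n) 4 (oddGauss (-2) id id) := by
    have := isOddGaussian_oddGauss (n := n) (-2)
    norm_num at this
    exact this
  refine mul_ne_zero (inv_ne_zero (pow_ne_zero _ (by exact_mod_cast Real.pi_ne_zero)))
    (mul_ne_zero (pow_ne_zero _ (by norm_num)) (h4.apply_univ_ne (by norm_num) ?_))
  rw [oddGauss_empty]
  exact one_ne_zero

theorem omega_ne_zero : omega m n ≠ 0 := by
  rw [omega_eq]
  exact mul_ne_zero bosInt_zero_one_ne oddInt_oddGaussian_ne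

theorem sbAt_hermite (z : Fin m → ℂ) (p : Fock m n) :
    sbAt z (hermite p) = omega m n • evalAt z p := by
  induction p using Fock.induction with
  | h1 => rw [hermite_one, sbAt_one, map_one (evalAt z), omega_eq]
  | ha p q hp hq => rw [map_add, map_add, hp, hq, map_add, smul_add]
  | hs c p hp => rw [map_smul, map_smul, hp, map_smul, smul_comm]
  | hz i p hp => rw [hermite_zvar_mul, sbAt_creation, hp, map_mul, mul_smul_comm]

/-- Both sides take products of creation operators applied to the vacuum to products of
variables. -/
theorem SB_invSB (p : Fock m n) : SB (invSB p) = evalC p := by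
  refine Gr.ext_ev fun z => ?_
  rw [invSB_apply, ev_SB, sbAt_hermite, smul_smul, inv_mul_cancel₀ omega_ne_zero, one_smul,
    ev_evalC]

theorem evalC_injective : Function.Injective (evalC : Fock m n → SFC m n) := by
  intro p q h
  ext1 S
  exact MvPolynomial.funext fun z => congrFun (congrFun h S) z

theorem SBpoly_invSB (p : Fock m n) : SBpoly (invSB p) = p := by
  rw [SBpoly, SB_invSB]
  exact Function.leftInverse_invFun evalC_injective p

theorem invSB_injective : Function.Injective (invSB (m := m) (n := n)) :=
  Function.LeftInverse.injective SBpoly_invSB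

end transform

/-! ### The Schrödinger product -/

section schroProduct
variable {m n : ℕ}

theorem conjFun_schroMap (p : Fock m n) : conjFun (schroMap p) = schroMap (conjPoly p) := by
  have hc : ∀ (x : Fin m → ℝ) (f : MvPolynomial (Fin m) ℂ),
      (starRingEnd ℂ) (evalReal x f) = evalReal x (MvPolynomial.map (starRingEnd ℂ) f) := by
    intro x f
    induction f using MvPolynomial.induction_on with
    | C a => rw [evalReal_C, MvPolynomial.map_C, evalReal_C]
    | add p q hp hq => rw [map_add, map_add, hp, hq, map_add, map_add]
    | mul_X p i hp =>
      rw [map_mul, map_mul, hp, map_mul, map_mul, evalReal_X, MvPolynomial.map_X, evalReal_X,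
        Complex.conj_ofReal]
  refine Gr.ext_ev fun x => ?_
  have h1 : Gr.ev x (conjFun (schroMap p)) = conjGr (Gr.ev x (schroMap p)) := rfl
  have h2 : conjGr (evalRealAt x p) = evalRealAt x (conjPoly p) := by
    ext1 S
    exact hc x (p S)
  have h3 : conjGr (evalRealAt x p * oddGaussian n) =
      conjGr (evalRealAt x p) * conjGr (oddGaussian n) := Gr.mapCoeff_mul (starRingEnd ℂ) _ _
  rw [h1, ev_schroMap, conjGr_smul, ev_schroMap, map_mul, map_mul, evalRealAt_gaussPoly, h3, h2,
    conjGr_oddGaussian, ← Complex.exp_conj, hc]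
  congr 3
  rw [gaussExponent, map_neg, map_sum]
  simp

/-- The integral of `p exp(-2R²)`. -/
def gaussInt : Fock m n →ₗ[ℂ] ℂ :=
  Gr.coeffₗ ∅ ∘ₗ oddInt ∘ₗ Gr.mapₗ (bosInt 0) ∘ₗ LinearMap.mulRight ℂ (gaussPoly m n)

theorem intR_schroMap_mul (p r : Fock m n) :
    intR (schroMap p * schroMap r) = gaussInt (p * r) := by
  have h := integral_apply 0 (p * r * gaussPoly m n) (Gr.coeffₗ ∅ ∘ₗ oddInt)
  refine Eq.trans ?_ h
  refine integral_congr_ae (Filter.Eventually.of_forall fun x => ?_)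
  change ((Real.pi : ℂ) ^ n)⁻¹ * Gr.ev x ((List.finRange (2 * n)).foldl
    (fun g t => Gr.pdOdd (id t) g) _) ∅ = Complex.exp (evalReal x (bosExponent 0)) *
      oddInt (evalRealAt x (p * r * gaussPoly m n)) ∅
  have h2 : Gr.ev x (schroMap p * schroMap r) = Complex.exp (evalReal x (bosExponent 0)) •
      (evalRealAt x (p * r * gaussPoly m n) * oddGaussian n) := by
    rw [map_mul, ev_schroMap, ev_schroMap, smul_mul_smul_comm, ← Complex.exp_add]
    refine congrArg₂ _ (congrArg _ ?_) ?_
    · rw [evalReal_bosExponent, gaussExponent, map_neg, map_sum, ← Finset.sum_neg_distrib,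
        ← Finset.sum_add_distrib]
      refine Finset.sum_congr rfl fun i _ => ?_
      rw [map_mul, evalReal_X]
      simp
      ring
    · simp only [map_mul, evalRealAt_gaussPoly, mul_assoc]
      rw [← mul_assoc (oddGaussian n), Gr.mul_comm_of_even parity_oddGaussian, mul_assoc]
  rw [Gr.ev_foldl_pdOdd, h2, Gr.foldl_pdOdd_smul, Gr.smul_apply, smul_eq_mul, mul_left_comm,
    oddInt_empty]
  rfl

theorem formW_schroMap (p q : Fock m n) :
    formW (schroMap p) (schroMap q) = (omega m n)⁻¹ * gaussInt (p * conjPoly q) := by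
  rw [formW, conjFun_schroMap, intR_schroMap_mul]

theorem gaussInt_eq (p : Fock m n) : gaussInt p = sbAt 0 p ∅ := by
  rw [sbAt_apply, oddSB_apply]
  refine Eq.trans ?_ (Gr.smul_apply _ _ _).symm
  rw [mul_empty, oddGauss_empty]
  simp only [mul_zero, Pi.zero_apply, Finset.sum_const_zero, Complex.exp_zero, one_mul, smul_eq_mul]
  rfl

theorem gaussInt_one : gaussInt (1 : Fock m n) = omega m n := by
  rw [gaussInt_eq, sbAt_one, ← omega_eq]
  refine (Gr.smul_apply _ _ _).trans ?_
  rw [Gr.one_apply, if_pos rfl, smul_eq_mul, mul_one]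

theorem gaussInt_creation (i : Idx m n) (p : Fock m n) : gaussInt (creation i p) = 0 := by
  rw [gaussInt_eq, sbAt_creation, mul_empty]
  refine mul_eq_zero_of_left ?_ _
  rcases i with i | a
  · have h2 : evalAt 0 (zvar (Sum.inl i) : Fock m n) = Gr.const 0 :=
      (Gr.mapAlg_const _ _).trans (congrArg _ (MvPolynomial.aeval_X _ _))
    rw [h2, Gr.const, if_pos rfl]
  · have h2 : evalAt 0 (zvar (Sum.inr a) : Fock m n) = Gr.gen a := Gr.mapAlg_gen _ _
    rw [h2, Gr.gen, if_neg (Finset.singleton_ne_empty a).symm]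

theorem gaussInt_creation_mul (i : Idx m n) (p q : Fock m n) :
    gaussInt (creation i p * q) = (1 / 2 : ℂ) * gaussInt (sgn i p * dF i q) := by
  have h := gaussInt_creation i (p * q)
  have h2 : creation i (p * q) = creation i p * q - (1 / 2 : ℂ) • (sgn i p * dF i q) := by
    rw [creation_apply, dF_mul, creation_apply, sub_mul, smul_mul_assoc, smul_mul_assoc, mul_assoc]
    module
  rw [h2, map_sub, map_smul, smul_eq_mul, sub_eq_zero] at h
  exact h

theorem conj_two : (starRingEnd ℂ) 2 = 2 := map_ofNat _ 2

theorem conjPoly_creation (i : Idx m n) (p : Fock m n) :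
    conjPoly (creation i p) = creation i (conjPoly p) := by
  rw [creation_apply, sub_eq_add_neg, ← neg_smul, conjPoly_add, conjPoly_smul, conjPoly_smul,
    conjPoly_mul, conjPoly_zvar, conjPoly_dF, creation_apply, sub_eq_add_neg, ← neg_smul]
  simp [conj_two]

theorem gaussInt_conjPoly_hermite (q : Fock m n) :
    gaussInt (conjPoly (hermite q)) = omega m n * fockForm 1 q := by
  induction q using Fock.induction with
  | h1 => rw [hermite_one, conjPoly_one, gaussInt_one, fockForm_one_left, Gr.one_apply]; simp
  | ha p q hp hq => rw [map_add, conjPoly_add, map_add, hp, hq, fockForm_add_right, mul_add]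
  | hs c p hp =>
    rw [map_smul, conjPoly_smul, map_smul, hp, fockForm_smul_right, smul_eq_mul, mul_left_comm]
  | hz i p _ =>
    rw [hermite_zvar_mul, conjPoly_creation, gaussInt_creation, fockForm_zvar_mul_right, dF_one,
      ← zero_smul ℂ (0 : Fock m n), fockForm_smul_left]
    ring

theorem hermite_sgn (i : Idx m n) (p : Fock m n) : hermite (sgn i p) = sgn i (hermite p) := by
  rcases i with i | a
  · rfl
  · exact hermite_parity p

/-- On both sides the adjoint of a creation operator, respectively of a variable, is a derivative,
so that the claim reduces to products with the vacuum. -/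
theorem gaussInt_hermite (p q : Fock m n) :
    gaussInt (hermite p * conjPoly (hermite q)) = omega m n * fockForm p q := by
  have hz : ∀ (i : Idx m n) (p q : Fock m n),
      gaussInt (hermite (sgn i p) * conjPoly (hermite (dF i q))) =
        omega m n * fockForm (sgn i p) (dF i q) →
      gaussInt (hermite (zvar i * p) * conjPoly (hermite q)) =
        omega m n * fockForm (zvar i * p) q := by
    intro i p q h
    rw [hermite_zvar_mul, gaussInt_creation_mul, fockForm_zvar_mul, ← h, hermite_sgn, hermite_dF,
      conjPoly_smul, conjPoly_dF, mul_smul_comm, map_smul, smul_eq_mul]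
    simp [conj_two]
  -- the parity twist is carried along because the adjoint of an odd variable changes signs
  suffices h : ∀ q, gaussInt (hermite p * conjPoly (hermite q)) = omega m n * fockForm p q ∧
      gaussInt (hermite (Gr.parity p) * conjPoly (hermite q)) =
        omega m n * fockForm (Gr.parity p) q from (h q).1
  induction p using Fock.induction with
  | h1 => simp only [Gr.parity_one, hermite_one, one_mul, gaussInt_conjPoly_hermite, and_self,
      implies_true]
  | ha p p' hp hp' =>
    simp only [map_add, add_mul, fockForm_add_left, mul_add, hp, hp', and_self, implies_true]
  | hs c p hp =>
    simp only [map_smul, smul_mul_assoc, fockForm_smul_left, hp, smul_eq_mul, mul_left_comm,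
      and_self, implies_true]
  | hz i p hp =>
    intro q
    have h : (gaussInt (hermite (zvar i * p) * conjPoly (hermite q)) =
        omega m n * fockForm (zvar i * p) q) ∧
        gaussInt (hermite (zvar i * Gr.parity p) * conjPoly (hermite q)) =
        omega m n * fockForm (zvar i * Gr.parity p) q := by
      rcases i with i | a
      · exact ⟨hz _ p q (hp _).1, hz _ (Gr.parity p) q (hp _).2⟩
      · have h2 : sgn (m := m) (Sum.inr a) (Gr.parity p) = p := Gr.parity_parity p
        exact ⟨hz _ p q (hp _).2, hz _ (Gr.parity p) q (by rw [h2]; exact (hp _).1)⟩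
    refine ⟨h.1, ?_⟩
    rw [parity_zvar_mul, map_smul, smul_mul_assoc, map_smul, fockForm_smul_left, smul_eq_mul, h.2,
      mul_left_comm]

/-- The inverse Segal-Bargmann transform preserves the products. -/
theorem formW_invSB (p q : Fock m n) : formW (invSB p) (invSB q) = fockForm p q := by
  rw [invSB_apply, invSB_apply, formW_schroMap, gaussInt_hermite, ← mul_assoc,
    inv_mul_cancel₀ omega_ne_zero, one_mul]

end schroProduct

/-! ### Hilbert superspaces whose parity is the square of a fundamental symmetry -/

namespace SuperForm

section graded
variable {V : Type*} [AddCommGroup V] [Module ℂ V]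

/-- A fundamental symmetry `J` whose square is the parity operator `x ↦ (-1)^{|x|} x`. -/
structure IsGradedSymmetry (H : SuperForm V) (J : V → V) : Prop
    extends H.IsFundamentalSymmetry J where
  mem_part : ∀ (a : ZMod 2) (x), x ∈ H.part a ↔ J (J x) = ((-1 : ℂ) ^ a.val) • x

/-- If the grading is given by the eigenspaces of `J²`, then the linearity in the second argument,
the evenness and the superhermitian symmetry of the form follow from the hermitian symmetry of
`⟨x, J y⟩`. -/
theorem isGradedSymmetry_of {H : SuperForm V} {J : V →ₗ[ℂ] V}
    (add_left : ∀ x y z, H.form (x + y) z = H.form x z + H.form y z)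
    (smul_left : ∀ (c : ℂ) (x y), H.form (c • x) y = c * H.form x y)
    (four : ∀ x, J (J (J (J x))) = x) (form_map : ∀ x y, H.form (J x) (J y) = H.form x y)
    (inner_conj : ∀ x y, H.form x (J y) = (starRingEnd ℂ) (H.form y (J x)))
    (inner_nonneg : ∀ x, 0 ≤ (H.form x (J x)).re)
    (inner_definite : ∀ x, H.form x (J x) = 0 → x = 0)
    (mem_part : ∀ (a : ZMod 2) (x), x ∈ H.part a ↔ J (J x) = ((-1 : ℂ) ^ a.val) • x) :
    H.IsGradedSymmetry J := by
  have hconj : ∀ x y, H.form x y = (starRingEnd ℂ) (H.form y (J (J x))) := fun x y => by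
    rw [← form_map x y, inner_conj]
  have hsr : ∀ (c : ℂ) (x y), H.form x (c • y) = (starRingEnd ℂ) c * H.form x y := by
    intro c x y
    rw [hconj, smul_left, map_mul, ← hconj]
  have h0 : ∀ x, x ∈ H.part 0 ↔ J (J x) = x := fun x => by
    rw [mem_part, ZMod.val_zero, pow_zero, one_smul]
  have h1 : ∀ x, x ∈ H.part 1 ↔ J (J x) = -x := fun x => by
    rw [mem_part, ZMod.val_one, pow_one, neg_one_smul]
  refine ⟨⟨⟨?_, add_left, smul_left, ?_, hsr, ?_, ?_⟩, J.isLinear, four, form_map, inner_conj,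
    inner_nonneg, inner_definite⟩, mem_part⟩
  · constructor
    · rw [Submodule.disjoint_def]
      intro x hx hx'
      have h := ((h0 x).1 hx).symm.trans ((h1 x).1 hx')
      have h2 : (2 : ℂ) • x = 0 := by
        rw [two_smul]
        nth_rewrite 1 [h]
        exact neg_add_cancel x
      exact (smul_eq_zero_iff_right two_ne_zero).1 h2
    · rw [codisjoint_iff, eq_top_iff]
      intro x _
      refine Submodule.mem_sup.2 ⟨(1 / 2 : ℂ) • (x + J (J x)), ?_, (1 / 2 : ℂ) • (x - J (J x)), ?_, ?_⟩
      · rw [h0, map_smul, map_smul, map_add, map_add, four, add_comm]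
      · rw [h1, map_smul, map_smul, map_sub, map_sub, four]
        module
      · module
  · intro x y z
    rw [hconj, add_left, map_add, ← hconj, ← hconj]
  · intro a b x hx y hy
    have e1 : H.form x y = (-1) ^ a.val * (starRingEnd ℂ) (H.form y x) := by
      rw [hconj, (mem_part a x).1 hx, hsr, map_mul, Complex.conj_conj]
    have e2 : H.form x y = (-1) ^ a.val * (-1) ^ b.val * H.form x y := by
      conv_lhs => rw [← form_map, ← form_map, (mem_part a x).1 hx, (mem_part b y).1 hy, smul_left,
        hsr]
      simp [mul_assoc]
    have hab : ∀ a : ZMod 2, a = 0 ∨ a = 1 := by decide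
    rcases hab a with rfl | rfl <;> rcases hab b with rfl | rfl <;>
      simp only [ZMod.val_zero, ZMod.val_one, pow_zero, pow_one, mul_zero, mul_one,
        one_mul] at e1 e2 ⊢
    · exact e1
    · rw [neg_one_mul] at e2
      rw [← e1]
    · rw [neg_one_mul] at e1 e2
      have e3 := self_eq_neg.1 e2
      rw [e3] at e1 ⊢
      exact neg_eq_zero.1 e1.symm |>.symm
    · exact e1
  · intro x hx
    exact inner_definite x (hx _)

/-- Fundamental symmetries can be pulled back along injections that preserve the forms. -/
theorem IsGradedSymmetry.pullback {A : Type*} [AddCommGroup A] [Module ℂ A] {H : SuperForm V}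
    {J : V → V} (h : H.IsGradedSymmetry J) {H' : SuperForm A} {J' : A → A} (φ : A →ₗ[ℂ] V)
    (hφ : Function.Injective φ) (hform : ∀ x y, H'.form x y = H.form (φ x) (φ y))
    (hpart : ∀ a x, x ∈ H'.part a ↔ φ x ∈ H.part a) (hJ : ∀ x, φ (J' x) = J (φ x)) :
    H'.IsGradedSymmetry J' := by
  let J'' : A →ₗ[ℂ] A :=
    { toFun := J'
      map_add' := fun x y => hφ (by rw [hJ, map_add, h.isLinear.map_add, map_add, hJ, hJ])
      map_smul' := fun c x => hφ (by
        rw [hJ, map_smul, h.isLinear.map_smul, RingHom.id_apply, map_smul, hJ]) }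
  have hJ'' : ∀ x, φ (J'' x) = J (φ x) := hJ
  change H'.IsGradedSymmetry J''
  refine isGradedSymmetry_of (fun x y z => ?_) (fun c x y => ?_) (fun x => hφ ?_) (fun x y => ?_)
    (fun x y => ?_) (fun x => ?_) (fun x hx => hφ ?_) (fun a x => ?_)
  · rw [hform, map_add, h.isHermitian.form_add_left, ← hform, ← hform]
  · rw [hform, map_smul, h.isHermitian.form_smul_left, ← hform]
  · rw [hJ'', hJ'', hJ'', hJ'', h.iterate_four]
  · rw [hform, hJ'', hJ'', h.form_map, hform]
  · rw [hform, hJ'', h.inner_conj, hform, hJ'']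
  · rw [hform, hJ'']
    exact h.inner_nonneg _
  · rw [hform, hJ''] at hx
    rw [h.inner_definite _ hx, map_zero]
  · rw [hpart, h.mem_part, ← hJ'', ← hJ'', ← map_smul, hφ.eq_iff]

end graded

section hilbert
variable {V E : Type*} [AddCommGroup V] [Module ℂ V] [NormedAddCommGroup E]
  [InnerProductSpace ℂ E] [CompleteSpace E]

/-- The space `V` with the inner product `(·,·)_J` is identified by `e` with the Hilbert space
`E`. -/
structure IsHilbertModel (H : SuperForm V) (J : V →ₗ[ℂ] V) (e : V ≃ₗ[ℂ] E) : Prop where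
  graded : H.IsGradedSymmetry J
  inner_eq : ∀ x y, inner ℂ (e x) (e y) = H.form y (J x)

theorem isHilbertModel_of {H : SuperForm V} {J : V →ₗ[ℂ] V} {e : V ≃ₗ[ℂ] E}
    (inner_eq : ∀ x y, inner ℂ (e x) (e y) = H.form y (J x))
    (inner_map : ∀ x y, inner ℂ (e (J x)) (e (J y)) = inner ℂ (e x) (e y))
    (four : ∀ x, J (J (J (J x))) = x)
    (mem_part : ∀ (a : ZMod 2) (x), x ∈ H.part a ↔ J (J x) = ((-1 : ℂ) ^ a.val) • x) :
    H.IsHilbertModel J e := by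
  have hf : ∀ x y, H.form x y = inner ℂ (e (J (J (J y)))) (e x) := fun x y => by
    rw [inner_eq, four]
  refine ⟨isGradedSymmetry_of ?_ ?_ four ?_ ?_ ?_ ?_ mem_part, inner_eq⟩
  · intro x y z
    rw [hf, map_add, inner_add_right, ← hf, ← hf]
  · intro c x y
    rw [hf, map_smul, inner_smul_right, ← hf]
  · intro x y
    rw [hf, inner_map, ← hf]
  · intro x y
    rw [← inner_eq, ← inner_eq, inner_conj_symm]
  · intro x
    rw [← inner_eq]
    exact inner_self_nonneg (𝕜 := ℂ)
  · intro x hx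
    rw [← inner_eq, inner_self_eq_zero] at hx
    exact (map_eq_zero_iff e e.injective).1 hx

variable {H : SuperForm V} {J : V →ₗ[ℂ] V} {e : V ≃ₗ[ℂ] E}

theorem IsHilbertModel.form_eq (h : H.IsHilbertModel J e) (x y : V) :
    H.form x y = inner ℂ (e (J (J (J y)))) (e x) := by
  rw [h.inner_eq, h.graded.iterate_four]

theorem IsHilbertModel.inner_map (h : H.IsHilbertModel J e) (x y : V) :
    inner ℂ (e (J x)) (e (J y)) = inner ℂ (e x) (e y) := by
  rw [h.inner_eq, h.graded.form_map, h.inner_eq]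

theorem IsHilbertModel.normJ_eq (h : H.IsHilbertModel J e) (x : V) : H.normJ J x = ‖e x‖ := by
  rw [normJ, ← h.inner_eq, norm_eq_sqrt_re_inner (𝕜 := ℂ)]
  rfl

theorem IsHilbertModel.isHilbertSymmetry (h : H.IsHilbertModel J e) : H.IsHilbertSymmetry J := by
  refine { h.graded.toIsFundamentalSymmetry with complete := fun u hu => ?_ }
  have hc : CauchySeq fun k => e (u k) := by
    rw [Metric.cauchySeq_iff]
    intro ε hε
    obtain ⟨N, hN⟩ := hu ε hε
    refine ⟨N, fun p hp q hq => ?_⟩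
    rw [dist_eq_norm, ← map_sub, ← h.normJ_eq]
    exact hN p hp q hq
  obtain ⟨y, hy⟩ := cauchySeq_tendsto_of_complete hc
  refine ⟨e.symm y, fun ε hε => ?_⟩
  obtain ⟨N, hN⟩ := Metric.tendsto_atTop.1 hy ε hε
  refine ⟨N, fun p hp => ?_⟩
  rw [h.normJ_eq, map_sub, LinearEquiv.apply_symm_apply, ← dist_eq_norm]
  exact hN p hp

theorem IsHilbertModel.isHilbert (h : H.IsHilbertModel J e) : H.IsHilbert :=
  ⟨J, h.isHilbertSymmetry⟩

/-- Closed subspaces that are stable under the fundamental symmetry are Hilbert superspaces. -/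
theorem IsHilbertModel.restrict (h : H.IsHilbertModel J e) (N : Submodule ℂ V)
    (hN : ∀ x ∈ N, J x ∈ N) [CompleteSpace (N.map (e : V →ₗ[ℂ] E))] :
    (H.restrict N).IsHilbertModel (J.restrict hN) (e.submoduleMap N) := by
  refine isHilbertModel_of (fun x y => ?_) (fun x y => ?_) (fun x => ?_) (fun a x => ?_)
  · exact h.inner_eq x y
  · exact h.inner_map x y
  · exact Subtype.ext (h.graded.iterate_four x)
  · refine (h.graded.mem_part a x).trans ?_
    exact ⟨fun h => Subtype.ext h, fun h => congrArg Subtype.val h⟩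

end hilbert

/-! ### Completions -/

section completion
variable {V : Type*} [AddCommGroup V] [Module ℂ V] {H : SuperForm V} {J : V → V}

/-- The fundamental symmetry as an isometry. -/
def symIsometry (h : H.IsFundamentalSymmetry J) :
    PreHilbert H J h →ₗᵢ[ℂ] PreHilbert H J h :=
  LinearMap.isometryOfInner
    { toFun := J
      map_add' := h.isLinear.map_add
      map_smul' := h.isLinear.map_smul } fun _ _ => h.form_map _ _

/-- The extension of the fundamental symmetry to the completion. -/
def symCompletion (h : H.IsFundamentalSymmetry J) : Completion h →ₗ[ℂ] Completion h :=
  ((symIsometry h).toContinuousLinearMap.completion : Completion h →L[ℂ] Completion h)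

theorem symCompletion_toCompletion (h : H.IsFundamentalSymmetry J) (x : V) :
    symCompletion h (toCompletion h x) = toCompletion h (J x) :=
  ContinuousLinearMap.completion_apply_coe _ _

theorem continuous_symCompletion (h : H.IsFundamentalSymmetry J) :
    Continuous (symCompletion h) :=
  ((symIsometry h).toContinuousLinearMap.completion : Completion h →L[ℂ] Completion h).continuous

theorem denseRange_toCompletion (h : H.IsFundamentalSymmetry J) :
    DenseRange (toCompletion h) :=
  UniformSpace.Completion.denseRange_coe (α := PreHilbert H J h)

theorem inner_toCompletion (h : H.IsFundamentalSymmetry J) (x y : V) :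
    inner ℂ (toCompletion h x) (toCompletion h y) = H.form y (J x) :=
  UniformSpace.Completion.inner_coe (𝕜 := ℂ) (E := PreHilbert H J h) x y

theorem symCompletion_four (h : H.IsFundamentalSymmetry J) (x : Completion h) :
    symCompletion h (symCompletion h (symCompletion h (symCompletion h x))) = x := by
  have hc := continuous_symCompletion h
  refine (denseRange_toCompletion h).induction_on x
    (isClosed_eq (hc.comp (hc.comp (hc.comp hc))) continuous_id) fun x => ?_
  simp only [symCompletion_toCompletion, h.iterate_four]

theorem completion_form (h : H.IsFundamentalSymmetry J) (x y : Completion h) :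
    (completion h).form x y =
      inner ℂ (symCompletion h (symCompletion h (symCompletion h y))) x := by
  have hc := continuous_symCompletion h
  have key := (UniformSpace.Completion.isDenseInducing_coe.prodMap
    UniformSpace.Completion.isDenseInducing_coe).extend_unique
    (f := fun p : PreHilbert H J h × PreHilbert H J h => H.form p.1 p.2)
    (g := fun p : Completion h × Completion h =>
      inner ℂ (symCompletion h (symCompletion h (symCompletion h p.2))) p.1) ?_ ?_
  · exact congrFun key (x, y)
  · suffices hs : ∀ x y : V, inner ℂ (symCompletion h (symCompletion h (symCompletion h
        (toCompletion h y)))) (toCompletion h x) = H.form x y from fun p => hs p.1 p.2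
    intro x y
    rw [symCompletion_toCompletion, symCompletion_toCompletion, symCompletion_toCompletion,
      inner_toCompletion, h.iterate_four]
  · exact Continuous.inner (hc.comp (hc.comp (hc.comp continuous_snd))) continuous_fst

theorem IsGradedSymmetry.completion (h : H.IsGradedSymmetry J) :
    (completion h.toIsFundamentalSymmetry).IsHilbertModel
      (symCompletion h.toIsFundamentalSymmetry) (LinearEquiv.refl ℂ _) := by
  set h' := h.toIsFundamentalSymmetry
  have hc := continuous_symCompletion h'
  refine isHilbertModel_of (fun x y => ?_) (fun x y => ?_) (symCompletion_four h') (fun a x => ?_)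
  · rw [completion_form, symCompletion_four]
    rfl
  · change inner ℂ (symCompletion h' x) (symCompletion h' y) = inner ℂ x y
    refine (denseRange_toCompletion h').induction_on₂ (isClosed_eq ?_ ?_) ?_ x y
    · exact Continuous.inner (hc.comp continuous_fst) (hc.comp continuous_snd)
    · exact Continuous.inner continuous_fst continuous_snd
    · intro x y
      rw [symCompletion_toCompletion, symCompletion_toCompletion, inner_toCompletion, h'.form_map,
        inner_toCompletion]
  · have hs : ((-1 : ℂ) ^ a.val) * ((-1 : ℂ) ^ a.val) = 1 := by
      rw [← pow_add, ← two_mul, pow_mul]; simp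
    constructor
    · intro hx
      refine closure_minimal (s := ((H.part a).map (toCompletion h') : Set (Completion h')))
        (t := {x | symCompletion h' (symCompletion h' x) = ((-1 : ℂ) ^ a.val) • x}) ?_ ?_ hx
      · rintro _ ⟨y, hy, rfl⟩
        change symCompletion h' (symCompletion h' (toCompletion h' y)) = _ • toCompletion h' y
        rw [symCompletion_toCompletion, symCompletion_toCompletion, (h.mem_part a y).1 hy, map_smul]
      · exact isClosed_eq (hc.comp hc) (continuous_const_smul _)
    · intro hx
      -- the projection onto the homogeneous part maps the dense subspace into it
      have key : ∀ y : Completion h', (1 / 2 : ℂ) • (y + ((-1 : ℂ) ^ a.val) •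
          symCompletion h' (symCompletion h' y)) ∈
          ((H.part a).map (toCompletion h')).topologicalClosure := by
        intro y
        refine (denseRange_toCompletion h').induction_on y ?_ fun y => ?_
        · refine (Submodule.isClosed_topologicalClosure _).preimage ?_
          exact (continuous_const_smul _).comp
            (continuous_id.add ((continuous_const_smul _).comp (hc.comp hc)))
        · refine Submodule.le_topologicalClosure _ ⟨(1 / 2 : ℂ) • (y + ((-1 : ℂ) ^ a.val) • J (J y)),
            ?_, ?_⟩
          · refine (h.mem_part a _).2 ?_
            have hl := h'.isLinear
            rw [hl.map_smul, hl.map_smul, hl.map_add, hl.map_add, hl.map_smul, hl.map_smul,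
              h'.iterate_four]
            generalize J (J y) = w
            generalize ((-1 : ℂ) ^ a.val) = s at hs
            match_scalars
            · linear_combination (-1 / 2 : ℂ) * hs
            · ring
          · rw [map_smul, map_add, map_smul, symCompletion_toCompletion,
              symCompletion_toCompletion]
      have h2 := key x
      rw [hx, smul_smul, hs, one_smul, ← two_smul ℂ x, smul_smul] at h2
      norm_num at h2
      exact h2

end completion

/-! ### Extension of densely defined maps to superunitary operators -/

section extension
variable {V₁ V₂ E₁ E₂ : Type*} [AddCommGroup V₁] [Module ℂ V₁] [AddCommGroup V₂] [Module ℂ V₂]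
  [NormedAddCommGroup E₁] [InnerProductSpace ℂ E₁] [CompleteSpace E₁]
  [NormedAddCommGroup E₂] [InnerProductSpace ℂ E₂] [CompleteSpace E₂]
  {H₁ : SuperForm V₁} {H₂ : SuperForm V₂} {J₁ : V₁ →ₗ[ℂ] V₁} {J₂ : V₂ →ₗ[ℂ] V₂}
  {e₁ : V₁ ≃ₗ[ℂ] E₁} {e₂ : V₂ ≃ₗ[ℂ] E₂}

theorem IsHilbertModel.continuous_conj (h : H₁.IsHilbertModel J₁ e₁) :
    Continuous fun x : E₁ => e₁ (J₁ (e₁.symm x)) := by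
  let f : E₁ →ₗᵢ[ℂ] E₁ := LinearMap.isometryOfInner
    ((e₁ : V₁ →ₗ[ℂ] E₁) ∘ₗ J₁ ∘ₗ (e₁.symm : E₁ →ₗ[ℂ] V₁)) fun x y => by
      have := h.inner_map (e₁.symm x) (e₁.symm y)
      rwa [LinearEquiv.apply_symm_apply, LinearEquiv.apply_symm_apply] at this
  exact f.continuous

theorem isSuperadjoint_of (h₁ : H₁.IsHilbertModel J₁ e₁) (h₂ : H₂.IsHilbertModel J₂ e₂)
    (T : V₁ ≃ₗ[ℂ] V₂) (hT : ∀ x y, inner ℂ (e₂ (T x)) (e₂ (T y)) = inner ℂ (e₁ x) (e₁ y))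
    (hJ : ∀ x, T (J₁ x) = J₂ (T x)) :
    H₁.IsSuperunitary H₂ T.toLinearMap := by
  have hn : ∀ x, ‖e₂ (T x)‖ = ‖e₁ x‖ := fun x => by
    rw [norm_eq_sqrt_re_inner (𝕜 := ℂ), hT, ← norm_eq_sqrt_re_inner (𝕜 := ℂ)]
  refine ⟨h₁.isHilbert, h₂.isHilbert, ⟨J₁, J₂, h₁.isHilbertSymmetry, h₂.isHilbertSymmetry, 1,
    fun x => ?_⟩, fun a x hx => ?_, T.symm.toLinearMap, ⟨⟨J₂, J₁, h₂.isHilbertSymmetry,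
    h₁.isHilbertSymmetry, 1, fun x => ?_⟩, fun a x _ y => ?_⟩, ?_, ?_⟩
  · rw [h₂.normJ_eq, h₁.normJ_eq, one_mul]
    exact (hn x).le
  · rw [zero_add, h₂.graded.mem_part]
    rw [h₁.graded.mem_part] at hx
    change J₂ (J₂ (T x)) = _ • T x
    rw [← hJ, ← hJ, hx, map_smul]
  · rw [h₂.normJ_eq, h₁.normJ_eq, one_mul, ← hn]
    exact le_of_eq (congrArg _ (congrArg _ (T.apply_symm_apply x)))
  · have h : H₂.form x (T y) = H₁.form (T.symm x) y := by
      rw [h₂.form_eq, h₁.form_eq, ← hJ, ← hJ, ← hJ, ← hT, T.apply_symm_apply]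
    rw [ZMod.val_zero, zero_mul, pow_zero, one_mul]
    exact h.symm
  · ext x; exact T.symm_apply_apply x
  · ext x; exact T.apply_symm_apply x

theorem IsSuperunitary.form_map {T : V₁ →ₗ[ℂ] V₂} (h₁ : H₁.IsHermitian) (h₂ : H₂.IsHermitian)
    (hT : H₁.IsSuperunitary H₂ T) (x y : V₁) : H₂.form (T x) (T y) = H₁.form x y := by
  obtain ⟨T', hT', hl, -⟩ := hT.adjoint
  have key : ∀ z, H₁.form (T' z) y = H₂.form z (T y) := by
    intro z
    have hz : z ∈ H₂.part 0 ⊔ H₂.part 1 := by rw [h₂.isCompl.sup_eq_top]; trivial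
    obtain ⟨u, hu, v, hv, rfl⟩ := Submodule.mem_sup.1 hz
    have hu' := hT'.2 0 u hu y
    have hv' := hT'.2 1 v hv y
    rw [ZMod.val_zero, zero_mul, pow_zero, one_mul] at hu' hv'
    rw [map_add, h₁.form_add_left, h₂.form_add_left, hu', hv']
  rw [← key]
  exact congrArg (fun u => H₁.form u y) (LinearMap.congr_fun hl x)

/-- A densely defined map with dense range that preserves the forms and commutes with the
fundamental symmetries extends to exactly one superunitary operator. -/
theorem existsUnique_superunitary {B : Type*} [AddCommGroup B] [Module ℂ B]
    (h₁ : H₁.IsHilbertModel J₁ e₁) (h₂ : H₂.IsHilbertModel J₂ e₂) (j₁ : B →ₗ[ℂ] V₁)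
    (j₂ : B →ₗ[ℂ] V₂) (J : B → B) (hd₁ : DenseRange fun b => e₁ (j₁ b))
    (hd₂ : DenseRange fun b => e₂ (j₂ b)) (hJ₁ : ∀ b, j₁ (J b) = J₁ (j₁ b))
    (hJ₂ : ∀ b, j₂ (J b) = J₂ (j₂ b))
    (hform : ∀ b c, H₂.form (j₂ b) (j₂ c) = H₁.form (j₁ b) (j₁ c)) :
    ∃! T : V₁ →ₗ[ℂ] V₂, (∀ b, T (j₁ b) = j₂ b) ∧ H₁.IsSuperunitary H₂ T := by
  let U : E₁ ≃ₗᵢ[ℂ] E₂ := (LinearEquiv.refl ℂ B).extendOfIsometry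
    ((e₁ : V₁ →ₗ[ℂ] E₁) ∘ₗ j₁) ((e₂ : V₂ →ₗ[ℂ] E₂) ∘ₗ j₂) hd₁ hd₂ fun b => by
      change ‖e₂ (j₂ b)‖ = ‖e₁ (j₁ b)‖
      rw [norm_eq_sqrt_re_inner (𝕜 := ℂ), h₂.inner_eq, ← hJ₂, hform, hJ₁, ← h₁.inner_eq,
        ← norm_eq_sqrt_re_inner (𝕜 := ℂ)]
  have hU : ∀ b, U (e₁ (j₁ b)) = e₂ (j₂ b) :=
    LinearEquiv.extendOfIsometry_eq (LinearEquiv.refl ℂ B) ((e₁ : V₁ →ₗ[ℂ] E₁) ∘ₗ j₁)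
      ((e₂ : V₂ →ₗ[ℂ] E₂) ∘ₗ j₂) hd₁ hd₂ _
  let T : V₁ ≃ₗ[ℂ] V₂ := e₁.trans (U.toLinearEquiv.trans e₂.symm)
  have hTe : ∀ x, e₂ (T x) = U (e₁ x) := fun x => e₂.apply_symm_apply _
  have hTj : ∀ b, T (j₁ b) = j₂ b := fun b => e₂.injective (by rw [hTe, hU])
  have hTJ : ∀ x, T (J₁ x) = J₂ (T x) := by
    have key : ∀ y : E₁, U (e₁ (J₁ (e₁.symm y))) = e₂ (J₂ (e₂.symm (U y))) := by
      intro y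
      refine hd₁.induction_on y (isClosed_eq (U.continuous.comp h₁.continuous_conj)
        (h₂.continuous_conj.comp U.continuous)) fun b => ?_
      rw [LinearEquiv.symm_apply_apply, ← hJ₁, hU, hJ₂, hU, LinearEquiv.symm_apply_apply]
    intro x
    refine e₂.injective ?_
    have := key (e₁ x)
    rw [LinearEquiv.symm_apply_apply] at this
    rw [hTe, this, ← hTe, LinearEquiv.symm_apply_apply]
  refine ⟨T.toLinearMap, ⟨hTj, isSuperadjoint_of h₁ h₂ T (fun x y => ?_) hTJ⟩, ?_⟩
  · rw [hTe, hTe, U.inner_map_map]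
  · rintro S ⟨hSj, hS⟩
    refine LinearMap.ext fun x => ?_
    -- `S x - T x` is orthogonal to the dense image of `j₂`
    have hS' := hS.form_map h₁.graded.isHermitian h₂.graded.isHermitian x
    have hT' := (isSuperadjoint_of h₁ h₂ T (fun x y => by rw [hTe, hTe, U.inner_map_map])
      hTJ).form_map h₁.graded.isHermitian h₂.graded.isHermitian x
    have key : ∀ z : E₂, inner ℂ z (e₂ (S x)) = inner ℂ z (e₂ (T x)) := by
      intro z
      refine hd₂.induction_on z (isClosed_eq (continuous_id.inner continuous_const)
        (continuous_id.inner continuous_const)) fun b => ?_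
      rw [h₂.inner_eq, h₂.inner_eq, ← hJ₂]
      have h3 := hS' (j₁ (J b))
      have h4 := hT' (j₁ (J b))
      rw [hSj] at h3
      rw [h3, ← h4]
      exact congrArg _ (hTj _)
    exact e₂.injective (ext_inner_left ℂ key)

end extension
end SuperForm


/-! ### The minimal Fock model inside the metaplectic Fock model -/

section fockModels
variable {m n : ℕ}

theorem symFₗ_coe : (symFₗ : Fock m n → Fock m n) = symF := funext symFₗ_apply

theorem fockInner_self_re (p : Fock m n) : (fockInner p p).re = ∑ S, (polyFock (p S) (p S)).re := by
  rw [fockInner, Complex.re_sum]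

theorem fock_isGradedSymmetry : (fockSuper m n).IsGradedSymmetry symF := by
  rw [← symFₗ_coe]
  refine SuperForm.isGradedSymmetry_of fockForm_add_left fockForm_smul_left symFₗ_four
    (fun p q => ?_) (fun p q => ?_) (fun p => ?_) (fun p hp => ?_) (fun a p => ?_)
  · change fockForm (symFₗ p) (symFₗ q) = fockForm p q
    rw [fockForm_symFₗ, fockForm_conj p q, ← symFₗ_symFₗ, fockForm_symFₗ, ← fockInner_conj]
  · change fockForm p (symFₗ q) = (starRingEnd ℂ) (fockForm q (symFₗ p))
    rw [fockForm_symFₗ, fockForm_symFₗ, ← fockInner_conj]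
  · change 0 ≤ (fockForm p (symFₗ p)).re
    rw [fockForm_symFₗ, fockInner_self_re]
    exact Finset.sum_nonneg fun S _ => polyFock_self_nonneg _
  · change fockForm p (symFₗ p) = 0 at hp
    rw [fockForm_symFₗ] at hp
    have h := fockInner_self_re p
    rw [hp, Complex.zero_re] at h
    have h2 := (Finset.sum_eq_zero_iff_of_nonneg fun S _ => polyFock_self_nonneg _).1 h.symm
    ext1 S
    exact polyFock_definite _ (h2 S (Finset.mem_univ S))
  · rw [symFₗ_symFₗ]
    exact Gr.mem_part_iff p a

theorem foldAlg_mkQ_eq {p q : PJ m n} (h : (idealJ m n).mkQ p = (idealJ m n).mkQ q) :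
    foldAlg p = foldAlg q := by
  rw [← sub_eq_zero, ← map_sub, foldAlg_eq_zero_iff, ← Submodule.Quotient.eq]
  exact h

theorem mkQ_out (x : MinFock m n) : (idealJ m n).mkQ x.out = x := Quotient.out_eq x

theorem psiC_mkQ (p : PJ m n) : psiC ((idealJ m n).mkQ p) = foldAlg p := by
  rw [psiC, ← foldAlg_apply]
  exact foldAlg_mkQ_eq (mkQ_out _)

/-- The folding isomorphism as a linear map. -/
def psiCₗ : MinFock m n →ₗ[ℂ] Fock m n :=
  (idealJ m n).liftQ foldAlg.toLinearMap fun _ hp => (foldAlg_eq_zero_iff _).2 hp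

theorem psiCₗ_apply (x : MinFock m n) : psiCₗ x = psiC x := by
  obtain ⟨p, rfl⟩ := (idealJ m n).mkQ_surjective x
  rw [psiC_mkQ]
  rfl

theorem psiCₗ_injective : Function.Injective (psiCₗ (m := m) (n := n)) := by
  rw [injective_iff_map_eq_zero]
  intro x hx
  obtain ⟨p, rfl⟩ := (idealJ m n).mkQ_surjective x
  rw [psiCₗ_apply, psiC_mkQ, foldAlg_eq_zero_iff] at hx
  exact (Submodule.Quotient.mk_eq_zero _).2 hx

theorem range_psiCₗ : LinearMap.range (psiCₗ (m := m) (n := n)) = fockEven m n := by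
  ext q
  constructor
  · rintro ⟨x, rfl⟩
    obtain ⟨p, rfl⟩ := (idealJ m n).mkQ_surjective x
    rw [psiCₗ_apply, psiC_mkQ]
    exact foldAlg_mem_fockEven p
  · intro hq
    obtain ⟨p, hp⟩ := exists_foldAlg_eq hq
    exact ⟨(idealJ m n).mkQ p, by rw [psiCₗ_apply, psiC_mkQ, hp]⟩

theorem psiC_injective : Function.Injective (psiC (m := m) (n := n)) := by
  have h := psiCₗ_injective (m := m) (n := n)
  rwa [show (psiCₗ : MinFock m n → Fock m n) = psiC from funext psiCₗ_apply] at h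

theorem psiC_invFun {q : Fock m n} (hq : q ∈ fockEven m n) :
    psiC (Function.invFun psiC q) = q := by
  refine Function.invFun_eq ?_
  rw [← range_psiCₗ] at hq
  obtain ⟨x, hx⟩ := hq
  exact ⟨x, by rw [← psiCₗ_apply, hx]⟩

theorem psiC_mem_fockEven (x : MinFock m n) : psiC x ∈ fockEven m n := by
  rw [← range_psiCₗ]
  exact ⟨x, psiCₗ_apply x⟩

theorem negVars_mul (p q : Fock m n) : negVars (p * q) = negVars p * negVars q := by
  rw [negVars_eq, map_mul, Gr.parity_mul]
  rfl

theorem negVars_zup (j : Idx m n) : negVars (zup j : Fock m n) = -zup j := by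
  have h := negVars_zvar_mul (dual j) (1 : Fock m n)
  rw [mul_one, negVars_one, mul_one] at h
  rw [zup, map_smul, h, smul_neg]

theorem symFₗ_negVars (p : Fock m n) : symFₗ (negVars p) = negVars (symFₗ p) := by
  induction p using Fock.induction with
  | h1 => rw [negVars_one, symFₗ_one, negVars_one]
  | ha p q hp hq => rw [map_add, map_add, hp, hq, map_add, map_add]
  | hs c p hp => rw [map_smul, map_smul, hp, map_smul, map_smul]
  | hz j p hp =>
    rw [negVars_zvar_mul, map_neg, symFₗ_zvar_mul, hp, symFₗ_zvar_mul, negVars_mul, negVars_zup,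
      mul_neg]

theorem symF_mem_fockEven {q : Fock m n} (hq : q ∈ fockEven m n) : symF q ∈ fockEven m n := by
  rw [mem_fockEven_iff] at hq ⊢
  rw [← symFₗ_apply, ← symFₗ_negVars, hq]

theorem psiC_symMinF (x : MinFock m n) : psiC (symMinF x) = symF (psiC x) :=
  psiC_invFun (symF_mem_fockEven (psiC_mem_fockEven x))

theorem besselFischer_out (p q : PJ m n) :
    besselFischer ((idealJ m n).mkQ p).out ((idealJ m n).mkQ q).out = besselFischer p q := by
  rw [besselFischer_eq, besselFischer_eq, foldAlg_mkQ_eq (mkQ_out _), foldAlg_mkQ_eq (mkQ_out _)]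

theorem minFock_form (x y : MinFock m n) :
    (minFockSuper m n).form x y = fockForm (psiC x) (psiC y) := by
  rw [psiC, psiC, ← foldAlg_apply, ← foldAlg_apply, ← besselFischer_eq]
  rfl

theorem foldAlg_parity (p : PJ m n) : foldAlg (Gr.parity p) = Gr.parity (foldAlg p) := by
  induction p using SPoly.induction' with
  | h1 => rw [Gr.parity_one, map_one, Gr.parity_one]
  | ha p q hp hq => rw [map_add, map_add, hp, hq, map_add, map_add]
  | hs c p hp => rw [map_smul, map_smul, hp, map_smul, map_smul]
  | hv u p hp =>
    have h : Gr.parity (zz (pairOf u).1 (pairOf u).2 : Fock m n) =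
        ((-1 : ℂ) ^ (par (pairOf u).1 + par (pairOf u).2)) • zz (pairOf u).1 (pairOf u).2 := by
      have h1 := parity_zvar_mul (pairOf u).2 (1 : Fock m n)
      rw [mul_one, Gr.parity_one, mul_one] at h1
      rw [zz, parity_zvar_mul, h1, mul_smul_comm, smul_smul, pow_add]
    rw [Gr.parity_mul, map_mul, map_mul, Gr.parity_mul, hp, foldAlg_var, h, var_eq_ellP,
      parity_ellP, map_smul, foldAlg_ellP]

theorem minFock_part (a : ZMod 2) (x : MinFock m n) :
    x ∈ (minFockSuper m n).part a ↔ psiC x ∈ (fockSuper m n).part a := by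
  obtain ⟨p, rfl⟩ := (idealJ m n).mkQ_surjective x
  rw [psiC_mkQ]
  constructor
  · rintro ⟨q, hq, hqp⟩
    rw [← foldAlg_mkQ_eq hqp]
    change _ ∈ Gr.part a
    rw [Gr.mem_part_iff, ← foldAlg_parity, (Gr.mem_part_iff _ _).1 hq, map_smul]
  · intro hp
    have hs : ((-1 : ℂ) ^ a.val) * ((-1 : ℂ) ^ a.val) = 1 := by
      rw [← pow_add, ← two_mul, pow_mul]; simp
    have h1 := (Gr.mem_part_iff _ _).1 hp
    refine ⟨(1 / 2 : ℂ) • (p + ((-1 : ℂ) ^ a.val) • Gr.parity p), ?_, ?_⟩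
    · refine (Gr.mem_part_iff _ _).2 ?_
      rw [map_smul, map_add, map_smul, Gr.parity_parity]
      generalize Gr.parity p = w
      generalize ((-1 : ℂ) ^ a.val) = s at hs
      match_scalars
      · linear_combination (-1 / 2 : ℂ) * hs
      · ring
    · refine psiC_injective ?_
      rw [psiC_mkQ, psiC_mkQ, map_smul, map_add, map_smul, foldAlg_parity, h1, smul_smul, hs,
        one_smul, ← two_smul ℂ (foldAlg p), smul_smul]
      norm_num

theorem minFock_isGradedSymmetry : (minFockSuper m n).IsGradedSymmetry symMinF := by
  refine fock_isGradedSymmetry.pullback psiCₗ psiCₗ_injective (fun x y => ?_) (fun a x => ?_)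
    (fun x => ?_)
  · rw [minFock_form, psiCₗ_apply, psiCₗ_apply]; rfl
  · rw [minFock_part, psiCₗ_apply]
  · rw [psiCₗ_apply, psiCₗ_apply, psiC_symMinF]

end fockModels

/-! ### The minimal Schrödinger model -/

section minSchro
variable {m n : ℕ}

theorem sexp_const {X τ : Type*} [LinearOrder τ] [Fintype τ] (a : X → ℂ) :
    sexp (Gr.const a : SFun X τ) = Gr.const fun x => Complex.exp (a x) := by
  have h0 : (Gr.const a : SFun X τ) ∅ = a := by rw [Gr.const, if_pos rfl]
  rw [sexp, h0, sub_self, Finset.sum_eq_single 0]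
  · simp
  · intro k _ hk; rw [zero_pow hk, smul_zero]
  · simp

/-- The exponent of `exp(-2e)`. -/
def expExponent (m n : ℕ) : MvPolynomial (EvJ m n) ℂ :=
  -∑ i, ∑ j, (betaInv i j • (ellP i j : PJ m n)) ∅

theorem ell_evJ (i j : Idx m n) : ell evJ i j = evalR (ellP i j : PJ m n) := by
  have hX : ∀ u : EvJ m n, AlgHom.pi (fun x : EvJ m n → ℝ => evalReal x) (MvPolynomial.X u) =
      evJ u := by
    intro u
    funext x
    exact MvPolynomial.aeval_X (R := ℂ) (fun i => ((x i : ℝ) : ℂ)) u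
  have hc : ∀ u : EvJ m n, evalRAlg (Gr.const (MvPolynomial.X u) : PJ m n) = Gr.const (evJ u) := by
    intro u
    rw [evalRAlg, Gr.mapAlg_const, hX]
  have hg : ∀ t : OdJ m n, evalRAlg (Gr.gen t : PJ m n) = Gr.gen t := fun t => Gr.mapAlg_gen _ t
  rw [← evalRAlg_apply]
  rcases i with i | a <;> rcases j with j | b <;> simp only [ellP, ell]
  · split_ifs <;> rw [hc]
  · rw [hg]
  · rw [hg]
  · split_ifs
    · rw [hc]
    · rw [map_neg, hc]
    · rw [map_zero]

theorem betaInv_smul_ellP (i j : Idx m n) : betaInv i j • (ellP i j : PJ m n) =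
    Gr.const ((betaInv i j • (ellP i j : PJ m n)) ∅) := by
  have hc : ∀ (c : ℂ) (r : MvPolynomial (EvJ m n) ℂ), c • (Gr.const r : PJ m n) =
      Gr.const ((c • (Gr.const r : PJ m n)) ∅) := by
    intro c r
    ext1 S
    refine (Gr.smul_apply _ _ _).trans ?_
    rw [Gr.const, Gr.const, Gr.smul_apply c]
    by_cases h : S = ∅ <;> simp [h, Gr.const]
  rcases i with i | a <;> rcases j with j | b
  · simp only [ellP, ell]
    split_ifs <;> exact hc _ _
  · simp only [betaInv, beta, zero_smul, Gr.zero_apply, Gr.const_zero]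
  · simp only [betaInv, beta, zero_smul, Gr.zero_apply, Gr.const_zero]
  · simp only [ellP, ell]
    split_ifs
    · exact hc _ _
    · rw [smul_neg, ← neg_smul]; exact hc _ _
    · simp only [smul_zero, Gr.zero_apply, Gr.const_zero]

theorem expJ_eq : expJ m n = expPoly (expExponent m n) := by
  have h : (-∑ i, ∑ j, betaInv i j • ell evJ i j : SFJ m n) =
      Gr.const fun x => evalReal x (expExponent m n) := by
    have h1 : (-∑ i, ∑ j, betaInv i j • ellP i j : PJ m n) = Gr.const (expExponent m n) := by
      let c : MvPolynomial (EvJ m n) ℂ →+ PJ m n := AddMonoidHom.mk' Gr.const Gr.const_add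
      have hc : c (expExponent m n) =
          -∑ i, ∑ j, c ((betaInv i j • (ellP i j : PJ m n)) ∅) := by
        rw [expExponent, map_neg, map_sum]
        simp only [map_sum]
      change _ = c _
      rw [hc]
      exact congrArg _ (Finset.sum_congr rfl fun i _ => Finset.sum_congr rfl fun j _ =>
        betaInv_smul_ellP i j)
    have h2 := congrArg evalRAlg h1
    rw [map_neg, map_sum] at h2
    simp only [map_sum, map_smul, evalRAlg_apply, ← ell_evJ] at h2
    rw [h2, ← evalRAlg_apply, evalRAlg, Gr.mapAlg_const]
    rfl
  rw [expJ, h, sexp_const]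
  rfl

theorem evalR_mul (p q : PJ m n) : evalR (p * q) = evalR p * evalR q := by
  rw [← evalRAlg_apply, map_mul, evalRAlg_apply, evalRAlg_apply]

/-- The superfunction `p exp(-2e)`. -/
def expMap : PJ m n →ₗ[ℂ] SFJ m n := LinearMap.mulRight ℂ (expJ m n) ∘ₗ evalRAlg.toLinearMap

theorem expMap_apply (p : PJ m n) : expMap p = evalR p * expJ m n := by
  rw [← evalRAlg_apply]; rfl

theorem expMap_eq (p : PJ m n) : expMap p = expPoly (expExponent m n) * evalR p := by
  rw [expMap_apply, expJ_eq, expPoly_mul_comm]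

theorem expMap_injective : Function.Injective (expMap (m := m) (n := n)) := by
  intro p q h
  rw [expMap_eq, expMap_eq] at h
  have h2 := expPoly_mul_injective _ h
  rw [← evalRAlg_apply, ← evalRAlg_apply] at h2
  exact evalRAlg_injective h2

theorem ell_mul_expMap (i j : Idx m n) (p : PJ m n) :
    ell evJ i j * expMap p = expMap (ellP i j * p) := by
  rw [expMap_apply, expMap_apply, ell_evJ, ← mul_assoc, evalR_mul]

theorem pd_expMap (u : EvJ m n ⊕ OdJ m n) (p : PJ m n) : pd pdFun u (expMap p) =
    expMap (SPoly.deriv u p + derivExponent (expExponent m n) u * p) := by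
  rw [expMap_eq, pd_expPoly_mul, expMap_eq]

theorem linJ_evJ (X : Matrix (Idx m n) (Idx m n) ℂ) :
    linJ evJ X = evalR (linJ MvPolynomial.X X : PJ m n) := by
  rw [← evalRAlg_apply, linJ, linJ]
  simp only [map_sum, map_smul, ell_evJ, ← evalRAlg_apply]
  rfl

theorem bessel_expMap (x : EvJ m n ⊕ OdJ m n) (p : PJ m n) :
    bessel evJ pdFun x (expMap p) ∈ LinearMap.range (expMap (m := m) (n := n)) := by
  rw [bessel]
  refine Submodule.add_mem _ (Submodule.sum_mem _ fun u _ => ?_)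
    (Submodule.sum_mem _ fun u _ => Submodule.sum_mem _ fun v _ => ?_)
  · rw [pd_expMap]
    exact Submodule.smul_mem _ _ ⟨_, rfl⟩
  · rw [pd_expMap, pd_expMap, linJ_evJ, expMap_apply, ← mul_assoc, ← evalR_mul, ← expMap_apply]
    exact ⟨_, rfl⟩

theorem modExp_eq : modExp m n = LinearMap.range (expMap (m := m) (n := n)) := by
  refine le_antisymm (sInf_le ⟨⟨1, ?_⟩, ?_, ?_⟩) (le_sInf ?_)
  · rw [expMap_apply, ← evalRAlg_apply, map_one, one_mul]
  · rintro i j _ ⟨p, rfl⟩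
    exact ⟨_, (ell_mul_expMap i j p).symm⟩
  · rintro x _ ⟨p, rfl⟩
    exact bessel_expMap x p
  · rintro N ⟨h1, h2, -⟩ _ ⟨p, rfl⟩
    induction p using SPoly.induction' with
    | h1 => rwa [expMap_apply, ← evalRAlg_apply, map_one, one_mul]
    | ha p q hp hq => rw [map_add]; exact N.add_mem hp hq
    | hs c p hp => rw [map_smul]; exact N.smul_mem c hp
    | hv u p hp =>
      rw [var_eq_ellP, ← ell_mul_expMap]
      exact h2 _ _ _ hp

theorem idealExp_eq : idealExp m n = (idealJ m n).map expMap := by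
  rw [idealExp]
  have : {f : SFJ m n | ∃ p ∈ idealJ m n, f = evalR p * expJ m n} =
      ((idealJ m n).map expMap : Submodule ℂ (SFJ m n)) := by
    ext f
    constructor
    · rintro ⟨p, hp, rfl⟩
      exact ⟨p, hp, expMap_apply p⟩
    · rintro ⟨p, hp, rfl⟩
      exact ⟨p, hp, expMap_apply p⟩
  rw [this, Submodule.span_eq]

theorem expClass_eq (p : PJ m n) : expClass p = (idealExp m n).mkQ (expMap p) := by
  rw [expMap_apply]; rfl

theorem expClass_eq_iff (p q : PJ m n) : expClass p = expClass q ↔ foldAlg p = foldAlg q := by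
  rw [expClass_eq, expClass_eq, ← sub_eq_zero, ← map_sub, ← map_sub, Submodule.mkQ_apply,
    Submodule.Quotient.mk_eq_zero, idealExp_eq, ← sub_eq_zero (a := foldAlg p), ← map_sub,
    foldAlg_eq_zero_iff]
  constructor
  · rintro ⟨r, hr, h⟩
    rwa [← expMap_injective h]
  · intro h
    exact ⟨_, h, rfl⟩

theorem expClass_mem (p : PJ m n) : expClass p ∈ minSchrodinger m n := by
  rw [expClass_eq, minSchrodinger, modExp_eq]
  exact ⟨_, ⟨p, rfl⟩, rfl⟩

theorem exists_expClass (w : minSchrodinger m n) :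
    ∃ p, expClass p = (w : SFJ m n ⧸ idealExp m n) := by
  obtain ⟨w, hw⟩ := w
  rw [minSchrodinger, modExp_eq] at hw
  obtain ⟨_, ⟨p, rfl⟩, rfl⟩ := hw
  exact ⟨p, expClass_eq p⟩

theorem psiR_expClass (p : PJ m n) : psiR (expClass p) = schroMap (foldAlg p) := by
  have h : expClass (Function.invFun expClass (expClass p)) = expClass p :=
    Function.invFun_eq ⟨p, rfl⟩
  rw [expClass_eq_iff] at h
  rw [psiR, ← foldAlg_apply, h, schroMap_apply]

/-- The superpolynomial `p` in the metaplectic Fock model with `SB (ψ_ℝ w) = p`. -/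
def fockOfMinSchro (w : minSchrodinger m n) : Fock m n :=
  SBpoly (psiR (w : SFJ m n ⧸ idealExp m n))

theorem invSB_fockOfMinSchro (w : minSchrodinger m n) :
    invSB (fockOfMinSchro w) = psiR (w : SFJ m n ⧸ idealExp m n) := by
  obtain ⟨p, hp⟩ := exists_expClass w
  obtain ⟨q, hq⟩ := hermite_surjective (foldAlg p)
  rw [fockOfMinSchro, ← hp, psiR_expClass, ← hq, ← invSB_apply, SBpoly_invSB]

theorem hermite_fockOfMinSchro (w : minSchrodinger m n) (p : PJ m n)
    (hp : expClass p = (w : SFJ m n ⧸ idealExp m n)) : hermite (fockOfMinSchro w) = foldAlg p := by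
  obtain ⟨q, hq⟩ := hermite_surjective (foldAlg p)
  rw [fockOfMinSchro, ← hp, psiR_expClass, ← hq, ← invSB_apply, SBpoly_invSB]

theorem hermite_injective : Function.Injective (hermite (m := m) (n := n)) := by
  intro p q h
  refine invSB_injective ?_
  rw [invSB_apply, invSB_apply, h]

/-- `fockOfMinSchro` as a linear map. -/
def fockOfMinSchroₗ : minSchrodinger m n →ₗ[ℂ] Fock m n where
  toFun := fockOfMinSchro
  map_add' v w := by
    obtain ⟨p, hp⟩ := exists_expClass v
    obtain ⟨q, hq⟩ := exists_expClass w
    have hpq : expClass (p + q) = ((v + w : minSchrodinger m n) : SFJ m n ⧸ idealExp m n) := by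
      rw [Submodule.coe_add, ← hp, ← hq, expClass_eq, expClass_eq, expClass_eq, map_add, map_add]
    refine hermite_injective ?_
    rw [map_add, hermite_fockOfMinSchro v p hp, hermite_fockOfMinSchro w q hq,
      hermite_fockOfMinSchro _ _ hpq, map_add]
  map_smul' c v := by
    obtain ⟨p, hp⟩ := exists_expClass v
    have hpq : expClass (c • p) = ((c • v : minSchrodinger m n) : SFJ m n ⧸ idealExp m n) := by
      rw [Submodule.coe_smul, ← hp, expClass_eq, expClass_eq, map_smul, map_smul]
    refine hermite_injective ?_
    rw [RingHom.id_apply, map_smul, hermite_fockOfMinSchro v p hp, hermite_fockOfMinSchro _ _ hpq,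
      map_smul]

theorem fockOfMinSchro_injective : Function.Injective (fockOfMinSchro (m := m) (n := n)) := by
  intro v w h
  obtain ⟨p, hp⟩ := exists_expClass v
  obtain ⟨q, hq⟩ := exists_expClass w
  refine Subtype.ext ?_
  rw [← hp, ← hq, expClass_eq_iff, ← hermite_fockOfMinSchro v p hp, h,
    hermite_fockOfMinSchro w q hq]

theorem fockOfMinSchro_mem (w : minSchrodinger m n) : fockOfMinSchro w ∈ fockEven m n := by
  obtain ⟨p, hp⟩ := exists_expClass w
  rw [mem_fockEven_iff]
  refine hermite_injective ?_
  rw [hermite_negVars, hermite_fockOfMinSchro w p hp]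
  exact (mem_fockEven_iff _).1 (foldAlg_mem_fockEven p)

theorem exists_fockOfMinSchro {q : Fock m n} (hq : q ∈ fockEven m n) :
    ∃ w : minSchrodinger m n, fockOfMinSchro w = q := by
  have h : hermite q ∈ fockEven m n := by
    rw [mem_fockEven_iff, ← hermite_negVars, (mem_fockEven_iff _).1 hq]
  obtain ⟨p, hp⟩ := exists_foldAlg_eq h
  refine ⟨⟨expClass p, expClass_mem p⟩, hermite_injective ?_⟩
  rw [hermite_fockOfMinSchro _ p rfl, hp]

theorem psiC_SBhat (w : minSchrodinger m n) : psiC (SBhat w) = fockOfMinSchro w :=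
  psiC_invFun (fockOfMinSchro_mem w)

theorem SBhat_invFun (x : MinFock m n) : SBhat (Function.invFun SBhat x) = x := by
  refine Function.invFun_eq ?_
  obtain ⟨w, hw⟩ := exists_fockOfMinSchro (psiC_mem_fockEven x)
  exact ⟨w, psiC_injective (by rw [psiC_SBhat, hw])⟩

theorem fockOfMinSchro_symMinW (w : minSchrodinger m n) :
    fockOfMinSchro (symMinW w) = symF (fockOfMinSchro w) := by
  rw [← psiC_SBhat, symMinW, SBhat_invFun, psiC_symMinF, psiC_SBhat]

theorem minSchrodinger_form (v w : minSchrodinger m n) :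
    (minSchrodingerSuper m n).form v w = fockForm (fockOfMinSchro v) (fockOfMinSchro w) := by
  rw [← formW_invSB, invSB_fockOfMinSchro, invSB_fockOfMinSchro]
  rfl

theorem parity_expMap (p : PJ m n) : Gr.parity (expMap p) = expMap (Gr.parity p) := by
  rw [expMap_eq, expMap_eq, Gr.parity_mul, ← evalRAlg_apply, ← evalRAlg_apply]
  refine congrArg₂ _ (Gr.parity_const _) ?_
  exact Gr.parity_mapAlg _ _

theorem minSchrodinger_part (a : ZMod 2) (w : minSchrodinger m n) :
    w ∈ (minSchrodingerSuper m n).part a ↔ fockOfMinSchro w ∈ (fockSuper m n).part a := by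
  obtain ⟨p, hp⟩ := exists_expClass w
  change (w : SFJ m n ⧸ idealExp m n) ∈ (Gr.part a).map (idealExp m n).mkQ ↔
    fockOfMinSchro w ∈ Gr.part a
  have h3 : fockOfMinSchro w ∈ Gr.part a ↔
      foldAlg (Gr.parity p) = foldAlg (((-1 : ℂ) ^ a.val) • p) := by
    rw [Gr.mem_part_iff, ← hermite_injective.eq_iff, hermite_parity, map_smul,
      hermite_fockOfMinSchro w p hp, foldAlg_parity, map_smul]
  rw [h3, ← expClass_eq_iff, ← hp]
  constructor
  · rintro ⟨f, hf, h⟩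
    rw [expClass_eq, Submodule.mkQ_apply, Submodule.mkQ_apply, Submodule.Quotient.eq,
      idealExp_eq] at h
    obtain ⟨r, hr, h⟩ := h
    have h4 : f = expMap (p + r) := by rw [map_add, h]; abel
    have h5 : expClass (p + r) = expClass p := by
      rw [expClass_eq_iff, map_add, (foldAlg_eq_zero_iff r).2 hr, add_zero]
    have h6 := (Gr.mem_part_iff _ _).1 hf
    rw [h4, parity_expMap, ← map_smul] at h6
    have h7 := expMap_injective h6
    rw [expClass_eq_iff] at h5
    rw [expClass_eq_iff, foldAlg_parity, ← h5, ← foldAlg_parity, h7, map_smul, map_smul, h5]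
  · intro h
    have hs : ((-1 : ℂ) ^ a.val) * ((-1 : ℂ) ^ a.val) = 1 := by
      rw [← pow_add, ← two_mul, pow_mul]; simp
    refine ⟨expMap ((1 / 2 : ℂ) • (p + ((-1 : ℂ) ^ a.val) • Gr.parity p)), ?_, ?_⟩
    · refine (Gr.mem_part_iff _ _).2 ?_
      rw [parity_expMap, ← map_smul expMap]
      refine congrArg _ ?_
      rw [map_smul, map_add, map_smul, Gr.parity_parity]
      generalize Gr.parity p = w
      generalize ((-1 : ℂ) ^ a.val) = s at hs
      match_scalars
      · linear_combination (-1 / 2 : ℂ) * hs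
      · ring
    · rw [← expClass_eq, expClass_eq_iff, map_smul, map_add, map_smul,
        (expClass_eq_iff _ _).1 h, map_smul, smul_smul, hs, one_smul, ← two_smul ℂ (foldAlg p),
        smul_smul]
      norm_num

theorem minSchrodinger_isGradedSymmetry :
    (minSchrodingerSuper m n).IsGradedSymmetry symMinW := by
  refine fock_isGradedSymmetry.pullback fockOfMinSchroₗ fockOfMinSchro_injective
    (fun v w => ?_) (fun a w => ?_) (fun w => ?_)
  · exact minSchrodinger_form v w
  · exact minSchrodinger_part a w
  · exact fockOfMinSchro_symMinW w

end minSchro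

/-! ### The fundamental symmetry on superfunctions -/

section hodge
variable {n : ℕ}

/-- The coefficients of `hodge`. They satisfy the recursion `hodgeCoeff_insert`, which accounts
for the signs and for the factor two in the commutation of `hodge` with the odd variables, and the
value at `∅` is normalized so that the odd Gaussian is fixed. -/
def hodgeCoeff (S : Finset (Fin (2 * n))) : ℂ :=
  (oddGaussian n Finset.univ)⁻¹ * 2 ^ S.card *
    (-1) ^ (∑ a ∈ S, (a : ℕ) + ∑ k ∈ Finset.range (S.card + 1), k)

theorem hodgeCoeff_insert {S : Finset (Fin (2 * n))} {a : Fin (2 * n)} (ha : a ∉ S) :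
    hodgeCoeff (insert a S) = 2 * (-1) ^ ((a : ℕ) + S.card + 1) * hodgeCoeff S := by
  rw [hodgeCoeff, hodgeCoeff, Finset.sum_insert ha, Finset.card_insert_of_notMem ha,
    Finset.sum_range_succ _ (S.card + 1)]
  simp only [pow_add]
  ring

theorem hodgeCoeff_erase {S : Finset (Fin (2 * n))} {a : Fin (2 * n)} (ha : a ∈ S) :
    hodgeCoeff S = 2 * (-1) ^ ((a : ℕ) + S.card) * hodgeCoeff (S.erase a) := by
  have h := hodgeCoeff_insert (Finset.notMem_erase a S)
  rw [Finset.insert_erase ha, add_assoc, Finset.card_erase_add_one ha] at h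
  exact h

theorem oddGaussian_univ_ne : oddGaussian n Finset.univ ≠ 0 :=
  isOddGaussian_oddGaussian.apply_univ_ne two_ne_zero (by rw [oddGaussian_empty]; exact one_ne_zero)

theorem hodgeCoeff_empty : hodgeCoeff (n := n) ∅ = (oddGaussian n Finset.univ)⁻¹ := by
  simp [hodgeCoeff]

theorem card_filter_lt_add (a : Fin (2 * n)) (S : Finset (Fin (2 * n))) :
    (S.filter fun s => s < a).card + (Sᶜ.filter fun s => s < a).card = (a : ℕ) := by
  rw [← Finset.card_union_of_disjoint
    (Finset.disjoint_filter_filter disjoint_compl_right), ← Finset.filter_union,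
    Finset.union_compl]
  have : (Finset.univ.filter fun s => s < a) = Finset.Iio a := by ext; simp
  rw [this, Fin.card_Iio]

theorem neg_one_pow_card_compl (S : Finset (Fin (2 * n))) :
    (-1 : ℂ) ^ Sᶜ.card = (-1) ^ S.card := by
  have h1 : S.card + Sᶜ.card = 2 * n := by rw [Finset.card_add_card_compl, Fintype.card_fin]
  have h2 : (-1 : ℂ) ^ S.card * (-1) ^ Sᶜ.card = 1 := by
    rw [← pow_add, h1, pow_mul]; simp
  have h3 : (-1 : ℂ) ^ S.card * (-1) ^ S.card = 1 := by
    rw [← pow_add, ← two_mul, pow_mul]; simp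
  exact (mul_left_cancel₀ (pow_ne_zero S.card (by norm_num)) (h3.trans h2.symm)).symm

section module
variable {R : Type*} [AddCommGroup R] [Module ℂ R]

/-- The operator on superfunctions that corresponds to `S_F` under the Segal-Bargmann transform.
It resembles a Hodge star: it takes the monomial `θ_T` to a multiple of the complementary
monomial, with the coefficients for which it exchanges `θ_a` with `½ ∂/∂θ_a` up to sign and parity
and fixes the odd Gaussian. The coefficients may lie in any module, such as `L²(ℝ^m)`. -/
def hodge : Gr R (Fin (2 * n)) →ₗ[ℂ] Gr R (Fin (2 * n)) where
  toFun f S := hodgeCoeff S • f Sᶜ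
  map_add' f g := by ext1 S; exact smul_add _ _ _
  map_smul' c f := by ext1 S; exact smul_comm _ _ _

theorem hodge_apply (f : Gr R (Fin (2 * n))) (S : Finset (Fin (2 * n))) :
    hodge f S = hodgeCoeff S • f Sᶜ := rfl

theorem hodge_mapₗ {R' : Type*} [CommRing R'] [Algebra ℂ R'] {R : Type*} [CommRing R] [Algebra ℂ R]
    (φ : R →ₗ[ℂ] R') (f : Gr R (Fin (2 * n))) : hodge (Gr.mapₗ φ f) = Gr.mapₗ φ (hodge f) := by
  ext1 S
  rw [hodge_apply, Gr.mapₗ_apply, Gr.mapₗ_apply, hodge_apply, map_smul]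

end module

section ring
variable {R : Type*} [CommRing R] [Algebra ℂ R]

theorem smul_neg_one_pow_mul (c : ℂ) (k : ℕ) (r : R) : c • ((-1) ^ k * r) = (c * (-1) ^ k) • r := by
  have h : ((-1 : R) ^ k * r) = ((-1 : ℂ) ^ k) • r := by
    rcases neg_one_pow_eq_or ℂ k with h | h
    · rcases Nat.even_or_odd k with hk | hk <;> simp [hk.neg_one_pow]
    · rcases Nat.even_or_odd k with hk | hk <;> simp [hk.neg_one_pow]
  rw [h, smul_smul]

theorem hodge_gen_mul (a : Fin (2 * n)) (f : Gr R (Fin (2 * n))) :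
    hodge (Gr.gen a * f) = (1 / 2 : ℂ) • Gr.pdOdd a (Gr.parity (hodge f)) := by
  ext1 S
  rw [hodge_apply, Gr.gen_mul_apply, Gr.smul_apply (1 / 2 : ℂ) (Gr.pdOdd a _), Gr.pdOdd]
  by_cases ha : a ∈ S
  · rw [if_neg (by simpa using ha), if_pos ha, smul_zero, smul_zero]
  · rw [if_pos (by simpa using ha), if_neg ha, Gr.parity_apply, hodge_apply, hodgeCoeff_insert ha,
      smul_neg_one_pow_mul, smul_neg_one_pow_mul, smul_smul, smul_smul,
      Finset.card_insert_of_notMem ha, Finset.compl_insert]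
    refine congrArg₂ (· • ·) ?_ rfl
    have h := card_filter_lt_add a S
    rw [← h]
    generalize hodgeCoeff S = d
    have h1 : ∀ k : ℕ, (-1 : ℂ) ^ k * (-1) ^ k = 1 := fun k => by
      rw [← pow_add, ← two_mul, pow_mul]; simp
    have h2 := h1 (S.filter fun s => s < a).card
    have h3 := h1 S.card
    simp only [pow_add, pow_one]
    generalize (-1 : ℂ) ^ (S.filter fun s => s < a).card = x at h2 ⊢
    generalize (-1 : ℂ) ^ S.card = y at h3 ⊢
    linear_combination (-d * (-1) ^ (Sᶜ.filter fun s => s < a).card * (y * y)) * h2 -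
      (d * (-1) ^ (Sᶜ.filter fun s => s < a).card) * h3

theorem hodge_pdOdd (a : Fin (2 * n)) (f : Gr R (Fin (2 * n))) :
    hodge (Gr.pdOdd a f) = (-2 : ℂ) • (Gr.gen a * Gr.parity (hodge f)) := by
  ext1 S
  rw [hodge_apply, Gr.smul_apply (-2 : ℂ) (Gr.gen a * _), Gr.gen_mul_apply, Gr.pdOdd]
  by_cases ha : a ∈ S
  · rw [if_neg (by simpa using ha), if_pos ha, Gr.parity_apply, hodge_apply, hodgeCoeff_erase ha,
      smul_neg_one_pow_mul, smul_neg_one_pow_mul, smul_smul, smul_smul, Finset.compl_erase]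
    refine congrArg₂ (· • ·) ?_ rfl
    have h := card_filter_lt_add a S
    rw [← h, ← Finset.card_erase_add_one ha]
    generalize hodgeCoeff (S.erase a) = d
    have h1 : ∀ k : ℕ, (-1 : ℂ) ^ k * (-1) ^ k = 1 := fun k => by
      rw [← pow_add, ← two_mul, pow_mul]; simp
    have h2 := h1 (Sᶜ.filter fun s => s < a).card
    simp only [pow_add, pow_one]
    generalize (-1 : ℂ) ^ (Sᶜ.filter fun s => s < a).card = x at h2 ⊢
    linear_combination (-2 * d * (-1) ^ (S.filter fun s => s < a).card *
      (-1) ^ (S.erase a).card) * h2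
  · rw [if_pos (by simpa using ha), if_neg ha, smul_zero, smul_zero]

end ring

/-- The parity of `hodge` of the odd Gaussian satisfies the differential equation of the odd
Gaussian, because `hodge` exchanges its two sides. -/
theorem hodge_oddGaussian : hodge (oddGaussian n) = oddGaussian n := by
  have h : Gr.parity (hodge (oddGaussian n)) = oddGaussian n := by
    refine IsOddGaussian.ext (c := 2) (fun a => ?_) isOddGaussian_oddGaussian ?_
    · have h1 := hodge_pdOdd (odual a) (oddGaussian n)
      rw [pdOdd_oddGaussian, map_smul, hodge_gen_mul, odual_odual, osign_odual, smul_smul] at h1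
      have h2 := congrArg (fun f => (-osign a) • f) h1
      simp only [smul_smul] at h2
      have h3 : -osign a * (2 * -osign a * (1 / 2)) = 1 := by linear_combination osign_sq a
      rw [h3, one_smul] at h2
      rw [h2]
      refine congrArg₂ (· • ·) ?_ rfl
      ring
    · rw [Gr.parity_apply, hodge_apply, hodgeCoeff_empty, Finset.compl_empty, oddGaussian_empty,
        Finset.card_empty, pow_zero, one_smul, smul_eq_mul, inv_mul_cancel₀ oddGaussian_univ_ne]
  rw [← Gr.parity_parity (hodge (oddGaussian n)), h, parity_oddGaussian]

/-- The sign alternates by the recursion; for `S = ∅` the claim holds because `hodge` fixes the odd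
Gaussian, which has the scalar part `1`. -/
theorem hodgeCoeff_mul_compl (S : Finset (Fin (2 * n))) :
    hodgeCoeff S * hodgeCoeff Sᶜ = (-1) ^ S.card := by
  induction S using Finset.induction_on with
  | empty =>
    have h := congrFun (hodge_oddGaussian (n := n)) Finset.univ
    rw [hodge_apply, Finset.compl_univ, oddGaussian_empty, smul_eq_mul, mul_one] at h
    rw [hodgeCoeff_empty, Finset.compl_empty, h, inv_mul_cancel₀ oddGaussian_univ_ne]
    simp
  | insert a S ha ih =>
    have h := hodgeCoeff_erase (S := Sᶜ) (a := a) (by simpa using ha)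
    rw [← Finset.compl_insert] at h
    have h2 := neg_one_pow_card_compl S
    have h3 : (-1 : ℂ) ^ (a : ℕ) * (-1) ^ (a : ℕ) = 1 := by
      rw [← pow_add, ← two_mul, pow_mul]; simp
    rw [h] at ih
    rw [hodgeCoeff_insert ha, Finset.card_insert_of_notMem ha]
    simp only [pow_add, pow_one] at ih ⊢
    generalize (-1 : ℂ) ^ (a : ℕ) = x at *
    generalize (-1 : ℂ) ^ S.card = y at *
    generalize (-1 : ℂ) ^ Sᶜ.card = z at *
    generalize hodgeCoeff (insert a S)ᶜ = A at *
    generalize hodgeCoeff S = B at *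
    subst h2
    linear_combination -ih

theorem hodge_hodge {R : Type*} [AddCommGroup R] [Module ℂ R] (f : Gr R (Fin (2 * n))) :
    hodge (hodge f) = Gr.parity f := by
  ext1 S
  rw [hodge_apply, hodge_apply, compl_compl, smul_smul, hodgeCoeff_mul_compl, Gr.parity_apply]

end hodge

section hermiteGauss
variable {m n : ℕ}

/-- The superpolynomial `q` for which the inverse Segal-Bargmann transform of `p` is `q` times the
even part of `exp(-R²)`. -/
def hermiteGauss : Fock m n →ₗ[ℂ] Fock m n :=
  LinearMap.mulRight ℂ (gaussPoly m n) ∘ₗ hermite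

theorem hermiteGauss_apply (p : Fock m n) : hermiteGauss p = hermite p * gaussPoly m n := rfl

theorem hermiteGauss_surjective : Function.Surjective (hermiteGauss (m := m) (n := n)) := by
  intro q
  have hu : IsUnit (gaussPoly m n) := isUnit_oddGaussian.map _
  obtain ⟨u, hu⟩ := hu.exists_left_inv
  obtain ⟨p, hp⟩ := hermite_surjective (q * u)
  exact ⟨p, by rw [hermiteGauss_apply, hp, mul_assoc, hu, mul_one]⟩

theorem hermiteGauss_inl_mul (i : Fin m) (p : Fock m n) :
    hermiteGauss (zvar (Sum.inl i) * p) = (2 : ℂ) • (zvar (Sum.inl i) * hermiteGauss p) -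
      (1 / 2 : ℂ) • dF (Sum.inl i) (hermiteGauss p) := by
  rw [hermiteGauss_apply, hermite_zvar_mul, creation_mul_gaussPoly_inl]; rfl

theorem hermiteGauss_inr_mul (a : Fin (2 * n)) (p : Fock m n) :
    hermiteGauss (zvar (Sum.inr a) * p) = zvar (Sum.inr a) * hermiteGauss p -
      (1 / 2 : ℂ) • dF (Sum.inr a) (hermiteGauss p) := by
  rw [hermiteGauss_apply, hermite_zvar_mul, creation_mul_gaussPoly_inr]; rfl

theorem hermiteGauss_parity (p : Fock m n) :
    hermiteGauss (Gr.parity p) = Gr.parity (hermiteGauss p) := by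
  rw [hermiteGauss_apply, hermite_parity, hermiteGauss_apply, Gr.parity_mul, parity_gaussPoly]

theorem hodge_gaussPoly : hodge (gaussPoly m n) = gaussPoly m n := by
  have h := hodge_mapₗ (Algebra.ofId ℂ (MvPolynomial (Fin m) ℂ)).toLinearMap (oddGaussian n)
  rw [hodge_oddGaussian] at h
  exact h

theorem hodge_inl_mul (i : Fin m) (f : Fock m n) :
    hodge (zvar (Sum.inl i) * f) = zvar (Sum.inl i) * hodge f := by
  have h : ∀ g : Fock m n, zvar (Sum.inl i) * g =
      Gr.mapₗ (LinearMap.mulLeft ℂ (MvPolynomial.X i : MvPolynomial (Fin m) ℂ)) g := by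
    intro g
    ext1 S
    exact Gr.const_mul _ _ _
  rw [h, h, hodge_mapₗ]

theorem hodge_dF_inl (i : Fin m) (f : Fock m n) :
    hodge (dF (Sum.inl i) f) = dF (Sum.inl i) (hodge f) := by
  have h : ∀ g : Fock m n, dF (Sum.inl i) g = Gr.mapₗ (MvPolynomial.pderiv i).toLinearMap g := by
    intro g
    rw [dF_apply]
    refine (one_smul ℂ _).trans ?_
    ext1 S
    exact dz_inl_apply i g S
  rw [h, h, hodge_mapₗ]

/-- The inverse Segal-Bargmann transform intertwines `S_F` with the operator `hodge` on
superfunctions. -/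
theorem hodge_hermiteGauss (p : Fock m n) : hodge (hermiteGauss p) = hermiteGauss (symFₗ p) := by
  induction p using Fock.induction with
  | h1 => rw [symFₗ_one, hermiteGauss_apply, hermite_one, one_mul, hodge_gaussPoly]
  | ha p q hp hq => rw [map_add, map_add, hp, hq, map_add, map_add]
  | hs c p hp => rw [map_smul, map_smul, hp, map_smul, map_smul]
  | hz i p hp =>
    rw [symFₗ_zvar_mul]
    rcases i with i | a
    · have h1 : symFₗ p * zup (Sum.inl i) = zvar (Sum.inl i) * symFₗ p := by
        rw [mul_zup, zup, show betaSign (Sum.inl i : Idx m n) = 1 from rfl, one_smul]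
        rfl
      rw [h1, hermiteGauss_inl_mul, hermiteGauss_inl_mul, map_sub, map_smul, map_smul,
        hodge_inl_mul, hodge_dF_inl, hp]
    · have h1 : symFₗ p * zup (Sum.inr a) =
          osign a • (zvar (Sum.inr (odual a)) * Gr.parity (symFₗ p)) := by
        rw [mul_zup, zup, smul_mul_assoc]
        rfl
      rw [h1, map_smul, hermiteGauss_inr_mul, hermiteGauss_inr_mul, map_sub, map_smul,
        hermiteGauss_parity, ← hp]
      have h2 : ∀ (b : Fin (2 * n)) (f : Fock m n),
          dF (Sum.inr b) f = osign b • Gr.pdOdd (odual b) f := fun _ _ => rfl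
      have h3 : ∀ (b : Fin (2 * n)), (zvar (Sum.inr b) : Fock m n) = Gr.gen b := fun _ => rfl
      rw [h2, h2, h3, h3, map_smul, hodge_gen_mul, hodge_pdOdd, odual_odual, osign_odual]
      generalize Gr.gen (odual a) * Gr.parity (hodge (hermiteGauss p)) = A
      generalize Gr.pdOdd a (Gr.parity (hodge (hermiteGauss p))) = B
      have h4 := osign_sq a
      match_scalars
      · linear_combination (-1 / 2 : ℂ) * h4
      · ring

end hermiteGauss


/-! ### Density of the Hermite functions -/

section density
variable {m : ℕ}

/-- An integrable real function whose Fourier transform vanishes is zero almost everywhere. -/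
theorem ae_eq_zero_of_charFun_real {r : (Fin m → ℝ) → ℝ} (hr : Integrable r)
    (h : ∀ L : StrongDual ℝ (Fin m → ℝ), ∫ x, (r x : ℂ) * Complex.exp (L x * Complex.I) = 0) :
    r =ᵐ[volume] 0 := by
  set P : (Fin m → ℝ) → ENNReal := fun x => ENNReal.ofReal (r x) with hP
  set N : (Fin m → ℝ) → ENNReal := fun x => ENNReal.ofReal (-r x) with hN
  have hPm : AEMeasurable P := hr.aemeasurable.ennreal_ofReal
  have hNm : AEMeasurable N := hr.aemeasurable.neg.ennreal_ofReal
  have hPf : ∫⁻ x, P x ≠ ⊤ := hr.lintegral_lt_top.ne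
  have hNf : ∫⁻ x, N x ≠ ⊤ := hr.neg.lintegral_lt_top.ne
  have : IsFiniteMeasure (volume.withDensity P) := isFiniteMeasure_withDensity hPf
  have : IsFiniteMeasure (volume.withDensity N) := isFiniteMeasure_withDensity hNf
  have hint : ∀ (s : (Fin m → ℝ) → ℝ), Integrable s → ∀ L : StrongDual ℝ (Fin m → ℝ),
      Integrable fun x => ((ENNReal.ofReal (s x)).toReal : ℂ) * Complex.exp (L x * Complex.I) := by
    intro s hs L
    refine Integrable.mono hs (((hs.aemeasurable.ennreal_ofReal.ennreal_toReal.complex_ofReal).mul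
      (by fun_prop)).aestronglyMeasurable) (Filter.Eventually.of_forall fun x => ?_)
    rw [norm_mul, Complex.norm_exp_ofReal_mul_I, mul_one, Complex.norm_real,
      ENNReal.toReal_ofReal', Real.norm_eq_abs, Real.norm_eq_abs]
    rcases le_total (s x) 0 with hx | hx
    · rw [max_eq_right hx, abs_zero]; exact abs_nonneg _
    · rw [max_eq_left hx]
  have heq : volume.withDensity P = volume.withDensity N := by
    refine Measure.ext_of_charFunDual (funext fun L => ?_)
    rw [charFunDual_apply, charFunDual_apply,
      integral_withDensity_eq_integral_toReal_smul₀ hPm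
        (Filter.Eventually.of_forall fun x => ENNReal.ofReal_lt_top),
      integral_withDensity_eq_integral_toReal_smul₀ hNm
        (Filter.Eventually.of_forall fun x => ENNReal.ofReal_lt_top)]
    simp only [Complex.real_smul]
    refine sub_eq_zero.1
      (((integral_sub (hint r hr L) (hint _ hr.neg L)).symm.trans ?_).trans (h L))
    refine integral_congr_ae (Filter.Eventually.of_forall fun x => ?_)
    simp only [Pi.neg_apply]
    rw [← sub_mul, ENNReal.toReal_ofReal', ENNReal.toReal_ofReal', ← Complex.ofReal_sub]
    refine congrArg₂ _ (congrArg _ ?_) rfl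
    rcases le_total (r x) 0 with hx | hx
    · rw [max_eq_right hx, max_eq_left (neg_nonneg.2 hx)]; ring
    · rw [max_eq_left hx, max_eq_right (neg_nonpos.2 hx)]; ring
  have hae := (withDensity_eq_iff hPm hNm hPf).1 heq
  filter_upwards [hae] with x hx
  rw [Pi.zero_apply]
  simp only [hP, hN] at hx
  rcases lt_trichotomy (r x) 0 with h0 | h0 | h0
  · rw [ENNReal.ofReal_of_nonpos h0.le, eq_comm, ENNReal.ofReal_eq_zero] at hx
    linarith
  · exact h0
  · rw [ENNReal.ofReal_of_nonpos (p := -r x) (by linarith), ENNReal.ofReal_eq_zero] at hx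
    linarith

/-- An integrable function whose Fourier transform vanishes is zero almost everywhere. -/
theorem ae_eq_zero_of_charFun {h : (Fin m → ℝ) → ℂ} (hh : Integrable h)
    (h0 : ∀ L : StrongDual ℝ (Fin m → ℝ), ∫ x, h x * Complex.exp (L x * Complex.I) = 0) :
    h =ᵐ[volume] 0 := by
  have hi : ∀ L : StrongDual ℝ (Fin m → ℝ),
      Integrable fun x => h x * Complex.exp (L x * Complex.I) := by
    intro L
    refine hh.mono (hh.aestronglyMeasurable.mul (by fun_prop))
      (Filter.Eventually.of_forall fun x => ?_)
    rw [norm_mul, Complex.norm_exp_ofReal_mul_I, mul_one]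
  have hc : ∀ L : StrongDual ℝ (Fin m → ℝ),
      ∫ x, (starRingEnd ℂ) (h x) * Complex.exp (L x * Complex.I) = 0 := by
    intro L
    have h1 := congrArg (starRingEnd ℂ) (h0 (-L))
    rw [← integral_conj, map_zero] at h1
    rw [← h1]
    refine integral_congr_ae (Filter.Eventually.of_forall fun x => ?_)
    simp only [map_mul, ← Complex.exp_conj, Complex.conj_ofReal, Complex.conj_I]
    refine congrArg₂ _ rfl (congrArg _ ?_)
    rw [_root_.neg_apply]
    push_cast
    ring
  have hic : ∀ L : StrongDual ℝ (Fin m → ℝ),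
      Integrable fun x => (starRingEnd ℂ) (h x) * Complex.exp (L x * Complex.I) := by
    intro L
    refine hh.mono ((Complex.continuous_conj.comp_aestronglyMeasurable
      hh.aestronglyMeasurable).mul (by fun_prop)) (Filter.Eventually.of_forall fun x => ?_)
    rw [norm_mul, Complex.norm_exp_ofReal_mul_I, mul_one, RCLike.norm_conj]
  have hre := ae_eq_zero_of_charFun_real hh.re fun L => by
    have h2 : ∀ x, ((RCLike.re (h x) : ℝ) : ℂ) * Complex.exp (L x * Complex.I) =
        (1 / 2 : ℂ) * (h x * Complex.exp (L x * Complex.I) +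
          (starRingEnd ℂ) (h x) * Complex.exp (L x * Complex.I)) := by
      intro x
      rw [← add_mul, Complex.add_conj, RCLike.re_to_complex]
      push_cast
      ring
    simp only [h2]
    rw [integral_const_mul, integral_add (hi L) (hic L), h0, hc, add_zero, mul_zero]
  have him := ae_eq_zero_of_charFun_real hh.im fun L => by
    have h2 : ∀ x, ((RCLike.im (h x) : ℝ) : ℂ) * Complex.exp (L x * Complex.I) =
        (-(1 / 2) * Complex.I : ℂ) * (h x * Complex.exp (L x * Complex.I) -
          (starRingEnd ℂ) (h x) * Complex.exp (L x * Complex.I)) := by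
      intro x
      rw [← sub_mul, Complex.sub_conj, RCLike.im_to_complex]
      push_cast
      linear_combination ((h x).im * Complex.exp (L x * Complex.I)) * Complex.I_mul_I
    simp only [h2]
    rw [integral_const_mul, integral_sub (hi L) (hic L), h0, hc, sub_zero, mul_zero]
  filter_upwards [hre, him] with x h1 h2
  exact Complex.ext h1 h2

/-- The Gaussian `exp(-x²)` times a polynomial. -/
def gaussFun (q : MvPolynomial (Fin m) ℂ) (x : Fin m → ℝ) : ℂ :=
  Complex.exp (evalReal x (gaussExponent m)) * evalReal x q

theorem continuous_evalReal (q : MvPolynomial (Fin m) ℂ) :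
    Continuous fun x : Fin m → ℝ => evalReal x q := by
  induction q using MvPolynomial.induction_on with
  | C c => simp only [evalReal_C]; exact continuous_const
  | add p q hp hq => simp only [map_add]; exact hp.add hq
  | mul_X p i hp => simp only [map_mul, evalReal_X]; fun_prop

theorem evalReal_gaussExponent (x : Fin m → ℝ) :
    evalReal x (gaussExponent m) = ((-∑ i, x i ^ 2 : ℝ) : ℂ) := by
  rw [gaussExponent, map_neg, map_sum]
  push_cast
  refine congrArg _ (Finset.sum_congr rfl fun i _ => ?_)
  rw [map_mul, evalReal_X, sq]

theorem exp_gaussExponent_sq (x : Fin m → ℝ) : ‖Complex.exp (evalReal x (gaussExponent m))‖ ^ 2 =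
    ‖Complex.exp (evalReal x (bosExponent 0))‖ := by
  rw [← norm_pow, ← Complex.exp_nat_mul, evalReal_bosExponent, evalReal_gaussExponent]
  refine congrArg _ (congrArg _ ?_)
  push_cast
  rw [mul_neg, Finset.mul_sum, ← Finset.sum_neg_distrib]
  refine Finset.sum_congr rfl fun i _ => ?_
  simp

theorem memLp_gaussFun (q : MvPolynomial (Fin m) ℂ) : MemLp (gaussFun q) 2 volume := by
  have hc : Continuous (gaussFun q) :=
    (Complex.continuous_exp.comp (continuous_evalReal _)).mul (continuous_evalReal _)
  rw [memLp_two_iff_integrable_sq_norm hc.aestronglyMeasurable]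
  refine (integrable_bosExponent 0 (q * q)).norm.congr (Filter.Eventually.of_forall fun x => ?_)
  simp only [gaussFun, norm_mul, mul_pow, exp_gaussExponent_sq, map_mul]
  rw [← sq]

/-- The class in `L²` of the Gaussian times a polynomial. -/
def gaussLp : MvPolynomial (Fin m) ℂ →ₗ[ℂ]
    Lp ℂ 2 (volume : Measure (Fin m → ℝ)) where
  toFun q := (memLp_gaussFun q).toLp (gaussFun q)
  map_add' p q := by
    rw [← MemLp.toLp_add]
    refine MemLp.toLp_congr _ _ (Filter.Eventually.of_forall fun x => ?_)
    simp only [gaussFun, map_add, mul_add, Pi.add_apply]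
  map_smul' c q := by
    rw [RingHom.id_apply, ← MemLp.toLp_const_smul]
    refine MemLp.toLp_congr _ _ (Filter.Eventually.of_forall fun x => ?_)
    simp only [gaussFun, map_smul, Pi.smul_apply, smul_eq_mul]
    ring

theorem gaussLp_apply (q : MvPolynomial (Fin m) ℂ) :
    gaussLp q = (memLp_gaussFun q).toLp (gaussFun q) := rfl

theorem coeFn_gaussLp (q : MvPolynomial (Fin m) ℂ) : gaussLp q =ᵐ[volume] gaussFun q :=
  MemLp.coeFn_toLp (memLp_gaussFun q)

/-- `exp(-x² + |L x|)` is square integrable for every linear form `L`. -/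
theorem memLp_gauss_mul_exp_abs (L : StrongDual ℝ (Fin m → ℝ)) :
    MemLp (fun x => Real.exp (-∑ i, x i ^ 2) * Real.exp |L x|) 2 volume := by
  have hc : Continuous fun x : Fin m → ℝ => Real.exp (-∑ i, x i ^ 2) * Real.exp |L x| := by
    fun_prop
  rw [memLp_two_iff_integrable_sq_norm hc.aestronglyMeasurable]
  have hL : ∀ x, L x = ∑ i, x i * L (Pi.single i 1) := fun x => by
    conv_lhs => rw [← Finset.univ_sum_single x]
    rw [map_sum]
    refine Finset.sum_congr rfl fun i _ => ?_
    rw [← smul_eq_mul, ← map_smul, ← Pi.single_smul, smul_eq_mul, mul_one]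
  have h1 : ∀ s : ℝ, ∀ x : Fin m → ℝ, ‖Complex.exp (evalReal x
      (bosExponent fun i => ((s * L (Pi.single i 1) : ℝ) : ℂ))) * evalReal x 1‖ =
        Real.exp (-2 * ∑ i, x i ^ 2 + 2 * (s * L x)) := by
    intro s x
    rw [map_one, mul_one, evalReal_bosExponent, Complex.norm_exp, hL, Finset.mul_sum,
      Finset.mul_sum, Finset.mul_sum, ← Finset.sum_add_distrib, Complex.re_sum]
    refine congrArg _ (Finset.sum_congr rfl fun i _ => ?_)
    rw [← Complex.ofReal_re (-2 * x i ^ 2 + 2 * (s * (x i * L (Pi.single i 1))))]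
    refine congrArg _ ?_
    push_cast
    ring
  refine (((integrable_bosExponent (fun i => ((1 * L (Pi.single i 1) : ℝ) : ℂ)) 1).norm.add
    (integrable_bosExponent (fun i => ((-1 * L (Pi.single i 1) : ℝ) : ℂ)) 1).norm)).mono'
    (hc.norm.pow 2).aestronglyMeasurable (Filter.Eventually.of_forall fun x => ?_)
  simp only [Pi.add_apply, h1]
  rw [Real.norm_of_nonneg (by positivity), Real.norm_of_nonneg (by positivity), mul_pow,
    ← Real.exp_nat_mul, ← Real.exp_nat_mul, ← Real.exp_add]
  push_cast
  rcases abs_cases (L x) with ⟨h, -⟩ | ⟨h, -⟩ <;> rw [h]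
  · refine le_add_of_le_of_nonneg (Real.exp_le_exp.2 ?_) (Real.exp_pos _).le
    linarith
  · refine le_add_of_nonneg_of_le (Real.exp_pos _).le (Real.exp_le_exp.2 ?_)
    linarith

/-- The Gaussian times the polynomials is a dense subspace of `L²`: the Fourier transform of
`f exp(-x²)` is a power series in the moments of `f exp(-x²)`, so it vanishes if `f` is orthogonal
to this subspace. -/
theorem denseRange_gaussLp : DenseRange (gaussLp (m := m)) := by
  have key : (LinearMap.range (gaussLp (m := m)))ᗮ = ⊥ := by
    rw [Submodule.eq_bot_iff]
    intro f hf
    -- orthogonality means that all moments of `exp(-x²) \bar{f}` vanish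
    have hf0 : ∀ q : MvPolynomial (Fin m) ℂ, ∫ x, gaussFun q x * (starRingEnd ℂ) (f x) = 0 := by
      intro q
      have h := (Submodule.mem_orthogonal' _ f).1 hf _ (LinearMap.mem_range_self gaussLp q)
      rw [L2.inner_def] at h
      rw [← h]
      refine integral_congr_ae ?_
      filter_upwards [coeFn_gaussLp q] with x hx
      rw [hx, RCLike.inner_apply]
    have hfm : MemLp f 2 volume := Lp.memLp f
    have hb : ∀ L : StrongDual ℝ (Fin m → ℝ),
        Integrable fun x => ‖f x‖ * (Real.exp (-∑ i, x i ^ 2) * Real.exp |L x|) :=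
      fun L => hfm.norm.integrable_mul (memLp_gauss_mul_exp_abs L)
    set h : (Fin m → ℝ) → ℂ := fun x => gaussFun 1 x * (starRingEnd ℂ) (f x) with hh
    have hg : ∀ x : Fin m → ℝ, ‖gaussFun 1 x‖ = Real.exp (-∑ i, x i ^ 2) := by
      intro x
      rw [gaussFun, map_one, mul_one, evalReal_gaussExponent, ← Complex.ofReal_exp,
        Complex.norm_real, Real.norm_of_nonneg (Real.exp_pos _).le]
    have hm : AEStronglyMeasurable h volume :=
      (memLp_gaussFun 1).aestronglyMeasurable.mul
        (Complex.continuous_conj.comp_aestronglyMeasurable hfm.aestronglyMeasurable)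
    have hhi : Integrable h := by
      refine (hb 0).mono' hm (Filter.Eventually.of_forall fun x => ?_)
      rw [hh, norm_mul, hg, RCLike.norm_conj, _root_.zero_apply, abs_zero,
        Real.exp_zero, mul_one, mul_comm]
    -- hence so does its Fourier transform, by expanding the exponential under the integral
    have hz := ae_eq_zero_of_charFun hhi fun L => by
      have hsum := hasSum_integral_of_dominated_convergence (μ := volume)
        (F := fun (k : ℕ) (x : Fin m → ℝ) => h x * ((L x * Complex.I) ^ k / k.factorial))
        (f := fun x => h x * Complex.exp (L x * Complex.I))
        (fun k x => ‖f x‖ * Real.exp (-∑ i, x i ^ 2) * (|L x| ^ k / k.factorial))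
        (fun k => hm.mul (by fun_prop))
        (fun k => Filter.Eventually.of_forall fun x => ?_)
        (Filter.Eventually.of_forall fun x => ?_) ?_
        (Filter.Eventually.of_forall fun x => ?_)
      · refine hsum.unique ?_
        have h0 : ∀ k : ℕ, ∫ x, h x * ((L x * Complex.I) ^ k / k.factorial) = 0 := by
          intro k
          have h1 := hf0 ((∑ i, MvPolynomial.C (L (Pi.single i 1) : ℂ) * MvPolynomial.X i) ^ k)
          have h2 : ∀ x : Fin m → ℝ, evalReal x
              (∑ i, MvPolynomial.C (L (Pi.single i 1) : ℂ) * MvPolynomial.X i) = (L x : ℂ) := by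
            intro x
            conv_rhs => rw [← Finset.univ_sum_single x]
            rw [map_sum, map_sum]
            push_cast
            refine Finset.sum_congr rfl fun i _ => ?_
            rw [map_mul, evalReal_C, evalReal_X, ← Complex.ofReal_mul, mul_comm, ← smul_eq_mul,
              ← map_smul, ← Pi.single_smul, smul_eq_mul, mul_one]
          have h3 : ∀ x, h x * ((L x * Complex.I) ^ k / k.factorial) =
              (Complex.I ^ k / k.factorial) * (gaussFun ((∑ i, MvPolynomial.C (L (Pi.single i 1) : ℂ)
                * MvPolynomial.X i) ^ k) x * (starRingEnd ℂ) (f x)) := by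
            intro x
            rw [hh]
            simp only [gaussFun, map_one, map_pow, h2]
            ring
          simp only [h3]
          rw [integral_const_mul, h1, mul_zero]
        simp only [h0]
        exact hasSum_zero
      · rw [hh, norm_mul, norm_mul, hg, RCLike.norm_conj, norm_div, norm_pow, norm_mul,
          Complex.norm_I, mul_one, Complex.norm_real, Real.norm_eq_abs, Complex.norm_natCast,
          mul_comm (Real.exp _)]
      · exact (Real.summable_pow_div_factorial _).mul_left _
      · refine (hb L).congr (Filter.Eventually.of_forall fun x => ?_)
        simp only
        rw [tsum_mul_left, Real.exp_eq_exp_ℝ, NormedSpace.exp_eq_tsum_div]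
        ring
      · refine HasSum.mul_left _ ?_
        rw [Complex.exp_eq_exp_ℂ]
        exact NormedSpace.expSeries_div_hasSum_exp _
    rw [Lp.eq_zero_iff_ae_eq_zero]
    filter_upwards [hz] with x hx
    have h1 := (mul_eq_zero.1 hx).resolve_left (by
      rw [← Ne, ← norm_ne_zero_iff, hg]; exact (Real.exp_pos _).ne')
    exact (map_eq_zero _).1 h1
  have h2 := Submodule.topologicalClosure_eq_top_iff.2 key
  rw [DenseRange, ← LinearMap.coe_range]
  exact Submodule.dense_iff_topologicalClosure_eq_top.2 h2

end density


/-! ### The Lebesgue superspace as a Hilbert superspace -/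

section lebesgue
variable {m n : ℕ}

/-- The product of `L²(ℝ^{m|2n})` pairs the coefficients of complementary monomials. -/
theorem exists_formW_weight (m n : ℕ) : ∃ w : Finset (Fin (2 * n)) → ℂ,
    ∀ (f g : SFR m n) (f' g' : L2 m n), (∀ S, f' S =ᵐ[volume] f S) → (∀ S, g' S =ᵐ[volume] g S) →
      formW f g = ∑ S, w S * inner ℂ (g' Sᶜ) (f' S) := by
  obtain ⟨k, hk⟩ := foldl_pdOdd_empty (R := (Fin m → ℝ) → ℂ) (List.finRange (2 * n))
    (List.nodup_finRange _) List.mem_finRange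
  refine ⟨fun S => (omega m n)⁻¹ * ((((Real.pi : ℂ) ^ n)⁻¹ * (-1) ^ k) * (-1) ^ Gr.inv S Sᶜ),
    fun f g f' g' hf hg => ?_⟩
  have h1 : ∀ x, ((Real.pi : ℂ) ^ n)⁻¹ * ((List.finRange (2 * n)).foldl
      (fun g t => Gr.pdOdd t g) (f * conjFun g)) ∅ x = ∑ S, (((Real.pi : ℂ) ^ n)⁻¹ * (-1) ^ k) *
        (-1) ^ Gr.inv S Sᶜ * (f S x * (starRingEnd ℂ) (g Sᶜ x)) := by
    intro x
    rw [hk]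
    change ((Real.pi : ℂ) ^ n)⁻¹ * ((-1) ^ k * (f * conjFun g : SFR m n) Finset.univ x) = _
    rw [Gr.mul_apply, Finset.powerset_univ, Finset.sum_apply, ← mul_assoc, Finset.mul_sum]
    exact Finset.sum_congr rfl fun S _ => (mul_assoc _ _ _).symm
  have h2 : ∀ S, (fun x => inner ℂ (g' Sᶜ x) (f' S x)) =ᵐ[volume]
      fun x => f S x * (starRingEnd ℂ) (g Sᶜ x) := by
    intro S
    filter_upwards [hf S, hg Sᶜ] with x h h'
    rw [h, h', RCLike.inner_apply]
  rw [formW, intR]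
  simp only [h1]
  rw [integral_finsetSum]
  · rw [Finset.mul_sum]
    refine Finset.sum_congr rfl fun S _ => ?_
    rw [integral_const_mul, L2.inner_def, integral_congr_ae (h2 S)]
    ring
  · intro S _
    exact ((L2.integrable_inner (g' Sᶜ) (f' S)).congr (h2 S)).const_mul _

/-- The inverse Segal-Bargmann transform with values in `L²(ℝ^{m|2n})`. -/
def hermiteL2 : Fock m n →ₗ[ℂ] L2 m n where
  toFun p S := gaussLp (hermiteGauss p S)
  map_add' p q := by ext1 S; rw [map_add, Gr.add_apply, map_add]; rfl
  map_smul' c p := by ext1 S; rw [map_smul, Gr.smul_apply, map_smul]; rfl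

theorem hermiteL2_apply (p : Fock m n) (S : Finset (Fin (2 * n))) :
    hermiteL2 p S = gaussLp (hermiteGauss p S) := rfl

theorem invSB_apply_eq (p : Fock m n) (S : Finset (Fin (2 * n))) :
    invSB p S = gaussFun (hermiteGauss p S) := by
  funext x
  rw [invSB_apply, schroMap_eq, expPoly_mul_apply, evalR_apply]
  rfl

theorem toL2_invSB (p : Fock m n) : toL2 (invSB p) = hermiteL2 p := by
  ext1 S
  have h : MemLp (invSB p S) 2 volume := by
    rw [invSB_apply_eq]; exact memLp_gaussFun _
  rw [toL2, dif_pos h, hermiteL2_apply, gaussLp_apply]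
  exact MemLp.toLp_congr _ _ (Filter.Eventually.of_forall fun x => by rw [invSB_apply_eq])

theorem coeFn_hermiteL2 (p : Fock m n) (S : Finset (Fin (2 * n))) :
    hermiteL2 p S =ᵐ[volume] invSB p S := by
  rw [invSB_apply_eq]; exact coeFn_gaussLp _

theorem l2Super_form_hermiteL2 (p q : Fock m n) :
    (l2Super m n).form (hermiteL2 p) (hermiteL2 q) = fockForm p q := by
  obtain ⟨w, hw⟩ := exists_formW_weight m n
  rw [← formW_invSB, hw _ _ _ _ (coeFn_hermiteL2 p) (coeFn_hermiteL2 q)]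
  exact hw _ _ _ _ (fun S => Filter.EventuallyEq.rfl) (fun S => Filter.EventuallyEq.rfl)

theorem hodge_hermiteL2 (p : Fock m n) : hodge (hermiteL2 p) = hermiteL2 (symFₗ p) := by
  ext1 S
  rw [hodge_apply, hermiteL2_apply, hermiteL2_apply, ← hodge_hermiteGauss, hodge_apply, map_smul]

/-- For each `S` there is an element of `L²(ℝ^{m|2n})` in the range of the inverse Segal-Bargmann
transform whose only coefficient is the Gaussian, at `S`. -/
theorem exists_hermiteL2_single (S : Finset (Fin (2 * n))) : ∃ p : Fock m n, p ≠ 0 ∧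
    ∀ T, hermiteL2 p T = if T = S then gaussLp 1 else 0 := by
  obtain ⟨p, hp⟩ := hermiteGauss_surjective (Gr.single S (1 : MvPolynomial (Fin m) ℂ))
  refine ⟨p, ?_, fun T => ?_⟩
  · rintro rfl
    rw [map_zero] at hp
    have h := congrFun hp S
    rw [Gr.single, if_pos rfl] at h
    exact zero_ne_one h
  · rw [hermiteL2_apply, hp, Gr.single]
    split_ifs
    · rfl
    · exact map_zero _

/-- The product `(f, g) ↦ ⟨f, J g⟩_W` for the symmetry `J = hodge` is a sum of multiples of the
products of the coefficients. The multiples are found, and seen to be positive, by means of the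
Hermite functions with one coefficient, on which the product is the one of the Fock space. -/
theorem exists_l2Weight (m n : ℕ) : ∃ κ : Finset (Fin (2 * n)) → ℝ, (∀ S, 0 < κ S) ∧
    (∀ S, (κ S : ℂ) * ((starRingEnd ℂ) (hodgeCoeff S) * hodgeCoeff S) = κ Sᶜ) ∧
    ∀ f g : L2 m n, (l2Super m n).form g (hodge f) = ∑ S, (κ S : ℂ) * inner ℂ (f S) (g S) := by
  obtain ⟨w, hw⟩ := exists_formW_weight m n
  have h1 : ∀ f g : L2 m n, (l2Super m n).form g (hodge f) =
      ∑ S, w S * (starRingEnd ℂ) (hodgeCoeff Sᶜ) * inner ℂ (f S) (g S) := by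
    intro f g
    refine (hw _ _ _ _ (fun S => Filter.EventuallyEq.rfl)
      (fun S => Filter.EventuallyEq.rfl)).trans (Finset.sum_congr rfl fun S _ => ?_)
    rw [hodge_apply, compl_compl, inner_smul_left, mul_assoc]
  set v : Finset (Fin (2 * n)) → ℂ := fun S => w S * (starRingEnd ℂ) (hodgeCoeff Sᶜ) with hv
  have hsym : ∀ p : Fock m n, symFₗ p = symF p := fun _ => rfl
  -- test on a function with the single coefficient `gaussLp 1`
  have h2 : ∀ S, ∃ r : ℝ, 0 < r ∧ v S * inner ℂ (gaussLp (m := m) 1) (gaussLp 1) = r := by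
    intro S
    obtain ⟨p, hp0, hp⟩ := exists_hermiteL2_single (m := m) S
    have h3 := h1 (hermiteL2 p) (hermiteL2 p)
    rw [hodge_hermiteL2, l2Super_form_hermiteL2, Finset.sum_eq_single S
      (fun T _ hT => by rw [hp, if_neg hT, inner_zero_left, mul_zero])
      (fun h => absurd (Finset.mem_univ S) h), hp, if_pos rfl] at h3
    have h4 := (fock_isGradedSymmetry (m := m) (n := n)).inner_conj p p
    have h5 := (fock_isGradedSymmetry (m := m) (n := n)).inner_nonneg p
    have h6 := (fock_isGradedSymmetry (m := m) (n := n)).inner_definite p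
    have h7 : (fockSuper m n).form p (symF p) = fockForm p (symFₗ p) := rfl
    rw [h7] at h4 h5 h6
    have h8 := Complex.conj_eq_iff_real.1 h4.symm
    obtain ⟨r, hr⟩ := h8
    rw [hr, Complex.ofReal_re] at h5
    refine ⟨r, lt_of_le_of_ne h5 fun h9 => hp0 (h6 ?_), h3.symm.trans hr⟩
    rw [hr, ← h9, Complex.ofReal_zero]
  set N : ℝ := ‖gaussLp (m := m) 1‖ ^ 2 with hN
  have hNi : inner ℂ (gaussLp (m := m) 1) (gaussLp 1) = (N : ℂ) := by
    rw [inner_self_eq_norm_sq_to_K, hN]; norm_cast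
  rw [hNi] at h2
  -- the Gaussian is not zero, since otherwise the product of a test function would vanish
  have hN0 : N ≠ 0 := by
    intro h
    obtain ⟨r, hr, hr'⟩ := h2 ∅
    rw [h, Complex.ofReal_zero, mul_zero] at hr'
    exact hr.ne (Complex.ofReal_injective hr')
  have hNpos : 0 < N := lt_of_le_of_ne (by positivity) hN0.symm
  choose r hr hrv using h2
  have hκ : ∀ S, v S = ((r S / N : ℝ) : ℂ) := by
    intro S
    rw [Complex.ofReal_div, eq_div_iff (Complex.ofReal_ne_zero.2 hN0), hrv]
  refine ⟨fun S => r S / N, fun S => div_pos (hr S) hNpos, fun S => ?_, fun f g => ?_⟩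
  · -- `hodge` preserves the product of the test function at `Sᶜ`
    obtain ⟨p, hp0, hp⟩ := exists_hermiteL2_single (m := m) Sᶜ
    have h3 := h1 (hodge (hermiteL2 p)) (hodge (hermiteL2 p))
    have h4 := h1 (hermiteL2 p) (hermiteL2 p)
    have h5 : (l2Super m n).form (hodge (hermiteL2 p)) (hodge (hodge (hermiteL2 p))) =
        (l2Super m n).form (hermiteL2 p) (hodge (hermiteL2 p)) := by
      rw [hodge_hermiteL2, hodge_hermiteL2, l2Super_form_hermiteL2, l2Super_form_hermiteL2]
      exact (fock_isGradedSymmetry (m := m) (n := n)).form_map p (symF p)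
    rw [Finset.sum_eq_single Sᶜ
      (fun T _ hT => by rw [hp, if_neg hT, inner_zero_left, mul_zero])
      (fun h => absurd (Finset.mem_univ _) h), hp, if_pos rfl] at h4
    rw [h5, h4, Finset.sum_eq_single S
      (fun T _ hT => by
        rw [hodge_apply, hp, if_neg (fun h => hT (compl_injective h)), smul_zero, inner_zero_left,
          mul_zero])
      (fun h => absurd (Finset.mem_univ _) h), hodge_apply, hp, if_pos rfl, inner_smul_left,
      inner_smul_right, hNi] at h3
    rw [← hκ, ← hκ]
    refine mul_right_cancel₀ (Complex.ofReal_ne_zero.2 hN0) ?_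
    refine Eq.trans ?_ h3.symm
    ring
  · rw [h1]
    exact Finset.sum_congr rfl fun S _ => congrArg₂ _ (hκ S) rfl

/-- The weights of the inner product of `L²(ℝ^{m|2n})`. -/
def l2Weight (m n : ℕ) : Finset (Fin (2 * n)) → ℝ := (exists_l2Weight m n).choose

theorem l2Weight_pos (S : Finset (Fin (2 * n))) : 0 < l2Weight m n S :=
  (exists_l2Weight m n).choose_spec.1 S

theorem l2Weight_mul (S : Finset (Fin (2 * n))) : (l2Weight m n S : ℂ) *
    ((starRingEnd ℂ) (hodgeCoeff S) * hodgeCoeff S) = l2Weight m n Sᶜ :=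
  (exists_l2Weight m n).choose_spec.2.1 S

theorem l2Super_form_hodge (f g : L2 m n) : (l2Super m n).form g (hodge f) =
    ∑ S, (l2Weight m n S : ℂ) * inner ℂ (f S) (g S) :=
  (exists_l2Weight m n).choose_spec.2.2 f g

theorem sqrt_l2Weight_ne (S : Finset (Fin (2 * n))) : ((√(l2Weight m n S) : ℝ) : ℂ) ≠ 0 :=
  Complex.ofReal_ne_zero.2 (Real.sqrt_pos.2 (l2Weight_pos S)).ne'

/-- The Hilbert space of the coefficients of the elements of `L²(ℝ^{m|2n})`. -/
abbrev L2Coeff (m n : ℕ) := PiLp 2 fun _ : Finset (Fin (2 * n)) =>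
  Lp ℂ 2 (volume : Measure (Fin m → ℝ))

/-- The identification of `L²(ℝ^{m|2n})` with a Hilbert space, by rescaling the coefficients. -/
def l2Equiv : L2 m n ≃ₗ[ℂ] L2Coeff m n where
  toFun f := WithLp.toLp 2 fun S => ((√(l2Weight m n S) : ℝ) : ℂ) • f S
  invFun y S := ((√(l2Weight m n S) : ℝ) : ℂ)⁻¹ • y S
  map_add' f g := by
    ext1 S
    exact smul_add _ _ _
  map_smul' c f := by
    ext1 S
    exact smul_comm ((√(l2Weight m n S) : ℝ) : ℂ) c (f S)
  left_inv f := by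
    ext1 S
    exact inv_smul_smul₀ (sqrt_l2Weight_ne S) _
  right_inv y := by
    ext1 S
    exact smul_inv_smul₀ (sqrt_l2Weight_ne S) _

theorem l2Equiv_apply (f : L2 m n) (S : Finset (Fin (2 * n))) :
    l2Equiv f S = ((√(l2Weight m n S) : ℝ) : ℂ) • f S := rfl

theorem inner_l2Equiv (f g : L2 m n) : inner ℂ (l2Equiv f) (l2Equiv g) =
    ∑ S, (l2Weight m n S : ℂ) * inner ℂ (f S) (g S) := by
  rw [PiLp.inner_apply]
  refine Finset.sum_congr rfl fun S _ => ?_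
  rw [l2Equiv_apply, l2Equiv_apply, inner_smul_left, inner_smul_right, Complex.conj_ofReal,
    ← mul_assoc, ← Complex.ofReal_mul, Real.mul_self_sqrt (l2Weight_pos S).le]

theorem l2_isHilbertModel : (l2Super m n).IsHilbertModel hodge l2Equiv := by
  refine SuperForm.isHilbertModel_of (fun f g => ?_) (fun f g => ?_) (fun f => ?_) (fun a f => ?_)
  · rw [inner_l2Equiv, l2Super_form_hodge]
  · rw [inner_l2Equiv, inner_l2Equiv,
      ← Equiv.sum_comp (Function.Involutive.toPerm (compl : Finset (Fin (2 * n)) → _)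
        compl_involutive)]
    refine Finset.sum_congr rfl fun S _ => ?_
    rw [Function.Involutive.coe_toPerm, hodge_apply, hodge_apply, compl_compl, inner_smul_left,
      inner_smul_right, ← compl_compl S, ← l2Weight_mul Sᶜ, compl_compl]
    ring
  · rw [hodge_hodge, hodge_hodge, Gr.parity_parity]
  · rw [hodge_hodge]
    exact Gr.mem_part_iff f a

theorem denseRange_hermiteL2 :
    DenseRange fun p : Fock m n => (l2Equiv (hermiteL2 p) : L2Coeff m n) := by
  have h1 : ∀ S : Finset (Fin (2 * n)), DenseRange fun q : MvPolynomial (Fin m) ℂ =>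
      ((√(l2Weight m n S) : ℝ) : ℂ) • gaussLp q := by
    intro S
    have h2 : Function.Surjective fun q : MvPolynomial (Fin m) ℂ =>
        ((√(l2Weight m n S) : ℝ) : ℂ) • q := fun q =>
      ⟨((√(l2Weight m n S) : ℝ) : ℂ)⁻¹ • q, smul_inv_smul₀ (sqrt_l2Weight_ne S) q⟩
    have h3 := h2.range_comp (gaussLp (m := m))
    rw [DenseRange]
    have h4 : (fun q : MvPolynomial (Fin m) ℂ => ((√(l2Weight m n S) : ℝ) : ℂ) • gaussLp q) =
        gaussLp ∘ fun q => ((√(l2Weight m n S) : ℝ) : ℂ) • q := by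
      funext q; exact (map_smul _ _ _).symm
    rw [h4, h3]
    exact denseRange_gaussLp
  have h2 := DenseRange.piMap h1
  have h3 := (WithLp.toLp_surjective 2 (V := ∀ _ : Finset (Fin (2 * n)),
    Lp ℂ 2 (volume : Measure (Fin m → ℝ)))).denseRange.comp h2 (PiLp.continuous_toLp 2 _)
  have h4 := (hermiteGauss_surjective (m := m) (n := n)).range_comp
    (WithLp.toLp 2 ∘ Pi.map fun (S : Finset (Fin (2 * n))) (q : MvPolynomial (Fin m) ℂ) =>
      ((√(l2Weight m n S) : ℝ) : ℂ) • gaussLp q)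
  exact (congrArg Dense h4).mpr h3

end lebesgue


/-! ### The even part of the Lebesgue superspace -/

section even
variable {m n : ℕ}

theorem evalReal_aeval_neg (x : Fin m → ℝ) (q : MvPolynomial (Fin m) ℂ) :
    evalReal x (MvPolynomial.aeval (fun i => -MvPolynomial.X i) q) = evalReal (-x) q := by
  induction q using MvPolynomial.induction_on with
  | C c => rw [MvPolynomial.aeval_C, MvPolynomial.algebraMap_eq, evalReal_C, evalReal_C]
  | add p q hp hq => simp only [map_add, hp, hq]
  | mul_X p i hp =>
    rw [map_mul, map_mul, map_mul, hp, MvPolynomial.aeval_X, map_neg, evalReal_X, evalReal_X,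
      Pi.neg_apply, Complex.ofReal_neg]

theorem reflect_gaussLp (q : MvPolynomial (Fin m) ℂ) : reflect m (gaussLp q) =
    gaussLp (MvPolynomial.aeval (fun i => -MvPolynomial.X i) q) := by
  refine (Lp.toLp_compMeasurePreserving (memLp_gaussFun q)
    (Measure.measurePreserving_neg (volume : Measure (Fin m → ℝ)))).trans
    (MemLp.toLp_congr _ (memLp_gaussFun _) (Filter.Eventually.of_forall fun x => ?_))
  simp only [gaussFun, Function.comp_apply, evalReal_aeval_neg, evalReal_gaussExponent,
    Pi.neg_apply, neg_sq]

theorem continuous_reflect : Continuous (reflect m) :=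
  (Lp.isometry_compMeasurePreserving (p := 2) (E := ℂ)
    (Measure.measurePreserving_neg (volume : Measure (Fin m → ℝ)))).continuous

theorem negVars_gaussPoly : negVars (gaussPoly m n) = gaussPoly m n := by
  have h : Gr.mapAlg (MvPolynomial.aeval (R := ℂ) fun i : Fin m => -MvPolynomial.X i)
      (gaussPoly m n) = gaussPoly m n := by
    ext1 S
    rw [Gr.mapAlg_apply, gaussPoly, Gr.mapAlg_apply, Algebra.ofId_apply, AlgHom.commutes]
  rw [negVars_eq, h, parity_gaussPoly]

theorem negVars_negVars (p : Fock m n) : negVars (negVars p) = p := by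
  induction p using Fock.induction with
  | h1 => rw [negVars_one, negVars_one]
  | ha p q hp hq => rw [map_add, map_add, hp, hq]
  | hs c p hp => rw [map_smul, map_smul, hp]
  | hz j p hp => rw [negVars_zvar_mul, map_neg, negVars_zvar_mul, hp, neg_neg]

theorem hermiteGauss_negVars (p : Fock m n) :
    hermiteGauss (negVars p) = negVars (hermiteGauss p) := by
  rw [hermiteGauss_apply, hermite_negVars, hermiteGauss_apply, negVars_mul, negVars_gaussPoly]

theorem reflect_hermiteL2 (p : Fock m n) (S : Finset (Fin (2 * n))) :
    ((-1 : ℂ) ^ S.card) • reflect m (hermiteL2 p S) = hermiteL2 (negVars p) S := by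
  rw [hermiteL2_apply, hermiteL2_apply, hermiteGauss_negVars, reflect_gaussLp, negVars_eq,
    Gr.parity_apply, Gr.mapAlg_apply, map_smul]

theorem neg_one_pow_smul_smul {V : Type*} [AddCommGroup V] [Module ℂ V] (k : ℕ) (v : V) :
    ((-1 : ℂ) ^ k) • ((-1 : ℂ) ^ k) • v = v := by
  rw [smul_smul, ← pow_add, ← two_mul, pow_mul]
  simp

theorem mem_l2Even_iff (f : L2 m n) :
    f ∈ l2Even m n ↔ ∀ S, ((-1 : ℂ) ^ S.card) • reflect m (f S) = f S := by
  refine forall_congr' fun S => ⟨fun h => ?_, fun h => ?_⟩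
  · rw [h, neg_one_pow_smul_smul]
  · rw [← h, neg_one_pow_smul_smul, h]

theorem hermiteL2_mem_l2Even {p : Fock m n} (hp : p ∈ fockEven m n) :
    hermiteL2 p ∈ l2Even m n := by
  rw [mem_l2Even_iff]
  intro S
  rw [reflect_hermiteL2, (mem_fockEven_iff p).1 hp]

theorem hodge_mem_l2Even (f : L2 m n) (hf : f ∈ l2Even m n) : hodge f ∈ l2Even m n := by
  rw [mem_l2Even_iff] at hf ⊢
  intro S
  rw [hodge_apply, map_smul, smul_comm, ← neg_one_pow_card_compl, hf]

theorem mem_map_l2Even_iff (y : L2Coeff m n) :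
    y ∈ (l2Even m n).map (l2Equiv (m := m) (n := n) : L2 m n →ₗ[ℂ] L2Coeff m n) ↔
      ∀ S, ((-1 : ℂ) ^ S.card) • reflect m (y S) = y S := by
  rw [Submodule.mem_map]
  constructor
  · rintro ⟨f, hf, rfl⟩ S
    change ((-1 : ℂ) ^ S.card) • reflect m (l2Equiv f S) = l2Equiv f S
    rw [l2Equiv_apply, map_smul, smul_comm, (mem_l2Even_iff f).1 hf]
  · intro h
    refine ⟨l2Equiv.symm y, (mem_l2Even_iff _).2 fun S => ?_, l2Equiv.apply_symm_apply y⟩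
    have h1 : l2Equiv.symm y S = ((√(l2Weight m n S) : ℝ) : ℂ)⁻¹ • y S := rfl
    rw [h1, map_smul, smul_comm, h]

theorem continuous_reflect_coeff (S : Finset (Fin (2 * n))) :
    Continuous fun y : L2Coeff m n => ((-1 : ℂ) ^ S.card) • reflect m (y S) :=
  (continuous_const_smul _).comp (continuous_reflect.comp (PiLp.continuous_apply 2 _ S))

instance completeSpace_l2Even :
    CompleteSpace ((l2Even m n).map (l2Equiv (m := m) (n := n) : L2 m n →ₗ[ℂ] L2Coeff m n)) := by
  refine IsClosed.completeSpace_coe (hs := ?_)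
  have h : (((l2Even m n).map (l2Equiv (m := m) (n := n) : L2 m n →ₗ[ℂ] L2Coeff m n) : Submodule ℂ _) :
      Set (L2Coeff m n)) = ⋂ S, {y | ((-1 : ℂ) ^ S.card) • reflect m (y S) = y S} := by
    ext y
    rw [SetLike.mem_coe, mem_map_l2Even_iff, Set.mem_iInter]
    rfl
  rw [h]
  exact isClosed_iInter fun S =>
    isClosed_eq (continuous_reflect_coeff S) (PiLp.continuous_apply 2 _ S)

theorem l2Even_isHilbertModel : ((l2Super m n).restrict (l2Even m n)).IsHilbertModel
    (hodge.restrict hodge_mem_l2Even) (l2Equiv.submoduleMap (l2Even m n)) :=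
  l2_isHilbertModel.restrict _ hodge_mem_l2Even

/-- The Hermite functions of even degree are dense in the even part: the projection
`f ↦ ½ (f + f(-x))` takes the Hermite functions to those of even degree. -/
theorem denseRange_hermiteL2_even : DenseRange fun p : fockEven m n =>
    l2Equiv.submoduleMap (l2Even m n) ⟨hermiteL2 p, hermiteL2_mem_l2Even p.2⟩ := by
  intro y
  rw [closure_subtype, ← Set.range_comp]
  obtain ⟨P, hPS⟩ : ∃ P : L2Coeff m n → L2Coeff m n, ∀ y, P y = WithLp.toLp 2 fun S =>
      (1 / 2 : ℂ) • (y S + ((-1 : ℂ) ^ S.card) • reflect m (y S)) := ⟨_, fun _ => rfl⟩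
  have hP : Continuous P := by
    rw [funext hPS]
    exact (PiLp.continuous_toLp 2 _).comp (continuous_pi fun S =>
      (continuous_const_smul _).comp
        ((PiLp.continuous_apply 2 _ S).add (continuous_reflect_coeff S)))
  have hy : P y = y := by
    rw [hPS]
    ext1 S
    change (1 / 2 : ℂ) • ((y : L2Coeff m n) S + ((-1 : ℂ) ^ S.card) •
      reflect m ((y : L2Coeff m n) S)) = (y : L2Coeff m n) S
    rw [(mem_map_l2Even_iff _).1 y.2]
    module
  rw [← hy]
  refine map_mem_closure hP (denseRange_hermiteL2 (y : L2Coeff m n)) ?_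
  rintro _ ⟨p, rfl⟩
  have hp : (1 / 2 : ℂ) • (p + negVars p) ∈ fockEven m n := by
    rw [mem_fockEven_iff, map_smul, map_add, negVars_negVars, add_comm]
  refine ⟨⟨_, hp⟩, ?_⟩
  rw [hPS]
  ext1 S
  change l2Equiv (hermiteL2 ((1 / 2 : ℂ) • (p + negVars p))) S = (1 / 2 : ℂ) •
    (l2Equiv (hermiteL2 p) S + ((-1 : ℂ) ^ S.card) • reflect m (l2Equiv (hermiteL2 p) S))
  rw [l2Equiv_apply, l2Equiv_apply, map_smul (reflect m), smul_comm ((-1 : ℂ) ^ S.card),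
    reflect_hermiteL2, map_smul, map_add, ← smul_add, smul_comm (1 / 2 : ℂ)]
  rfl

end even


/-! ### The four superunitary operators -/

section operators
variable {m n : ℕ}

theorem SuperForm.completion_form_toCompletion {V : Type*} [AddCommGroup V] [Module ℂ V]
    {H : SuperForm V} {J : V → V} (h : H.IsFundamentalSymmetry J) (x y : V) :
    (SuperForm.completion h).form (SuperForm.toCompletion h x) (SuperForm.toCompletion h y) =
      H.form x y := by
  rw [SuperForm.completion_form, SuperForm.symCompletion_toCompletion,
    SuperForm.symCompletion_toCompletion, SuperForm.symCompletion_toCompletion,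
    SuperForm.inner_toCompletion, h.iterate_four]

theorem extends_SB (hF : (fockSuper m n).IsFundamentalSymmetry symF) (hmn : (m, n) ≠ (0, 1)) :
    ExtendsToSuperunitary (l2Super m n) (SuperForm.completion hF)
      (fun f : schrodingerModel m n => toL2 (f : SFR m n)) id
      (fun f => SuperForm.toCompletion hF (SBpoly (f : SFR m n))) := by
  have h := SuperForm.existsUnique_superunitary (B := Fock m n) l2_isHilbertModel
    (fock_isGradedSymmetry (m := m) (n := n)).completion hermiteL2
    (SuperForm.toCompletion hF) symFₗ denseRange_hermiteL2 (SuperForm.denseRange_toCompletion hF)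
    (fun p => (hodge_hermiteL2 p).symm)
    (fun p => (SuperForm.symCompletion_toCompletion hF p).symm)
    (fun p q => (SuperForm.completion_form_toCompletion hF p q).trans
      (l2Super_form_hermiteL2 p q).symm)
  have hiff : ∀ T : L2 m n →ₗ[ℂ] SuperForm.Completion hF,
      (∀ p, T (hermiteL2 p) = SuperForm.toCompletion hF p) ↔
      ∀ f : schrodingerModel m n, id (T (toL2 (f : SFR m n))) =
        SuperForm.toCompletion hF (SBpoly (f : SFR m n)) := by
    intro T
    constructor
    · rintro hT ⟨f, hf⟩
      rw [← range_invSB hmn] at hf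
      obtain ⟨p, rfl⟩ := hf
      rw [toL2_invSB, SBpoly_invSB, id, hT]
    · intro hT p
      have hp : invSB p ∈ schrodingerModel m n := by
        rw [← range_invSB hmn]; exact ⟨p, rfl⟩
      have := hT ⟨_, hp⟩
      rwa [toL2_invSB, SBpoly_invSB] at this
  simpa only [ExtendsToSuperunitary, ← hiff] using h

theorem extends_SBhat (hR : (minSchrodingerSuper m n).IsFundamentalSymmetry symMinW)
    (hO : (minFockSuper m n).IsFundamentalSymmetry symMinF) :
    ExtendsToSuperunitary (SuperForm.completion hR) (SuperForm.completion hO)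
      (SuperForm.toCompletion hR) id
      (fun w => SuperForm.toCompletion hO (SBhat w)) := by
  let S : minSchrodinger m n →ₗ[ℂ] MinFock m n :=
    { toFun := SBhat
      map_add' := fun v w => psiCₗ_injective (by
        rw [map_add]
        simp only [psiCₗ_apply, psiC_SBhat]
        exact map_add fockOfMinSchroₗ v w)
      map_smul' := fun c v => psiCₗ_injective (by
        rw [map_smul]
        simp only [psiCₗ_apply, psiC_SBhat]
        exact map_smul fockOfMinSchroₗ c v) }
  have hS : Function.Surjective S := fun x => ⟨_, SBhat_invFun x⟩
  refine SuperForm.existsUnique_superunitary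
    (minSchrodinger_isGradedSymmetry (m := m) (n := n)).completion
    (minFock_isGradedSymmetry (m := m) (n := n)).completion (SuperForm.toCompletion hR)
    (SuperForm.toCompletion hO ∘ₗ S) symMinW (SuperForm.denseRange_toCompletion hR) ?_
    (fun w => (SuperForm.symCompletion_toCompletion hR w).symm) (fun w => ?_) (fun v w => ?_)
  · have h := hS.range_comp (SuperForm.toCompletion hO)
    exact (congrArg Dense h).mpr (SuperForm.denseRange_toCompletion hO)
  · refine Eq.trans ?_ (SuperForm.symCompletion_toCompletion hO (S w)).symm
    exact congrArg (SuperForm.toCompletion hO) (SBhat_invFun _)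
  · refine (SuperForm.completion_form_toCompletion hO _ _).trans
      (Eq.trans ?_ (SuperForm.completion_form_toCompletion hR v w).symm)
    rw [minFock_form, minSchrodinger_form]
    exact congrArg₂ fockForm (psiC_SBhat v) (psiC_SBhat w)

theorem extends_psiR (hR : (minSchrodingerSuper m n).IsFundamentalSymmetry symMinW) :
    ExtendsToSuperunitary (SuperForm.completion hR) ((l2Super m n).restrict (l2Even m n))
      (SuperForm.toCompletion hR) Subtype.val
      (fun w => toL2 (psiR (w : SFJ m n ⧸ idealExp m n))) := by
  let j : minSchrodinger m n →ₗ[ℂ] l2Even m n :=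
    (hermiteL2 ∘ₗ fockOfMinSchroₗ).codRestrict (l2Even m n) fun w =>
      hermiteL2_mem_l2Even (fockOfMinSchro_mem w)
  have hj : ∀ w, (j w : L2 m n) = toL2 (psiR (w : SFJ m n ⧸ idealExp m n)) := fun w => by
    rw [← invSB_fockOfMinSchro, toL2_invSB]; rfl
  have h := SuperForm.existsUnique_superunitary
    (minSchrodinger_isGradedSymmetry (m := m) (n := n)).completion
    l2Even_isHilbertModel (SuperForm.toCompletion hR) j symMinW
    (SuperForm.denseRange_toCompletion hR) ?_
    (fun w => (SuperForm.symCompletion_toCompletion hR w).symm) (fun w => ?_) (fun v w => ?_)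
  · simp only [ExtendsToSuperunitary, ← hj, Subtype.val_inj]
    exact h
  · have hs : Function.Surjective fun w : minSchrodinger m n =>
        (⟨fockOfMinSchro w, fockOfMinSchro_mem w⟩ : fockEven m n) := by
      rintro ⟨q, hq⟩
      obtain ⟨w, hw⟩ := exists_fockOfMinSchro hq
      exact ⟨w, Subtype.ext hw⟩
    exact (congrArg Dense (hs.range_comp fun p : fockEven m n =>
      l2Equiv.submoduleMap (l2Even m n) ⟨hermiteL2 p, hermiteL2_mem_l2Even p.2⟩)).mpr
      denseRange_hermiteL2_even
  · refine Subtype.ext ?_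
    change hermiteL2 (fockOfMinSchro (symMinW w)) = hodge (hermiteL2 (fockOfMinSchro w))
    rw [hodge_hermiteL2, fockOfMinSchro_symMinW]
    rfl
  · refine Eq.trans (l2Super_form_hermiteL2 _ _)
      (Eq.trans ?_ (SuperForm.completion_form_toCompletion hR v w).symm)
    rw [minSchrodinger_form]
    rfl

theorem extends_psiC (hO : (minFockSuper m n).IsFundamentalSymmetry symMinF)
    (hF : (fockSuper m n).IsFundamentalSymmetry symF) :
    ExtendsToSuperunitary (SuperForm.completion hO)
      ((SuperForm.completion hF).restrict
        ((fockEven m n).map (SuperForm.toCompletion hF)).topologicalClosure)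
      (SuperForm.toCompletion hO) Subtype.val
      (fun x => SuperForm.toCompletion hF (psiC x)) := by
  set N := ((fockEven m n).map (SuperForm.toCompletion hF)).topologicalClosure with hN
  have hsym : ∀ x ∈ N, SuperForm.symCompletion hF x ∈ N := by
    intro x hx
    refine map_mem_closure (SuperForm.continuous_symCompletion hF) hx ?_
    rintro _ ⟨q, hq, rfl⟩
    exact ⟨symF q, symF_mem_fockEven hq, (SuperForm.symCompletion_toCompletion hF q).symm⟩
  have hNe : N.map (LinearEquiv.refl ℂ (SuperForm.Completion hF) :
      SuperForm.Completion hF →ₗ[ℂ] SuperForm.Completion hF) = N := Submodule.map_id N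
  have hcomplete : CompleteSpace (N.map (LinearEquiv.refl ℂ (SuperForm.Completion hF) :
      SuperForm.Completion hF →ₗ[ℂ] SuperForm.Completion hF)) := by
    rw [hNe]
    exact (Submodule.isClosed_topologicalClosure _).completeSpace_coe
  have hmodel := (fock_isGradedSymmetry (m := m) (n := n)).completion.restrict N hsym
  let j : MinFock m n →ₗ[ℂ] N :=
    (SuperForm.toCompletion hF ∘ₗ psiCₗ).codRestrict N fun x =>
      Submodule.le_topologicalClosure _ ⟨psiC x, psiC_mem_fockEven x,
        congrArg (SuperForm.toCompletion hF) (psiCₗ_apply x).symm⟩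
  have hj : ∀ x, (j x : SuperForm.Completion hF) = SuperForm.toCompletion hF (psiC x) := fun x =>
    congrArg (SuperForm.toCompletion hF) (psiCₗ_apply x)
  have h := SuperForm.existsUnique_superunitary
    (minFock_isGradedSymmetry (m := m) (n := n)).completion hmodel (SuperForm.toCompletion hO) j
    symMinF (SuperForm.denseRange_toCompletion hO) ?_
    (fun w => (SuperForm.symCompletion_toCompletion hO w).symm) (fun w => ?_) (fun v w => ?_)
  · simp only [ExtendsToSuperunitary, ← hj, Subtype.val_inj]
    exact h
  · rintro ⟨y, hy⟩
    rw [closure_subtype, ← Set.range_comp]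
    have hy' : y ∈ N := by rwa [hNe] at hy
    refine closure_mono ?_ hy'
    rintro _ ⟨q, hq, rfl⟩
    rw [SetLike.mem_coe, ← range_psiCₗ] at hq
    obtain ⟨x, rfl⟩ := hq
    exact ⟨x, rfl⟩
  · refine Subtype.ext ?_
    refine (hj _).trans ?_
    rw [psiC_symMinF, ← SuperForm.symCompletion_toCompletion hF, ← hj]
    rfl
  · refine Eq.trans (congrArg₂ (SuperForm.completion hF).form (hj v) (hj w)) ?_
    rw [SuperForm.completion_form_toCompletion, SuperForm.completion_form_toCompletion,
      minFock_form]
    rfl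

end operators

end SegalBargmann

end

open SegalBargmann in
theorem theorem7p11 (m n : ℕ) (hmn : (m, n) ≠ (0, 1)) :
    -- `SB` takes its values in the superpolynomials and preserves the super-inner products
    (∀ f ∈ schrodingerModel m n, evalC (SBpoly f) = SB f) ∧
    (∀ f ∈ schrodingerModel m n, ∀ g ∈ schrodingerModel m n,
      formF (SB f) (SB g) = formW f g) ∧
    -- the product and the folding maps on the quotients do not depend on representatives
    (∀ p q : PJ m n, (minFockSuper m n).form ((idealJ m n).mkQ p) ((idealJ m n).mkQ q) =
      besselFischer p q) ∧
    (∀ p : PJ m n, psiC ((idealJ m n).mkQ p) = fold p) ∧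
    (∀ p : PJ m n, expClass p ∈ minSchrodinger m n ∧
      psiR (expClass p) = evalR (fold p) * gauss m n) ∧
    -- the maps that define the Hilbert completions are fundamental symmetries
    ∃ (hF : (fockSuper m n).IsFundamentalSymmetry symF)
      (hO : (minFockSuper m n).IsFundamentalSymmetry symMinF)
      (hR : (minSchrodingerSuper m n).IsFundamentalSymmetry symMinW),
      -- `SB : L²(ℝ^{m|2n}) → F(ℂ^{m|2n})`
      ExtendsToSuperunitary (l2Super m n) (SuperForm.completion hF)
        (fun f : schrodingerModel m n => toL2 (f : SFR m n)) id
        (fun f => SuperForm.toCompletion hF (SBpoly (f : SFR m n))) ∧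
      -- `ψ_ℂ : F(𝕆_ℂ) → F_even(ℂ^{m|2n})`
      ExtendsToSuperunitary (SuperForm.completion hO)
        ((SuperForm.completion hF).restrict
          ((fockEven m n).map (SuperForm.toCompletion hF)).topologicalClosure)
        (SuperForm.toCompletion hO) Subtype.val
        (fun x => SuperForm.toCompletion hF (psiC x)) ∧
      -- `ψ_ℝ : L²(𝕆_ℝ) → L²_even(ℝ^{m|2n})`
      ExtendsToSuperunitary (SuperForm.completion hR) ((l2Super m n).restrict (l2Even m n))
        (SuperForm.toCompletion hR) Subtype.val
        (fun w => toL2 (psiR (w : SFJ m n ⧸ idealExp m n))) ∧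
      -- the minimal-orbit transform from `L²(𝕆_ℝ)` to `F(𝕆_ℂ)`
      ExtendsToSuperunitary (SuperForm.completion hR) (SuperForm.completion hO)
        (SuperForm.toCompletion hR) id
        (fun w => SuperForm.toCompletion hO (SBhat w)) := by
  refine ⟨fun f hf => ?_, fun f hf g hg => ?_, fun p q => besselFischer_out p q, fun p => ?_,
    fun p => ⟨expClass_mem p, ?_⟩, fock_isGradedSymmetry.toIsFundamentalSymmetry,
    minFock_isGradedSymmetry.toIsFundamentalSymmetry,
    minSchrodinger_isGradedSymmetry.toIsFundamentalSymmetry, extends_SB _ hmn, extends_psiC _ _,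
    extends_psiR _, extends_SBhat _ _⟩
  · rw [← range_invSB hmn] at hf
    obtain ⟨p, rfl⟩ := hf
    rw [SBpoly_invSB, SB_invSB]
  · rw [← range_invSB hmn] at hf hg
    obtain ⟨p, rfl⟩ := hf
    obtain ⟨q, rfl⟩ := hg
    rw [SB_invSB, SB_invSB, formW_invSB]
    rfl
  · rw [psiC_mkQ, foldAlg_apply]
  · rw [psiR_expClass, schroMap_apply, foldAlg_apply]
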